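/- **Setting.** Let $\mathcal H$ be an infinite-dimensional separable complex Hilbert space and let $\mathcal K$ be the set of (nonempty) open double cones of four-dimensional Minkowski spacetime; $a\perp b$ means that $a,b$ are spacelike separated. Let $\mathcal K\ni a\mapsto\mathfrak A(a)$ be a net of von Neumann algebras on $\mathcal H$ that is isotonous ($a\subseteq b\Rightarrow\mathfrak A(a)\subseteq\mathfrak A(b)$), local ($a\perp b\Rightarrow\mathfrak A(a)\subseteq\mathfrak A(b)'$), irreducible (the C*-algebra $\mathfrak A$ generated by all $\mathfrak A(a)$ has commutant $\mathbb C1$) and satisfies Haag duality: $\mathfrak A(a^\perp)'=\mathfrak A(a)$ for all $a$, where $\mathfrak A(a^\perp)$ is the C*-algebra generated by the $\mathfrak A(b)$, $b\perp a$. **The category $\mathcal B(\boldsymbol{\mathfrak A})$.** A *morphism* of multiplicity $n$ is a (not necessarily unital) *-homomorphism $\rho:\mathfrak A\to\mathfrak B(\mathcal H)\otimes\mathbb M_n$; it is *localized in* $o\in\mathcal K$ if $\rho(A)=(A\otimes1_n)\rho(1)$ for all $A\in\mathfrak A(a)$, $a\perp o$. An intertwiner $T\in(\rho,\sigma)$ is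 a bounded operator $\mathcal H\otimes\mathbb C^{n_\rho}\to\mathcal H\otimes\mathbb C^{n_\sigma}$ with $T\rho(1)=T=\sigma(1)T$ and $T\rho(A)=\sigma(A)T$ for all $A\in\mathfrak A$; $1_\rho:=\rho(1)$ is the identity arrow; $T$ is an isometry if $T^*T=1_\rho$, and unitary if also $TT^*=1_\sigma$. A localized $\rho$ is *transportable* if for every $o\in\mathcal K$ there is a unitary from $\rho$ to a morphism localized in $o$. The objects of $\mathcal B(\boldsymbol{\mathfrak A})$ are the localized transportable morphisms, which by Haag duality have values in $\mathfrak A\otimes\mathbb M_n$; the arrows are the intertwiners, whose matrix entries lie in $\mathfrak A$. The tensor product is $\rho\sigma(\,\cdot\,)_{ij}=\rho(\sigma(\,\cdot\,)_{i_2j_2})_{i_1j_1}$ and, for $T\in(\rho_1,\rho_2)$, $(T\times S)_{ij}=\sum_kT_{i_1k}\,\rho_1(S_{i_2j_2})_{kj_1}$, with lexicographic indices ($i=i_1+n\,i_2$); its unit is $\iota(A)=A$. An object $\rho$ is *irreducible* if $1_\rho\ne0$ and $(\rho,\rho)=\mathbb C1_\rho$. A *direct sum* of $\rho_1,\dots,\rho_k$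 is an object $\alpha$ with isometries $W_i\in(\rho_i,\alpha)$, $\sum_iW_iW_i^*=1_\alpha$; finite direct sums are nonempty ($k\ge1$). The symmetry is $\varepsilon(\rho,\sigma)=(V^*\times U^*)\,\theta\,(U\times V)\in(\rho\sigma,\sigma\rho)$ for any unitaries $U\in(\rho,\rho')$, $V\in(\sigma,\sigma')$ with $\rho',\sigma'$ localized in spacelike separated double cones, $\theta$ being the flip matrix (it does not depend on the choices). **Homogeneity.** The extension of $\rho$ to the presheaf $a\mapsto\mathfrak A(a)'$ has the components ${}_a\rho(A)=U^*(A\otimes1)U$, $A\in\mathfrak A(a)'$, where $U$ is any unitary from $\rho$ to an object localized in $a$. The object $\rho$ is *faithful* if it is injective on $\mathfrak A$, and *doubly faithful* if ${}_a\rho$ is injective for every $a\in\mathcal K$. A *presheaf-left inverse* of $\rho$, localized in $o$, is a family of nonzero completely positive linear maps ${}_a\varphi:\rho(1)(\mathfrak A(a)'\otimes\mathbb M_{n_\rho})\rho(1)\to\mathfrak A(a)'$, $a\perp o$, with ${}_a\varphi(\rho(1))=1$, such that ${}_a\varphi$ extends ${}_b\varphi$ whenever $a\subseteq b$, $b\perp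 o$, and ${}_a\varphi(B\cdot{}_a\rho(A))={}_a\varphi(B)A$ for all $A\in\mathfrak A(a)'$ and all $B$ in the domain. The object $\rho$ is *homogeneous* if, for every $a\in\mathcal K$, every object that is unitarily equivalent to $\rho$ and localized in $a$ has a presheaf-left inverse with respect to $a$. **Statistics.** An object $\gamma$ is *simple* if $\varepsilon(\gamma,\gamma)=\pm1_{\gamma^2}$. Let $\mathrm S_d,\mathrm A_d\in(\rho^d,\rho^d)$ be the totally symmetric and antisymmetric projections of the representation of the permutation group on $\rho^d$ defined by $\varepsilon$ (adjacent transpositions act by $1\times\varepsilon(\rho,\rho)\times1$). A *triple* for $\rho$ is $(d,\gamma,V)$ with $d\ge1$ an integer, $\gamma$ a faithful simple object and $V\in(\gamma,\rho^d)$ an isometry with $VV^*=\mathrm A_d$ or $VV^*=\mathrm S_d$. Let $\mathcal B(\boldsymbol{\mathfrak A})_{\rm f}$ be the full subcategory of $\mathcal B(\boldsymbol{\mathfrak A})$ of the finite direct sums of irreducible objects that have a triple (objects with *finite statistics*), and $\mathcal B(\boldsymbol{\mathfrak A})_{\rm fh}$ the full subcategory of the finite direct sums of irreducible objects with finite statistics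 that have a triple with $\gamma$ doubly faithful. A full subcategory $\mathcal C$ is closed under tensor products if it contains $\rho\sigma$ for all its objects $\rho,\sigma$; under direct sums if it contains a direct sum of any two of its objects; under subobjects if for each of its objects $\rho$ and each orthogonal projection $0\ne E\in(\rho,\rho)$ there is an isometry $V\in(\beta,\rho)$ with $\beta$ in $\mathcal C$ and $VV^*=E$. **Proposition.** (a) $\mathcal B(\boldsymbol{\mathfrak A})_{\rm fh}$ is closed under tensor products, direct sums and subobjects, and all its objects are homogeneous. (b) $\mathcal B(\boldsymbol{\mathfrak A})_{\rm fh}$ is the largest full subcategory of $\mathcal B(\boldsymbol{\mathfrak A})_{\rm f}$ that is closed under subobjects and whose objects are all homogeneous: it is one, and it contains every other. -/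

import Mathlib

open scoped Matrix

namespace AQFT

/-! ## Minkowski spacetime and its double cones -/

/-- Four-dimensional Minkowski spacetime; the coordinate `0` is time. -/
abbrev Minkowski : Type := Fin 4 → ℝ

/-- `v` lies in the open forward light cone. -/
def IsForward (v : Minkowski) : Prop :=
  0 < v 0 ∧ (v 1) ^ 2 + (v 2) ^ 2 + (v 3) ^ 2 < (v 0) ^ 2

/-- `x` and `y` are spacelike separated. -/
def SpacelikePts (x y : Minkowski) : Prop :=
  (x 0 - y 0) ^ 2 < (x 1 - y 1) ^ 2 + (x 2 - y 2) ^ 2 + (x 3 - y 3) ^ 2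

/-- The set of the points in the future of `x` and in the past of `y`. -/
def coneSet (x y : Minkowski) : Set Minkowski :=
  {z | IsForward (z - x) ∧ IsForward (y - z)}

/-- The (nonempty) open double cones of Minkowski spacetime. -/
def DoubleCone : Type :=
  {S : Set Minkowski // ∃ x y, IsForward (y - x) ∧ S = coneSet x y}

/-- The spacelike complement of a region. -/
def spacelikeCompl (S : Set Minkowski) : Set Minkowski :=
  {x | ∀ y ∈ S, SpacelikePts x y}

namespace DoubleCone

/-- `a.sub b`: the double cone `a` is contained in `b`. -/
def Sub (a b : DoubleCone) : Prop := a.1 ⊆ b.1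

/-- `a.Perp b`: the double cones `a` and `b` are spacelike separated. -/
def Perp (a b : DoubleCone) : Prop := a.1 ⊆ spacelikeCompl b.1

theorem Perp.symm {a b : DoubleCone} (h : a.Perp b) : b.Perp a := by
  intro y hy x hx
  have := h hx y hy
  unfold SpacelikePts at this ⊢
  nlinarith

theorem Perp.mono {a b c : DoubleCone} (h : a.Perp c) (hb : b.Sub c) : a.Perp b :=
  fun _ hx y hy => h hx y (hb hy)

end DoubleCone

theorem IsForward.add {v w : Minkowski} (hv : IsForward v) (hw : IsForward w) :
    IsForward (v + w) := by
  obtain ⟨h0, h1⟩ := hv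
  obtain ⟨k0, k1⟩ := hw
  refine ⟨by simp only [Pi.add_apply]; linarith, ?_⟩
  simp only [Pi.add_apply]
  have key : v 1 * w 1 + v 2 * w 2 + v 3 * w 3 ≤ v 0 * w 0 := by
    apply le_of_sq_le_sq _ (by positivity)
    have : (v 1 * w 1 + v 2 * w 2 + v 3 * w 3) ^ 2 ≤
        ((v 1) ^ 2 + (v 2) ^ 2 + (v 3) ^ 2) * ((w 1) ^ 2 + (w 2) ^ 2 + (w 3) ^ 2) := by
      nlinarith [sq_nonneg (v 1 * w 2 - v 2 * w 1), sq_nonneg (v 1 * w 3 - v 3 * w 1),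
        sq_nonneg (v 2 * w 3 - v 3 * w 2)]
    have h2 : ((v 1) ^ 2 + (v 2) ^ 2 + (v 3) ^ 2) * ((w 1) ^ 2 + (w 2) ^ 2 + (w 3) ^ 2) ≤
        (v 0) ^ 2 * (w 0) ^ 2 := by gcongr
    nlinarith
  nlinarith

theorem exists_forward_shift (v : Minkowski) :
    ∃ T : ℝ, ∀ S, T ≤ S → IsForward (v + Pi.single 0 S) := by
  refine ⟨1 + |v 0| + |v 1| + |v 2| + |v 3|, fun S hS => ?_⟩
  have h0 := neg_abs_le (v 0)
  have := abs_nonneg (v 0)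
  have := abs_nonneg (v 1)
  have := abs_nonneg (v 2)
  have := abs_nonneg (v 3)
  refine ⟨by simp; linarith, ?_⟩
  simp only [Pi.add_apply, Pi.single_eq_same, ne_eq, one_ne_zero, not_false_eq_true,
    Pi.single_eq_of_ne, add_zero, Fin.reduceEq]
  rw [← sq_abs (v 1), ← sq_abs (v 2), ← sq_abs (v 3)]
  have : |v 1| + |v 2| + |v 3| < v 0 + S := by linarith
  have h3 : (|v 1| + |v 2| + |v 3|) ^ 2 < (v 0 + S) ^ 2 := by gcongr
  nlinarith [mul_nonneg (abs_nonneg (v 1)) (abs_nonneg (v 2)),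
    mul_nonneg (abs_nonneg (v 1)) (abs_nonneg (v 3)),
    mul_nonneg (abs_nonneg (v 2)) (abs_nonneg (v 3))]

/-- Any two double cones are contained in a third one. -/
theorem DoubleCone.directed (a b : DoubleCone) : ∃ c : DoubleCone, a.Sub c ∧ b.Sub c := by
  obtain ⟨_, x, y, hxy, rfl⟩ := a
  obtain ⟨_, x', y', hxy', rfl⟩ := b
  obtain ⟨T1, h1⟩ := exists_forward_shift x
  obtain ⟨T2, h2⟩ := exists_forward_shift x'
  obtain ⟨T3, h3⟩ := exists_forward_shift (-y)
  obtain ⟨T4, h4⟩ := exists_forward_shift (-y')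
  set T := max (max T1 T2) (max T3 T4) with hT
  have e1 := h1 T (by simp [hT])
  have e2 := h2 T (by simp [hT])
  have e3 := h3 T (by simp [hT])
  have e4 := h4 T (by simp [hT])
  refine ⟨⟨coneSet (-Pi.single 0 T) (Pi.single 0 T), _, _, ?_, rfl⟩, ?_, ?_⟩
  · have := (e1.add hxy).add e3
    convert this using 1
    abel
  · rintro z ⟨hz1, hz2⟩
    refine ⟨?_, ?_⟩
    · convert e1.add hz1 using 1; abel
    · convert e3.add hz2 using 1; abel
  · rintro z ⟨hz1, hz2⟩
    refine ⟨?_, ?_⟩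
    · convert e2.add hz1 using 1; abel
    · convert e4.add hz2 using 1; abel

theorem DoubleCone.exists_perp : ∃ a b : DoubleCone, a.Perp b := by
  refine ⟨⟨coneSet 0 (Pi.single 0 1), _, _, by constructor <;> simp, rfl⟩,
    ⟨coneSet (Pi.single 1 10) (Pi.single 1 10 + Pi.single 0 1), _, _,
      by constructor <;> simp, rfl⟩, ?_⟩
  rintro z ⟨⟨h1, h2⟩, ⟨h3, h4⟩⟩ w ⟨⟨h5, h6⟩, ⟨h7, h8⟩⟩
  simp at h1 h2 h3 h4 h5 h6 h7 h8
  unfold SpacelikePts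
  have a1 : z 1 < 1 := by nlinarith [sq_nonneg (z 2), sq_nonneg (z 3)]
  have a2 : 9 < w 1 := by nlinarith [sq_nonneg (w 2), sq_nonneg (w 3)]
  nlinarith [sq_nonneg (z 2 - w 2), sq_nonneg (z 3 - w 3)]

/-! ## The net of local observables -/

variable {H : Type*} [NormedAddCommGroup H] [InnerProductSpace ℂ H] [CompleteSpace H]

/-- The C⋆-algebra of bounded operators generated by the local algebras of the double cones
contained in the region `S`. -/
noncomputable def regionAlgebra (loc : DoubleCone → VonNeumannAlgebra H) (S : Set Minkowski) :
    StarSubalgebra ℂ (H →L[ℂ] H) :=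
  (StarAlgebra.adjoin ℂ
    (⋃ a : {a : DoubleCone // a.1 ⊆ S}, (loc a.1 : Set (H →L[ℂ] H)))).topologicalClosure

variable (H) in
/-- A local net of von Neumann algebras over the double cones of Minkowski spacetime, irreducible
and satisfying Haag duality: the net of local observables in the reference representation. -/
structure Net where
  /-- the algebra of the observables localized in a double cone -/
  loc : DoubleCone → VonNeumannAlgebra H
  isotony : ∀ a b : DoubleCone, a.Sub b → loc a ≤ loc b
  locality : ∀ a b : DoubleCone, a.Perp b → loc a ≤ (loc b).commutant
  irreducible : ∀ T : H →L[ℂ] H, (∀ A ∈ regionAlgebra loc Set.univ, A * T = T * A) →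
    ∃ c : ℂ, T = c • (1 : H →L[ℂ] H)
  haag_duality : ∀ a : DoubleCone,
    Set.centralizer (regionAlgebra loc (spacelikeCompl a.1) : Set (H →L[ℂ] H)) = loc a

/-- The C⋆-algebra `𝔄` of all the quasilocal observables. -/
noncomputable abbrev Net.alg (N : Net H) : StarSubalgebra ℂ (H →L[ℂ] H) :=
  regionAlgebra N.loc Set.univ

variable {N : Net H}

theorem Net.loc_le_alg (N : Net H) (a : DoubleCone) {x : H →L[ℂ] H} (hx : x ∈ N.loc a) :
    x ∈ N.alg :=
  StarSubalgebra.le_topologicalClosure _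
    (StarAlgebra.subset_adjoin ℂ _ (Set.mem_iUnion.2 ⟨⟨a, Set.subset_univ _⟩, hx⟩))

/-- An operator commuting with the local algebras of all the double cones spacelike to `c`
belongs to the local algebra of `c`. -/
theorem Net.mem_loc_of_commute (N : Net H) (c : DoubleCone) {T : H →L[ℂ] H}
    (hT : ∀ b : DoubleCone, b.Perp c → ∀ B ∈ N.loc b, T * B = B * T) : T ∈ N.loc c := by
  have h : T ∈ Set.centralizer
      (regionAlgebra N.loc (spacelikeCompl c.1) : Set (H →L[ℂ] H)) := by
    rw [Set.mem_centralizer_iff]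
    intro y hy
    have hcl : IsClosed {y : H →L[ℂ] H | y * T = T * y} :=
      isClosed_eq (by fun_prop) (by fun_prop)
    refine closure_minimal (s := (StarAlgebra.adjoin ℂ
      (⋃ a : {a : DoubleCone // a.1 ⊆ spacelikeCompl c.1},
        (N.loc a.1 : Set (H →L[ℂ] H))) : Set (H →L[ℂ] H))) ?_ hcl hy
    intro z hz
    have : z * T = T * z ∧ star z * T = T * star z := by
      induction hz using StarAlgebra.adjoin_induction with
      | mem x hx =>
        obtain ⟨⟨b, hb⟩, hx⟩ := Set.mem_iUnion.1 hx
        exact ⟨(hT b hb x hx).symm, (hT b hb _ (star_mem hx)).symm⟩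
      | algebraMap r =>
        refine ⟨Algebra.commutes r T, ?_⟩
        rw [← algebraMap_star_comm]
        exact Algebra.commutes _ T
      | add x y _ _ h1 h2 =>
        rw [star_add, add_mul, add_mul, mul_add, mul_add, h1.1, h1.2, h2.1, h2.2]
        exact ⟨rfl, rfl⟩
      | mul x y _ _ h1 h2 =>
        refine ⟨?_, ?_⟩
        · rw [mul_assoc, h2.1, ← mul_assoc, h1.1, mul_assoc]
        · rw [star_mul, mul_assoc, h1.2, ← mul_assoc, h2.2, mul_assoc]
      | star x _ h => rw [star_star]; exact h.symm
    exact this.1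
  rw [N.haag_duality c] at h
  exact h

/-- A property of quasilocal observables that is closed and holds for the local observables of all
sufficiently large double cones holds for all quasilocal observables. -/
theorem Net.alg_induction (N : Net H) {P : N.alg → Prop} (hP : IsClosed {A | P A})
    (o : DoubleCone)
    (h : ∀ c : DoubleCone, o.Sub c → ∀ A : N.alg, (A : H →L[ℂ] H) ∈ N.loc c → P A) (A : N.alg) :
    P A := by
  have key : ∀ z ∈ StarAlgebra.adjoin ℂ
      (⋃ a : {a : DoubleCone // a.1 ⊆ Set.univ}, (N.loc a.1 : Set (H →L[ℂ] H))),
      ∃ c : DoubleCone, o.Sub c ∧ z ∈ N.loc c := by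
    intro z hz
    induction hz using StarAlgebra.adjoin_induction with
    | mem x hx =>
      obtain ⟨⟨b, hb⟩, hx⟩ := Set.mem_iUnion.1 hx
      obtain ⟨c, h1, h2⟩ := DoubleCone.directed o b
      exact ⟨c, h1, N.isotony b c h2 hx⟩
    | algebraMap r => exact ⟨o, subset_rfl, (N.loc o).algebraMap_mem r⟩
    | add x y _ _ h1 h2 =>
      obtain ⟨c, hc, hx⟩ := h1
      obtain ⟨d, hd, hy⟩ := h2
      obtain ⟨e, he, he'⟩ := DoubleCone.directed c d
      exact ⟨e, hc.trans he, add_mem (N.isotony _ _ he hx) (N.isotony _ _ he' hy)⟩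
    | mul x y _ _ h1 h2 =>
      obtain ⟨c, hc, hx⟩ := h1
      obtain ⟨d, hd, hy⟩ := h2
      obtain ⟨e, he, he'⟩ := DoubleCone.directed c d
      exact ⟨e, hc.trans he, mul_mem (N.isotony _ _ he hx) (N.isotony _ _ he' hy)⟩
    | star x _ h =>
      obtain ⟨c, hc, hx⟩ := h
      exact ⟨c, hc, star_mem hx⟩
  have hd : A ∈ closure {B : N.alg | P B} := by
    rw [closure_subtype]
    refine closure_mono ?_ A.2
    intro z hz
    obtain ⟨c, hc, hzc⟩ := key z hz
    exact ⟨⟨z, N.loc_le_alg c hzc⟩, h c hc _ hzc, rfl⟩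
  rw [hP.closure_eq] at hd
  exact hd

/-! ## Localized transportable morphisms -/

variable (N) in
/-- A morphism `𝔄 → 𝔅(H) ⊗ 𝕄ₙ` of multiplicity `n`, not necessarily unital. Operators
`H ⊗ ℂⁿ → H ⊗ ℂᵐ` are written as `m × n` matrices of operators of `H`. -/
structure Mor where
  /-- the multiplicity -/
  n : ℕ
  hom : N.alg →⋆ₙₐ[ℂ] Matrix (Fin n) (Fin n) (H →L[ℂ] H)

namespace Mor

/-- `ρ` is localized in `o`: `ρ(A) = (A ⊗ 1) ρ(1)` for the observables `A` spacelike to `o`. -/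
def LocalizedIn (ρ : Mor N) (o : DoubleCone) : Prop :=
  ∀ a : DoubleCone, a.Perp o → ∀ A : N.alg, (A : H →L[ℂ] H) ∈ N.loc a →
    ρ.hom A = Matrix.diagonal (fun _ => (A : H →L[ℂ] H)) * ρ.hom 1

/-- `T` is an intertwiner from `ρ` to `σ`. -/
def IsIntertwiner (ρ σ : Mor N) (T : Matrix (Fin σ.n) (Fin ρ.n) (H →L[ℂ] H)) : Prop :=
  T * ρ.hom 1 = T ∧ σ.hom 1 * T = T ∧ ∀ A, T * ρ.hom A = σ.hom A * T

/-- `T` is a unitary intertwiner from `ρ` to `σ`; the identity of `ρ` is `ρ(1)`. -/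
def IsUnitary (ρ σ : Mor N) (T : Matrix (Fin σ.n) (Fin ρ.n) (H →L[ℂ] H)) : Prop :=
  ρ.IsIntertwiner σ T ∧ Tᴴ * T = ρ.hom 1 ∧ T * Tᴴ = σ.hom 1

/-- `ρ` is transportable: it is unitarily equivalent to a morphism localized in any given
double cone. -/
def IsTransportable (ρ : Mor N) : Prop :=
  ∀ o : DoubleCone, ∃ τ : Mor N, τ.LocalizedIn o ∧ ∃ U, ρ.IsUnitary τ U

theorem hom_one_mul (ρ : Mor N) (A : N.alg) : ρ.hom 1 * ρ.hom A = ρ.hom A := by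
  rw [← map_mul, one_mul]

theorem hom_mul_one (ρ : Mor N) (A : N.alg) : ρ.hom A * ρ.hom 1 = ρ.hom A := by
  rw [← map_mul, mul_one]

theorem hom_one_star (ρ : Mor N) : (ρ.hom 1)ᴴ = ρ.hom 1 := by
  rw [← Matrix.star_eq_conjTranspose, ← map_star, star_one]

theorem IsUnitary.symm {ρ σ : Mor N} {U : Matrix (Fin σ.n) (Fin ρ.n) (H →L[ℂ] H)}
    (h : ρ.IsUnitary σ U) : σ.IsUnitary ρ (Matrix.conjTranspose U) := by
  obtain ⟨⟨u1, u2, u3⟩, u4, u5⟩ := h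
  have us : ∀ A, Uᴴ * σ.hom A = ρ.hom A * Uᴴ := fun A => by
    have h1 : Uᴴ * (U * ρ.hom A) * Uᴴ = Uᴴ * (σ.hom A * U) * Uᴴ := by rw [u3]
    rw [← Matrix.mul_assoc, u4, ρ.hom_one_mul, Matrix.mul_assoc, Matrix.mul_assoc, u5,
      σ.hom_mul_one] at h1
    exact h1.symm
  refine ⟨⟨?_, ?_, us⟩, ?_, ?_⟩
  · rw [← σ.hom_one_star, ← Matrix.conjTranspose_mul, u2]
  · rw [← ρ.hom_one_star, ← Matrix.conjTranspose_mul, u1]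
  · rw [Matrix.conjTranspose_conjTranspose, u5]
  · rw [Matrix.conjTranspose_conjTranspose, u4]

theorem IsUnitary.trans {ρ σ τ : Mor N} {U : Matrix (Fin σ.n) (Fin ρ.n) (H →L[ℂ] H)}
    {W : Matrix (Fin τ.n) (Fin σ.n) (H →L[ℂ] H)} (hU : ρ.IsUnitary σ U)
    (hW : σ.IsUnitary τ W) : ρ.IsUnitary τ (W * U) := by
  obtain ⟨⟨u1, u2, u3⟩, u4, u5⟩ := hU
  obtain ⟨⟨w1, w2, w3⟩, w4, w5⟩ := hW
  refine ⟨⟨?_, ?_, fun A => ?_⟩, ?_, ?_⟩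
  · rw [Matrix.mul_assoc, u1]
  · rw [← Matrix.mul_assoc, w2]
  · rw [Matrix.mul_assoc, u3, ← Matrix.mul_assoc, w3, Matrix.mul_assoc]
  · rw [Matrix.conjTranspose_mul, Matrix.mul_assoc, ← Matrix.mul_assoc Wᴴ, w4, u2, u4]
  · rw [Matrix.conjTranspose_mul, Matrix.mul_assoc, ← Matrix.mul_assoc U, u5,
      ← Matrix.mul_assoc, w1, w5]

theorem LocalizedIn.mono {ρ : Mor N} {o c : DoubleCone} (h : ρ.LocalizedIn o) (hc : o.Sub c) :
    ρ.LocalizedIn c :=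
  fun a ha A hA => h a (ha.mono hc) A hA

theorem LocalizedIn.hom_eq_right {ρ : Mor N} {o : DoubleCone} (h : ρ.LocalizedIn o)
    {a : DoubleCone} (ha : a.Perp o) (A : N.alg) (hA : (A : H →L[ℂ] H) ∈ N.loc a) :
    ρ.hom A = ρ.hom 1 * Matrix.diagonal (fun _ => (A : H →L[ℂ] H)) := by
  have h1 := congrArg Matrix.conjTranspose (h a ha (star A) (by simpa using star_mem hA))
  rw [Matrix.conjTranspose_mul, ρ.hom_one_star, Matrix.diagonal_conjTranspose,
    ← Matrix.star_eq_conjTranspose, ← map_star, star_star] at h1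
  rw [h1]
  congr 2
  ext1 i
  simp

/-- The entries of an intertwiner of localized morphisms are local observables. -/
theorem IsIntertwiner.entry_mem {ρ σ : Mor N} {c : DoubleCone} (hρ : ρ.LocalizedIn c)
    (hσ : σ.LocalizedIn c) {T : Matrix (Fin σ.n) (Fin ρ.n) (H →L[ℂ] H)}
    (hT : ρ.IsIntertwiner σ T) (i : Fin σ.n) (j : Fin ρ.n) : T i j ∈ N.loc c := by
  refine N.mem_loc_of_commute c fun b hb B hB => ?_
  have hB' := N.loc_le_alg b hB
  have key : T * (Matrix.diagonal fun _ => B : Matrix (Fin ρ.n) (Fin ρ.n) (H →L[ℂ] H)) =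
      (Matrix.diagonal fun _ => B : Matrix (Fin σ.n) (Fin σ.n) (H →L[ℂ] H)) * T := by
    have h1 := hρ.hom_eq_right hb ⟨B, hB'⟩ hB
    have h2 := hσ b hb ⟨B, hB'⟩ hB
    have h3 := hT.2.2 ⟨B, hB'⟩
    rw [h1, h2, ← Matrix.mul_assoc, hT.1, Matrix.mul_assoc, hT.2.1] at h3
    exact h3
  have := congrFun (congrFun key i) j
  have e1 := Matrix.mul_diagonal (fun _ : Fin ρ.n => B) T i j
  have e2 := Matrix.diagonal_mul (fun _ : Fin σ.n => B) T i j
  exact e1.symm.trans (this.trans e2)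

/-- The values of a localized morphism at local observables have local entries. -/
theorem LocalizedIn.entry_mem_loc {ρ : Mor N} {c : DoubleCone} (h : ρ.LocalizedIn c)
    (A : N.alg) (hA : (A : H →L[ℂ] H) ∈ N.loc c) (i j : Fin ρ.n) : ρ.hom A i j ∈ N.loc c := by
  refine N.mem_loc_of_commute c fun b hb B hB => ?_
  have hB' := N.loc_le_alg b hB
  have hcomm : A * ⟨B, hB'⟩ = ⟨B, hB'⟩ * A := by
    apply Subtype.ext
    have := N.locality b c hb hB
    rw [VonNeumannAlgebra.mem_commutant_iff] at this
    exact this _ hA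
  have key : ρ.hom A * Matrix.diagonal (fun _ => B) =
      Matrix.diagonal (fun _ => B) * ρ.hom A := by
    have h1 := h.hom_eq_right hb ⟨B, hB'⟩ hB
    have h2 := h b hb ⟨B, hB'⟩ hB
    have h3 := congrArg ρ.hom hcomm
    rw [map_mul, map_mul] at h3
    nth_rewrite 1 [h1] at h3
    rw [h2, ← mul_assoc, ρ.hom_mul_one, mul_assoc, ρ.hom_one_mul] at h3
    exact h3
  have := congrFun (congrFun key i) j
  simpa [Matrix.mul_diagonal, Matrix.diagonal_mul] using this

theorem continuous_entry (ρ : Mor N) (i j : Fin ρ.n) : Continuous fun A => ρ.hom A i j := by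
  have : IsClosed (N.alg : Set (H →L[ℂ] H)) := StarSubalgebra.isClosed_topologicalClosure _
  let f : N.alg →⋆ₙₐ[ℂ] CStarMatrix (Fin ρ.n) (Fin ρ.n) (H →L[ℂ] H) :=
    (CStarMatrix.ofMatrixStarAlgEquiv (A := H →L[ℂ] H) (n := Fin ρ.n) :
      Matrix (Fin ρ.n) (Fin ρ.n) (H →L[ℂ] H) →⋆ₙₐ[ℂ] _).comp ρ.hom
  let g : N.alg →+ (H →L[ℂ] H) :=
    { toFun := fun A => ρ.hom A i j
      map_zero' := by simp
      map_add' := by simp }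
  refine AddMonoidHomClass.continuous_of_bound g 1 fun A => ?_
  rw [one_mul]
  exact (CStarMatrix.norm_entry_le_norm (M := f A) (i := i) (j := j)).trans
    (NonUnitalStarAlgHom.norm_apply_le f A)

/-- A localized morphism has values in `𝔄 ⊗ 𝕄ₙ`. -/
theorem LocalizedIn.entry_mem {ρ : Mor N} {o : DoubleCone} (h : ρ.LocalizedIn o)
    (A : N.alg) (i j : Fin ρ.n) : ρ.hom A i j ∈ N.alg := by
  refine N.alg_induction (P := fun A => ρ.hom A i j ∈ N.alg) ?_ o ?_ A
  · exact (StarSubalgebra.isClosed_topologicalClosure _).preimage (ρ.continuous_entry i j)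
  · intro c hc A hA
    exact N.loc_le_alg c ((h.mono hc).entry_mem_loc A hA i j)

end Mor
/-! ## The tensor category of bimodules of `𝔄` -/

/-- A matrix over `𝔄`, seen as a matrix of bounded operators. -/
noncomputable def coeMat {m n : ℕ} (M : Matrix (Fin m) (Fin n) N.alg) :
    Matrix (Fin m) (Fin n) (H →L[ℂ] H) :=
  M.map N.alg.subtype

theorem coeMat_mul {l m n : ℕ} (M : Matrix (Fin l) (Fin m) N.alg)
    (M' : Matrix (Fin m) (Fin n) N.alg) : coeMat (M * M') = coeMat M * coeMat M' := by
  ext1 i j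
  simp [coeMat, Matrix.mul_apply]

theorem coeMat_conjTranspose {m n : ℕ} (M : Matrix (Fin m) (Fin n) N.alg) :
    coeMat Mᴴ = (coeMat M)ᴴ := rfl

theorem coeMat_diagonal (n : ℕ) (A : N.alg) :
    coeMat (Matrix.diagonal fun _ : Fin n => A) =
      Matrix.diagonal fun _ : Fin n => (A : H →L[ℂ] H) := by
  rw [coeMat, Matrix.diagonal_map (map_zero _)]
  rfl

theorem coeMat_injective {m n : ℕ} :
    Function.Injective (coeMat : Matrix (Fin m) (Fin n) N.alg → _) := by
  intro M M' h
  ext1 i j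
  exact Subtype.ext (congrFun (congrFun h i) j)

variable (N) in
/-- A bimodule of `𝔄`: a morphism `𝔄 → 𝔄 ⊗ 𝕄ₙ` of multiplicity `n`, not necessarily unital. -/
structure Bimod where
  /-- the multiplicity -/
  n : ℕ
  hom : N.alg →⋆ₙₐ[ℂ] Matrix (Fin n) (Fin n) N.alg

namespace Bimod

/-- The underlying morphism `𝔄 → 𝔅(H) ⊗ 𝕄ₙ` of a bimodule. -/
noncomputable abbrev toMor (ρ : Bimod N) : Mor N where
  n := ρ.n
  hom :=
    { toFun := fun A => coeMat (ρ.hom A)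
      map_smul' := fun c A => by rw [map_smul]; rfl
      map_zero' := by rw [map_zero]; rfl
      map_add' := fun A B => by rw [map_add]; rfl
      map_mul' := fun A B => by rw [map_mul, coeMat_mul]
      map_star' := fun A => by rw [map_star]; rfl }

theorem toMor_hom (ρ : Bimod N) (A : N.alg) : ρ.toMor.hom A = coeMat (ρ.hom A) := rfl

/-- The identity arrow `1_ρ = ρ(1)` of the object `ρ`. -/
noncomputable def idArrow (ρ : Bimod N) : Matrix (Fin ρ.n) (Fin ρ.n) N.alg := ρ.hom 1

/-- `T` is an arrow from `ρ` to `σ`, i.e. an intertwiner with values in `𝔄`. -/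
def IsArrow (ρ σ : Bimod N) (T : Matrix (Fin σ.n) (Fin ρ.n) N.alg) : Prop :=
  T * ρ.idArrow = T ∧ σ.idArrow * T = T ∧ ∀ A, T * ρ.hom A = σ.hom A * T

/-- `T` is an isometric arrow from `ρ` to `σ`. -/
def IsIsometry (ρ σ : Bimod N) (T : Matrix (Fin σ.n) (Fin ρ.n) N.alg) : Prop :=
  ρ.IsArrow σ T ∧ Tᴴ * T = ρ.idArrow

/-- `T` is a unitary arrow from `ρ` to `σ`. -/
def IsUnitary (ρ σ : Bimod N) (T : Matrix (Fin σ.n) (Fin ρ.n) N.alg) : Prop :=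
  ρ.IsIsometry σ T ∧ T * Tᴴ = σ.idArrow

/-- The bimodule `ρ` is localized in `o`. -/
def LocalizedIn (ρ : Bimod N) (o : DoubleCone) : Prop := ρ.toMor.LocalizedIn o

/-- The tensor product `T × S` of an arrow `T` with source `ρ` and an arrow `S`:
`(T × S) i j = ∑ k, T i₁ k * ρ(S i₂ j₂) k j₁`, where `i = i₁ + m₂ i₂` and `j = j₁ + n_ρ j₂`. -/
noncomputable def tensorHom (ρ : Bimod N) {m₂ k₁ k₂ : ℕ} (T : Matrix (Fin m₂) (Fin ρ.n) N.alg)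
    (S : Matrix (Fin k₂) (Fin k₁) N.alg) : Matrix (Fin (k₂ * m₂)) (Fin (k₁ * ρ.n)) N.alg :=
  Matrix.of fun i j =>
    ∑ k, T (finProdFinEquiv.symm i).2 k *
      ρ.hom (S (finProdFinEquiv.symm i).1 (finProdFinEquiv.symm j).1) k (finProdFinEquiv.symm j).2

theorem tensorHom_apply (ρ : Bimod N) {m₂ k₁ k₂ : ℕ} (T : Matrix (Fin m₂) (Fin ρ.n) N.alg)
    (S : Matrix (Fin k₂) (Fin k₁) N.alg) (i₁ : Fin m₂) (i₂ : Fin k₂) (j₁ : Fin ρ.n)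
    (j₂ : Fin k₁) : ρ.tensorHom T S (finProdFinEquiv (i₂, i₁)) (finProdFinEquiv (j₂, j₁)) =
      (T * ρ.hom (S i₂ j₂)) i₁ j₁ := by
  simp only [tensorHom, Matrix.of_apply, Equiv.symm_apply_apply, Matrix.mul_apply]

theorem ext_fin {m n k l : ℕ} {M M' : Matrix (Fin (m * n)) (Fin (k * l)) N.alg}
    (h : ∀ i₂ i₁ j₂ j₁, M (finProdFinEquiv (i₂, i₁)) (finProdFinEquiv (j₂, j₁)) =
      M' (finProdFinEquiv (i₂, i₁)) (finProdFinEquiv (j₂, j₁))) : M = M' := by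
  ext1 i j
  obtain ⟨⟨i₂, i₁⟩, rfl⟩ := finProdFinEquiv.surjective i
  obtain ⟨⟨j₂, j₁⟩, rfl⟩ := finProdFinEquiv.surjective j
  exact h _ _ _ _

theorem idArrow_isArrow (ρ : Bimod N) : ρ.IsArrow ρ ρ.idArrow := by
  refine ⟨?_, ?_, fun A => ?_⟩
  · rw [idArrow, ← map_mul, one_mul]
  · rw [idArrow, ← map_mul, one_mul]
  · rw [idArrow, ← map_mul, ← map_mul, one_mul, mul_one]

theorem idArrow_star (ρ : Bimod N) : (ρ.idArrow)ᴴ = ρ.idArrow := by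
  rw [idArrow, ← Matrix.star_eq_conjTranspose, ← map_star, star_one]

theorem IsArrow.star {ρ σ : Bimod N} {T : Matrix (Fin σ.n) (Fin ρ.n) N.alg}
    (h : ρ.IsArrow σ T) : σ.IsArrow ρ Tᴴ := by
  refine ⟨?_, ?_, fun A => ?_⟩
  · rw [← σ.idArrow_star, ← Matrix.conjTranspose_mul, h.2.1]
  · rw [← ρ.idArrow_star, ← Matrix.conjTranspose_mul, h.1]
  · have := congrArg Matrix.conjTranspose (h.2.2 (Star.star A))
    rw [Matrix.conjTranspose_mul, Matrix.conjTranspose_mul, ← Matrix.star_eq_conjTranspose,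
      ← Matrix.star_eq_conjTranspose (σ.hom _), ← map_star, ← map_star, star_star] at this
    exact this.symm

/-- The exchange property of the tensor product. -/
theorem tensorHom_mul {ρ₁ ρ₂ : Bimod N} {m k₁ k₂ k₃ : ℕ}
    (T : Matrix (Fin m) (Fin ρ₂.n) N.alg) {T' : Matrix (Fin ρ₂.n) (Fin ρ₁.n) N.alg}
    (hT' : ρ₁.IsArrow ρ₂ T') (S : Matrix (Fin k₃) (Fin k₂) N.alg)
    (S' : Matrix (Fin k₂) (Fin k₁) N.alg) :
    ρ₂.tensorHom T S * ρ₁.tensorHom T' S' = ρ₁.tensorHom (T * T') (S * S') := by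
  apply ext_fin
  intro i₂ i₁ j₂ j₁
  rw [Matrix.mul_apply, ← finProdFinEquiv.sum_comp, Fintype.sum_prod_type]
  simp only [tensorHom_apply]
  simp only [← Matrix.mul_apply]
  rw [← Matrix.sum_apply]
  refine congrFun (congrFun ?_ i₁) j₁
  rw [Matrix.mul_apply, map_sum, Matrix.mul_sum]
  refine Finset.sum_congr rfl fun x _ => ?_
  rw [map_mul, Matrix.mul_assoc, ← Matrix.mul_assoc (ρ₂.hom _), ← hT'.2.2]
  simp only [Matrix.mul_assoc]
  rfl

theorem tensorHom_star {ρ₁ ρ₂ : Bimod N} {k₁ k₂ : ℕ}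
    {T : Matrix (Fin ρ₂.n) (Fin ρ₁.n) N.alg} (hT : ρ₁.IsArrow ρ₂ T)
    (S : Matrix (Fin k₂) (Fin k₁) N.alg) :
    (ρ₁.tensorHom T S)ᴴ = ρ₂.tensorHom Tᴴ Sᴴ := by
  apply ext_fin
  intro i₂ i₁ j₂ j₁
  rw [Matrix.conjTranspose_apply, tensorHom_apply, tensorHom_apply, hT.star.2.2,
    Matrix.conjTranspose_apply, map_star, Matrix.star_eq_conjTranspose,
    ← Matrix.conjTranspose_mul, Matrix.conjTranspose_apply]

/-- The tensor product `ρσ` of two bimodules: `ρσ(A) i j = ρ(σ(A) i₂ j₂) i₁ j₁`, where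
`i = i₁ + n_ρ i₂` and `j = j₁ + n_ρ j₂`. -/
noncomputable abbrev tensor (ρ σ : Bimod N) : Bimod N where
  n := σ.n * ρ.n
  hom :=
    { toFun := fun A => Matrix.of fun i j =>
        ρ.hom (σ.hom A (finProdFinEquiv.symm i).1 (finProdFinEquiv.symm j).1)
          (finProdFinEquiv.symm i).2 (finProdFinEquiv.symm j).2
      map_smul' := fun c A => by ext1 i j; simp
      map_zero' := by ext1 i j; simp
      map_add' := fun A B => by ext1 i j; simp
      map_mul' := fun A B => by
        apply ext_fin
        intro i₂ i₁ j₂ j₁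
        rw [Matrix.mul_apply, ← finProdFinEquiv.sum_comp, Fintype.sum_prod_type]
        simp only [Matrix.of_apply, Equiv.symm_apply_apply]
        simp only [← Matrix.mul_apply, ← map_mul]
        rw [← Matrix.sum_apply, ← map_sum, ← Matrix.mul_apply, map_mul]
      map_star' := fun A => by
        ext1 i j
        simp only [Matrix.of_apply, Matrix.star_apply]
        rw [map_star, Matrix.star_apply, map_star, Matrix.star_apply] }

theorem tensor_hom (ρ σ : Bimod N) (A : N.alg) :
    (ρ.tensor σ).hom A = ρ.tensorHom ρ.idArrow (σ.hom A) := by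
  apply ext_fin (m := σ.n) (n := ρ.n) (k := σ.n) (l := ρ.n)
  intro i₂ i₁ j₂ j₁
  rw [tensorHom_apply, idArrow, ← map_mul, one_mul]
  change ρ.hom (σ.hom A (finProdFinEquiv.symm _).1 (finProdFinEquiv.symm _).1)
    (finProdFinEquiv.symm _).2 (finProdFinEquiv.symm _).2 = _
  simp only [Equiv.symm_apply_apply]

theorem tensor_idArrow (ρ σ : Bimod N) :
    (ρ.tensor σ).idArrow = ρ.tensorHom ρ.idArrow σ.idArrow := ρ.tensor_hom σ 1

theorem IsArrow.tensor {ρ₁ ρ₂ σ₁ σ₂ : Bimod N} {T : Matrix (Fin ρ₂.n) (Fin ρ₁.n) N.alg}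
    {S : Matrix (Fin σ₂.n) (Fin σ₁.n) N.alg} (hT : ρ₁.IsArrow ρ₂ T) (hS : σ₁.IsArrow σ₂ S) :
    (ρ₁.tensor σ₁).IsArrow (ρ₂.tensor σ₂) (ρ₁.tensorHom T S) := by
  refine ⟨?_, ?_, fun A => ?_⟩
  · rw [tensor_idArrow]
    refine (tensorHom_mul T ρ₁.idArrow_isArrow S _).trans ?_
    rw [hT.1, hS.1]
  · rw [tensor_idArrow]
    refine (tensorHom_mul _ hT _ S).trans ?_
    rw [hT.2.1, hS.2.1]
  · rw [tensor_hom, tensor_hom]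
    refine (tensorHom_mul T ρ₁.idArrow_isArrow S _).trans ?_
    refine Eq.trans ?_ (tensorHom_mul _ hT _ S).symm
    rw [hT.1, hT.2.1, hS.2.2]

theorem IsUnitary.tensor {ρ₁ ρ₂ σ₁ σ₂ : Bimod N} {T : Matrix (Fin ρ₂.n) (Fin ρ₁.n) N.alg}
    {S : Matrix (Fin σ₂.n) (Fin σ₁.n) N.alg} (hT : ρ₁.IsUnitary ρ₂ T) (hS : σ₁.IsUnitary σ₂ S) :
    (ρ₁.tensor σ₁).IsUnitary (ρ₂.tensor σ₂) (ρ₁.tensorHom T S) := by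
  refine ⟨⟨hT.1.1.tensor hS.1.1, ?_⟩, ?_⟩
  · rw [tensor_idArrow, tensorHom_star hT.1.1]
    refine (tensorHom_mul _ hT.1.1 _ S).trans ?_
    rw [hT.1.2, hS.1.2]
  · rw [tensor_idArrow, tensorHom_star hT.1.1]
    refine (tensorHom_mul T hT.1.1.star S _).trans ?_
    rw [hT.2, hS.2]

theorem LocalizedIn.hom_eq {ρ : Bimod N} {o a : DoubleCone} (h : ρ.LocalizedIn o)
    (ha : a.Perp o) {A : N.alg} (hA : (A : H →L[ℂ] H) ∈ N.loc a) :
    ρ.hom A = Matrix.diagonal (fun _ => A) * ρ.idArrow := by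
  apply coeMat_injective
  rw [coeMat_mul]
  refine (h a ha A hA).trans ?_
  rw [coeMat_diagonal]
  rfl

theorem localizedIn_of {ρ : Bimod N} {o : DoubleCone}
    (h : ∀ a : DoubleCone, a.Perp o → ∀ A : N.alg, (A : H →L[ℂ] H) ∈ N.loc a →
      ρ.hom A = Matrix.diagonal (fun _ => A) * ρ.idArrow) : ρ.LocalizedIn o := by
  intro a ha A hA
  rw [toMor_hom, h a ha A hA, coeMat_mul]
  rw [coeMat_diagonal]
  rfl

theorem LocalizedIn.tensor {ρ σ : Bimod N} {o : DoubleCone} (hρ : ρ.LocalizedIn o)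
    (hσ : σ.LocalizedIn o) : (ρ.tensor σ).LocalizedIn o := by
  refine localizedIn_of fun a ha A hA => ?_
  rw [tensor_hom, tensor_idArrow]
  apply ext_fin (m := σ.n) (n := ρ.n) (k := σ.n) (l := ρ.n)
  intro i₂ i₁ j₂ j₁
  have e := Matrix.diagonal_mul (fun _ : Fin (σ.n * ρ.n) => A)
    (ρ.tensorHom ρ.idArrow σ.idArrow) (finProdFinEquiv (i₂, i₁)) (finProdFinEquiv (j₂, j₁))
  refine Eq.trans ?_ e.symm
  rw [tensorHom_apply, tensorHom_apply, hσ.hom_eq ha hA, Matrix.diagonal_mul, map_mul,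
    hρ.hom_eq ha hA, ← Matrix.mul_assoc, ← Matrix.mul_assoc]
  have h1 : ρ.idArrow * Matrix.diagonal (fun _ => A) * ρ.idArrow =
      Matrix.diagonal (fun _ => A) * ρ.idArrow := by
    rw [Matrix.mul_assoc, ← hρ.hom_eq ha hA]
    exact ρ.idArrow_isArrow.2.2 A |>.trans (by
      rw [idArrow, ← map_mul, mul_one])
  rw [h1, Matrix.mul_assoc, Matrix.diagonal_mul]

theorem idArrow_isUnitary (ρ : Bimod N) : ρ.IsUnitary ρ ρ.idArrow := by
  refine ⟨⟨ρ.idArrow_isArrow, ?_⟩, ?_⟩ <;> rw [idArrow_star] <;> exact ρ.idArrow_isArrow.1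

theorem IsUnitary.toMor {ρ σ : Bimod N} {U : Matrix (Fin σ.n) (Fin ρ.n) N.alg}
    (h : ρ.IsUnitary σ U) : ρ.toMor.IsUnitary σ.toMor (coeMat U) := by
  obtain ⟨⟨⟨w1, w2, w3⟩, w4⟩, w5⟩ := h
  refine ⟨⟨?_, ?_, fun A => ?_⟩, ?_, ?_⟩
  · rw [toMor_hom, ← coeMat_mul]; exact congrArg coeMat w1
  · rw [toMor_hom, ← coeMat_mul]; exact congrArg coeMat w2
  · rw [toMor_hom, toMor_hom, ← coeMat_mul, ← coeMat_mul, w3]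
  · rw [← coeMat_conjTranspose, ← coeMat_mul, w4]; rfl
  · rw [← coeMat_conjTranspose, ← coeMat_mul, w5]; rfl

theorem isUnitary_of_toMor {ρ σ : Bimod N} {U : Matrix (Fin σ.n) (Fin ρ.n) N.alg}
    (h : ρ.toMor.IsUnitary σ.toMor (coeMat U)) : ρ.IsUnitary σ U := by
  obtain ⟨⟨w1, w2, w3⟩, w4, w5⟩ := h
  refine ⟨⟨⟨?_, ?_, fun A => ?_⟩, ?_⟩, ?_⟩ <;> apply coeMat_injective
  · rw [coeMat_mul]; exact w1
  · rw [coeMat_mul]; exact w2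
  · rw [coeMat_mul, coeMat_mul]; exact w3 A
  · rw [coeMat_mul]; exact w4
  · rw [coeMat_mul]; exact w5

/-- The identity object `ι` of the tensor product, as a bimodule: `ι(A) = A`. -/
noncomputable def unit (N : Net H) : Bimod N where
  n := 1
  hom :=
    { toFun := fun A => Matrix.of fun _ _ => A
      map_smul' := fun c A => rfl
      map_zero' := rfl
      map_add' := fun A B => rfl
      map_mul' := fun A B => by ext1 i j; simp [Matrix.mul_apply]
      map_star' := fun A => rfl }

theorem unit_localizedIn (o : DoubleCone) : (unit N).LocalizedIn o := by
  refine localizedIn_of fun a _ A _ => ?_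
  ext1 i j
  rw [Matrix.diagonal_mul]
  exact (mul_one A).symm

end Bimod

/-- A localized morphism is a bimodule of `𝔄`. -/
noncomputable abbrev Mor.LocalizedIn.toBimod {ρ : Mor N} {o : DoubleCone} (h : ρ.LocalizedIn o) :
    Bimod N where
  n := ρ.n
  hom :=
    { toFun := fun A => Matrix.of fun i j => ⟨ρ.hom A i j, h.entry_mem A i j⟩
      map_smul' := fun c A => by ext1 i j; apply Subtype.ext; simp
      map_zero' := by ext1 i j; apply Subtype.ext; simp
      map_add' := fun A B => by ext1 i j; apply Subtype.ext; simp
      map_mul' := fun A B => by ext1 i j; apply Subtype.ext; simp [Matrix.mul_apply]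
      map_star' := fun A => by ext1 i j; apply Subtype.ext; simp only [map_star]; rfl }

theorem Mor.LocalizedIn.toBimod_toMor {ρ : Mor N} {o : DoubleCone} (h : ρ.LocalizedIn o) :
    h.toBimod.toMor = ρ := rfl
/-! ## The category of the localized transportable bimodules -/

variable (N) in
/-- An object of the category `𝓑(𝔄)`: a bimodule of `𝔄` that is localized in some double cone and
transportable. `𝓑(𝔄)` is the full subcategory of the category of bimodules with these objects:
the arrows from `ρ` to `σ` are the matrices `T` with `Bimod.IsArrow ρ σ T`, the composition is the
matrix product, the identities are the `idArrow`, and the adjoint is the conjugate transpose. -/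
structure Obj extends Bimod N where
  localized : ∃ o : DoubleCone, toBimod.LocalizedIn o
  transportable : toBimod.toMor.IsTransportable

namespace Obj

/-- An object can be transported within `𝓑(𝔄)`. -/
theorem transport (ρ : Obj N) (o : DoubleCone) :
    ∃ τ : Obj N, τ.LocalizedIn o ∧
      ∃ U : Matrix (Fin τ.n) (Fin ρ.n) N.alg, ρ.IsUnitary τ.toBimod U := by
  obtain ⟨p, hp⟩ := ρ.localized
  obtain ⟨τ, hτ, U, hU⟩ := ρ.transportable o
  obtain ⟨c, hpc, hoc⟩ := DoubleCone.directed p o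
  have hmem : ∀ i j, U i j ∈ N.alg := fun i j =>
    N.loc_le_alg c (hU.1.entry_mem (hp.mono hpc) (hτ.mono hoc) i j)
  refine ⟨⟨hτ.toBimod, ⟨o, hτ⟩, fun q => ?_⟩, hτ, Matrix.of fun i j => ⟨U i j, hmem i j⟩, ?_⟩
  · obtain ⟨τ', hτ', W, hW⟩ := ρ.transportable q
    exact ⟨τ', hτ', _, hU.symm.trans hW⟩
  · exact Bimod.isUnitary_of_toMor hU

/-- The identity object `ι` of the tensor product. -/
noncomputable def unit (N : Net H) : Obj N where
  toBimod := Bimod.unit N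
  localized := by
    obtain ⟨o, _, _⟩ := DoubleCone.exists_perp
    exact ⟨o, Bimod.unit_localizedIn o⟩
  transportable := fun o =>
    ⟨_, Bimod.unit_localizedIn o, _, (Bimod.unit N).idArrow_isUnitary.toMor⟩

/-- The tensor product `ρσ` of two objects. -/
noncomputable abbrev tensor (ρ σ : Obj N) : Obj N where
  toBimod := ρ.toBimod.tensor σ.toBimod
  localized := by
    obtain ⟨p, hp⟩ := ρ.localized
    obtain ⟨q, hq⟩ := σ.localized
    obtain ⟨c, hpc, hqc⟩ := DoubleCone.directed p q
    exact ⟨c, Bimod.LocalizedIn.tensor (Mor.LocalizedIn.mono hp hpc)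
      (Mor.LocalizedIn.mono hq hqc)⟩
  transportable := fun o => by
    obtain ⟨ρ', hρ', U, hU⟩ := ρ.transport o
    obtain ⟨σ', hσ', V, hV⟩ := σ.transport o
    exact ⟨_, hρ'.tensor hσ', _, (hU.tensor hV).toMor⟩

/-- The powers `ρᵈ` of an object. -/
noncomputable def pow (ρ : Obj N) : ℕ → Obj N
  | 0 => unit N
  | d + 1 => ρ.tensor (ρ.pow d)

/-- The objects `ρ` and `σ` are unitarily equivalent, i.e. `σ` belongs to the class `[ρ]`. -/
def Equivalent (ρ σ : Obj N) : Prop :=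
  ∃ U : Matrix (Fin σ.n) (Fin ρ.n) N.alg, ρ.IsUnitary σ.toBimod U

/-- `ρ` is irreducible: it is nonzero and its only endomorphisms are the multiples of `1_ρ`. -/
def IsIrreducible (ρ : Obj N) : Prop :=
  ρ.idArrow ≠ 0 ∧ ∀ T, ρ.IsArrow ρ.toBimod T → ∃ c : ℂ, T = c • ρ.idArrow

/-- `ρ` is a direct sum of the objects `σ 0, …, σ (k - 1)`. -/
def IsDirectSum (ρ : Obj N) {k : ℕ} (σ : Fin k → Obj N) : Prop :=
  ∃ W : ∀ i, Matrix (Fin ρ.n) (Fin (σ i).n) N.alg,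
    (∀ i, (σ i).IsIsometry ρ.toBimod (W i)) ∧ ∑ i, W i * (W i)ᴴ = ρ.idArrow

/-! ## The extension to the presheaf of the commutants, and homogeneity -/

/-- The component at `a` of the extension of `ρ` to the presheaf `a ↦ 𝔄(a)'`:
`ₐρ(A) = U⁺ (A ⊗ 1) U` for `A` in `𝔄(a)'`, where `U` is a unitary arrow from `ρ` to an object
localized in `a` (the result does not depend on the choice of `U`). -/
noncomputable def ext (ρ : Obj N) (a : DoubleCone) (A : H →L[ℂ] H) :
    Matrix (Fin ρ.n) (Fin ρ.n) (H →L[ℂ] H) :=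
  let τ := (ρ.transport a).choose
  let U : Matrix (Fin τ.n) (Fin ρ.n) (H →L[ℂ] H) :=
    coeMat (ρ.transport a).choose_spec.2.choose
  Uᴴ * (Matrix.diagonal fun _ => A : Matrix (Fin τ.n) (Fin τ.n) (H →L[ℂ] H)) * U

/-- `ρ` is a faithful morphism of `𝔄`. -/
def IsFaithful (ρ : Obj N) : Prop := ∀ A : N.alg, ρ.hom A = 0 → A = 0

/-- `ρ` is doubly faithful: each component of its extension to the presheaf is faithful. -/
def IsDoublyFaithful (ρ : Obj N) : Prop :=
  ∀ (a : DoubleCone), ∀ A ∈ (N.loc a).commutant, ρ.ext a A = 0 → A = 0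

/-- The reduced algebra `(𝔄(a)' ⊗ 𝕄ₙ)_{ρ(1)}`: the matrices `B` over `𝔄(a)'` with
`ρ(1) B ρ(1) = B`. It is used for double cones `a` spacelike to a double cone where `ρ` is
localized, so that `ρ(1)` belongs to `𝔄(a)' ⊗ 𝕄ₙ`. -/
noncomputable def reduced (ρ : Obj N) (a : DoubleCone) :
    Submodule ℂ (Matrix (Fin ρ.n) (Fin ρ.n) (H →L[ℂ] H)) where
  carrier := {B | (∀ i j, B i j ∈ (N.loc a).commutant) ∧
    coeMat ρ.idArrow * B * coeMat ρ.idArrow = B}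
  zero_mem' := ⟨fun _ _ => zero_mem _, by rw [Matrix.mul_zero, Matrix.zero_mul]⟩
  add_mem' := fun {A B} hA hB => ⟨fun i j => add_mem (hA.1 i j) (hB.1 i j), by
    rw [Matrix.mul_add, Matrix.add_mul, hA.2, hB.2]⟩
  smul_mem' := fun c B hB => ⟨fun i j => by
    rw [Matrix.smul_apply, VonNeumannAlgebra.mem_commutant_iff]
    intro g hg
    rw [mul_smul_comm, smul_mul_assoc,
      VonNeumannAlgebra.mem_commutant_iff.1 (hB.1 i j) g hg], by
    rw [Matrix.mul_smul, Matrix.smul_mul, hB.2]⟩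

end Obj

/-- The matrix of operators `M` is a positive operator of the Hilbert space `H ⊗ ℂ^ι`. -/
def IsPositiveOpMatrix {ι : Type} [Fintype ι] (M : Matrix ι ι (H →L[ℂ] H)) : Prop :=
  ∀ x : ι → H, 0 ≤ (∑ i, ∑ j, inner ℂ (x i) (M i j (x j))).re ∧
    (∑ i, ∑ j, inner ℂ (x i) (M i j (x j))).im = 0

/-- The linear map `φ`, defined on a space `D` of `n × n` matrices of operators and with operators
as its values, is completely positive: applied entrywise it maps positive `k × k` matrices over `D`
to positive matrices, for all `k`. -/
def IsCompletelyPositive {n : ℕ} {D : Submodule ℂ (Matrix (Fin n) (Fin n) (H →L[ℂ] H))}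
    (φ : D →ₗ[ℂ] (H →L[ℂ] H)) : Prop :=
  ∀ (k : ℕ) (M : Matrix (Fin k) (Fin k) D),
    IsPositiveOpMatrix
      (Matrix.of fun p q : Fin k × Fin n =>
        (M p.1 q.1 : Matrix (Fin n) (Fin n) (H →L[ℂ] H)) p.2 q.2) →
    IsPositiveOpMatrix (M.map φ)

namespace Obj

/-- The maps `φ a`, for the double cones `a` spacelike to `o`, are a presheaf-left inverse of the
object `ρ` localized in `o`. (The maps `φ a` for the other double cones are irrelevant.) -/
structure IsPresheafLeftInverse (ρ : Obj N) (o : DoubleCone)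
    (φ : ∀ a : DoubleCone, ρ.reduced a →ₗ[ℂ] (H →L[ℂ] H)) : Prop where
  /-- `φ a` has its values in `𝔄(a)'` -/
  mem : ∀ a : DoubleCone, a.Perp o → ∀ B, φ a B ∈ (N.loc a).commutant
  nonzero : ∀ a : DoubleCone, a.Perp o → φ a ≠ 0
  completelyPositive : ∀ a : DoubleCone, a.Perp o → IsCompletelyPositive (φ a)
  normalized : ∀ a : DoubleCone, a.Perp o →
    ∃ h : coeMat ρ.idArrow ∈ ρ.reduced a, φ a ⟨_, h⟩ = 1
  compatible : ∀ a b : DoubleCone, a.Perp o → b.Perp o → a.Sub b → ∀ B : ρ.reduced b,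
    ∃ h : (B : Matrix (Fin ρ.n) (Fin ρ.n) (H →L[ℂ] H)) ∈ ρ.reduced a, φ a ⟨_, h⟩ = φ b B
  leftInverse : ∀ a : DoubleCone, a.Perp o → ∀ A ∈ (N.loc a).commutant, ∀ B : ρ.reduced a,
    ∃ h : (B : Matrix (Fin ρ.n) (Fin ρ.n) (H →L[ℂ] H)) * ρ.ext a A ∈ ρ.reduced a,
      φ a ⟨_, h⟩ = φ a B * A

/-- `ρ` is homogeneous: each object equivalent to `ρ` and localized in a double cone `a` has a
presheaf-left inverse there. -/
def IsHomogeneous (ρ : Obj N) : Prop :=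
  ∀ (a : DoubleCone) (σ : Obj N), ρ.Equivalent σ → σ.LocalizedIn a →
    ∃ φ, σ.IsPresheafLeftInverse a φ

/-! ## The symmetry and the statistics -/

/-- The flip `θ(n, m)`, a matrix of scalars. -/
noncomputable def flip (N : Net H) (n m : ℕ) : Matrix (Fin (n * m)) (Fin (m * n)) N.alg :=
  Matrix.of fun i j =>
    if (finProdFinEquiv.symm i).1 = (finProdFinEquiv.symm j).2 ∧
      (finProdFinEquiv.symm i).2 = (finProdFinEquiv.symm j).1 then 1 else 0

/-- `E` is the value at `(ρ, σ)` of the symmetry: `E = (V⁺ × U⁺) θ (U × V)`, where `U` and `V` are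
unitary arrows from `ρ` and `σ` to objects localized in spacelike separated double cones. -/
def IsSymmetryValue (ρ σ : Obj N) (E : Matrix (Fin (ρ.n * σ.n)) (Fin (σ.n * ρ.n)) N.alg) : Prop :=
  ∃ (o a : DoubleCone) (ρ' σ' : Obj N) (U : Matrix (Fin ρ'.n) (Fin ρ.n) N.alg)
    (V : Matrix (Fin σ'.n) (Fin σ.n) N.alg),
    o.Perp a ∧ ρ'.LocalizedIn o ∧ σ'.LocalizedIn a ∧ ρ.IsUnitary ρ'.toBimod U ∧
      σ.IsUnitary σ'.toBimod V ∧
      E = σ'.tensorHom Vᴴ Uᴴ * flip N ρ'.n σ'.n * ρ.tensorHom U V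

theorem exists_isSymmetryValue (ρ σ : Obj N) : ∃ E, ρ.IsSymmetryValue σ E := by
  obtain ⟨o, a, h⟩ := DoubleCone.exists_perp
  obtain ⟨ρ', hρ', U, hU⟩ := ρ.transport o
  obtain ⟨σ', hσ', V, hV⟩ := σ.transport a
  exact ⟨_, o, a, ρ', σ', U, V, h, hρ', hσ', hU, hV, rfl⟩

/-- The symmetry `ε(ρ, σ)`, an arrow from `ρσ` to `σρ`; it does not depend on the choices of
`IsSymmetryValue`. -/
noncomputable def symmetry (ρ σ : Obj N) : Matrix (Fin (ρ.n * σ.n)) (Fin (σ.n * ρ.n)) N.alg :=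
  (ρ.exists_isSymmetryValue σ).choose

/-- `γ` is simple: `ε(γ, γ)` equals `1` or `-1`. -/
def IsSimple (γ : Obj N) : Prop :=
  γ.symmetry γ = (γ.tensor γ).idArrow ∨ γ.symmetry γ = -(γ.tensor γ).idArrow

/-- The endomorphism `1 × ⋯ × ε(ρ, ρ) × ⋯ × 1` of `ρᵈ⁺¹` with `ε(ρ, ρ)` acting on the factors `i`
and `i + 1`. The index sets of `(ρρ)ρᵈ` and `ρ(ρρᵈ)` are identified; this is the associativity of
the tensor product. -/
noncomputable def adjacentFlip (ρ : Obj N) : (d : ℕ) → Fin d →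
    Matrix (Fin (ρ.pow (d + 1)).n) (Fin (ρ.pow (d + 1)).n) N.alg
  | d + 1, ⟨0, _⟩ =>
    Matrix.reindex (finCongr (mul_assoc (ρ.pow d).n ρ.n ρ.n).symm)
      (finCongr (mul_assoc (ρ.pow d).n ρ.n ρ.n).symm)
      ((ρ.tensor ρ).tensorHom (ρ.symmetry ρ) (ρ.pow d).idArrow)
  | d + 1, ⟨i + 1, h⟩ => ρ.tensorHom ρ.idArrow (ρ.adjacentFlip d ⟨i, Nat.lt_of_succ_lt_succ h⟩)

/-- `π` is the representation of the permutation group of `d + 1` elements on `ρᵈ⁺¹` associated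
with the symmetry: it is multiplicative, and it maps each adjacent transposition to the endomorphism
given by `ε(ρ, ρ)`. As these transpositions generate the group, `π` is unique. -/
structure IsPermRep (ρ : Obj N) (d : ℕ) (π : Equiv.Perm (Fin (d + 1)) →
    Matrix (Fin (ρ.pow (d + 1)).n) (Fin (ρ.pow (d + 1)).n) N.alg) : Prop where
  map_one : π 1 = (ρ.pow (d + 1)).idArrow
  map_mul : ∀ p q, π (p * q) = π p * π q
  map_adjacent : ∀ i : Fin d, π (Equiv.swap i.castSucc i.succ) = ρ.adjacentFlip d i

/-- `(d + 1, γ, V)` is a triple for the statistics of `ρ`: `γ` is faithful and simple, and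
`V` is an isometry from `γ` to `ρᵈ⁺¹` whose range projection is the totally antisymmetric or the
totally symmetric projection of `ρᵈ⁺¹`. -/
def IsStatTriple (ρ : Obj N) (d : ℕ) (γ : Obj N)
    (V : Matrix (Fin (ρ.pow (d + 1)).n) (Fin γ.n) N.alg) : Prop :=
  γ.IsFaithful ∧ γ.IsSimple ∧ γ.IsIsometry (ρ.pow (d + 1)).toBimod V ∧
    ∃ π, ρ.IsPermRep d π ∧
      (V * Vᴴ = ((d + 1).factorial : ℂ)⁻¹ • ∑ p, ((Equiv.Perm.sign p : ℤ) : ℂ) • π p ∨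
        V * Vᴴ = ((d + 1).factorial : ℂ)⁻¹ • ∑ p, π p)

end Obj

/-! ## The subcategories -/

variable (N) in
/-- The objects with finite statistics, i.e. the objects of `𝓑(𝔄)_f`: the (nonempty) finite direct
sums of irreducible objects that have a triple. -/
def finiteStatistics : Set (Obj N) :=
  {ρ | ∃ (k : ℕ) (σ : Fin k → Obj N), 0 < k ∧ ρ.IsDirectSum σ ∧
    ∀ i, (σ i).IsIrreducible ∧ ∃ d γ V, (σ i).IsStatTriple d γ V}

variable (N) in
/-- The objects of `𝓑(𝔄)_fh`: the (nonempty) finite direct sums of irreducible objects with finite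
statistics that have a triple whose simple object is doubly faithful. -/
def finiteHomogeneous : Set (Obj N) :=
  {ρ | ∃ (k : ℕ) (σ : Fin k → Obj N), 0 < k ∧ ρ.IsDirectSum σ ∧
    ∀ i, (σ i).IsIrreducible ∧ σ i ∈ finiteStatistics N ∧
      ∃ d γ V, (σ i).IsStatTriple d γ V ∧ γ.IsDoublyFaithful}

/-- The full subcategory with the set of objects `C` is closed under tensor products. -/
def ClosedUnderTensor (C : Set (Obj N)) : Prop := ∀ ρ ∈ C, ∀ σ ∈ C, ρ.tensor σ ∈ C

/-- The full subcategory with the set of objects `C` is closed under direct sums. -/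
def ClosedUnderDirectSums (C : Set (Obj N)) : Prop :=
  ∀ ρ₁ ∈ C, ∀ ρ₂ ∈ C, ∃ α ∈ C, ∃ (W₁ : Matrix (Fin α.n) (Fin ρ₁.n) N.alg)
    (W₂ : Matrix (Fin α.n) (Fin ρ₂.n) N.alg), ρ₁.IsIsometry α.toBimod W₁ ∧
      ρ₂.IsIsometry α.toBimod W₂ ∧ W₁ * W₁ᴴ + W₂ * W₂ᴴ = α.idArrow

/-- The full subcategory with the set of objects `C` is closed under subobjects: each nonzero
orthogonal projection `E` of endomorphisms of an object of `C` is the range projection of an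
isometry from an object of `C`. -/
def ClosedUnderSubobjects (C : Set (Obj N)) : Prop :=
  ∀ ρ ∈ C, ∀ E, ρ.IsArrow ρ.toBimod E → Eᴴ = E → E * E = E → E ≠ 0 →
    ∃ β ∈ C, ∃ V : Matrix (Fin ρ.n) (Fin β.n) N.alg, β.IsIsometry ρ.toBimod V ∧ V * Vᴴ = E

end AQFT

set_option linter.unusedSectionVars false
set_option linter.unusedVariables false

universe v u

/-! ## Representations of the permutation groups from the Coxeter relations -/

namespace PermRep

open Equiv

/-- The relations satisfied by the adjacent transpositions of `n + 1` elements. -/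
structure Coxeter {M : Type*} [Monoid M] (n : ℕ) (s : ℕ → M) : Prop where
  sq : ∀ i, i < n → s i * s i = 1
  braid : ∀ i, i + 1 < n → s i * s (i + 1) * s i = s (i + 1) * s i * s (i + 1)
  comm : ∀ i j, i + 1 < j → j < n → s i * s j = s j * s i

/-- The image of the cycle moving `0` to `k`. -/
def cyc {M : Type*} [Monoid M] (s : ℕ → M) : ℕ → M
  | 0 => 1
  | k + 1 => s k * cyc s k

section
variable {M : Type*} [Monoid M] {n : ℕ} {s : ℕ → M}

theorem Coxeter.shift (h : Coxeter (n + 1) s) : Coxeter n fun i => s (i + 1) where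
  sq i hi := h.sq _ (by omega)
  braid i hi := h.braid _ (by omega)
  comm i j hi hj := h.comm _ _ (by omega) (by omega)

theorem Coxeter.cyc_comm (h : Coxeter n s) (k i : ℕ) (hk : k < i) (hi : i < n) :
    s i * cyc s k = cyc s k * s i := by
  induction k with
  | zero => simp [cyc]
  | succ k ih =>
    rw [cyc, ← mul_assoc, ← h.comm k i hk hi, mul_assoc, ih (by omega), mul_assoc]

theorem Coxeter.cyc_shift (h : Coxeter n s) (k i : ℕ) (hk : i + 1 < k) (hi : k ≤ n) :
    s i * cyc s k = cyc s k * s (i + 1) := by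
  induction k with
  | zero => omega
  | succ k ih =>
    rcases Nat.lt_or_ge (i + 1) k with hk' | hk'
    · rw [cyc, ← mul_assoc, h.comm i k hk' (by omega), mul_assoc, ih hk' (by omega), mul_assoc]
    · obtain rfl : k = i + 1 := by omega
      rw [cyc, cyc, ← mul_assoc, ← mul_assoc, h.braid i (by omega), mul_assoc,
        mul_assoc, h.cyc_comm i (i + 1) (by omega) (by omega), mul_assoc, mul_assoc]

end

/-- The transposition of `i` and `i + 1`. -/
def adj (n i : ℕ) : Perm (Fin (n + 1)) :=
  if h : i < n then swap (Fin.castSucc ⟨i, h⟩) (Fin.succ ⟨i, h⟩) else 1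

/-- A permutation of the nonzero elements. -/
def lift {n : ℕ} : Perm (Fin n) →* Perm (Fin (n + 1)) where
  toFun q := Perm.decomposeFin.symm (0, q)
  map_one' := by simp; rfl
  map_mul' p q := by
    ext x
    refine Fin.cases ?_ (fun x => ?_) x <;> simp

@[simp] theorem lift_zero {n : ℕ} (q : Perm (Fin n)) : lift q 0 = 0 := by simp [lift]

@[simp] theorem lift_succ {n : ℕ} (q : Perm (Fin n)) (x : Fin n) :
    lift q x.succ = (q x).succ := by simp [lift]

theorem lift_injective {n : ℕ} : Function.Injective (lift (n := n)) := by
  intro p q h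
  have := Perm.decomposeFin.symm.injective h
  simpa using this

theorem lift_swap {n : ℕ} (x y : Fin n) : lift (swap x y) = swap x.succ y.succ := by
  ext z
  refine Fin.cases ?_ (fun z => ?_) z
  · rw [lift_zero, swap_apply_of_ne_of_ne (Fin.succ_ne_zero x).symm (Fin.succ_ne_zero y).symm]
  · rw [lift_succ, (Fin.succ_injective n).swap_apply]

theorem sign_lift {n : ℕ} (q : Perm (Fin n)) : Perm.sign (lift q) = Perm.sign q := by
  simp [lift, Perm.decomposeFin.symm_sign]

theorem lift_adj (n i : ℕ) : lift (adj n i) = adj (n + 1) (i + 1) := by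
  unfold adj
  by_cases h : i < n
  · rw [dif_pos h, dif_pos (by omega), lift_swap]
    rfl
  · rw [dif_neg h, dif_neg (by omega), map_one]

theorem adj_coxeter (n : ℕ) : Coxeter n (adj n) where
  sq i hi := by rw [adj, dif_pos hi, swap_mul_self]
  braid i hi := by
    rw [adj, adj, dif_pos (show i < n by omega), dif_pos hi]
    have e : (Fin.succ ⟨i, by omega⟩ : Fin (n + 1)) = Fin.castSucc ⟨i + 1, hi⟩ := rfl
    rw [e]
    set x : Fin (n + 1) := Fin.castSucc ⟨i, by omega⟩ with hx
    set y : Fin (n + 1) := Fin.castSucc ⟨i + 1, hi⟩ with hy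
    set z : Fin (n + 1) := Fin.succ ⟨i + 1, hi⟩ with hz
    have hxy : x ≠ y := by simp [hx, hy, Fin.ext_iff]
    have hxz : x ≠ z := by simp [hx, hz, Fin.ext_iff]; omega
    have hyz : y ≠ z := by simp [hy, hz, Fin.ext_iff]
    rw [swap_mul_swap_mul_swap hxy hxz, swap_comm x y, swap_comm y z,
      swap_mul_swap_mul_swap hyz.symm hxz.symm, swap_comm]
  comm i j hi hj := by
    rw [adj, adj, dif_pos (show i < n by omega), dif_pos hj]
    refine (Perm.disjoint_swap_swap ?_).commute.eq
    simp [Fin.ext_iff]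
    omega

theorem cyc_adj_zero (n k : ℕ) (hk : k < n + 1) : cyc (adj n) k 0 = ⟨k, hk⟩ := by
  induction k with
  | zero => rfl
  | succ k ih =>
    rw [cyc, Perm.mul_apply, ih (by omega), adj, dif_pos (by omega)]
    exact swap_apply_left _ _

theorem adj_induction {n : ℕ} {P : Perm (Fin (n + 1)) → Prop} (h1 : P 1)
    (h2 : ∀ i, i < n → ∀ p, P p → P (adj n i * p)) (p : Perm (Fin (n + 1))) : P p := by
  have hp : p ∈ Submonoid.closure (Set.range fun i : Fin n => swap i.castSucc i.succ) := by
    rw [Perm.mclosure_swap_castSucc_succ]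
    trivial
  induction hp using Submonoid.closure_induction_left with
  | one => exact h1
  | mul_left x hx y _ ih =>
    obtain ⟨i, rfl⟩ := hx
    have := h2 i i.2 y ih
    rwa [adj, dif_pos i.2] at this

/-- A representation of the permutation group is determined by the adjacent transpositions. -/
theorem hom_ext {M : Type*} [Monoid M] {n : ℕ} {f g : Perm (Fin (n + 1)) →* M}
    (h : ∀ i, i < n → f (adj n i) = g (adj n i)) : f = g := by
  ext p
  induction p using adj_induction with
  | h1 => rw [map_one, map_one]
  | h2 i hi p ih => rw [map_mul, map_mul, h i hi, ih]

/-- The Coxeter relations present the permutation group. -/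
theorem Coxeter.exists_hom {M : Type*} [Monoid M] {n : ℕ} {s : ℕ → M} (h : Coxeter n s) :
    ∃ π : Perm (Fin (n + 1)) →* M, ∀ i, i < n → π (adj n i) = s i := by
  induction n generalizing s with
  | zero => exact ⟨1, fun i hi => absurd hi (by omega)⟩
  | succ n ih =>
    obtain ⟨π, hπ⟩ := ih h.shift
    let f : Fin (n + 2) × Perm (Fin (n + 1)) → Perm (Fin (n + 2)) :=
      fun x => cyc (adj (n + 1)) x.1 * lift x.2
    have hf0 : ∀ x, f x 0 = x.1 := fun x => by
      simp only [f, Perm.mul_apply, lift_zero]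
      exact cyc_adj_zero _ _ x.1.2
    have hfi : Function.Injective f := by
      rintro ⟨k, q⟩ ⟨k', q'⟩ hx
      have h1 := congrArg (fun p : Perm (Fin (n + 2)) => p 0) hx
      simp only [hf0] at h1
      subst h1
      have h2 : lift q = lift q' := mul_left_cancel hx
      rw [lift_injective h2]
    let g : Fin (n + 2) × Perm (Fin (n + 1)) → M := fun x => cyc s x.1 * π x.2
    have key : ∀ i, i < n + 1 → ∀ x, ∃ y, f y = adj (n + 1) i * f x ∧ g y = s i * g x := by
      rintro i hi ⟨⟨k, hk⟩, q⟩
      rcases Nat.lt_trichotomy i k with hik | rfl | hik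
      · rcases Nat.lt_or_ge (i + 1) k with hik' | hik'
        · refine ⟨(⟨k, hk⟩, adj n i * q), ?_, ?_⟩
          · simp only [f]
            rw [← mul_assoc, (adj_coxeter (n + 1)).cyc_shift k i hik' (by omega), map_mul,
              lift_adj, mul_assoc]
          · simp only [g]
            rw [← mul_assoc, h.cyc_shift k i hik' (by omega), map_mul, hπ i (by omega), mul_assoc]
        · obtain rfl : k = i + 1 := by omega
          refine ⟨(⟨i, by omega⟩, q), ?_, ?_⟩
          · simp only [f, cyc]
            rw [← mul_assoc, ← mul_assoc, (adj_coxeter (n + 1)).sq i hi, one_mul]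
          · simp only [g, cyc]
            rw [← mul_assoc, ← mul_assoc, h.sq i hi, one_mul]
      · refine ⟨(⟨i + 1, by omega⟩, q), ?_, ?_⟩
        · simp only [f, cyc, mul_assoc]
        · simp only [g, cyc, mul_assoc]
      · obtain ⟨j, rfl⟩ : ∃ j, i = j + 1 := ⟨i - 1, by omega⟩
        refine ⟨(⟨k, hk⟩, adj n j * q), ?_, ?_⟩
        · simp only [f]
          rw [← mul_assoc, (adj_coxeter (n + 1)).cyc_comm k (j + 1) hik hi, map_mul,
            lift_adj, mul_assoc]
        · simp only [g]
          rw [← mul_assoc, h.cyc_comm k (j + 1) hik hi, map_mul, hπ j (by omega), mul_assoc]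
    have hfs : Function.Surjective f := by
      intro p
      induction p using adj_induction with
      | h1 => exact ⟨(0, 1), by simp [f, cyc]⟩
      | h2 i hi p ih =>
        obtain ⟨x, rfl⟩ := ih
        obtain ⟨y, hy, -⟩ := key i hi x
        exact ⟨y, hy⟩
    let e := Equiv.ofBijective f ⟨hfi, hfs⟩
    have hge : ∀ x, g (e.symm (f x)) = g x := fun x => congrArg g (e.symm_apply_apply x)
    have hmul : ∀ i, i < n + 1 → ∀ p, g (e.symm (adj (n + 1) i * p)) = s i * g (e.symm p) := by
      intro i hi p
      obtain ⟨x, rfl⟩ := hfs p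
      obtain ⟨y, hy, hy'⟩ := key i hi x
      rw [← hy, hge, hge, hy']
    have hone : g (e.symm 1) = 1 := by
      have : f (0, 1) = 1 := by simp [f, cyc]
      rw [← this, hge]
      simp [g, cyc]
    refine ⟨⟨⟨fun p => g (e.symm p), hone⟩, fun p q => ?_⟩, fun i hi => ?_⟩
    · show g (e.symm (p * q)) = g (e.symm p) * g (e.symm q)
      induction p using adj_induction with
      | h1 => rw [one_mul, hone, one_mul]
      | h2 i hi p ih => rw [mul_assoc, hmul i hi, ih, hmul i hi, mul_assoc (s i)]
    · show g (e.symm (adj (n + 1) i)) = s i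
      rw [← mul_one (adj (n + 1) i), hmul i hi, hone, mul_one]

/-! ### The totally symmetric and antisymmetric projections -/

/-- The value at the transpositions of the sign character (`b = true`) or of the trivial one. -/
def sgn (b : Bool) : ℂ := if b then -1 else 1

theorem sgn_mul_self (b : Bool) : sgn b * sgn b = 1 := by cases b <;> simp [sgn]

/-- The sign character (`b = true`) or the trivial one. -/
def chi (b : Bool) {n : ℕ} (p : Perm (Fin n)) : ℂ := if b then ((Perm.sign p : ℤ) : ℂ) else 1

section
variable (b : Bool) {n : ℕ}

theorem chi_mul (p q : Perm (Fin n)) : chi b (p * q) = chi b p * chi b q := by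
  cases b <;> simp [chi]

@[simp] theorem chi_one : chi b (1 : Perm (Fin n)) = 1 := by cases b <;> simp [chi]

theorem chi_mul_self (p : Perm (Fin n)) : chi b p * chi b p = 1 := by
  cases b
  · simp [chi]
  · rcases Int.units_eq_one_or (Perm.sign p) with h | h <;> simp [chi, h]

theorem chi_inv (p : Perm (Fin n)) : chi b p⁻¹ = chi b p := by
  cases b <;> simp [chi]

theorem chi_swap {x y : Fin n} (h : x ≠ y) : chi b (swap x y) = sgn b := by
  cases b <;> simp [chi, sgn, Perm.sign_swap h]

theorem chi_lift (p : Perm (Fin n)) : chi b (lift p) = chi b p := by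
  simp only [chi, sign_lift]

variable {R : Type*} [Ring R] [Algebra ℂ R]

/-- The totally symmetric or antisymmetric projection of a representation. -/
noncomputable def proj (π : Perm (Fin n) →* R) : R :=
  (n.factorial : ℂ)⁻¹ • ∑ p, chi b p • π p

theorem map_mul_proj (π : Perm (Fin n) →* R) (q : Perm (Fin n)) :
    π q * proj b π = chi b q • proj b π := by
  rw [proj, mul_smul_comm, smul_comm (chi b q)]
  congr 1
  rw [Finset.mul_sum, Finset.smul_sum,
    ← Equiv.sum_comp (Equiv.mulLeft q) (fun p => chi b q • chi b p • π p)]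
  refine Finset.sum_congr rfl fun p _ => ?_
  rw [Equiv.coe_mulLeft, chi_mul, map_mul, mul_smul_comm, smul_smul, ← mul_assoc, chi_mul_self,
    one_mul]

theorem proj_mul_map (π : Perm (Fin n) →* R) (q : Perm (Fin n)) :
    proj b π * π q = chi b q • proj b π := by
  rw [proj, smul_mul_assoc, smul_comm (chi b q)]
  congr 1
  rw [Finset.sum_mul, Finset.smul_sum,
    ← Equiv.sum_comp (Equiv.mulRight q) (fun p => chi b q • chi b p • π p)]
  refine Finset.sum_congr rfl fun p _ => ?_
  rw [Equiv.coe_mulRight, chi_mul, map_mul, smul_mul_assoc, smul_smul, mul_comm (chi b p),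
    ← mul_assoc, chi_mul_self, one_mul]

theorem proj_mul_eq (π : Perm (Fin n) →* R) {x : R} (hx : ∀ p, π p * x = chi b p • x) :
    proj b π * x = x := by
  have : ∀ p, chi b p • π p * x = x := fun p => by
    rw [smul_mul_assoc, hx, smul_smul, chi_mul_self, one_smul]
  rw [proj, smul_mul_assoc, Finset.sum_mul, Finset.sum_congr rfl fun p _ => this p,
    Finset.sum_const, Finset.card_univ, Fintype.card_perm, Fintype.card_fin,
    ← Nat.cast_smul_eq_nsmul ℂ, smul_smul, inv_mul_cancel₀ (by exact_mod_cast n.factorial_ne_zero),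
    one_smul]

theorem proj_mul_proj (π : Perm (Fin n) →* R) : proj b π * proj b π = proj b π :=
  proj_mul_eq b π (map_mul_proj b π)

theorem proj_one (π : Perm (Fin 1) →* R) : proj b π = 1 := by
  have h : ∀ p : Perm (Fin 1), p = 1 := fun p => Subsingleton.elim _ _
  rw [proj, Fintype.sum_eq_single 1 (fun p hp => absurd (h p) hp)]
  simp

theorem proj_succ_eq (π : Perm (Fin (n + 1)) →* R) :
    proj b π = ((n : ℂ) + 1)⁻¹ • ∑ k, chi b (swap 0 k) • (π (swap 0 k) * proj b (π.comp lift)) := by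
  have h : ∀ (k : Fin (n + 1)) (q : Perm (Fin n)),
      Perm.decomposeFin.symm (k, q) = swap 0 k * lift q := by
    intro k q
    ext x
    refine Fin.cases ?_ (fun x => ?_) x <;> simp
  have e : (((n + 1).factorial : ℕ) : ℂ)⁻¹ = ((n : ℂ) + 1)⁻¹ * (n.factorial : ℂ)⁻¹ := by
    rw [Nat.factorial_succ]
    push_cast
    rw [mul_inv]
  rw [proj, e, ← smul_smul, ← Equiv.sum_comp Perm.decomposeFin.symm fun p => chi b p • π p,
    Fintype.sum_prod_type]
  congr 1
  rw [Finset.smul_sum]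
  refine Finset.sum_congr rfl fun k _ => ?_
  rw [proj, mul_smul_comm, smul_comm (chi b _)]
  congr 1
  rw [Finset.mul_sum, Finset.smul_sum]
  refine Finset.sum_congr rfl fun q _ => ?_
  rw [h, chi_mul, map_mul, chi_lift, mul_smul_comm, smul_smul, MonoidHom.comp_apply]

/-- The recursion of the totally symmetric and antisymmetric projections. -/
theorem proj_recursion (π : Perm (Fin (n + 2)) →* R) :
    proj b π = ((n : ℂ) + 2)⁻¹ • (proj b (π.comp lift) +
      (((n : ℂ) + 1) * sgn b) • (proj b (π.comp lift) * π (swap 0 1) * proj b (π.comp lift))) := by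
  set a := proj b (π.comp lift) with ha
  have h1 : a * proj b π = proj b π := by
    refine proj_mul_eq b _ fun p => ?_
    rw [MonoidHom.comp_apply, map_mul_proj, chi_lift]
  have h2 : ∀ k : Fin (n + 1), a * (π (swap 0 k.succ) * a) = a * π (swap 0 1) * a := by
    intro k
    have e : (swap 0 k.succ : Perm (Fin (n + 2))) = lift (swap 0 k) * swap 0 1 * lift (swap 0 k) := by
      rw [lift_swap]
      rcases eq_or_ne k 0 with rfl | hk
      · rw [swap_self]
        rfl
      · rw [show Fin.succ (0 : Fin (n + 1)) = 1 from rfl,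
          swap_mul_swap_mul_swap (by simp) (Fin.succ_ne_zero _).symm, swap_comm]
    rw [e, map_mul, map_mul]
    have h3 : a * π (lift (swap 0 k)) = chi b (swap 0 k) • a := proj_mul_map b (π.comp lift) _
    have h4 : π (lift (swap 0 k)) * a = chi b (swap 0 k) • a := map_mul_proj b (π.comp lift) _
    rw [mul_assoc _ _ a, h4, ← mul_assoc, ← mul_assoc, h3, mul_smul_comm, smul_mul_assoc,
      smul_mul_assoc, smul_smul, chi_mul_self, one_smul]
  have h3 : a * (π (swap 0 0) * a) = a := by
    rw [swap_self]
    exact (congrArg (a * ·) (by rw [show (Equiv.refl (Fin (n + 2))) = 1 from rfl, map_one,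
      one_mul])).trans (proj_mul_proj b _)
  rw [← h1, proj_succ_eq b π, mul_smul_comm, Finset.mul_sum, Fin.sum_univ_succ]
  have h4 : ∀ k : Fin (n + 1), a * chi b (swap 0 k.succ) • (π (swap 0 k.succ) * a) =
      sgn b • (a * π (swap 0 1) * a) := fun k => by
    rw [mul_smul_comm, h2, chi_swap b (Fin.succ_ne_zero k).symm]
  rw [← ha, Finset.sum_congr rfl fun k _ => h4 k, mul_smul_comm, h3, swap_self,
    show (Equiv.refl (Fin (n + 2))) = 1 from rfl, chi_one, one_smul, Finset.sum_const,
    Finset.card_univ, Fintype.card_fin, ← Nat.cast_smul_eq_nsmul ℂ, smul_smul]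
  push_cast
  rw [add_assoc, one_add_one_eq_two]

end

end PermRep

section

open CategoryTheory MonoidalCategory PermRep
open scoped ComplexOrder

/-! ## Symmetric tensor ⋆-categories -/

/-- A symmetric tensor category with an adjoint, a positive cone of endomorphisms, irreducible unit
and subobjects. `kills i` is a family of ideals of arrows. -/
class StarTensor (C : Type u) [Category.{v} C] [Preadditive C] [Linear ℂ C] [MonoidalCategory C]
    [SymmetricCategory C] where
  dag : ∀ {X Y : C}, (X ⟶ Y) → (Y ⟶ X)
  dag_dag : ∀ {X Y : C} (f : X ⟶ Y), dag (dag f) = f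
  dag_id : ∀ X : C, dag (𝟙 X) = 𝟙 X
  dag_comp : ∀ {X Y Z : C} (f : X ⟶ Y) (g : Y ⟶ Z), dag (f ≫ g) = dag g ≫ dag f
  dag_add : ∀ {X Y : C} (f g : X ⟶ Y), dag (f + g) = dag f + dag g
  dag_smul : ∀ {X Y : C} (c : ℂ) (f : X ⟶ Y), dag (c • f) = star c • dag f
  dag_whiskerLeft : ∀ (X : C) {Y Z : C} (f : Y ⟶ Z), dag (X ◁ f) = X ◁ dag f
  dag_whiskerRight : ∀ {Y Z : C} (f : Y ⟶ Z) (X : C), dag (f ▷ X) = dag f ▷ X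
  dag_associator : ∀ X Y Z : C, dag (α_ X Y Z).hom = (α_ X Y Z).inv
  dag_leftUnitor : ∀ X : C, dag (λ_ X).hom = (λ_ X).inv
  dag_rightUnitor : ∀ X : C, dag (ρ_ X).hom = (ρ_ X).inv
  dag_braiding : ∀ X Y : C, dag (β_ X Y).hom = (β_ Y X).hom
  eq_zero_of_comp_dag : ∀ {X Y : C} (f : X ⟶ Y), f ≫ dag f = 0 → f = 0
  unit_irreducible : ∀ f : 𝟙_ C ⟶ 𝟙_ C, ∃ c : ℂ, f = c • 𝟙 _
  unit_ne_zero : 𝟙 (𝟙_ C) ≠ 0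
  Pos : ∀ {X : C}, (X ⟶ X) → Prop
  pos_id : ∀ X : C, Pos (𝟙 X)
  pos_add : ∀ {X : C} {S T : X ⟶ X}, Pos S → Pos T → Pos (S + T)
  pos_smul : ∀ {X : C} {T : X ⟶ X} {r : ℝ}, 0 ≤ r → Pos T → Pos ((r : ℂ) • T)
  pos_conj : ∀ {X Y : C} {T : Y ⟶ Y} (f : X ⟶ Y), Pos T → Pos (f ≫ T ≫ dag f)
  pos_whiskerLeft : ∀ (X : C) {Y : C} {T : Y ⟶ Y}, Pos T → Pos (X ◁ T)
  pos_antisymm : ∀ {X : C} {T : X ⟶ X}, Pos T → Pos (-T) → T = 0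
  nonneg_of_pos_smul : ∀ {X : C} {E : X ⟶ X} {c : ℂ}, Pos E → E ≠ 0 → Pos (c • E) → 0 ≤ c
  exists_sqrt : ∀ {X : C} {T : X ⟶ X}, Pos T → ∃ Q : X ⟶ X, dag Q = Q ∧ Q ≫ Q = T
  exists_sub : ∀ {X : C} {E : X ⟶ X}, dag E = E → E ≫ E = E →
    ∃ (Z : C) (W : Z ⟶ X), W ≫ dag W = 𝟙 Z ∧ dag W ≫ W = E
  exists_proj : ∀ {X : C} (τ : (X ⟶ X) →ₗ[ℂ] ℂ) (c : ℝ),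
    (∀ T, Pos T → 0 ≤ τ T ∧ Pos (((c : ℂ) * τ T) • 𝟙 X - T)) →
    ∀ T : X ⟶ X, dag T = T → (∀ a : ℂ, T ≠ a • 𝟙 X) →
      ∃ E : X ⟶ X, dag E = E ∧ E ≫ E = E ∧ E ≠ 0 ∧ E ≠ 𝟙 X
  Index : Type u
  kills : Index → ∀ {X Y : C}, (X ⟶ Y) → Prop
  kills_comp_right : ∀ {i : Index} {X Y Z : C} {f : X ⟶ Y} (g : Y ⟶ Z),
    kills i f → kills i (f ≫ g)
  kills_comp_left : ∀ {i : Index} {X Y Z : C} (f : X ⟶ Y) {g : Y ⟶ Z},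
    kills i g → kills i (f ≫ g)
  kills_whiskerLeft : ∀ {i : Index} (X : C) {Y Z : C} {f : Y ⟶ Z}, kills i f → kills i (X ◁ f)

namespace StarTensor

variable {C : Type u} [Category.{v} C] [Preadditive C] [Linear ℂ C] [MonoidalCategory C]
  [MonoidalPreadditive C] [MonoidalLinear ℂ C] [SymmetricCategory C] [StarTensor C]

theorem dag_zero (X Y : C) : dag (0 : X ⟶ Y) = 0 := by
  have := dag_smul (0 : ℂ) (0 : X ⟶ Y)
  simpa using this

theorem dag_neg {X Y : C} (f : X ⟶ Y) : dag (-f) = -dag f := by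
  have := dag_smul (-1 : ℂ) f
  simpa using this

theorem dag_sub {X Y : C} (f g : X ⟶ Y) : dag (f - g) = dag f - dag g := by
  rw [sub_eq_add_neg, dag_add, dag_neg, sub_eq_add_neg]

theorem dag_associator_inv (X Y Z : C) : dag (α_ X Y Z).inv = (α_ X Y Z).hom := by
  rw [← dag_associator, dag_dag]

theorem dag_leftUnitor_inv (X : C) : dag (λ_ X).inv = (λ_ X).hom := by
  rw [← dag_leftUnitor, dag_dag]

theorem dag_rightUnitor_inv (X : C) : dag (ρ_ X).inv = (ρ_ X).hom := by
  rw [← dag_rightUnitor, dag_dag]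

theorem pos_comp_dag {X Y : C} (f : X ⟶ Y) : Pos (f ≫ dag f) := by
  have := pos_conj f (pos_id Y)
  rwa [Category.id_comp] at this

theorem pos_whiskerRight {X : C} {T : X ⟶ X} (h : Pos T) (Y : C) : Pos (T ▷ Y) := by
  have := pos_conj (β_ X Y).hom (pos_whiskerLeft Y h)
  rwa [dag_braiding, ← BraidedCategory.braiding_naturality_left_assoc,
    SymmetricCategory.symmetry, Category.comp_id] at this

theorem pos_of_proj {X : C} {E : X ⟶ X} (h : dag E = E) (h' : E ≫ E = E) : Pos E := by
  have := pos_comp_dag E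
  rwa [h, h'] at this

theorem pos_id_sub {X : C} {E : X ⟶ X} (h : dag E = E) (h' : E ≫ E = E) : Pos (𝟙 X - E) := by
  apply pos_of_proj
  · rw [dag_sub, dag_id, h]
  · rw [Preadditive.sub_comp, Preadditive.comp_sub, Preadditive.comp_sub, h']
    simp

theorem pos_zero (X : C) : Pos (0 : X ⟶ X) := by
  have := pos_smul le_rfl (pos_id X)
  simpa using this

theorem eq_zero_of_dag_comp {X Y : C} (f : X ⟶ Y) (h : dag f ≫ f = 0) : f = 0 := by
  have h1 : dag f = 0 := eq_zero_of_comp_dag (dag f) (by rwa [dag_dag])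
  rw [← dag_dag f, h1, dag_zero]

/-- An irreducible object. -/
def Irred (X : C) : Prop := 𝟙 X ≠ 0 ∧ ∀ f : X ⟶ X, ∃ c : ℂ, f = c • 𝟙 X

/-- `γ` can be cancelled on the left. -/
structure Cancellable (γ : C) : Prop where
  exists_eq : ∀ {Y Z : C} (T : γ ⊗ Y ⟶ γ ⊗ Z), ∃ S : Y ⟶ Z, γ ◁ S = T
  injective : ∀ {Y Z : C} {S S' : Y ⟶ Z}, γ ◁ S = γ ◁ S' → S = S'
  pos : ∀ {Y : C} {S : Y ⟶ Y}, Pos (γ ◁ S) → Pos S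
  kills : ∀ {i : Index C} {Y Z : C} {S : Y ⟶ Z}, kills i (γ ◁ S) → kills i S

/-- A left inverse of `X` with nonzero statistics parameter which is bounded below. -/
structure Markov (X : C) where
  Φ : ∀ Y Z : C, (X ⊗ Y ⟶ X ⊗ Z) →ₗ[ℂ] (Y ⟶ Z)
  left : ∀ {Y Y' Z : C} (f : Y ⟶ Y') (T : X ⊗ Y' ⟶ X ⊗ Z), Φ _ _ (X ◁ f ≫ T) = f ≫ Φ _ _ T
  right : ∀ {Y Z Z' : C} (T : X ⊗ Y ⟶ X ⊗ Z) (f : Z ⟶ Z'), Φ _ _ (T ≫ X ◁ f) = Φ _ _ T ≫ f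
  whisker : ∀ {Y Z : C} (T : X ⊗ Y ⟶ X ⊗ Z) (W : C),
    Φ _ _ ((α_ X Y W).inv ≫ T ▷ W ≫ (α_ X Z W).hom) = Φ _ _ T ▷ W
  pos : ∀ {Y : C} {T : X ⊗ Y ⟶ X ⊗ Y}, Pos T → Pos (Φ _ _ T)
  bound : ℝ
  bound_pos : 0 < bound
  bounded : ∀ {Y : C} {T : X ⊗ Y ⟶ X ⊗ Y}, Pos T → Pos ((bound : ℂ) • X ◁ Φ _ _ T - T)
  param : ℂ
  param_ne : param ≠ 0
  braiding : Φ _ _ (β_ X X).hom = param • 𝟙 X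
  norm : ℂ
  id : ∀ Y : C, Φ _ _ (𝟙 (X ⊗ Y)) = norm • 𝟙 Y
  kills : ∀ {i : Index C} {Y Z : C} {T : X ⊗ Y ⟶ X ⊗ Z}, kills i T → kills i (Φ _ _ T)

theorem whiskerLeft_sub' (X : C) {Y Z : C} (f g : Y ⟶ Z) : X ◁ (f - g) = X ◁ f - X ◁ g :=
  (tensorLeft X).map_sub

theorem sub_whiskerRight {Y Z : C} (f g : Y ⟶ Z) (X : C) : (f - g) ▷ X = f ▷ X - g ▷ X :=
  (tensorRight X).map_sub

/-- The tensor unit. -/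
def Markov.unit : Markov (𝟙_ C) where
  Φ Y Z :=
    { toFun := fun T => (λ_ Y).inv ≫ T ≫ (λ_ Z).hom
      map_add' := fun S T => by simp
      map_smul' := fun c T => by simp }
  left f T := by simp
  right T f := by simp
  whisker T W := by simp
  pos {Y T} h := by
    have := pos_conj (λ_ Y).inv h
    rwa [dag_leftUnitor_inv] at this
  bound := 1
  bound_pos := one_pos
  bounded {Y T} _ := by
    have := pos_zero (𝟙_ C ⊗ Y)
    simpa
  param := 1
  param_ne := one_ne_zero
  braiding := by
    simp only [LinearMap.coe_mk, AddHom.coe_mk]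
    rw [braiding_tensorUnit_left, Category.assoc, Iso.inv_hom_id_assoc, unitors_equal,
      Iso.inv_hom_id, one_smul]
  norm := 1
  id Y := by simp
  kills h := kills_comp_left _ (kills_comp_right _ h)

/-- The tensor product of two left inverses. -/
def Markov.tensor {X X' : C} (M : Markov X) (M' : Markov X') : Markov (X ⊗ X') where
  Φ Y Z :=
    { toFun := fun T => M'.Φ _ _ (M.Φ _ _ ((α_ X X' Y).inv ≫ T ≫ (α_ X X' Z).hom))
      map_add' := fun S T => by simp
      map_smul' := fun c T => by simp }
  left f T := by
    simp only [LinearMap.coe_mk, AddHom.coe_mk]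
    rw [← M'.left, ← M.left]
    congr 2
    monoidal
  right T f := by
    simp only [LinearMap.coe_mk, AddHom.coe_mk]
    rw [← M'.right, ← M.right]
    congr 2
    monoidal
  whisker T W := by
    simp only [LinearMap.coe_mk, AddHom.coe_mk]
    rw [← M'.whisker, ← M.whisker, ← M.right, ← M.left]
    congr 2
    monoidal
  pos {Y T} h := by
    have := pos_conj (α_ X X' Y).inv h
    rw [dag_associator_inv] at this
    exact M'.pos (M.pos this)
  bound := M.bound * M'.bound
  bound_pos := mul_pos M.bound_pos M'.bound_pos
  bounded {Y T} h := by
    have h0 := pos_conj (α_ X X' Y).inv h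
    rw [dag_associator_inv] at h0
    have h1 := M.bounded h0
    have h2 := pos_smul M.bound_pos.le (pos_whiskerLeft X (M'.bounded (M.pos h0)))
    have h3 := pos_conj (α_ X X' Y).hom (pos_add h1 h2)
    rw [dag_associator] at h3
    convert h3 using 1
    simp only [LinearMap.coe_mk, AddHom.coe_mk]
    rw [whiskerLeft_sub', MonoidalLinear.whiskerLeft_smul, smul_sub, smul_smul, sub_add_eq_add_sub,
      add_sub_cancel, Preadditive.sub_comp, Preadditive.comp_sub]
    push_cast
    simp
  param := M.param * M'.param
  param_ne := mul_ne_zero M.param_ne M'.param_ne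
  braiding := by
    simp only [LinearMap.coe_mk, AddHom.coe_mk]
    have h1 : (α_ X X' (X ⊗ X')).inv ≫ (β_ (X ⊗ X') (X ⊗ X')).hom ≫ (α_ X X' (X ⊗ X')).hom =
        X ◁ ((α_ X' X X').inv ≫ (β_ X' X).hom ▷ X' ≫ (α_ X X' X').hom) ≫
          ((α_ X X (X' ⊗ X')).inv ≫ (β_ X X).hom ▷ (X' ⊗ X') ≫ (α_ X X (X' ⊗ X')).hom) ≫
          X ◁ (X ◁ (β_ X' X').hom ≫ (α_ X X' X').inv ≫ (β_ X X').hom ▷ X' ≫ (α_ X' X X').hom) := by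
      simp only [BraidedCategory.braiding_tensor_left_hom,
        BraidedCategory.braiding_tensor_right_hom]
      monoidal
    have h2 : (α_ X' X X').inv ≫ (β_ X' X).hom ▷ X' ≫ (α_ X X' X').hom ≫ X ◁ (β_ X' X').hom ≫
        (α_ X X' X').inv ≫ (β_ X X').hom ▷ X' ≫ (α_ X' X X').hom =
        X' ◁ (β_ X X').hom ≫ ((α_ X' X' X).inv ≫ (β_ X' X').hom ▷ X ≫ (α_ X' X' X).hom) ≫
          X' ◁ (β_ X' X).hom := by
      rw [BraidedCategory.yang_baxter]
      simp
    rw [h1, M.left, M.right, M.whisker, M.braiding, MonoidalLinear.smul_whiskerRight,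
      id_whiskerRight, Linear.smul_comp, Linear.comp_smul, Category.id_comp, map_smul]
    simp only [Category.assoc]
    rw [h2, M'.left, M'.right, M'.whisker, M'.braiding]
    simp [smul_smul]
  norm := M.norm * M'.norm
  id Y := by
    simp only [LinearMap.coe_mk, AddHom.coe_mk, Category.id_comp, Iso.inv_hom_id]
    rw [M.id, map_smul, M'.id, smul_smul]
  kills h := M'.kills (M.kills (kills_comp_left _ (kills_comp_right _ h)))

/-- The left inverse of a subobject. -/
def Markov.sub {X Z : C} (M : Markov X) (W : Z ⟶ X) (hW : W ≫ dag W = 𝟙 Z) (s : ℂ)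
    (hs : M.Φ (𝟙_ C) (𝟙_ C) ((dag W ≫ W) ▷ 𝟙_ C) = s • 𝟙 _) : Markov Z where
  Φ Y Y' :=
    { toFun := fun T => M.Φ _ _ (dag W ▷ Y ≫ T ≫ W ▷ Y')
      map_add' := fun S T => by simp
      map_smul' := fun c T => by simp }
  left f T := by
    simp only [LinearMap.coe_mk, AddHom.coe_mk]
    rw [← M.left, whisker_exchange_assoc, Category.assoc]
  right T f := by
    simp only [LinearMap.coe_mk, AddHom.coe_mk]
    rw [← M.right, Category.assoc, Category.assoc, Category.assoc, whisker_exchange]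
  whisker T W' := by
    simp only [LinearMap.coe_mk, AddHom.coe_mk]
    rw [← M.whisker]
    congr 1
    monoidal
  pos {Y T} h := by
    have := pos_conj (dag W ▷ Y) h
    rw [dag_whiskerRight, dag_dag] at this
    exact M.pos this
  bound := M.bound
  bound_pos := M.bound_pos
  bounded {Y T} h := by
    have h0 := pos_conj (dag W ▷ Y) h
    rw [dag_whiskerRight, dag_dag] at h0
    have h1 := pos_conj (W ▷ Y) (M.bounded h0)
    convert h1 using 1
    simp only [LinearMap.coe_mk, AddHom.coe_mk, dag_whiskerRight]
    rw [Preadditive.sub_comp, Preadditive.comp_sub]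
    congr 1
    · rw [Linear.smul_comp, Linear.comp_smul, ← whisker_exchange_assoc, ← comp_whiskerRight, hW]
      simp
    · simp only [Category.assoc, ← comp_whiskerRight, ← comp_whiskerRight_assoc, hW]
      simp
  param := M.param
  param_ne := M.param_ne
  braiding := by
    simp only [LinearMap.coe_mk, AddHom.coe_mk]
    have : dag W ▷ Z ≫ (β_ Z Z).hom ≫ W ▷ Z = X ◁ W ≫ (β_ X X).hom ≫ X ◁ dag W := by
      rw [← BraidedCategory.braiding_naturality_right, ← BraidedCategory.braiding_naturality_left,
        whisker_exchange_assoc]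
    rw [this, M.left, M.right, M.braiding]
    simp [hW]
  norm := s
  id Y := by
    simp only [LinearMap.coe_mk, AddHom.coe_mk, Category.id_comp]
    have h1 : dag W ▷ Y ≫ W ▷ Y = X ◁ (λ_ Y).inv ≫ ((α_ X (𝟙_ C) Y).inv ≫
        ((dag W ≫ W) ▷ 𝟙_ C) ▷ Y ≫ (α_ X (𝟙_ C) Y).hom) ≫ X ◁ (λ_ Y).hom := by
      monoidal
    rw [h1, M.left, M.right, M.whisker, hs]
    simp
  kills h := M.kills (kills_comp_left _ (kills_comp_right _ h))

theorem dag_comp_id_sub {X Y : C} {V : Y ⟶ X} (hV : V ≫ dag V = 𝟙 Y) : Pos (𝟙 X - dag V ≫ V) := by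
  refine pos_id_sub ?_ ?_
  · rw [dag_comp, dag_dag]
  · rw [Category.assoc, reassoc_of% hV]

/-- `1 × ε × 1` on the first two factors. -/
abbrev swapLeft (X M : C) : X ⊗ X ⊗ M ⟶ X ⊗ X ⊗ M :=
  (α_ X X M).inv ≫ (β_ X X).hom ▷ M ≫ (α_ X X M).hom

section base
variable {X M γ : C} {V : γ ⟶ X ⊗ M} {c : ℂ}

theorem conjugate_eq (hc : X ◁ V ≫ swapLeft X M ≫ X ◁ dag V = c • 𝟙 _) :
    X ◁ (V ≫ (β_ X M).hom) ≫ (α_ X M X).inv ≫ dag V ▷ X = c • (β_ X γ).hom := by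
  have h1 : X ◁ (β_ X M).hom ≫ (α_ X M X).inv ≫ (β_ (X ⊗ M) X).hom = swapLeft X M := by
    rw [BraidedCategory.braiding_tensor_left_hom]
    simp only [Iso.inv_hom_id_assoc, ← MonoidalCategory.whiskerLeft_comp_assoc,
      SymmetricCategory.symmetry, MonoidalCategory.whiskerLeft_id, Category.id_comp]
  have h2 : dag V ▷ X = (β_ (X ⊗ M) X).hom ≫ X ◁ dag V ≫ (β_ X γ).hom := by
    rw [← BraidedCategory.braiding_naturality_left_assoc, SymmetricCategory.symmetry,
      Category.comp_id]
  rw [h2, MonoidalCategory.whiskerLeft_comp, Category.assoc, reassoc_of% h1]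
  have h3 := congrArg (fun f => f ≫ (β_ X γ).hom) hc
  simp only [Category.assoc, Linear.smul_comp, Category.id_comp] at h3
  simpa only [Category.assoc] using h3

/-- The left inverse of `X` defined by an isometry into `X ⊗ M`. -/
noncomputable def Cancellable.markov (hγ : Cancellable γ) (hV : V ≫ dag V = 𝟙 γ)
    (hc : X ◁ V ≫ swapLeft X M ≫ X ◁ dag V = c • 𝟙 _) (hc0 : c ≠ 0) : Markov X :=
  let V' := V ≫ (β_ X M).hom
  have hV' : V' ≫ dag V' = 𝟙 γ := by
    simp only [V', dag_comp, dag_braiding, Category.assoc, SymmetricCategory.symmetry_assoc, hV]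
  let ψ : ∀ {Y Z : C}, (X ⊗ Y ⟶ X ⊗ Z) → (γ ⊗ Y ⟶ γ ⊗ Z) := fun {Y Z} T =>
    V' ▷ Y ≫ (α_ M X Y).hom ≫ M ◁ T ≫ (α_ M X Z).inv ≫ dag V' ▷ Z
  let φ : ∀ {Y Z : C}, (X ⊗ Y ⟶ X ⊗ Z) → (Y ⟶ Z) := fun T => (hγ.exists_eq (ψ T)).choose
  have hφ : ∀ {Y Z : C} (T : X ⊗ Y ⟶ X ⊗ Z), γ ◁ φ T = ψ T := fun T =>
    (hγ.exists_eq (ψ T)).choose_spec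
  { Φ := fun Y Z =>
      { toFun := φ
        map_add' := fun S T => hγ.injective (by
          rw [MonoidalPreadditive.whiskerLeft_add, hφ, hφ, hφ]; simp [ψ])
        map_smul' := fun a T => hγ.injective (by
          rw [MonoidalLinear.whiskerLeft_smul, hφ, hφ]; simp [ψ]) }
    left := fun f T => hγ.injective (by
      simp only [LinearMap.coe_mk, AddHom.coe_mk]
      rw [MonoidalCategory.whiskerLeft_comp, hφ, hφ]
      simp only [ψ]
      rw [whisker_exchange_assoc]
      simp)
    right := fun T f => hγ.injective (by
      simp only [LinearMap.coe_mk, AddHom.coe_mk]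
      rw [MonoidalCategory.whiskerLeft_comp, hφ, hφ]
      simp only [ψ, Category.assoc]
      rw [← whisker_exchange]
      simp)
    whisker := fun T W => hγ.injective (by
      simp only [LinearMap.coe_mk, AddHom.coe_mk]
      have h := hφ T
      have h1 : γ ◁ (φ T ▷ W) = (α_ _ _ _).inv ≫ (γ ◁ φ T) ▷ W ≫ (α_ _ _ _).hom := by monoidal
      rw [h1, hφ, hφ]
      simp only [ψ]
      monoidal)
    pos := fun {Y T} h => hγ.pos (by
      simp only [LinearMap.coe_mk, AddHom.coe_mk]
      rw [hφ]
      have := pos_conj (V' ▷ Y ≫ (α_ M X Y).hom) (pos_whiskerLeft M h)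
      rw [dag_comp, dag_associator, dag_whiskerRight] at this
      simpa [ψ] using this)
    bound := (‖c‖ ^ 2)⁻¹
    bound_pos := by positivity
    bounded := fun {Y T} h => hγ.pos (by
      simp only [LinearMap.coe_mk, AddHom.coe_mk]
      obtain ⟨Q, hQ, hQT⟩ := exists_sqrt h
      set N : γ ⊗ Y ⟶ M ⊗ X ⊗ Y := V' ▷ Y ≫ (α_ M X Y).hom ≫ M ◁ Q with hN
      have h1 : N ≫ dag N = γ ◁ φ T := by
        rw [hφ]
        simp only [hN, ψ, dag_comp, dag_whiskerLeft, dag_associator, dag_whiskerRight, hQ, ← hQT]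
        simp
      set K : X ⊗ γ ⊗ Y ⟶ γ ⊗ X ⊗ Y :=
        X ◁ N ≫ (α_ X M (X ⊗ Y)).inv ≫ dag V ▷ (X ⊗ Y) with hK
      have h2 : K = c • ((α_ X γ Y).inv ≫ (β_ X γ).hom ▷ Y ≫ (α_ γ X Y).hom ≫ γ ◁ Q) := by
        have e := congrArg (fun f => (α_ X γ Y).inv ≫ f ▷ Y ≫ (α_ γ X Y).hom ≫ γ ◁ Q)
          (conjugate_eq hc)
        simp only [MonoidalLinear.smul_whiskerRight, Linear.smul_comp, Linear.comp_smul] at e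
        rw [← e]
        simp only [hK, hN, V']
        simp only [MonoidalCategory.whiskerLeft_comp, comp_whiskerRight, Category.assoc]
        have e1 : X ◁ M ◁ Q ≫ (α_ X M (X ⊗ Y)).inv ≫ dag V ▷ (X ⊗ Y) =
            (α_ X M (X ⊗ Y)).inv ≫ dag V ▷ (X ⊗ Y) ≫ γ ◁ Q := by
          rw [← whisker_exchange]
          simp
        rw [e1]
        monoidal
      have h3 : Pos (X ◁ γ ◁ φ T - K ≫ dag K) := by
        have := pos_conj (X ◁ N ≫ (α_ X M (X ⊗ Y)).inv)
          (pos_whiskerRight (dag_comp_id_sub hV) (X ⊗ Y))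
        convert this using 1
        rw [← h1, show (𝟙 (X ⊗ M) - dag V ≫ V) ▷ (X ⊗ Y) =
          𝟙 _ - dag V ▷ (X ⊗ Y) ≫ V ▷ (X ⊗ Y) by
            rw [sub_whiskerRight, comp_whiskerRight, id_whiskerRight]]
        simp only [hK, dag_comp, dag_whiskerLeft, dag_associator_inv, dag_whiskerRight, dag_dag,
          Preadditive.sub_comp, Preadditive.comp_sub, Category.assoc, Category.id_comp,
          Iso.inv_hom_id_assoc, MonoidalCategory.whiskerLeft_comp]
      set J : γ ⊗ X ⊗ Y ⟶ X ⊗ γ ⊗ Y :=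
        (α_ γ X Y).inv ≫ (β_ γ X).hom ▷ Y ≫ (α_ X γ Y).hom with hJ
      have h4 : J ≫ (X ◁ γ ◁ φ T) ≫ dag J = γ ◁ X ◁ φ T := by
        simp only [hJ, dag_comp, dag_associator, dag_associator_inv, dag_whiskerRight,
          dag_braiding, Category.assoc]
        rw [← associator_naturality_right_assoc, Iso.hom_inv_id_assoc, ← whisker_exchange_assoc,
          ← comp_whiskerRight_assoc, SymmetricCategory.symmetry]
        simp
      have h5 : J ≫ K = c • γ ◁ Q := by
        rw [h2, hJ, Linear.comp_smul]
        congr 1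
        simp [← comp_whiskerRight_assoc]
      have h6 := pos_smul (r := (‖c‖ ^ 2)⁻¹) (by positivity) (pos_conj J h3)
      convert h6 using 1
      rw [Preadditive.sub_comp, Preadditive.comp_sub, h4]
      have h7 : J ≫ (K ≫ dag K) ≫ dag J = ((‖c‖ ^ 2 : ℝ) : ℂ) • γ ◁ T := by
        have : J ≫ (K ≫ dag K) ≫ dag J = (J ≫ K) ≫ dag (J ≫ K) := by simp [dag_comp]
        rw [this, h5, dag_smul, dag_whiskerLeft, hQ, Linear.smul_comp, Linear.comp_smul, smul_smul,
          ← MonoidalCategory.whiskerLeft_comp, hQT]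
        congr 1
        rw [Complex.star_def, Complex.mul_conj, Complex.normSq_eq_norm_sq]
      have h8 : (((‖c‖ ^ 2)⁻¹ : ℝ) : ℂ) * ((‖c‖ ^ 2 : ℝ) : ℂ) = 1 := by
        rw [← Complex.ofReal_mul, inv_mul_cancel₀ (by positivity), Complex.ofReal_one]
      rw [h7, smul_sub, smul_smul, h8, one_smul, whiskerLeft_sub', MonoidalLinear.whiskerLeft_smul])
    param := c
    param_ne := hc0
    braiding := hγ.injective (by
      simp only [LinearMap.coe_mk, AddHom.coe_mk]
      rw [hφ, MonoidalLinear.whiskerLeft_smul, MonoidalCategory.whiskerLeft_id]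
      have h1 : dag V' = (β_ M X).hom ≫ dag V := by simp only [V', dag_comp, dag_braiding]
      have h2 : (α_ M X X).hom ≫ M ◁ (β_ X X).hom ≫ (α_ M X X).inv ≫ (β_ M X).hom ▷ X =
          (β_ (M ⊗ X) X).hom ≫ (α_ X M X).inv := by
        rw [BraidedCategory.braiding_tensor_left_hom]
        simp
      have h3 := congrArg (fun f => V' ▷ X ≫ f ≫ dag V ▷ X) h2
      simp only [Category.assoc] at h3
      simp only [ψ]
      rw [h1, comp_whiskerRight (β_ M X).hom, h3, BraidedCategory.braiding_naturality_left_assoc,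
        conjugate_eq hc]
      simp)
    norm := 1
    id := fun Y => hγ.injective (by
      simp only [LinearMap.coe_mk, AddHom.coe_mk]
      rw [hφ]
      simp [ψ, ← comp_whiskerRight, hV'])
    kills := fun {i Y Z T} h => hγ.kills (by
      simp only [LinearMap.coe_mk, AddHom.coe_mk]
      rw [hφ]
      exact kills_comp_left _ (kills_comp_left _ (kills_comp_right _ (kills_whiskerLeft M h)))) }

end base

/-- The tensor powers. -/
@[reducible] def pow (X : C) : ℕ → C
  | 0 => 𝟙_ C
  | n + 1 => X ⊗ pow X n

/-- Whiskering as a homomorphism of endomorphism monoids. -/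
def whisk (X Y : C) : End Y →* End (X ⊗ Y) where
  toFun f := X ◁ f
  map_one' := MonoidalCategory.whiskerLeft_id _ _
  map_mul' f g := MonoidalCategory.whiskerLeft_comp X g f

/-- The endomorphisms `1 × ⋯ × ε × ⋯ × 1` of a power. -/
def adjE (X : C) : (d _ : ℕ) → End (pow X (d + 1))
  | 0, _ => 𝟙 _
  | d + 1, 0 => swapLeft X (pow X d)
  | d + 1, i + 1 => X ◁ adjE X d i

theorem swapLeft_swapLeft (X M : C) : swapLeft X M ≫ swapLeft X M = 𝟙 _ := by
  simp [swapLeft, ← comp_whiskerRight_assoc]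

theorem dag_swapLeft (X M : C) : dag (swapLeft X M) = swapLeft X M := by
  simp [swapLeft, dag_comp, dag_whiskerRight, dag_associator, dag_associator_inv, dag_braiding]

theorem swapLeft_naturality (X : C) {M M' : C} (f : M ⟶ M') :
    X ◁ X ◁ f ≫ swapLeft X M' = swapLeft X M ≫ X ◁ X ◁ f := by
  simp only [swapLeft, Category.assoc]
  rw [← associator_naturality_right, ← whisker_exchange_assoc,
    associator_inv_naturality_right_assoc]

theorem swapLeft_braid (X M : C) :
    swapLeft X (X ⊗ M) ≫ X ◁ swapLeft X M ≫ swapLeft X (X ⊗ M) =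
      X ◁ swapLeft X M ≫ swapLeft X (X ⊗ M) ≫ X ◁ swapLeft X M := by
  have h := congrArg (fun f => X ◁ (α_ X X M).inv ≫ (α_ X (X ⊗ X) M).inv ≫ f ▷ M ≫
    (α_ X (X ⊗ X) M).hom ≫ X ◁ (α_ X X M).hom) (BraidedCategory.yang_baxter X X X)
  simp only [swapLeft]
  calc _ = _ := by monoidal
    _ = _ := h
    _ = _ := by monoidal

theorem adjE_coxeter (X : C) (d : ℕ) : Coxeter d (adjE X d) := by
  induction d with
  | zero => exact ⟨fun i h => by omega, fun i h => by omega, fun i j h h' => by omega⟩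
  | succ d ih =>
    refine ⟨fun i hi => ?_, fun i hi => ?_, fun i j hij hj => ?_⟩
    · cases i with
      | zero => exact swapLeft_swapLeft X _
      | succ i =>
        have := congrArg (whisk X _) (ih.sq i (by omega))
        rwa [map_mul, map_one] at this
    · cases i with
      | zero =>
        obtain ⟨d, rfl⟩ : ∃ e, d = e + 1 := ⟨d - 1, by omega⟩
        have := swapLeft_braid X (pow X d)
        simp only [adjE]
        exact this
      | succ i =>
        have := congrArg (whisk X _) (ih.braid i (by omega))
        rwa [map_mul, map_mul, map_mul, map_mul] at this
    · obtain ⟨j, rfl⟩ : ∃ e, j = e + 1 := ⟨j - 1, by omega⟩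
      cases i with
      | zero =>
        obtain ⟨j, rfl⟩ : ∃ e, j = e + 1 := ⟨j - 1, by omega⟩
        obtain ⟨d, rfl⟩ : ∃ e, d = e + 1 := ⟨d - 1, by omega⟩
        exact swapLeft_naturality X (adjE X d j)
      | succ i =>
        have := congrArg (whisk X _) (ih.comm i j (by omega) (by omega))
        rwa [map_mul, map_mul] at this

theorem dag_adjE (X : C) (d i : ℕ) : dag (adjE X d i) = adjE X d i := by
  induction d generalizing i with
  | zero => exact dag_id _
  | succ d ih =>
    cases i with
    | zero => exact dag_swapLeft X _
    | succ i => exact (dag_whiskerLeft X _).trans (congrArg (X ◁ ·) (ih i))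

/-- The representation of the permutation group on a power. -/
noncomputable def permE (X : C) (d : ℕ) : Equiv.Perm (Fin (d + 1)) →* End (pow X (d + 1)) :=
  (adjE_coxeter X d).exists_hom.choose

theorem permE_adj (X : C) (d i : ℕ) (hi : i < d) : permE X d (adj d i) = adjE X d i :=
  (adjE_coxeter X d).exists_hom.choose_spec i hi

theorem permE_comp_lift (X : C) (d : ℕ) :
    (permE X (d + 1)).comp lift = (whisk X _).comp (permE X d) := by
  refine hom_ext fun i hi => ?_
  rw [MonoidHom.comp_apply, MonoidHom.comp_apply, lift_adj, permE_adj X _ _ (by omega),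
    permE_adj X _ _ hi]
  rfl

theorem permE_swap (X : C) (d : ℕ) :
    permE X (d + 1) (Equiv.swap 0 1) = swapLeft X (pow X d) := by
  have := permE_adj X (d + 1) 0 (by omega)
  rwa [adj, dif_pos (by omega)] at this

theorem dag_permE (X : C) (d : ℕ) (p : Equiv.Perm (Fin (d + 1))) :
    dag (permE X d p) = permE X d p⁻¹ := by
  induction p using adj_induction with
  | h1 => rw [inv_one, map_one]; exact dag_id _
  | h2 i hi p ih =>
    have h : (adj d i)⁻¹ = adj d i := inv_eq_of_mul_eq_one_left ((adj_coxeter d).sq i hi)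
    rw [mul_inv_rev, map_mul, map_mul, ← ih, h, permE_adj X d i hi, End.mul_def, End.mul_def,
      dag_comp, dag_adjE]

/-- The totally antisymmetric (`b = true`) or symmetric projection of a power. -/
noncomputable def symm (b : Bool) (X : C) : (n : ℕ) → End (pow X n)
  | 0 => 1
  | d + 1 => proj b (permE X d)

theorem symm_mul_self (b : Bool) (X : C) (n : ℕ) : symm b X n ≫ symm b X n = symm b X n := by
  cases n with
  | zero => exact Category.id_comp _
  | succ d => exact proj_mul_proj b (permE X d)

theorem dag_sum {X Y : C} {ι : Type*} (s : Finset ι) (f : ι → (X ⟶ Y)) :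
    dag (∑ i ∈ s, f i) = ∑ i ∈ s, dag (f i) :=
  map_sum (⟨⟨dag, dag_zero X Y⟩, dag_add⟩ : (X ⟶ Y) →+ (Y ⟶ X)) f s

theorem dag_symm (b : Bool) (X : C) (n : ℕ) : dag (symm b X n) = symm b X n := by
  cases n with
  | zero => exact dag_id _
  | succ d =>
    have h1 : ∀ p : Equiv.Perm (Fin (d + 1)), dag (chi b p • permE X d p) =
        chi b p⁻¹ • permE X d p⁻¹ := fun p => by
      rw [← dag_permE, chi_inv]
      refine (dag_smul _ _).trans ?_
      congr 1
      cases b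
      · simp [chi]
      · rcases Int.units_eq_one_or (Equiv.Perm.sign p) with h | h <;> simp [chi, h]
    change dag (((d + 1).factorial : ℂ)⁻¹ • ∑ p, chi b p • permE X d p) =
      ((d + 1).factorial : ℂ)⁻¹ • ∑ p, chi b p • permE X d p
    refine (dag_smul _ _).trans ?_
    congr 1
    · simp
    · refine (dag_sum _ _).trans ?_
      rw [Finset.sum_congr rfl fun p _ => h1 p]
      exact Equiv.sum_comp (Equiv.inv _) fun p => chi b p • permE X d p

theorem pos_symm (b : Bool) (X : C) (n : ℕ) : Pos (symm b X n) :=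
  pos_of_proj (dag_symm b X n) (symm_mul_self b X n)

theorem symm_one (b : Bool) (X : C) : symm b X 1 = 𝟙 _ := proj_one b (permE X 0)

theorem proj_whisk (b : Bool) (X : C) (d : ℕ) :
    proj b ((whisk X _).comp (permE X d)) = X ◁ symm b X (d + 1) := by
  change _ = X ◁ (((d + 1).factorial : ℂ)⁻¹ • ∑ p, chi b p • permE X d p)
  rw [MonoidalLinear.whiskerLeft_smul, whiskerLeft_sum]
  simp only [proj]
  congr 1
  refine Finset.sum_congr rfl fun p _ => ?_
  exact (MonoidalLinear.whiskerLeft_smul X (chi b p) (permE X d p)).symm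

theorem symm_recursion (b : Bool) (X : C) (n : ℕ) :
    symm b X (n + 2) = ((n : ℂ) + 2)⁻¹ • (X ◁ symm b X (n + 1) + (((n : ℂ) + 1) * sgn b) •
      (X ◁ symm b X (n + 1) ≫ swapLeft X (pow X n) ≫ X ◁ symm b X (n + 1))) := by
  have h := proj_recursion b (permE X (n + 1))
  rw [permE_comp_lift, proj_whisk, permE_swap] at h
  rw [End.mul_def, End.mul_def] at h
  exact h

/-- The value of a left inverse at the symmetric projections. -/
theorem apply_symm (b : Bool) (X : C) (n : ℕ)
    (F : (X ⊗ pow X (n + 1) ⟶ X ⊗ pow X (n + 1)) →ₗ[ℂ] (pow X (n + 1) ⟶ pow X (n + 1)))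
    (left : ∀ f T, F (X ◁ f ≫ T) = f ≫ F T) (right : ∀ f T, F (T ≫ X ◁ f) = F T ≫ f)
    {κ c : ℂ} (h1 : F (𝟙 _) = κ • 𝟙 _) (hs : F (swapLeft X (pow X n)) = c • 𝟙 _) :
    F (symm b X (n + 2)) = ((κ + ((n : ℂ) + 1) * (sgn b * c)) / ((n : ℂ) + 2)) •
      symm b X (n + 1) := by
  have h2 : F (X ◁ symm b X (n + 1)) = κ • symm b X (n + 1) := by
    rw [← Category.comp_id (X ◁ symm b X (n + 1)), left, h1, Linear.comp_smul, Category.comp_id]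
  have h3 : F (X ◁ symm b X (n + 1) ≫ swapLeft X (pow X n) ≫ X ◁ symm b X (n + 1)) =
      c • symm b X (n + 1) := by
    rw [left, right, hs, Linear.smul_comp, Linear.comp_smul, Category.id_comp, symm_mul_self]
  rw [symm_recursion]
  refine (map_smul F _ _).trans ?_
  rw [map_add, map_smul, h2, h3, smul_smul, ← add_smul, smul_smul]
  congr 1
  ring

theorem Markov.Φ_swapLeft {X : C} (M : Markov X) (Y : C) :
    M.Φ _ _ (swapLeft X Y) = M.param • 𝟙 _ := by
  rw [swapLeft, M.whisker, M.braiding, MonoidalLinear.smul_whiskerRight, id_whiskerRight]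

theorem Markov.Φ_symm {X : C} (M : Markov X) (b : Bool) (n : ℕ) :
    M.Φ (pow X n) (pow X n) (symm b X (n + 1)) =
      ((M.norm + n * (sgn b * M.param)) / ((n : ℂ) + 1)) • symm b X n := by
  cases n with
  | zero =>
    rw [symm_one]
    refine (M.id _).trans ?_
    simp [symm]
  | succ n =>
    have := apply_symm b X n (M.Φ _ _) M.left (fun f T => M.right T f) (M.id _) (M.Φ_swapLeft _)
    refine this.trans ?_
    push_cast
    congr 2
    ring

/-- Iteration of a left inverse. -/
noncomputable def Markov.pow {X : C} (M : Markov X) : (n : ℕ) → Markov (pow X n)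
  | 0 => Markov.unit
  | n + 1 => M.tensor (M.pow n)

theorem Markov.pow_param {X : C} (M : Markov X) (n : ℕ) : (M.pow n).param = M.param ^ n := by
  induction n with
  | zero => rfl
  | succ n ih =>
    rw [pow_succ', ← ih]
    rfl

theorem Markov.pow_symm {X : C} (M : Markov X) (b : Bool) (n : ℕ) :
    (M.pow n).Φ (𝟙_ C) (𝟙_ C) (symm b X n ▷ 𝟙_ C) =
      (∏ j ∈ Finset.range n, (M.norm + j * (sgn b * M.param)) / ((j : ℂ) + 1)) • 𝟙 _ := by
  induction n with
  | zero =>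
    have h := (Markov.unit (C := C)).id (𝟙_ C)
    rw [Finset.range_zero, Finset.prod_empty]
    refine Eq.trans ?_ h
    congr 1
    exact id_whiskerRight _ _
  | succ n ih =>
    have h1 : (α_ X (StarTensor.pow X n) (𝟙_ C)).inv ≫ symm b X (n + 1) ▷ 𝟙_ C ≫
        (α_ X (StarTensor.pow X n) (𝟙_ C)).hom =
        X ◁ (ρ_ (StarTensor.pow X n)).hom ≫ symm b X (n + 1) ≫
          X ◁ (ρ_ (StarTensor.pow X n)).inv := by
      change _ ≫ (show X ⊗ StarTensor.pow X n ⟶ X ⊗ StarTensor.pow X n from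
        symm b X (n + 1)) ▷ 𝟙_ C ≫ _ = _ ≫ (show X ⊗ StarTensor.pow X n ⟶
        X ⊗ StarTensor.pow X n from symm b X (n + 1)) ≫ _
      generalize (show X ⊗ StarTensor.pow X n ⟶ X ⊗ StarTensor.pow X n from
        symm b X (n + 1)) = f
      monoidal
    change (M.pow n).Φ _ _ (M.Φ _ _ (_ ≫ symm b X (n + 1) ▷ 𝟙_ C ≫ _)) = _
    rw [h1, M.left, M.right]
    have h2 := M.Φ_symm b n
    refine (congrArg (fun f => (M.pow n).Φ _ _ (_ ≫ f ≫ _)) h2).trans ?_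
    rw [Linear.smul_comp, Linear.comp_smul, map_smul, ← rightUnitor_naturality_assoc,
      Iso.hom_inv_id, Category.comp_id, ih, smul_smul, Finset.prod_range_succ, mul_comm]

theorem exists_param {X M γ : C} (hX : Irred X) (hγ : Cancellable γ) (V : γ ⟶ X ⊗ M) :
    ∃ c : ℂ, X ◁ V ≫ swapLeft X M ≫ X ◁ dag V = c • 𝟙 _ := by
  obtain ⟨S, hS⟩ := hγ.exists_eq ((β_ γ X).hom ≫ (X ◁ V ≫ swapLeft X M ≫ X ◁ dag V) ≫
    (β_ X γ).hom)
  obtain ⟨c, rfl⟩ := hX.2 S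
  refine ⟨c, ?_⟩
  generalize X ◁ V ≫ swapLeft X M ≫ X ◁ dag V = K at hS ⊢
  have := congrArg (fun f => (β_ X γ).hom ≫ f ≫ (β_ γ X).hom) hS
  simpa using this.symm

theorem param_ne_zero {X γ : C} (hX : Irred X) (hγ : Cancellable γ) {m : ℕ} {b : Bool}
    {V : γ ⟶ X ⊗ pow X m} (hV : V ≫ dag V = 𝟙 γ) (hVb : dag V ≫ V = symm b X (m + 1)) {c : ℂ}
    (hc : X ◁ V ≫ swapLeft X (pow X m) ≫ X ◁ dag V = c • 𝟙 _) : c ≠ 0 := by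
  rintro rfl
  have h1 : X ◁ symm b X (m + 1) ≫ swapLeft X (pow X m) ≫ X ◁ symm b X (m + 1) = 0 := by
    change X ◁ (show X ⊗ pow X m ⟶ X ⊗ pow X m from symm b X (m + 1)) ≫ _ ≫
      X ◁ (show X ⊗ pow X m ⟶ X ⊗ pow X m from symm b X (m + 1)) = 0
    rw [← hVb, MonoidalCategory.whiskerLeft_comp]
    have := congrArg (fun f => X ◁ dag V ≫ f ≫ X ◁ V) hc
    simpa using this
  have h2 := symm_recursion b X m
  rw [h1, smul_zero, add_zero] at h2
  have h3 := symm_mul_self b X (m + 2)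
  rw [h2] at h3
  have h4 : X ◁ symm b X (m + 1) ≫ X ◁ symm b X (m + 1) = X ◁ symm b X (m + 1) := by
    rw [← MonoidalCategory.whiskerLeft_comp, symm_mul_self]
  have h5 : ((m : ℂ) + 2)⁻¹ • ((m : ℂ) + 2)⁻¹ • X ◁ symm b X (m + 1) =
      ((m : ℂ) + 2)⁻¹ • X ◁ symm b X (m + 1) := by
    refine Eq.trans ?_ h3
    refine Eq.trans ?_ (Linear.smul_comp _ _ _ _ _ _).symm
    refine congrArg _ ?_
    refine Eq.trans ?_ (Linear.comp_smul _ _ _ _ _ _).symm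
    exact congrArg _ h4.symm
  have hm : ((m : ℂ) + 2) ≠ 0 := by
    have : ((m + 2 : ℕ) : ℂ) ≠ 0 := by exact_mod_cast (by omega : m + 2 ≠ 0)
    exact_mod_cast this
  have h6 : X ◁ symm b X (m + 1) = 0 := by
    rw [smul_smul, ← sub_eq_zero, ← sub_smul] at h5
    refine (smul_eq_zero.1 h5).resolve_left ?_
    rw [sub_eq_zero]
    intro h
    field_simp at h
    have : ((m + 1 : ℕ) : ℂ) = 0 := by
      push_cast
      linear_combination -h
    exact absurd this (by exact_mod_cast (by omega : m + 1 ≠ 0))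
  have h7 : X ◁ V = 0 := by
    apply eq_zero_of_dag_comp
    rw [dag_whiskerLeft, ← MonoidalCategory.whiskerLeft_comp, hVb]
    exact h6
  have h8 : 𝟙 (X ⊗ γ) = 0 := by
    rw [← MonoidalCategory.whiskerLeft_id, ← hV, MonoidalCategory.whiskerLeft_comp, h7,
      Limits.zero_comp]
  apply hX.1
  apply hγ.injective
  rw [MonoidalCategory.whiskerLeft_id, MonoidalPreadditive.whiskerLeft_zero,
    show 𝟙 (γ ⊗ X) = (β_ γ X).hom ≫ 𝟙 (X ⊗ γ) ≫ (β_ X γ).hom by simp, h8, Limits.zero_comp,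
    Limits.comp_zero]

/-- An irreducible object with a (anti)symmetric cancellable subobject of a power has a left
inverse. -/
theorem exists_markov {X γ : C} (hX : Irred X) (hγ : Cancellable γ) {m : ℕ} {b : Bool}
    {V : γ ⟶ X ⊗ pow X m} (hV : V ≫ dag V = 𝟙 γ) (hVb : dag V ≫ V = symm b X (m + 1)) :
    Nonempty (Markov X) := by
  obtain ⟨c, hc⟩ := exists_param hX hγ V
  exact ⟨hγ.markov hV hc (param_ne_zero hX hγ hV hVb hc)⟩

section
variable {X : C} (M : Markov X)

theorem Markov.norm_nonneg : 0 ≤ M.norm := by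
  have h := M.pos (pos_id (X ⊗ 𝟙_ C))
  rw [M.id] at h
  exact nonneg_of_pos_smul (pos_id _) unit_ne_zero h

theorem Markov.eq_zero {Y : C} {T : X ⊗ Y ⟶ X ⊗ Y} (h : Pos T) (hT : M.Φ _ _ T = 0) : T = 0 := by
  have h1 := M.bounded h
  rw [hT, MonoidalPreadditive.whiskerLeft_zero, smul_zero, zero_sub] at h1
  exact pos_antisymm h h1

theorem id_eq_zero_of_tensorUnit {X : C} (h : 𝟙 (X ⊗ 𝟙_ C) = 0) : 𝟙 X = 0 := by
  rw [← (ρ_ X).inv_hom_id, ← Category.id_comp (ρ_ X).hom, h, Limits.zero_comp, Limits.comp_zero]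

theorem Markov.norm_ne_zero (hX : 𝟙 X ≠ 0) : M.norm ≠ 0 := by
  intro h
  refine hX (id_eq_zero_of_tensorUnit (M.eq_zero (pos_id _) ?_))
  rw [M.id, h, zero_smul]

theorem Markov.id_tensor_ne_zero (M : Markov X) {Y : C} (hX : 𝟙 X ≠ 0) (hY : 𝟙 Y ≠ 0) :
    𝟙 (X ⊗ Y) ≠ 0 := by
  intro h
  have := M.id Y
  rw [h, map_zero] at this
  exact (smul_ne_zero (M.norm_ne_zero hX) hY) this.symm

/-- A subobject of an object with a left inverse. -/
theorem Markov.exists_sub (M : Markov X) {Z : C} (W : Z ⟶ X) (hW : W ≫ dag W = 𝟙 Z) :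
    Nonempty (Markov Z) := by
  obtain ⟨s, hs⟩ := unit_irreducible (M.Φ (𝟙_ C) (𝟙_ C) ((dag W ≫ W) ▷ 𝟙_ C))
  exact ⟨M.sub W hW s hs⟩

theorem kills_smul {i : Index C} {Y Z : C} (f : Y ⟶ Z) (a : ℂ) (h : kills i f) :
    kills i (a • f) := by
  have := kills_comp_right (a • 𝟙 Z) h
  simpa using this

theorem Markov.kills_unit (M : Markov X) (hX : 𝟙 X ≠ 0) {i : Index C}
    (h : StarTensor.kills i (𝟙 X)) : StarTensor.kills i (𝟙 (𝟙_ C)) := by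
  have h1 := kills_comp_left (ρ_ X).hom (kills_comp_right (ρ_ X).inv h)
  have h2 := M.kills (Y := 𝟙_ C) (Z := 𝟙_ C) (T := 𝟙 _) (by simpa using h1)
  rw [M.id] at h2
  have h3 := kills_smul _ (M.norm)⁻¹ h2
  rwa [smul_smul, inv_mul_cancel₀ (M.norm_ne_zero hX), one_smul] at h3

theorem Markov.symm_pos (b : Bool) (n : ℕ) (h : symm b X n ≠ 0) :
    0 ≤ (M.norm + n * (sgn b * M.param)) / ((n : ℂ) + 1) := by
  have h1 := M.pos (pos_symm b X (n + 1))
  rw [M.Φ_symm] at h1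
  exact nonneg_of_pos_smul (pos_symm b X n) h h1

theorem nonneg_of_div {x : ℂ} {n : ℕ} (h : 0 ≤ x / ((n : ℂ) + 1)) : 0 ≤ x := by
  have hn : (0 : ℂ) ≤ (n : ℂ) + 1 := by
    have : (0 : ℝ) ≤ (n : ℝ) + 1 := by positivity
    exact_mod_cast this
  have := mul_nonneg h hn
  rwa [div_mul_cancel₀] at this
  exact Nat.cast_add_one_ne_zero n

/-- The parameters of the statistics. -/
theorem Markov.exists_param (hX : 𝟙 X ≠ 0) : ∃ (b : Bool) (d : ℕ) (t : ℝ), 0 < t ∧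
    M.param = -(sgn b * t) ∧ M.norm = ((d + 1 : ℕ) : ℂ) * t ∧ symm b X (d + 2) = 0 ∧
    symm b X (d + 1) ≠ 0 := by
  have hX1 : ∀ b, symm b X 1 ≠ 0 := fun b h => by
    rw [symm_one] at h
    exact hX (id_eq_zero_of_tensorUnit h)
  have hκ := M.norm_nonneg
  obtain ⟨κ, hκ'⟩ : ∃ κ : ℝ, M.norm = κ := ⟨M.norm.re,
    Complex.ext rfl (by simp [← (Complex.nonneg_iff.1 hκ).2])⟩
  have h1 := nonneg_of_div (M.symm_pos false 1 (hX1 _))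
  obtain ⟨c, hc⟩ : ∃ c : ℝ, M.param = c := by
    refine ⟨M.param.re, ?_⟩
    apply Complex.ext
    · simp
    · have := (Complex.nonneg_iff.1 h1).2
      simp [hκ', sgn] at this
      simp [← this]
  have hc0 : c ≠ 0 := fun h => M.param_ne (by rw [hc, h]; simp)
  obtain ⟨b, hb⟩ : ∃ b : Bool, sgn b * M.param = ((-|c| : ℝ) : ℂ) := by
    rcases lt_or_gt_of_ne hc0 with h | h
    · exact ⟨false, by rw [hc, abs_of_neg h]; simp [sgn]⟩
    · exact ⟨true, by rw [hc, abs_of_pos h]; simp [sgn]⟩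
  have hle : ∀ n, symm b X n ≠ 0 → (n : ℝ) * |c| ≤ κ := fun n hn => by
    have := nonneg_of_div (M.symm_pos b n hn)
    rw [hb, hκ'] at this
    have h2 : (0 : ℝ) ≤ κ + n * (-|c|) := by exact_mod_cast this
    linarith
  have hex : ∃ n, symm b X (n + 1) = 0 := by
    by_contra! hcon
    obtain ⟨n, hn⟩ := exists_nat_gt (κ / |c|)
    have h2 := hle _ (hcon n)
    rw [div_lt_iff₀ (abs_pos.2 hc0)] at hn
    push_cast at h2
    nlinarith [abs_pos.2 hc0]
  classical
  have hn0 : Nat.find hex ≠ 0 := fun h => hX1 b (by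
    have := Nat.find_spec hex
    rwa [h] at this)
  obtain ⟨d, hd⟩ := Nat.exists_eq_succ_of_ne_zero hn0
  have hd1 : symm b X (d + 2) = 0 := by
    have := Nat.find_spec hex
    rwa [hd] at this
  have hd2 : symm b X (d + 1) ≠ 0 := Nat.find_min hex (m := d) (by omega)
  refine ⟨b, d, |c|, abs_pos.2 hc0, ?_, ?_, hd1, hd2⟩
  · have : M.param = sgn b * (sgn b * M.param) := by rw [← mul_assoc, sgn_mul_self, one_mul]
    rw [this, hb]
    push_cast
    ring
  · have h2 := M.Φ_symm b (d + 1)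
    rw [hd1] at h2
    have h3 := (smul_eq_zero.1 (h2.symm.trans (map_zero _))).resolve_right hd2
    rw [hb, div_eq_zero_iff] at h3
    have h4 := h3.resolve_right (Nat.cast_add_one_ne_zero (d + 1))
    push_cast at h4 ⊢
    linear_combination h4

theorem prod_param (d : ℕ) (t : ℂ) :
    ∏ j ∈ Finset.range (d + 1), (((d + 1 : ℕ) : ℂ) * t + j * (-t)) / ((j : ℂ) + 1) =
      t ^ (d + 1) := by
  have h1 : ∀ j ∈ Finset.range (d + 1), (((d + 1 : ℕ) : ℂ) * t + j * (-t)) / ((j : ℂ) + 1) =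
      t * (((d + 1 - j : ℕ) : ℂ) / ((j + 1 : ℕ) : ℂ)) := fun j hj => by
    rw [Finset.mem_range] at hj
    rw [Nat.cast_sub hj.le]
    push_cast
    ring
  rw [Finset.prod_congr rfl h1, Finset.prod_mul_distrib, Finset.prod_const, Finset.card_range,
    Finset.prod_div_distrib]
  have h2 : ∏ j ∈ Finset.range (d + 1), ((d + 1 - j : ℕ) : ℂ) =
      ∏ j ∈ Finset.range (d + 1), ((j + 1 : ℕ) : ℂ) := by
    rw [← Finset.prod_range_reflect]
    refine Finset.prod_congr rfl fun j hj => ?_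
    rw [Finset.mem_range] at hj
    congr 1
    omega
  rw [h2, div_self, mul_one]
  exact Finset.prod_ne_zero_iff.2 fun j _ => by exact_mod_cast Nat.succ_ne_zero j

/-- An object with a left inverse has a (anti)symmetric subobject of a power with Bose or Fermi
statistics. -/
theorem Markov.exists_triple (M : Markov X) (hX : 𝟙 X ≠ 0) : ∃ (b : Bool) (d : ℕ) (δ : C)
    (W : δ ⟶ StarTensor.pow X (d + 1)), W ≫ dag W = 𝟙 δ ∧ dag W ≫ W = symm b X (d + 1) ∧
      ((β_ δ δ).hom = 𝟙 _ ∨ (β_ δ δ).hom = -𝟙 _) ∧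
      ∀ i : Index C, StarTensor.kills i (𝟙 δ) → StarTensor.kills i (𝟙 (𝟙_ C)) := by
  obtain ⟨b, d, t, ht, hp, hκ, -, h1⟩ := M.exists_param hX
  obtain ⟨δ, W, hW, hW'⟩ := StarTensor.exists_sub (dag_symm b X (d + 1)) (symm_mul_self b X (d + 1))
  have hs : (M.pow (d + 1)).Φ (𝟙_ C) (𝟙_ C) ((dag W ≫ W) ▷ 𝟙_ C) = (t : ℂ) ^ (d + 1) • 𝟙 _ := by
    have h2 : sgn b * M.param = -t := by
      rw [hp, mul_neg, ← mul_assoc, sgn_mul_self, one_mul]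
    rw [hW', M.pow_symm, hκ, h2, prod_param]
  set D := (M.pow (d + 1)).sub W hW _ hs with hD
  have hδ : 𝟙 δ ≠ 0 := fun h => h1 (by
    rw [← hW', ← Category.id_comp W, h, Limits.zero_comp, Limits.comp_zero])
  have hnorm : D.norm = (t : ℂ) ^ (d + 1) := rfl
  have hparam : D.param = M.param ^ (d + 1) := (M.pow_param (d + 1))
  obtain ⟨s, hs, hs'⟩ : ∃ s : ℝ, (s = 1 ∨ s = -1) ∧ D.param = (s : ℂ) * D.norm := by
    rw [hparam, hnorm, hp, neg_pow, mul_pow, ← mul_assoc]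
    cases b
    · rcases neg_one_pow_eq_or ℂ (d + 1) with h | h
      · exact ⟨1, Or.inl rfl, by rw [h]; simp [sgn]⟩
      · exact ⟨-1, Or.inr rfl, by rw [h]; simp [sgn]⟩
    · refine ⟨1, Or.inl rfl, ?_⟩
      rw [← mul_pow]
      simp [sgn]
  have hss : s * s = 1 := by rcases hs with rfl | rfl <;> norm_num
  have hβ : (β_ δ δ).hom = (s : ℂ) • 𝟙 _ := by
    set F : δ ⊗ δ ⟶ δ ⊗ δ := 𝟙 _ - (s : ℂ) • (β_ δ δ).hom with hF
    have hF1 : dag F = F := by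
      rw [hF, dag_sub, dag_id, dag_smul, dag_braiding]
      simp
    have hss' : (s : ℂ) * s = 1 := by exact_mod_cast hss
    have hF2 : F ≫ dag F = ((2 : ℝ) : ℂ) • F := by
      rw [hF1, hF, Preadditive.sub_comp, Preadditive.comp_sub, Preadditive.comp_sub,
        Linear.comp_smul, Linear.smul_comp, Linear.smul_comp, Linear.comp_smul,
        SymmetricCategory.symmetry, smul_smul, hss']
      simp only [Category.id_comp, Category.comp_id, one_smul]
      push_cast
      rw [two_smul]
      abel
    have hF3 : Pos F := by
      have := pos_smul (r := 2⁻¹) (by norm_num) (pos_comp_dag F)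
      rw [hF2, smul_smul, ← Complex.ofReal_mul] at this
      norm_num at this
      exact this
    have hF4 : D.Φ _ _ F = 0 := by
      rw [hF, map_sub, map_smul, D.id, D.braiding, hs', smul_smul, ← mul_assoc, hss', one_mul,
        sub_self]
    have := D.eq_zero hF3 hF4
    rw [hF, sub_eq_zero] at this
    rw [this, smul_smul, hss', one_smul]
  refine ⟨b, d, δ, W, hW, hW', ?_, fun i hi => D.kills_unit hδ hi⟩
  rw [hβ]
  rcases hs with rfl | rfl
  · left; simp
  · right; simp

end

/-! ### Decompositions -/

/-- `X` is the direct sum of the objects `σ i`. -/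
def IsSum (X : C) {ι : Type} [Fintype ι] (σ : ι → C) : Prop :=
  ∃ W : ∀ i, σ i ⟶ X, (∀ i, W i ≫ dag (W i) = 𝟙 _) ∧ ∑ i, dag (W i) ≫ W i = 𝟙 X

/-- `τ` is a trace-like functional dominating the endomorphisms of `X`. -/
structure Dominates {X : C} (τ : (X ⟶ X) →ₗ[ℂ] ℂ) (c : ℝ) : Prop where
  bound_pos : 0 < c
  bounded : ∀ T, Pos T → 0 ≤ τ T ∧ Pos (((c : ℂ) * τ T) • 𝟙 X - T)

theorem Markov.dominates {X : C} (M : Markov X) :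
    ∃ (τ : (X ⟶ X) →ₗ[ℂ] ℂ) (c : ℝ), Dominates τ c := by
  have hex : ∀ T : X ⟶ X, ∃ a : ℂ, M.Φ (𝟙_ C) (𝟙_ C) (T ▷ 𝟙_ C) = a • 𝟙 _ := fun T =>
    unit_irreducible _
  choose f hf using hex
  have hinj : ∀ a a' : ℂ, a • 𝟙 (𝟙_ C) = a' • 𝟙 _ → a = a' := fun a a' h => by
    rw [← sub_eq_zero, ← sub_smul] at h
    exact sub_eq_zero.1 ((smul_eq_zero.1 h).resolve_right unit_ne_zero)
  refine ⟨⟨⟨f, fun S T => hinj _ _ ?_⟩, fun a T => hinj _ _ ?_⟩, M.bound, M.bound_pos,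
    fun T hT => ?_⟩
  · rw [← hf, MonoidalPreadditive.add_whiskerRight, map_add, hf, hf, add_smul]
  · rw [← hf, MonoidalLinear.smul_whiskerRight, map_smul, hf, smul_smul]
    rfl
  · have hT' := pos_whiskerRight hT (𝟙_ C)
    have h1 := M.pos hT'
    have h2 := M.bounded hT'
    rw [hf] at h1 h2
    refine ⟨nonneg_of_pos_smul (pos_id _) unit_ne_zero h1, ?_⟩
    have h3 := pos_conj (ρ_ X).inv h2
    rw [dag_rightUnitor_inv] at h3
    convert h3 using 1
    simp [smul_smul, Preadditive.sub_comp, Preadditive.comp_sub]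

theorem Dominates.sub {X Z : C} {τ : (X ⟶ X) →ₗ[ℂ] ℂ} {c : ℝ} (h : Dominates τ c) (W : Z ⟶ X)
    (hW : W ≫ dag W = 𝟙 Z) : ∃ τ' : (Z ⟶ Z) →ₗ[ℂ] ℂ, Dominates τ' c ∧
      ∀ T, τ' T = τ (dag W ≫ T ≫ W) := by
  let g : (Z ⟶ Z) →ₗ[ℂ] (X ⟶ X) :=
    { toFun := fun T => dag W ≫ T ≫ W
      map_add' := fun S T => by simp
      map_smul' := fun a T => by simp }
  refine ⟨τ.comp g, ⟨h.bound_pos, fun T hT => ?_⟩,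
    fun T => rfl⟩
  have h1 := pos_conj (dag W) hT
  rw [dag_dag] at h1
  obtain ⟨h2, h3⟩ := h.bounded _ h1
  refine ⟨h2, ?_⟩
  have h4 := pos_conj W h3
  convert h4 using 1
  simp [Preadditive.sub_comp, Preadditive.comp_sub, hW, reassoc_of% hW]
  rfl

theorem IsSum.dominates {X : C} {ι : Type} [Fintype ι] [Nonempty ι] {σ : ι → C} (h : IsSum X σ)
    (hσ : ∀ i, Irred (σ i)) : ∃ (τ : (X ⟶ X) →ₗ[ℂ] ℂ) (c : ℝ), Dominates τ c := by
  obtain ⟨W, hW, hsum⟩ := h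
  have hex : ∀ (i : ι) (T : X ⟶ X), ∃ a : ℂ, W i ≫ T ≫ dag (W i) = a • 𝟙 _ :=
    fun i T => (hσ i).2 _
  choose f hf using hex
  have hinj : ∀ i (a a' : ℂ), a • 𝟙 (σ i) = a' • 𝟙 _ → a = a' := fun i a a' h => by
    rw [← sub_eq_zero, ← sub_smul] at h
    exact sub_eq_zero.1 ((smul_eq_zero.1 h).resolve_right (hσ i).1)
  let τ : ι → ((X ⟶ X) →ₗ[ℂ] ℂ) := fun i =>
    ⟨⟨f i, fun S T => hinj i _ _ (by
      rw [← hf, Preadditive.add_comp, Preadditive.comp_add, hf, hf, add_smul])⟩,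
      fun a T => hinj i _ _ (by
      rw [← hf, Linear.smul_comp, Linear.comp_smul, hf, smul_smul]
      rfl)⟩
  have hτ : ∀ i T, W i ≫ T ≫ dag (W i) = τ i T • 𝟙 _ := fun i T => hf i T
  have hpos : ∀ i T, Pos T → 0 ≤ τ i T := fun i T hT => by
    have := pos_conj (W i) hT
    rw [hτ] at this
    exact nonneg_of_pos_smul (pos_id _) (hσ i).1 this
  have hfin : ∀ (s : Finset ι) (g : ι → (X ⟶ X)), (∀ i, Pos (g i)) → Pos (∑ i ∈ s, g i) := by
    intro s g hg
    classical
    induction s using Finset.induction_on with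
    | empty => exact pos_zero X
    | insert a s ha ih => rw [Finset.sum_insert ha]; exact pos_add (hg a) ih
  set P : ι → (X ⟶ X) := fun i => dag (W i) ≫ W i with hP
  have hPd : ∀ i, dag (P i) = P i := fun i => by rw [hP, dag_comp, dag_dag]
  have hPP : ∀ i, P i ≫ P i = P i := fun i => by
    simp only [hP, Category.assoc, reassoc_of% (hW i)]
  refine ⟨∑ i, τ i, Fintype.card ι, by exact_mod_cast Fintype.card_pos, fun T hT => ?_⟩
  have hsumτ : (∑ i, τ i) T = ∑ i, τ i T := by simp
  rw [hsumτ]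
  refine ⟨Finset.sum_nonneg fun i _ => hpos i T hT, ?_⟩
  have h1 : ∀ i, P i ≫ T ≫ P i = τ i T • P i := fun i => by
    simp only [hP, Category.assoc]
    have := congrArg (fun g => dag (W i) ≫ g ≫ W i) (hτ i T)
    simpa using this
  -- the pinching inequality
  have h2 : Pos ((Fintype.card ι : ℂ) • ∑ i, P i ≫ T ≫ P i - T) := by
    have h3 : Pos (∑ i, ∑ j, (P i - P j) ≫ T ≫ dag (P i - P j)) :=
      hfin _ _ fun i => hfin _ _ fun j => pos_conj _ hT
    have h4 : ∑ i, ∑ j, (P i - P j) ≫ T ≫ dag (P i - P j) =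
        ((2 : ℝ) : ℂ) • ((Fintype.card ι : ℂ) • ∑ i, P i ≫ T ≫ P i - T) := by
      have e1 : ∀ i j, (P i - P j) ≫ T ≫ dag (P i - P j) =
          P i ≫ T ≫ P i - P i ≫ T ≫ P j - P j ≫ T ≫ P i + P j ≫ T ≫ P j := fun i j => by
        rw [dag_sub, hPd, hPd]
        simp only [Preadditive.sub_comp, Preadditive.comp_sub]
        abel
      have e2 : ∑ i, ∑ j, P i ≫ T ≫ P j = T := by
        rw [Finset.sum_congr rfl fun i _ => (by
          rw [← Preadditive.comp_sum, ← Preadditive.comp_sum, hsum, Category.comp_id] :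
          ∑ j, P i ≫ T ≫ P j = P i ≫ T), ← Preadditive.sum_comp, hsum, Category.id_comp]
      simp only [e1, Finset.sum_add_distrib, Finset.sum_sub_distrib]
      rw [e2, Finset.sum_comm (f := fun i j => P j ≫ T ≫ P i), e2]
      simp only [Finset.sum_const, Finset.card_univ, ← Nat.cast_smul_eq_nsmul ℂ,
        ← Finset.smul_sum]
      push_cast
      rw [two_smul]
      abel
    rw [h4] at h3
    have := pos_smul (r := 2⁻¹) (by norm_num) h3
    rw [smul_smul, ← Complex.ofReal_mul] at this
    norm_num at this
    exact this
  have h3 : ∀ i, Pos (τ i T • (𝟙 X - P i)) := fun i => by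
    obtain ⟨r, hr, hr'⟩ : ∃ r : ℝ, 0 ≤ r ∧ τ i T = r := by
      have h := Complex.nonneg_iff.1 (hpos i T hT)
      exact ⟨_, h.1, Complex.ext rfl (by simp [← h.2])⟩
    rw [hr']
    exact pos_smul hr (pos_id_sub (hPd i) (hPP i))
  have h4 := pos_add h2 (pos_smul (r := Fintype.card ι) (by positivity)
    (hfin Finset.univ _ h3))
  convert h4 using 1
  simp only [h1, smul_sub, Finset.sum_sub_distrib, ← Finset.sum_smul, smul_smul]
  push_cast
  abel

theorem exists_proj_of_not_irred {X : C} {τ : (X ⟶ X) →ₗ[ℂ] ℂ} {c : ℝ} (h : Dominates τ c)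
    (hX : 𝟙 X ≠ 0) (hX' : ¬ Irred X) : ∃ E : X ⟶ X, dag E = E ∧ E ≫ E = E ∧ E ≠ 0 ∧ E ≠ 𝟙 X := by
  by_contra hcon
  apply hX'
  have key : ∀ T : X ⟶ X, dag T = T → ∃ a : ℂ, T = a • 𝟙 X := fun T hT => by
    by_contra! hne
    exact hcon (exists_proj τ c h.bounded T hT hne)
  refine ⟨hX, fun f => ?_⟩
  obtain ⟨a, ha⟩ := key (f + dag f) (by rw [dag_add, dag_dag, add_comm])
  obtain ⟨a', ha'⟩ := key (Complex.I • (f - dag f)) (by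
    rw [dag_smul, dag_sub, dag_dag, Complex.star_def, Complex.conj_I, neg_smul, ← smul_neg,
      neg_sub])
  refine ⟨(1 / 2) * a + (-Complex.I / 2) * a', ?_⟩
  rw [add_smul, mul_smul, mul_smul, ← ha, ← ha', smul_smul,
    show -Complex.I / 2 * Complex.I = 1 / 2 by
      rw [div_mul_eq_mul_div, neg_mul, Complex.I_mul_I, neg_neg], ← smul_add]
  rw [show f + dag f + (f - dag f) = (2 : ℂ) • f by rw [two_smul]; abel, smul_smul]
  norm_num

/-- An object with a dominating functional is a finite direct sum of irreducible objects. -/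
theorem Dominates.exists_isSum {X : C} {τ : (X ⟶ X) →ₗ[ℂ] ℂ} {c : ℝ} (h : Dominates τ c) :
    ∃ (ι : Type) (_ : Fintype ι) (σ : ι → C), IsSum X σ ∧ ∀ i, Irred (σ i) := by
  obtain ⟨n, hn⟩ := exists_nat_gt (c * (τ (𝟙 X)).re)
  induction n generalizing X with
  | zero =>
    have h1 := (h.bounded _ (pos_id X)).1
    have h2 := mul_nonneg h.bound_pos.le (Complex.nonneg_iff.1 h1).1
    push_cast at hn
    linarith
  | succ n ih =>
    by_cases hX : 𝟙 X = 0
    · exact ⟨Empty, inferInstance, fun e => e.elim, ⟨fun e => e.elim, fun e => e.elim, by simp [hX]⟩,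
        fun e => e.elim⟩
    by_cases hirr : Irred X
    · exact ⟨Unit, inferInstance, fun _ => X, ⟨fun _ => 𝟙 X, fun _ => by simp [dag_id],
        by simp [dag_id]⟩, fun _ => hirr⟩
    obtain ⟨E, hE1, hE2, hE3, hE4⟩ := exists_proj_of_not_irred h hX hirr
    have hge : ∀ F : X ⟶ X, dag F = F → F ≫ F = F → F ≠ 0 → 1 ≤ c * (τ F).re := by
      intro F hF1 hF2 hF3
      obtain ⟨h1, h2⟩ := h.bounded F (pos_of_proj hF1 hF2)
      have h3 := pos_conj F h2
      have h4 : F ≫ (((c : ℂ) * τ F) • 𝟙 X - F) ≫ dag F = ((c : ℂ) * τ F - 1) • F := by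
        rw [hF1, Preadditive.sub_comp, Preadditive.comp_sub, hF2, hF2, Linear.smul_comp,
          Linear.comp_smul, Category.id_comp, hF2, sub_smul, one_smul]
      rw [h4] at h3
      have h5 := (Complex.nonneg_iff.1 (nonneg_of_pos_smul (pos_of_proj hF1 hF2) hF3 h3)).1
      simp at h5
      linarith
    have hstep : ∀ F : X ⟶ X, dag F = F → F ≫ F = F → F ≠ 𝟙 X →
        ∃ (ι : Type) (_ : Fintype ι) (σ : ι → C) (W : ∀ i, σ i ⟶ X),
          (∀ i, W i ≫ dag (W i) = 𝟙 _) ∧ ∑ i, dag (W i) ≫ W i = F ∧ ∀ i, Irred (σ i) := by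
      intro F hF1 hF2 hF3
      obtain ⟨Z, V, hV, hV'⟩ := StarTensor.exists_sub hF1 hF2
      obtain ⟨τ', hτ', hτ''⟩ := h.sub V hV
      have h1 : 1 ≤ c * (τ (𝟙 X - F)).re := by
        refine hge _ ?_ ?_ (sub_ne_zero.2 hF3.symm)
        · rw [dag_sub, dag_id, hF1]
        · rw [Preadditive.sub_comp, Preadditive.comp_sub, Preadditive.comp_sub, hF2]
          simp
      obtain ⟨ι, _, σ, ⟨W, hW, hsum⟩, hσ⟩ := ih hτ' (by
        rw [hτ'', Category.id_comp, hV']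
        rw [map_sub, Complex.sub_re] at h1
        push_cast at hn
        linarith)
      refine ⟨ι, inferInstance, σ, fun i => W i ≫ V, fun i => ?_, ?_, hσ⟩
      · rw [dag_comp, Category.assoc, reassoc_of% hV, hW]
      · simp only [dag_comp, Category.assoc]
        rw [← Preadditive.comp_sum]
        have : ∑ i, dag (W i) ≫ W i ≫ V = V := by
          have := congrArg (fun f => f ≫ V) hsum
          simpa [Preadditive.sum_comp] using this
        rw [this, hV']
    obtain ⟨ι₁, _, σ₁, W₁, h11, h12, h13⟩ := hstep E hE1 hE2 hE4
    obtain ⟨ι₂, _, σ₂, W₂, h21, h22, h23⟩ := hstep (𝟙 X - E)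
      (by rw [dag_sub, dag_id, hE1])
      (by
        rw [Preadditive.sub_comp, Preadditive.comp_sub, Preadditive.comp_sub, hE2]
        simp)
      (fun h => hE3 (by simpa using h))
    refine ⟨ι₁ ⊕ ι₂, inferInstance, Sum.elim σ₁ σ₂,
      ⟨fun i => match i with
        | Sum.inl i => W₁ i
        | Sum.inr i => W₂ i, ?_, ?_⟩, ?_⟩
    · rintro (i | i)
      · exact h11 i
      · exact h21 i
    · rw [Fintype.sum_sum_type]
      exact (congrArg₂ (· + ·) h12 h22).trans (by simp)
    · rintro (i | i)
      · exact h13 i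
      · exact h23 i

/-- Schur's lemma. -/
theorem Irred.exists_unitary {X Y : C} (hX : Irred X) (hY : Irred Y) {T : X ⟶ Y} (hT : T ≠ 0) :
    ∃ U : X ⟶ Y, U ≫ dag U = 𝟙 X ∧ dag U ≫ U = 𝟙 Y := by
  obtain ⟨a, ha⟩ := hX.2 (T ≫ dag T)
  have ha0 : a ≠ 0 := fun h => hT (eq_zero_of_comp_dag T (by rw [ha, h, zero_smul]))
  have ha1 : 0 ≤ a := nonneg_of_pos_smul (pos_id X) hX.1 (ha ▸ pos_comp_dag T)
  obtain ⟨r, hr, rfl⟩ : ∃ r : ℝ, 0 ≤ r ∧ a = r :=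
    ⟨_, (Complex.nonneg_iff.1 ha1).1, Complex.ext rfl (by simp [← (Complex.nonneg_iff.1 ha1).2])⟩
  have hr0 : 0 < r := lt_of_le_of_ne hr fun h => ha0 (by rw [← h]; simp)
  have hs : (((√r)⁻¹ : ℝ) : ℂ) * ((((√r)⁻¹ : ℝ) : ℂ) * r) = 1 := by
    rw [← Complex.ofReal_mul, ← Complex.ofReal_mul, ← mul_assoc, ← mul_inv,
      Real.mul_self_sqrt hr, inv_mul_cancel₀ hr0.ne', Complex.ofReal_one]
  set U : X ⟶ Y := (((√r)⁻¹ : ℝ) : ℂ) • T with hU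
  have h1 : U ≫ dag U = 𝟙 X := by
    rw [hU, dag_smul, Linear.smul_comp, Linear.comp_smul, ha, Complex.star_def, Complex.conj_ofReal,
      smul_smul, smul_smul, mul_assoc, hs, one_smul]
  refine ⟨U, h1, ?_⟩
  obtain ⟨e, he⟩ := hY.2 (dag U ≫ U)
  have h2 : (dag U ≫ U) ≫ (dag U ≫ U) = dag U ≫ U := by
    rw [Category.assoc, reassoc_of% h1]
  have h3 : U = e • U := by
    have h4 : U ≫ dag U ≫ U = U := by rw [reassoc_of% h1]
    rw [he, Linear.comp_smul, Category.comp_id] at h4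
    exact h4.symm
  have h4 : (e - 1) • U = 0 := by rw [sub_smul, one_smul, ← h3, sub_self]
  rcases smul_eq_zero.1 h4 with h | h
  · rw [he, sub_eq_zero.1 h, one_smul]
  · rw [h, Limits.zero_comp] at h1
    exact absurd h1.symm hX.1

/-- Irreducible subobjects of a direct sum of irreducible objects. -/
theorem IsSum.exists_unitary {X Z : C} {ι : Type} [Fintype ι] {σ : ι → C} (h : IsSum X σ)
    (hσ : ∀ i, Irred (σ i)) (hZ : Irred Z) {V : Z ⟶ X} (hV : V ≫ dag V = 𝟙 Z) :
    ∃ (i : ι) (U : Z ⟶ σ i), U ≫ dag U = 𝟙 Z ∧ dag U ≫ U = 𝟙 _ := by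
  obtain ⟨W, hW, hsum⟩ := h
  by_contra! hcon
  have h0 : ∀ i, V ≫ dag (W i) = 0 := fun i => by
    by_contra hne
    obtain ⟨U, hU, hU'⟩ := hZ.exists_unitary (hσ i) hne
    exact hcon i U hU hU'
  have hV0 : V = 0 := by
    rw [← Category.comp_id V, ← hsum, Preadditive.comp_sum]
    exact Finset.sum_eq_zero fun i _ => by rw [← Category.assoc, h0, Limits.zero_comp]
  rw [hV0, Limits.zero_comp] at hV
  exact hZ.1 hV.symm

theorem IsSum.of_unitary {X : C} {ι : Type} [Fintype ι] {σ σ' : ι → C} (h : IsSum X σ)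
    (U : ∀ i, σ i ⟶ σ' i) (hU : ∀ i, U i ≫ dag (U i) = 𝟙 _) (hU' : ∀ i, dag (U i) ≫ U i = 𝟙 _) :
    IsSum X σ' := by
  obtain ⟨W, hW, hsum⟩ := h
  refine ⟨fun i => dag (U i) ≫ W i, fun i => ?_, ?_⟩
  · rw [dag_comp, dag_dag, Category.assoc, reassoc_of% (hW i), hU']
  · rw [← hsum]
    refine Finset.sum_congr rfl fun i _ => ?_
    rw [dag_comp, dag_dag, Category.assoc, reassoc_of% (hU i)]

theorem IsSum.sigma {X : C} {ι : Type} [Fintype ι] {σ : ι → C} (h : IsSum X σ) {κ : ι → Type}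
    [∀ i, Fintype (κ i)] {τ : ∀ i, κ i → C} (h' : ∀ i, IsSum (σ i) (τ i)) :
    IsSum X fun p : Σ i, κ i => τ p.1 p.2 := by
  obtain ⟨W, hW, hsum⟩ := h
  choose V hV hsum' using h'
  refine ⟨fun p => V p.1 p.2 ≫ W p.1, fun p => ?_, ?_⟩
  · rw [dag_comp, Category.assoc, reassoc_of% (hW p.1), hV]
  · rw [Fintype.sum_sigma, ← hsum]
    refine Finset.sum_congr rfl fun i _ => ?_
    simp only [dag_comp, Category.assoc]
    rw [← Preadditive.comp_sum]
    congr 1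
    have := congrArg (fun f => f ≫ W i) (hsum' i)
    simpa [Preadditive.sum_comp] using this

theorem IsSum.tensor {X Y : C} {ι κ : Type} [Fintype ι] [Fintype κ] {σ : ι → C} {τ : κ → C}
    (h : IsSum X σ) (h' : IsSum Y τ) : IsSum (X ⊗ Y) fun p : ι × κ => σ p.1 ⊗ τ p.2 := by
  obtain ⟨W, hW, hsum⟩ := h
  obtain ⟨V, hV, hsum'⟩ := h'
  refine ⟨fun p => W p.1 ▷ τ p.2 ≫ X ◁ V p.2, fun p => ?_, ?_⟩
  · rw [dag_comp, dag_whiskerLeft, dag_whiskerRight, Category.assoc,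
      ← MonoidalCategory.whiskerLeft_comp_assoc, hV, MonoidalCategory.whiskerLeft_id,
      Category.id_comp, ← comp_whiskerRight, hW, id_whiskerRight]
  · rw [Fintype.sum_prod_type]
    have h1 : ∀ i j, dag (W i ▷ τ j ≫ X ◁ V j) ≫ W i ▷ τ j ≫ X ◁ V j =
        (dag (W i) ≫ W i) ▷ Y ≫ X ◁ (dag (V j) ≫ V j) := fun i j => by
      rw [dag_comp, dag_whiskerLeft, dag_whiskerRight, Category.assoc,
        ← comp_whiskerRight_assoc, whisker_exchange_assoc, MonoidalCategory.whiskerLeft_comp]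
    simp only [h1, ← Preadditive.comp_sum, ← Preadditive.sum_comp, ← whiskerLeft_sum,
      ← sum_whiskerRight, hsum, hsum']
    simp

/-- The nonempty finite direct sums of irreducible objects with the property `P`. -/
def Sums (P : C → Prop) (X : C) : Prop :=
  ∃ (ι : Type) (_ : Fintype ι) (_ : Nonempty ι) (σ : ι → C), IsSum X σ ∧
    ∀ i, Irred (σ i) ∧ P (σ i)

theorem IsSum.nonempty {X : C} {ι : Type} [Fintype ι] {σ : ι → C} (h : IsSum X σ)
    (hX : 𝟙 X ≠ 0) : Nonempty ι := by
  by_contra hne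
  rw [not_nonempty_iff] at hne
  obtain ⟨W, hW, hsum⟩ := h
  simp at hsum
  exact hX hsum.symm

theorem Sums.sub {P : C → Prop} {X Z : C} (h : Sums P X) {V : Z ⟶ X} (hV : V ≫ dag V = 𝟙 Z)
    (hZ : 𝟙 Z ≠ 0) : Sums P Z := by
  obtain ⟨ι, _, _, σ, hs, hσ⟩ := h
  obtain ⟨τ, c, hτ⟩ := hs.dominates fun i => (hσ i).1
  obtain ⟨τ', hτ', -⟩ := hτ.sub V hV
  obtain ⟨κ, _, δ, hδ, hδ'⟩ := hτ'.exists_isSum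
  have hδ₀ := hδ
  obtain ⟨W, hW, hsum⟩ := hδ
  have h1 : ∀ k, ∃ (i : ι) (U : δ k ⟶ σ i), U ≫ dag U = 𝟙 _ ∧ dag U ≫ U = 𝟙 _ := fun k =>
    hs.exists_unitary (fun i => (hσ i).1) (hδ' k) (V := W k ≫ V) (by
      rw [dag_comp, Category.assoc, reassoc_of% hV, hW])
  choose i U hU hU' using h1
  exact ⟨κ, inferInstance, hδ₀.nonempty hZ, fun k => σ (i k), hδ₀.of_unitary U hU hU',
    fun k => hσ (i k)⟩

theorem Sums.tensor {P : C → Prop} {X Y : C} (hX : Sums P X) (hY : Sums P Y)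
    (hP : ∀ Z, Irred Z → P Z → Nonempty (Markov Z))
    (hP' : ∀ Z, Irred Z → Nonempty (Markov Z) → P Z) : Sums P (X ⊗ Y) := by
  obtain ⟨ι, _, ⟨i₀⟩, σ, hs, hσ⟩ := hX
  obtain ⟨κ, _, ⟨k₀⟩, τ, ht, hτ⟩ := hY
  have hm : ∀ p : ι × κ, Nonempty (Markov (σ p.1 ⊗ τ p.2)) := fun p => by
    obtain ⟨M⟩ := hP _ (hσ p.1).1 (hσ p.1).2
    obtain ⟨M'⟩ := hP _ (hτ p.2).1 (hτ p.2).2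
    exact ⟨M.tensor M'⟩
  have hd : ∀ p : ι × κ, ∃ (ι' : Type) (_ : Fintype ι') (_ : Nonempty ι') (δ : ι' → C),
      IsSum (σ p.1 ⊗ τ p.2) δ ∧ ∀ i, Irred (δ i) ∧ P (δ i) := fun p => by
    obtain ⟨M⟩ := hm p
    obtain ⟨f, c, hf⟩ := M.dominates
    obtain ⟨ι', _, δ, hδ, hδ'⟩ := hf.exists_isSum
    have hne : 𝟙 (σ p.1 ⊗ τ p.2) ≠ 0 := by
      obtain ⟨M'⟩ := hP _ (hσ p.1).1 (hσ p.1).2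
      exact M'.id_tensor_ne_zero (hσ p.1).1.1 (hτ p.2).1.1
    refine ⟨ι', inferInstance, hδ.nonempty hne, δ, hδ, fun i => ⟨hδ' i, hP' _ (hδ' i) ?_⟩⟩
    obtain ⟨W, hW, -⟩ := hδ
    exact M.exists_sub (W i) (hW i)
  choose ι' hι' hne δ hδ hδ' using hd
  exact ⟨_, inferInstance, ⟨⟨(i₀, k₀), (hne _).some⟩⟩, _, (hs.tensor ht).sigma hδ,
    fun p => hδ' p.1 p.2⟩

/-- The powers of a morphism. -/
def powMap {X X' : C} (U : X ⟶ X') : (n : ℕ) → (pow X n ⟶ pow X' n)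
  | 0 => 𝟙 _
  | n + 1 => U ⊗ₘ powMap U n

theorem swapLeft_naturality_left {X X' M M' : C} (U : X ⟶ X') (f : M ⟶ M') :
    (U ⊗ₘ (U ⊗ₘ f)) ≫ swapLeft X' M' = swapLeft X M ≫ (U ⊗ₘ (U ⊗ₘ f)) := by
  simp only [swapLeft, Category.assoc]
  rw [associator_inv_naturality_assoc, ← associator_naturality]
  congr 1
  rw [← tensorHom_id, ← tensorHom_id, tensorHom_comp_tensorHom_assoc,
    tensorHom_comp_tensorHom_assoc, Category.comp_id, Category.id_comp,
    BraidedCategory.braiding_naturality]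

theorem powMap_symm {X X' : C} (U : X ⟶ X') (b : Bool) (n : ℕ) :
    powMap U n ≫ symm b X' n = symm b X n ≫ powMap U n := by
  induction n with
  | zero => exact (Category.comp_id _).trans (Category.id_comp _).symm
  | succ n ih =>
    cases n with
    | zero =>
      rw [symm_one, symm_one]
      exact (Category.comp_id _).trans (Category.id_comp _).symm
    | succ n =>
      have h1 : powMap U (n + 2) ≫ X' ◁ symm b X' (n + 1) =
          X ◁ symm b X (n + 1) ≫ powMap U (n + 2) := by
        change (U ⊗ₘ powMap U (n + 1)) ≫ X' ◁ symm b X' (n + 1) =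
          X ◁ symm b X (n + 1) ≫ (U ⊗ₘ powMap U (n + 1))
        rw [← id_tensorHom, ← id_tensorHom, tensorHom_comp_tensorHom, tensorHom_comp_tensorHom, ih,
          Category.comp_id, Category.id_comp]
      have h2 : powMap U (n + 2) ≫ swapLeft X' (pow X' n) =
          swapLeft X (pow X n) ≫ powMap U (n + 2) := swapLeft_naturality_left U (powMap U n)
      have h3 : powMap U (n + 2) ≫ X' ◁ symm b X' (n + 1) ≫ swapLeft X' (pow X' n) ≫
          X' ◁ symm b X' (n + 1) = (X ◁ symm b X (n + 1) ≫ swapLeft X (pow X n) ≫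
          X ◁ symm b X (n + 1)) ≫ powMap U (n + 2) := by
        rw [← Category.assoc, h1, Category.assoc, ← Category.assoc (powMap U (n + 2)), h2,
          Category.assoc, h1]
        simp only [Category.assoc]
      rw [symm_recursion, symm_recursion, Linear.comp_smul, Linear.smul_comp,
        Preadditive.comp_add, Preadditive.add_comp, Linear.comp_smul, Linear.smul_comp, h3, h1]

theorem symm_ne_zero_of_succ {X : C} {b : Bool} {n : ℕ} (h : symm b X (n + 1) ≠ 0) :
    symm b X n ≠ 0 := by
  cases n with
  | zero => exact StarTensor.unit_ne_zero
  | succ n =>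
    intro h0
    apply h
    rw [symm_recursion, h0]
    simp

theorem Sums.add {P : C → Prop} {X Y Z : C} (hX : Sums P X) (hY : Sums P Y) {W : X ⟶ Z}
    {W' : Y ⟶ Z} (hW : W ≫ dag W = 𝟙 X) (hW' : W' ≫ dag W' = 𝟙 Y)
    (h : dag W ≫ W + dag W' ≫ W' = 𝟙 Z) : Sums P Z := by
  obtain ⟨ι, _, ⟨i₀⟩, σ, ⟨V, hV, hsum⟩, hσ⟩ := hX
  obtain ⟨κ, _, _, τ, ⟨T, hT, hsum'⟩, hτ⟩ := hY
  refine ⟨ι ⊕ κ, inferInstance, ⟨.inl i₀⟩, Sum.elim σ τ, ⟨fun i => match i with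
    | .inl i => V i ≫ W
    | .inr k => T k ≫ W', ?_, ?_⟩, ?_⟩
  · rintro (i | k)
    · change (V i ≫ W) ≫ dag (V i ≫ W) = 𝟙 (σ i)
      rw [dag_comp, Category.assoc, reassoc_of% hW, hV]
    · change (T k ≫ W') ≫ dag (T k ≫ W') = 𝟙 (τ k)
      rw [dag_comp, Category.assoc, reassoc_of% hW', hT]
  · rw [Fintype.sum_sum_type]
    change ∑ i, dag (V i ≫ W) ≫ V i ≫ W + ∑ k, dag (T k ≫ W') ≫ T k ≫ W' = 𝟙 Z
    rw [← h]
    congr 1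
    · have := congrArg (fun f => dag W ≫ f ≫ W) hsum
      simpa [Preadditive.sum_comp, Preadditive.comp_sum, dag_comp] using this
    · have := congrArg (fun f => dag W' ≫ f ≫ W') hsum'
      simpa [Preadditive.sum_comp, Preadditive.comp_sum, dag_comp] using this
  · rintro (i | k)
    · exact hσ i
    · exact hτ k

end StarTensor

end

namespace AQFT

/-! ## Geometry of double cones -/

/-- The space coordinates. -/
noncomputable def sp : Minkowski →ₗ[ℝ] EuclideanSpace ℝ (Fin 3) where
  toFun v := !₂[v 1, v 2, v 3]
  map_add' v w := by ext i; fin_cases i <;> simp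
  map_smul' c v := by ext i; fin_cases i <;> simp

theorem norm_sp_sq (v : Minkowski) : ‖sp v‖ ^ 2 = v 1 ^ 2 + v 2 ^ 2 + v 3 ^ 2 := by
  rw [EuclideanSpace.norm_eq, Real.sq_sqrt (by positivity), Fin.sum_univ_three]
  simp [sp]

/-- The vector with given time and space coordinates. -/
noncomputable def st (t : ℝ) (p : EuclideanSpace ℝ (Fin 3)) : Minkowski := ![t, p 0, p 1, p 2]

@[simp] theorem st_zero (t : ℝ) (p : EuclideanSpace ℝ (Fin 3)) : st t p 0 = t := rfl

@[simp] theorem sp_st (t : ℝ) (p : EuclideanSpace ℝ (Fin 3)) : sp (st t p) = p := by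
  ext i; fin_cases i <;> rfl

theorem isForward_iff {v : Minkowski} : IsForward v ↔ ‖sp v‖ < v 0 := by
  unfold IsForward
  rw [← norm_sp_sq]
  constructor
  · rintro ⟨h0, h1⟩
    exact lt_of_pow_lt_pow_left₀ 2 h0.le h1
  · intro h
    have h0 := (norm_nonneg _).trans_lt h
    exact ⟨h0, by gcongr⟩

theorem spacelikePts_iff {x y : Minkowski} : SpacelikePts x y ↔ |(x - y) 0| < ‖sp (x - y)‖ := by
  unfold SpacelikePts
  rw [← sq_lt_sq₀ (abs_nonneg _) (norm_nonneg _), norm_sp_sq, sq_abs]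
  rfl

theorem forward_of_add {v w z : Minkowski} (hv : IsForward v) (hw : IsForward w)
    (hz : ‖sp z‖ ≤ z 0) : IsForward (v + z + w) := by
  rw [isForward_iff] at *
  rw [map_add, map_add]
  simp only [Pi.add_apply]
  linarith [norm_add_le (sp v + sp z) (sp w), norm_add_le (sp v) (sp z)]

theorem perp_of {u w x y : Minkowski}
    (h1 : ¬ IsForward (w - x)) (h2 : ¬ IsForward (y - u)) :
    coneSet u w ⊆ spacelikeCompl (coneSet x y) := by
  rintro z ⟨hz1, hz2⟩ z' ⟨hz1', hz2'⟩
  rw [spacelikePts_iff]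
  by_contra! hcon
  rcases le_abs.1 hcon with h | h
  · apply h1
    have := forward_of_add hz2 hz1' h
    convert this using 1
    abel
  · apply h2
    rw [← norm_neg, ← map_neg, neg_sub, ← Pi.neg_apply, neg_sub] at h
    have := forward_of_add hz2' hz1 h
    convert this using 1
    abel

theorem isOpen_isForward : IsOpen {v : Minkowski | IsForward v} := by
  have : {v : Minkowski | IsForward v} = {v | ‖sp v‖ < v 0} := by
    ext v; exact isForward_iff
  rw [this]
  exact isOpen_lt (sp.continuous_of_finiteDimensional.norm) (continuous_apply 0)

theorem IsForward.smul {v : Minkowski} (h : IsForward v) {c : ℝ} (hc : 0 < c) :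
    IsForward (c • v) := by
  rw [isForward_iff] at *
  rw [map_smul, norm_smul, Real.norm_of_nonneg hc.le]
  exact mul_lt_mul_of_pos_left h hc

theorem not_forward_of_perp_aux {u w x y : Minkowski} (ho : IsForward (w - u))
    (ha : IsForward (y - x)) (h : coneSet u w ⊆ spacelikeCompl (coneSet x y)) :
    ¬ IsForward (w - x) := by
  intro hf
  have hc : Continuous fun e : ℝ => w - x - e • (w - u) - e • (y - x) := by fun_prop
  have hev : ∀ᶠ e in nhds (0 : ℝ), IsForward (w - x - e • (w - u) - e • (y - x)) := by
    refine (hc.tendsto 0).eventually (isOpen_isForward.mem_nhds ?_)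
    simpa using hf
  obtain ⟨δ, hδ, hball⟩ := Metric.eventually_nhds_iff.1 hev
  set e := min (δ / 2) (1 / 2)
  have he0 : 0 < e := by positivity
  have he1 : e < 1 := (min_le_right _ _).trans_lt (by norm_num)
  have h1 := @hball e (by
    rw [Real.dist_eq, sub_zero, abs_of_pos he0]
    exact (min_le_left _ _).trans_lt (by linarith))
  have hz : w - e • (w - u) ∈ coneSet u w := by
    refine ⟨?_, ?_⟩
    · convert ho.smul (sub_pos.2 he1) using 1
      rw [sub_smul, one_smul]; abel
    · convert ho.smul he0 using 1; abel
  have hz' : x + e • (y - x) ∈ coneSet x y := by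
    refine ⟨?_, ?_⟩
    · convert ha.smul he0 using 1; abel
    · convert ha.smul (sub_pos.2 he1) using 1
      rw [sub_smul, one_smul]; abel
  have h2 := spacelikePts_iff.1 (h hz _ hz')
  rw [isForward_iff] at h1
  rw [show w - e • (w - u) - (x + e • (y - x)) = w - x - e • (w - u) - e • (y - x) by abel] at h2
  linarith [le_abs_self ((w - x - e • (w - u) - e • (y - x)) 0)]

/-- The double cone based on the ball of radius `r` centered at `p` at time `0`. -/
noncomputable def ball (p : EuclideanSpace ℝ (Fin 3)) (r : ℝ) (hr : 0 < r) : DoubleCone :=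
  ⟨coneSet (st (-r) p) (st r p), _, _, by
    rw [isForward_iff, map_sub, sp_st, sp_st, sub_self, norm_zero]
    simp; linarith, rfl⟩

theorem coneSet_subset {u w x y : Minkowski} (h1 : ‖sp (u - x)‖ ≤ (u - x) 0)
    (h2 : ‖sp (y - w)‖ ≤ (y - w) 0) : coneSet u w ⊆ coneSet x y := by
  rintro z ⟨hz1, hz2⟩
  have key : ∀ {a b : Minkowski}, IsForward a → ‖sp b‖ ≤ b 0 → IsForward (a + b) := by
    intro a b ha hb
    rw [isForward_iff] at *
    rw [map_add]
    simp only [Pi.add_apply]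
    linarith [norm_add_le (sp a) (sp b)]
  refine ⟨?_, ?_⟩
  · convert key hz1 h1 using 1; abel
  · convert key hz2 h2 using 1; abel

theorem ball_sub {p q : EuclideanSpace ℝ (Fin 3)} {r s : ℝ} {hr : 0 < r} {hs : 0 < s}
    (h : ‖p - q‖ + r ≤ s) : (ball p r hr).Sub (ball q s hs) := by
  apply coneSet_subset
  · rw [map_sub, sp_st, sp_st]; simp; linarith
  · rw [map_sub, sp_st, sp_st, norm_sub_rev]; simp; linarith

theorem ball_perp {p q : EuclideanSpace ℝ (Fin 3)} {r s : ℝ} {hr : 0 < r} {hs : 0 < s}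
    (h : r + s ≤ ‖p - q‖) : (ball p r hr).Perp (ball q s hs) := by
  refine perp_of ?_ ?_
  · rw [isForward_iff, map_sub, sp_st, sp_st]; simp; linarith
  · rw [isForward_iff, map_sub, sp_st, sp_st, norm_sub_rev]; simp; linarith

/-- Every double cone is contained in a ball. -/
theorem exists_sub_ball (b : DoubleCone) : ∃ (q : EuclideanSpace ℝ (Fin 3)) (s : ℝ) (hs : 0 < s),
    b.Sub (ball q s hs) := by
  obtain ⟨_, x, y, hxy, rfl⟩ := b
  have hs : 0 < 1 + |x 0| + ‖sp x‖ + |y 0| + ‖sp y‖ := by positivity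
  refine ⟨0, _, hs, coneSet_subset ?_ ?_⟩
  · rw [map_sub, sp_st, sub_zero]
    simp only [Pi.sub_apply, st_zero]
    linarith [neg_abs_le (x 0), abs_nonneg (y 0), norm_nonneg (sp y)]
  · rw [map_sub, sp_st, zero_sub, norm_neg]
    simp only [Pi.sub_apply, st_zero]
    linarith [le_abs_self (y 0), abs_nonneg (x 0), norm_nonneg (sp x)]

theorem exists_direction {f g : EuclideanSpace ℝ (Fin 3)} {f0 g0 : ℝ} (hf : f0 ≤ ‖f‖)
    (hg : -g0 ≤ ‖g‖) (hfg : ‖f - g‖ < f0 - g0) : ∃ n m : EuclideanSpace ℝ (Fin 3), ‖n‖ = 1 ∧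
    ‖m‖ = 1 ∧ n + m ≠ 0 ∧ f = ‖f‖ • n ∧ g = ‖g‖ • m := by
  have unit : ∀ v : EuclideanSpace ℝ (Fin 3), v ≠ 0 → ‖‖v‖⁻¹ • v‖ = 1 ∧ v = ‖v‖ • ‖v‖⁻¹ • v := by
    intro v hv
    have := norm_ne_zero_iff.2 hv
    refine ⟨?_, ?_⟩
    · rw [norm_smul, norm_inv, norm_norm, inv_mul_cancel₀ this]
    · rw [smul_smul, mul_inv_cancel₀ this, one_smul]
  have two : ∀ v : EuclideanSpace ℝ (Fin 3), ‖v‖ = 1 → v + v ≠ 0 := by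
    intro v hv h
    rw [← two_smul ℝ, smul_eq_zero] at h
    rcases h with h | h
    · norm_num at h
    · rw [h, norm_zero] at hv; norm_num at hv
  by_cases hf0 : f = 0
  · have hg0 : g ≠ 0 := by
      rintro rfl
      rw [hf0] at hf hfg
      simp at hf hg hfg
      linarith
    obtain ⟨h1, h2⟩ := unit g hg0
    exact ⟨_, _, h1, h1, two _ h1, by rw [hf0]; simp, h2⟩
  · obtain ⟨h1, h2⟩ := unit f hf0
    by_cases hg0 : g = 0
    · exact ⟨_, _, h1, h1, two _ h1, h2, by rw [hg0]; simp⟩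
    · obtain ⟨h3, h4⟩ := unit g hg0
      refine ⟨_, _, h1, h3, fun h => ?_, h2, h4⟩
      have h5 : f - g = (‖f‖ + ‖g‖) • (‖f‖⁻¹ • f) := by
        have : ‖g‖⁻¹ • g = -(‖f‖⁻¹ • f) := by rw [eq_neg_iff_add_eq_zero, add_comm]; exact h
        nth_rewrite 1 [h2, h4]
        rw [this, add_smul, smul_neg, sub_neg_eq_add]
      rw [h5, norm_smul, h1, mul_one, Real.norm_of_nonneg (by positivity)] at hfg
      linarith

/-- A double cone can be moved in the spacelike complement of another one to a ball that is
spacelike to any given double cone. -/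
theorem exists_move {o a : DoubleCone} (h : o.Perp a) (b : DoubleCone) :
    ∃ (p : EuclideanSpace ℝ (Fin 3)) (e : DoubleCone), o.Sub e ∧
      (ball p 1 one_pos).Sub e ∧ e.Perp a ∧ (ball p 1 one_pos).Perp b := by
  obtain ⟨q, s, hs, hbs⟩ := exists_sub_ball b
  have h' := h.symm
  obtain ⟨_, u, w, huw, rfl⟩ := o
  obtain ⟨_, x, y, hxy, rfl⟩ := a
  have h1 := not_forward_of_perp_aux huw hxy h
  have h2 := not_forward_of_perp_aux hxy huw h'
  rw [isForward_iff, not_lt] at h1 h2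
  rw [isForward_iff] at huw hxy
  obtain ⟨n, m, hn, hm, hnm, hfn, hgm⟩ := exists_direction (f := sp (w - x)) (g := sp (u - y))
    (f0 := (w - x) 0) (g0 := (u - y) 0) h1 (by
      rw [← Pi.neg_apply, neg_sub, ← norm_neg, ← map_neg, neg_sub]; exact h2) (by
      have : sp (w - x) - sp (u - y) = sp (w - u) + sp (y - x) := by
        rw [← map_sub, ← map_add]; congr 1; abel
      rw [this]
      simp only [Pi.sub_apply] at *
      linarith [norm_add_le (sp (w - u)) (sp (y - x))])
  have hlt : ‖n - m‖ < 2 := by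
    have h3 := parallelogram_law_with_norm ℝ n m
    rw [hn, hm] at h3
    have h4 : 0 < ‖n + m‖ := norm_pos_iff.2 hnm
    nlinarith [norm_nonneg (n - m)]
  -- the parameter of the motion
  set c := ‖n + m‖ / 2 with hc
  have hc0 : 0 < c := by have := norm_pos_iff.2 hnm; positivity
  set k := 1 - ‖n - m‖ / 2 with hk
  have hk0 : 0 < k := by rw [hk]; linarith
  obtain ⟨t, ht0, ht1, ht2⟩ : ∃ t : ℝ, 0 < t ∧ ‖q‖ + 1 + s ≤ t * c ∧
      ‖sp u‖ + ‖sp w‖ + |u 0| + |w 0| + 1 ≤ t * k := by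
    refine ⟨(‖q‖ + 1 + s) / c + (‖sp u‖ + ‖sp w‖ + |u 0| + |w 0| + 1) / k, by positivity, ?_, ?_⟩
    · rw [add_mul, div_mul_cancel₀ _ hc0.ne']
      have : 0 ≤ (‖sp u‖ + ‖sp w‖ + |u 0| + |w 0| + 1) / k * c := by positivity
      linarith
    · rw [add_mul, div_mul_cancel₀ _ hk0.ne']
      have : 0 ≤ (‖q‖ + 1 + s) / c * k := by positivity
      linarith
  set p := (t / 2) • (n + m) with hp
  have hpn : p - t • n = (t / 2) • (m - n) := by
    rw [hp]; module
  have hpm : p - t • m = (t / 2) • (n - m) := by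
    rw [hp]; module
  have hnorm : ‖(t / 2) • (n - m)‖ = t - t * k := by
    rw [norm_smul, Real.norm_of_nonneg (by positivity), hk]; ring
  have hnorm' : ‖(t / 2) • (m - n)‖ = t - t * k := by
    rw [← hnorm, norm_smul, norm_smul, norm_sub_rev]
  have e1 : ‖sp (st (-1) p - (u + st (-t) (t • m)))‖ ≤ (st (-1) p - (u + st (-t) (t • m))) 0 := by
    rw [map_sub, map_add, sp_st, sp_st]
    simp only [Pi.sub_apply, Pi.add_apply, st_zero]
    rw [sub_add_eq_sub_sub_swap, hpm]
    linarith [norm_sub_le ((t / 2) • (n - m)) (sp u), le_abs_self (u 0), norm_nonneg (sp w),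
      abs_nonneg (w 0)]
  have e2 : ‖sp (w + st t (t • n) - st 1 p)‖ ≤ (w + st t (t • n) - st 1 p) 0 := by
    rw [map_sub, map_add, sp_st, sp_st]
    simp only [Pi.sub_apply, Pi.add_apply, st_zero]
    rw [show sp w + t • n - p = sp w - (p - t • n) by abel, hpn]
    linarith [norm_sub_le (sp w) ((t / 2) • (m - n)), neg_abs_le (w 0), norm_nonneg (sp u),
      abs_nonneg (u 0)]
  have hfwd : IsForward (w + st t (t • n) - (u + st (-t) (t • m))) := by
    have h3 : IsForward (st 1 p - st (-1) p) := by
      rw [isForward_iff, map_sub, sp_st, sp_st, sub_self, norm_zero]; simp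
    rw [isForward_iff] at h3 ⊢
    have h4 : w + st t (t • n) - (u + st (-t) (t • m)) = (w + st t (t • n) - st 1 p) +
        (st 1 p - st (-1) p) + (st (-1) p - (u + st (-t) (t • m))) := by abel
    rw [h4, map_add, map_add]
    simp only [Pi.add_apply] at *
    linarith [norm_add_le (sp (w + st t (t • n) - st 1 p) + sp (st 1 p - st (-1) p))
      (sp (st (-1) p - (u + st (-t) (t • m)))), norm_add_le (sp (w + st t (t • n) - st 1 p))
      (sp (st 1 p - st (-1) p))]
  refine ⟨p, ⟨coneSet (u + st (-t) (t • m)) (w + st t (t • n)), _, _, hfwd, rfl⟩, ?_, ?_, ?_, ?_⟩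
  · apply coneSet_subset
    · rw [map_sub, map_add, sp_st]
      simp [norm_smul, hm, abs_of_pos ht0]
    · rw [map_sub, map_add, sp_st]
      simp [norm_smul, hn, abs_of_pos ht0]
  · exact coneSet_subset e1 e2
  · refine perp_of ?_ ?_
    · rw [isForward_iff, not_lt, show w + st t (t • n) - x = (w - x) + st t (t • n) by abel, map_add,
        sp_st, hfn, ← add_smul, norm_smul, hn, mul_one, Real.norm_of_nonneg (by positivity)]
      simp only [Pi.add_apply, st_zero]
      linarith
    · rw [isForward_iff, not_lt, ← norm_neg, ← map_neg, neg_sub,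
        show u + st (-t) (t • m) - y = (u - y) + st (-t) (t • m) by abel, map_add,
        sp_st, hgm, ← add_smul, norm_smul, hm, mul_one, Real.norm_of_nonneg (by positivity)]
      rw [← norm_neg, ← map_neg, neg_sub] at h2
      simp only [Pi.sub_apply, Pi.add_apply, st_zero] at *
      linarith
  · refine DoubleCone.Perp.mono (c := ball q s hs) (ball_perp ?_) hbs
    have : ‖p‖ = t * c := by
      rw [hp, norm_smul, Real.norm_of_nonneg (by positivity), hc]; ring
    linarith [norm_sub_norm_le p q]

theorem exists_perp (b : DoubleCone) : ∃ o : DoubleCone, o.Perp b := by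
  obtain ⟨o, a, h⟩ := DoubleCone.exists_perp
  obtain ⟨p, e, -, -, -, h'⟩ := exists_move h b
  exact ⟨_, h'⟩

section connectivity
variable {P : DoubleCone → DoubleCone → Prop}
  (hP : ∀ {o a o' a' e f : DoubleCone}, e.Perp f → o.Sub e → o'.Sub e → a.Sub f → a'.Sub f →
    P o a → P o' a')
include hP

theorem step_iff {o a o' a' e f : DoubleCone} (hef : e.Perp f) (h1 : o.Sub e) (h2 : o'.Sub e)
    (h3 : a.Sub f) (h4 : a'.Sub f) : P o a ↔ P o' a' :=
  ⟨hP hef h1 h2 h3 h4, hP hef h2 h1 h4 h3⟩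

theorem ball_step {p p' q : EuclideanSpace ℝ (Fin 3)}
    (h : ‖p - p'‖ / 2 + 2 ≤ ‖(1 / 2 : ℝ) • (p + p') - q‖) :
    P (ball p 1 one_pos) (ball q 1 one_pos) ↔ P (ball p' 1 one_pos) (ball q 1 one_pos) := by
  have hr : 0 < 1 + ‖p - p'‖ / 2 := by positivity
  refine step_iff hP (e := ball ((1 / 2 : ℝ) • (p + p')) _ hr) (f := ball q 1 one_pos)
    (ball_perp (by linarith)) (ball_sub ?_) (ball_sub ?_) subset_rfl subset_rfl
  · rw [show p - (1 / 2 : ℝ) • (p + p') = (1 / 2 : ℝ) • (p - p') by module, norm_smul]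
    norm_num
    linarith
  · rw [show p' - (1 / 2 : ℝ) • (p + p') = (1 / 2 : ℝ) • (p' - p) by module, norm_smul,
      norm_sub_rev]
    norm_num
    linarith

theorem ball_small_step {p p' q : EuclideanSpace ℝ (Fin 3)} (h : ‖p - p'‖ + 2 ≤ ‖p - q‖) :
    P (ball p 1 one_pos) (ball q 1 one_pos) ↔ P (ball p' 1 one_pos) (ball q 1 one_pos) := by
  refine ball_step hP ?_
  have h1 : p - q = ((1 / 2 : ℝ) • (p + p') - q) + (1 / 2 : ℝ) • (p - p') := by module
  have h2 := norm_add_le ((1 / 2 : ℝ) • (p + p') - q) ((1 / 2 : ℝ) • (p - p'))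
  rw [← h1, norm_smul, Real.norm_of_nonneg (by norm_num)] at h2
  linarith

theorem ball_scale {v q : EuclideanSpace ℝ (Fin 3)} (hv : 2 ≤ ‖v‖) {s : ℝ} (hs : 1 ≤ s) :
    P (ball (q + v) 1 one_pos) (ball q 1 one_pos) ↔
      P (ball (q + s • v) 1 one_pos) (ball q 1 one_pos) := by
  refine ball_step hP ?_
  rw [show q + v - (q + s • v) = (-(s - 1)) • v by module,
    show (1 / 2 : ℝ) • (q + v + (q + s • v)) - q = ((1 + s) / 2) • v by module, norm_smul, norm_smul,
    norm_neg, Real.norm_of_nonneg (by linarith), Real.norm_of_nonneg (by linarith)]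
  linarith

theorem ball_rotate {n m q : EuclideanSpace ℝ (Fin 3)} (hn : ‖n‖ = 1) (hm : ‖m‖ = 1)
    (hnm : inner ℝ n m = 0) {t : ℝ} (ht : 20 ≤ t) :
    P (ball (q + t • n) 1 one_pos) (ball q 1 one_pos) ↔
      P (ball (q + t • m) 1 one_pos) (ball q 1 one_pos) := by
  have ht0 : 0 ≤ t := by linarith
  have h1 : 1 ≤ ‖n + (9 / 10 : ℝ) • m‖ := by
    have := norm_add_sq_real n ((9 / 10 : ℝ) • m)
    rw [inner_smul_right, hnm, hn, norm_smul, hm] at this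
    norm_num at this
    nlinarith [norm_nonneg (n + (9 / 10 : ℝ) • m)]
  have h2 : 8 / 10 ≤ ‖(1 / 10 : ℝ) • n + (9 / 10 : ℝ) • m‖ := by
    have := norm_sub_le ((1 / 10 : ℝ) • n + (9 / 10 : ℝ) • m) ((1 / 10 : ℝ) • n)
    rw [add_sub_cancel_left, norm_smul, norm_smul, hn, hm] at this
    norm_num at this
    linarith
  rw [ball_small_step hP (p := q + t • n) (p' := q + t • (n + (9 / 10 : ℝ) • m)),
    ball_small_step hP (p := q + t • (n + (9 / 10 : ℝ) • m))
      (p' := q + t • ((1 / 10 : ℝ) • n + (9 / 10 : ℝ) • m)),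
    ball_small_step hP (p := q + t • ((1 / 10 : ℝ) • n + (9 / 10 : ℝ) • m)) (p' := q + t • m)]
  · rw [add_sub_cancel_left, norm_smul, Real.norm_of_nonneg ht0,
      show q + t • ((1 / 10 : ℝ) • n + (9 / 10 : ℝ) • m) - (q + t • m) = (t / 10) • (n - m) by module,
      norm_smul, Real.norm_of_nonneg (by positivity)]
    have := norm_sub_le n m
    rw [hn, hm] at this
    nlinarith
  · rw [add_sub_cancel_left, norm_smul, Real.norm_of_nonneg ht0,
      show q + t • (n + (9 / 10 : ℝ) • m) - (q + t • ((1 / 10 : ℝ) • n + (9 / 10 : ℝ) • m)) =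
        (9 * t / 10) • n by module,
      norm_smul, Real.norm_of_nonneg (by positivity), hn]
    nlinarith
  · rw [add_sub_cancel_left, norm_smul, Real.norm_of_nonneg ht0, hn,
      show q + t • n - (q + t • (n + (9 / 10 : ℝ) • m)) = (-(9 * t / 10)) • m by module,
      norm_smul, norm_neg, Real.norm_of_nonneg (by positivity), hm]
    linarith

theorem ball_any {v v' q : EuclideanSpace ℝ (Fin 3)} (hv : 2 ≤ ‖v‖) (hv' : 2 ≤ ‖v'‖) :
    P (ball (q + v) 1 one_pos) (ball q 1 one_pos) ↔
      P (ball (q + v') 1 one_pos) (ball q 1 one_pos) := by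
  obtain ⟨m, hm, hvm, hvm'⟩ : ∃ m : EuclideanSpace ℝ (Fin 3), ‖m‖ = 1 ∧ inner ℝ v m = 0 ∧
      inner ℝ v' m = 0 := by
    have h1 : (Submodule.span ℝ {v, v'})ᗮ ≠ ⊥ := by
      intro h
      rw [Submodule.orthogonal_eq_bot_iff] at h
      have h2 := finrank_span_le_card (R := ℝ) ({v, v'} : Set (EuclideanSpace ℝ (Fin 3)))
      rw [h, finrank_top, finrank_euclideanSpace_fin] at h2
      have h3 : ({v, v'} : Set (EuclideanSpace ℝ (Fin 3))).toFinset.card ≤ 2 := by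
        classical
        rw [Set.toFinset_insert, Set.toFinset_singleton]
        exact Finset.card_le_two
      omega
    obtain ⟨m, hm, hm0⟩ := Submodule.exists_mem_ne_zero_of_ne_bot h1
    rw [Submodule.mem_orthogonal] at hm
    refine ⟨‖m‖⁻¹ • m, ?_, ?_, ?_⟩
    · rw [norm_smul, norm_inv, norm_norm, inv_mul_cancel₀ (norm_ne_zero_iff.2 hm0)]
    · rw [inner_smul_right, hm v (Submodule.subset_span (by simp)), mul_zero]
    · rw [inner_smul_right, hm v' (Submodule.subset_span (by simp)), mul_zero]
  have key : ∀ w : EuclideanSpace ℝ (Fin 3), 2 ≤ ‖w‖ → inner ℝ w m = 0 → ∀ t : ℝ, ‖w‖ ≤ t → 20 ≤ t →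
      (P (ball (q + w) 1 one_pos) (ball q 1 one_pos) ↔
        P (ball (q + t • m) 1 one_pos) (ball q 1 one_pos)) := by
    intro w hw hwm t hwt ht
    have hw0 : 0 < ‖w‖ := by linarith
    rw [← ball_rotate hP (n := ‖w‖⁻¹ • w) _ hm _ ht, ball_scale hP hw (s := t * ‖w‖⁻¹), mul_smul]
    · rw [← div_eq_mul_inv, le_div_iff₀ hw0]; linarith
    · rw [norm_smul, norm_inv, norm_norm, inv_mul_cancel₀ hw0.ne']
    · rw [inner_smul_left, hwm, mul_zero]
  have h1 := key v hv hvm (max (max ‖v‖ ‖v'‖) 20) ((le_max_left _ _).trans (le_max_left _ _))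
    (le_max_right _ _)
  have h2 := key v' hv' hvm' (max (max ‖v‖ ‖v'‖) 20) ((le_max_right _ _).trans (le_max_left _ _))
    (le_max_right _ _)
  exact h1.trans h2.symm

theorem ball_pairs {p q p' q' : EuclideanSpace ℝ (Fin 3)} (h : 2 ≤ ‖p - q‖) (h' : 2 ≤ ‖p' - q'‖) :
    P (ball p 1 one_pos) (ball q 1 one_pos) ↔ P (ball p' 1 one_pos) (ball q' 1 one_pos) := by
  set v : EuclideanSpace ℝ (Fin 3) := (2 + ‖q - q'‖) • EuclideanSpace.single 0 1 with hv
  have hvn : ‖v‖ = 2 + ‖q - q'‖ := by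
    rw [hv, norm_smul, Real.norm_of_nonneg (by positivity)]; simp
  have h1 := ball_any hP (q := q) h (v' := v) (by rw [hvn]; linarith [norm_nonneg (q - q')])
  have h2 := ball_small_step (P := fun a b => P b a)
    (fun hef a1 a2 a3 a4 h => hP hef.symm a3 a4 a1 a2 h) (p := q) (p' := q') (q := q + v)
    (by rw [sub_add_cancel_left, norm_neg, hvn]; linarith)
  have h3 := ball_any hP (q := q') h' (v' := q + v - q') (by
    have := norm_sub_le (q + v - q') (q - q')
    rw [show q + v - q' - (q - q') = v by abel, hvn] at this
    linarith)
  rw [add_sub_cancel] at h1 h3 h3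
  exact h1.trans (h2.trans h3.symm)

/-- The pairs of spacelike separated double cones are connected. -/
theorem perp_connected {o a o' a' : DoubleCone} (h : o.Perp a) (h' : o'.Perp a') :
    P o a → P o' a' := by
  have key : ∀ {o a : DoubleCone}, o.Perp a → ∃ p q : EuclideanSpace ℝ (Fin 3), 2 ≤ ‖p - q‖ ∧
      (P o a ↔ P (ball p 1 one_pos) (ball q 1 one_pos)) := by
    intro o a h
    obtain ⟨p, e, h1, h2, h3, h4⟩ := exists_move h a
    obtain ⟨q, f, k1, k2, k3, k4⟩ := exists_move h4.symm (ball p 1 one_pos)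
    refine ⟨p, q, ?_, ?_⟩
    · have := not_forward_of_perp_aux (u := st (-1) p) (w := st 1 p) (x := st (-1) q) (y := st 1 q)
        (by rw [isForward_iff, map_sub, sp_st, sp_st, sub_self, norm_zero]; simp)
        (by rw [isForward_iff, map_sub, sp_st, sp_st, sub_self, norm_zero]; simp) k4.symm
      rw [isForward_iff, map_sub, sp_st, sp_st, not_lt] at this
      simp at this
      linarith
    · exact (step_iff hP h3 h1 h2 subset_rfl subset_rfl).trans
        (step_iff hP k3.symm subset_rfl subset_rfl k1 k2)
  obtain ⟨p, q, h1, h2⟩ := key h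
  obtain ⟨p', q', h1', h2'⟩ := key h'
  exact fun hp => h2'.2 ((ball_pairs hP h1 h1').1 (h2.1 hp))

end connectivity

open CategoryTheory MonoidalCategory

variable {H : Type u} [NormedAddCommGroup H] [InnerProductSpace ℂ H] [CompleteSpace H] {N : Net H}

/-! ## The tensor category -/

/-- The arrows between two bimodules. -/
def Bimod.arrows (ρ σ : Bimod N) : Submodule ℂ (Matrix (Fin σ.n) (Fin ρ.n) N.alg) where
  carrier := {T | ρ.IsArrow σ T}
  zero_mem' := ⟨by rw [Matrix.zero_mul], by rw [Matrix.mul_zero],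
    fun A => by rw [Matrix.zero_mul, Matrix.mul_zero]⟩
  add_mem' := fun {S T} hS hT => ⟨by rw [Matrix.add_mul, hS.1, hT.1],
    by rw [Matrix.mul_add, hS.2.1, hT.2.1],
    fun A => by rw [Matrix.add_mul, Matrix.mul_add, hS.2.2, hT.2.2]⟩
  smul_mem' := fun c T hT => ⟨by rw [Matrix.smul_mul, hT.1], by rw [Matrix.mul_smul, hT.2.1],
    fun A => by rw [Matrix.smul_mul, Matrix.mul_smul, hT.2.2]⟩

theorem Bimod.IsArrow.comp {ρ σ τ : Bimod N} {T : Matrix (Fin σ.n) (Fin ρ.n) N.alg}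
    {S : Matrix (Fin τ.n) (Fin σ.n) N.alg} (hT : ρ.IsArrow σ T) (hS : σ.IsArrow τ S) :
    ρ.IsArrow τ (S * T) :=
  ⟨by rw [Matrix.mul_assoc, hT.1], by rw [← Matrix.mul_assoc, hS.2.1],
    fun A => by rw [Matrix.mul_assoc, hT.2.2, ← Matrix.mul_assoc, hS.2.2, Matrix.mul_assoc]⟩

noncomputable instance : Category (Obj N) where
  Hom X Y := Bimod.arrows X.toBimod Y.toBimod
  id X := ⟨X.idArrow, X.idArrow_isArrow⟩
  comp f g := ⟨g.1 * f.1, f.2.comp g.2⟩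
  id_comp f := Subtype.ext f.2.1
  comp_id f := Subtype.ext f.2.2.1
  assoc f g h := Subtype.ext (Matrix.mul_assoc _ _ _).symm

namespace Obj

theorem hom_ext {X Y : Obj N} {f g : X ⟶ Y} (h : f.1 = g.1) : f = g := Subtype.ext h

@[simp] theorem id_val (X : Obj N) : (𝟙 X : X ⟶ X).1 = X.idArrow := rfl

@[simp] theorem comp_val {X Y Z : Obj N} (f : X ⟶ Y) (g : Y ⟶ Z) : (f ≫ g).1 = g.1 * f.1 := rfl

noncomputable instance : Preadditive (Obj N) where
  homGroup X Y := inferInstanceAs (AddCommGroup (Bimod.arrows X.toBimod Y.toBimod))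
  add_comp X Y Z f f' g := hom_ext (Matrix.mul_add _ _ _)
  comp_add X Y Z f g g' := hom_ext (Matrix.add_mul _ _ _)

@[simp] theorem add_val {X Y : Obj N} (f g : X ⟶ Y) : (f + g).1 = f.1 + g.1 := rfl

noncomputable instance : Linear ℂ (Obj N) where
  homModule X Y := inferInstanceAs (Module ℂ (Bimod.arrows X.toBimod Y.toBimod))
  smul_comp X Y Z c f g := hom_ext (Matrix.mul_smul _ _ _)
  comp_smul X Y Z f c g := hom_ext (Matrix.smul_mul _ _ _)

@[simp] theorem smul_val {X Y : Obj N} (c : ℂ) (f : X ⟶ Y) : (c • f).1 = c • f.1 := rfl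

theorem _root_.AQFT.Bimod.ext_cast {X Y : Bimod N} (h : X.n = Y.n)
    (h' : ∀ A i j, X.hom A i j = Y.hom A (Fin.cast h i) (Fin.cast h j)) : X = Y := by
  obtain ⟨n, f⟩ := X
  obtain ⟨m, g⟩ := Y
  dsimp only at h
  subst h
  congr 1
  ext1 A
  ext1 i j
  exact h' A i j

theorem ext_toBimod {X Y : Obj N} (h : X.toBimod = Y.toBimod) : X = Y := by
  cases X
  cases Y
  dsimp only at h
  subst h
  rfl

theorem n_eq {X Y : Obj N} (h : X = Y) : X.n = Y.n := by rw [h]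

theorem comp_eqToHom_val {X Y Z : Obj N} (f : X ⟶ Y) (h : Y = Z) (i : Fin Z.n) (j : Fin X.n) :
    (f ≫ eqToHom h).1 i j = f.1 (Fin.cast (n_eq h).symm i) j := by
  subst h
  rw [eqToHom_refl, Category.comp_id]
  rfl

theorem eqToHom_comp_val {X Y Z : Obj N} (h : X = Y) (f : Y ⟶ Z) (i : Fin Z.n) (j : Fin X.n) :
    (eqToHom h ≫ f).1 i j = f.1 i (Fin.cast (n_eq h) j) := by
  subst h
  rw [eqToHom_refl, Category.id_comp]
  rfl

theorem fin_assoc {l m n : ℕ} (k : Fin l) (j : Fin m) (i : Fin n) :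
    Fin.cast (mul_assoc l m n).symm (finProdFinEquiv (k, finProdFinEquiv (j, i))) =
      finProdFinEquiv (finProdFinEquiv (k, j), i) := by
  apply Fin.ext
  simp only [finProdFinEquiv, Equiv.coe_fn_mk, Fin.val_cast]
  ring

theorem fin_one_mul {n : ℕ} (k : Fin 1) (i : Fin n) :
    Fin.cast (one_mul n) (finProdFinEquiv (k, i)) = i := by
  apply Fin.ext
  have : k = 0 := Subsingleton.elim _ _
  simp [finProdFinEquiv, this]

theorem fin_mul_one {n : ℕ} (i : Fin n) (k : Fin 1) :
    Fin.cast (mul_one n) (finProdFinEquiv (i, k)) = i := by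
  apply Fin.ext
  simp [finProdFinEquiv]

theorem one_entry_mul (A B : N.alg) (i j : Fin 1) :
    ((Matrix.of fun _ _ => A) * (Matrix.of fun _ _ => B) : Matrix (Fin 1) (Fin 1) N.alg) i j =
      A * B := by
  simp [Matrix.mul_apply]

theorem tensor_hom_apply (X Y : Bimod N) (A : N.alg) (i₂ j₂ : Fin Y.n) (i₁ j₁ : Fin X.n) :
    (X.tensor Y).hom A (finProdFinEquiv (i₂, i₁)) (finProdFinEquiv (j₂, j₁)) =
      X.hom (Y.hom A i₂ j₂) i₁ j₁ := by
  change X.hom (Y.hom A (finProdFinEquiv.symm _).1 (finProdFinEquiv.symm _).1)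
    (finProdFinEquiv.symm _).2 (finProdFinEquiv.symm _).2 = _
  simp only [Equiv.symm_apply_apply]

theorem tensor_assoc (X Y Z : Obj N) : (X.tensor Y).tensor Z = X.tensor (Y.tensor Z) := by
  apply ext_toBimod
  refine Eq.symm (Bimod.ext_cast (mul_assoc _ _ _) fun A i j => ?_)
  obtain ⟨⟨i', i₁⟩, rfl⟩ := finProdFinEquiv.surjective i
  obtain ⟨⟨j', j₁⟩, rfl⟩ := finProdFinEquiv.surjective j
  obtain ⟨⟨i₃, i₂⟩, rfl⟩ := finProdFinEquiv.surjective i'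
  obtain ⟨⟨j₃, j₂⟩, rfl⟩ := finProdFinEquiv.surjective j'
  have e1 : Fin.cast (mul_assoc Z.n Y.n X.n) (finProdFinEquiv (finProdFinEquiv (i₃, i₂), i₁)) =
      finProdFinEquiv (i₃, finProdFinEquiv (i₂, i₁)) := by rw [← fin_assoc]; rfl
  have e2 : Fin.cast (mul_assoc Z.n Y.n X.n) (finProdFinEquiv (finProdFinEquiv (j₃, j₂), j₁)) =
      finProdFinEquiv (j₃, finProdFinEquiv (j₂, j₁)) := by rw [← fin_assoc]; rfl
  rw [e1, e2]
  refine (tensor_hom_apply X.toBimod (Y.toBimod.tensor Z.toBimod) A _ _ _ _).trans ?_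
  refine Eq.trans ?_ (tensor_hom_apply (X.toBimod.tensor Y.toBimod) Z.toBimod A _ _ _ _).symm
  rw [tensor_hom_apply, tensor_hom_apply]

theorem unit_tensor (X : Obj N) : (unit N).tensor X = X := by
  apply ext_toBimod
  refine Bimod.ext_cast (mul_one _) fun A i j => ?_
  obtain ⟨⟨i₂, i₁⟩, rfl⟩ := finProdFinEquiv.surjective i
  obtain ⟨⟨j₂, j₁⟩, rfl⟩ := finProdFinEquiv.surjective j
  refine (tensor_hom_apply (unit N).toBimod X.toBimod A _ _ _ _).trans ?_
  change X.hom A i₂ j₂ = _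
  exact congrArg₂ (X.hom A) (fin_mul_one i₂ i₁).symm (fin_mul_one j₂ j₁).symm

theorem tensor_unit (X : Obj N) : X.tensor (unit N) = X := by
  apply ext_toBimod
  refine Bimod.ext_cast (one_mul _) fun A i j => ?_
  obtain ⟨⟨i₂, i₁⟩, rfl⟩ := finProdFinEquiv.surjective i
  obtain ⟨⟨j₂, j₁⟩, rfl⟩ := finProdFinEquiv.surjective j
  refine (tensor_hom_apply X.toBimod (unit N).toBimod A _ _ _ _).trans ?_
  change X.hom A i₁ j₁ = _
  exact congrArg₂ (X.hom A) (fin_one_mul i₂ i₁).symm (fin_one_mul j₂ j₁).symm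

noncomputable instance : MonoidalCategoryStruct (Obj N) where
  tensorObj X Y := X.tensor Y
  tensorHom {X₁ _ _ _} f g := ⟨X₁.toBimod.tensorHom f.1 g.1, f.2.tensor g.2⟩
  whiskerLeft X _ _ f := ⟨X.toBimod.tensorHom X.idArrow f.1, X.idArrow_isArrow.tensor f.2⟩
  whiskerRight {X₁ _} f Y :=
    ⟨X₁.toBimod.tensorHom f.1 Y.idArrow, f.2.tensor Y.idArrow_isArrow⟩
  tensorUnit := unit N
  associator X Y Z := eqToIso (tensor_assoc X Y Z)
  leftUnitor X := eqToIso (unit_tensor X)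
  rightUnitor X := eqToIso (tensor_unit X)

theorem associator_def (X Y Z : Obj N) : α_ X Y Z = eqToIso (tensor_assoc X Y Z) := rfl
theorem leftUnitor_def (X : Obj N) : λ_ X = eqToIso (unit_tensor X) := rfl
theorem rightUnitor_def (X : Obj N) : ρ_ X = eqToIso (tensor_unit X) := rfl

theorem tensor_id_id (X Y : Obj N) : 𝟙 X ⊗ₘ 𝟙 Y = 𝟙 (X ⊗ Y) :=
  hom_ext (Bimod.tensor_idArrow X.toBimod Y.toBimod).symm

theorem tensorHom_eqToHom {X X' Y Y' : Obj N} (h : X = X') (h' : Y = Y') :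
    eqToHom h ⊗ₘ eqToHom h' = eqToHom (congrArg₂ (fun A B : Obj N => A ⊗ B) h h') := by
  subst h
  subst h'
  simp only [eqToHom_refl]
  exact tensor_id_id X Y

theorem tensorHom_apply_val {X₁ Y₁ X₂ Y₂ : Obj N} (f : X₁ ⟶ Y₁) (g : X₂ ⟶ Y₂) (i₂ i₁ j₂ j₁) :
    (f ⊗ₘ g).1 (finProdFinEquiv (i₂, i₁)) (finProdFinEquiv (j₂, j₁)) =
      (f.1 * X₁.hom (g.1 i₂ j₂)) i₁ j₁ := Bimod.tensorHom_apply _ _ _ _ _ _ _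

theorem tensorHom_assoc_apply {X₁ X₂ X₃ Y₁ Y₂ Y₃ : Obj N} (f₁ : X₁ ⟶ Y₁) (f₂ : X₂ ⟶ Y₂)
    (f₃ : X₃ ⟶ Y₃) (i₃ i₂ i₁ j₃ j₂ j₁) :
    ((f₁ ⊗ₘ f₂) ⊗ₘ f₃).1 (finProdFinEquiv (i₃, finProdFinEquiv (i₂, i₁)))
      (finProdFinEquiv (j₃, finProdFinEquiv (j₂, j₁))) =
      (f₁ ⊗ₘ (f₂ ⊗ₘ f₃)).1 (finProdFinEquiv (finProdFinEquiv (i₃, i₂), i₁))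
        (finProdFinEquiv (finProdFinEquiv (j₃, j₂), j₁)) := by
  refine (tensorHom_apply_val (f₁ ⊗ₘ f₂) f₃ _ _ _ _).trans ?_
  refine Eq.trans ?_ (tensorHom_apply_val f₁ (f₂ ⊗ₘ f₃) _ _ _ _).symm
  rw [tensorHom_apply_val f₂ f₃]
  have h1 : (f₁ ⊗ₘ f₂).1 * (X₁.toBimod.tensor X₂.toBimod).hom (f₃.1 i₃ j₃) =
      X₁.toBimod.tensorHom f₁.1 (f₂.1 * X₂.hom (f₃.1 i₃ j₃)) := by
    rw [Bimod.tensor_hom]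
    refine (Bimod.tensorHom_mul f₁.1 X₁.idArrow_isArrow f₂.1 (X₂.hom (f₃.1 i₃ j₃))).trans ?_
    rw [f₁.2.1]
  refine (congrFun (congrFun h1 _) _).trans ?_
  rw [Bimod.tensorHom_apply]

noncomputable instance : MonoidalCategory (Obj N) :=
  MonoidalCategory.ofTensorHom
    (id_tensorHom_id := tensor_id_id)
    (id_tensorHom := fun _ _ _ _ => rfl)
    (tensorHom_id := fun _ _ => rfl)
    (tensorHom_comp_tensorHom := fun f₁ f₂ g₁ g₂ =>
      hom_ext (Bimod.tensorHom_mul g₁.1 f₁.2 g₂.1 f₂.1))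
    (associator_naturality := fun {X₁ X₂ X₃ Y₁ Y₂ Y₃} f₁ f₂ f₃ => by
      apply hom_ext
      ext1 i j
      rw [associator_def, associator_def, eqToIso.hom, eqToIso.hom, comp_eqToHom_val,
        eqToHom_comp_val]
      obtain ⟨⟨i', i₁⟩, rfl⟩ := finProdFinEquiv.surjective i
      obtain ⟨⟨j₃, j'⟩, rfl⟩ := finProdFinEquiv.surjective j
      obtain ⟨⟨i₃, i₂⟩, rfl⟩ := finProdFinEquiv.surjective i'
      obtain ⟨⟨j₂, j₁⟩, rfl⟩ := finProdFinEquiv.surjective j'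
      have e1 : Fin.cast (mul_assoc Y₃.n Y₂.n Y₁.n)
          (finProdFinEquiv (finProdFinEquiv (i₃, i₂), i₁)) =
          finProdFinEquiv (i₃, finProdFinEquiv (i₂, i₁)) := by rw [← fin_assoc]; rfl
      have e2 := fin_assoc j₃ j₂ j₁
      refine Eq.trans ?_ ((tensorHom_assoc_apply f₁ f₂ f₃ i₃ i₂ i₁ j₃ j₂ j₁).trans ?_)
      · exact congrFun (congrArg ((f₁ ⊗ₘ f₂) ⊗ₘ f₃).1 e1) _
      · exact congrArg ((f₁ ⊗ₘ f₂ ⊗ₘ f₃).1 _) e2.symm)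
    (leftUnitor_naturality := fun {X Y} f => by
      apply hom_ext
      ext1 i j
      rw [leftUnitor_def, leftUnitor_def, eqToIso.hom, eqToIso.hom, comp_eqToHom_val,
        eqToHom_comp_val]
      obtain ⟨⟨j₂, j₁⟩, rfl⟩ := finProdFinEquiv.surjective j
      have e1 : Fin.cast (mul_one Y.n).symm i = finProdFinEquiv (i, (0 : Fin 1)) := by
        apply Fin.ext
        simp [finProdFinEquiv]
      have e2 := fin_mul_one j₂ j₁
      refine Eq.trans (congrFun (congrArg _ e1) _) ?_
      refine Eq.trans (tensorHom_apply_val (𝟙 (unit N)) f i (0 : Fin 1) j₂ j₁) ?_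
      refine Eq.trans ?_ (congrArg (f.1 i) e2.symm)
      exact (one_entry_mul 1 (f.1 i j₂) 0 j₁).trans (one_mul _))
    (rightUnitor_naturality := fun {X Y} f => by
      apply hom_ext
      ext1 i j
      rw [rightUnitor_def, rightUnitor_def, eqToIso.hom, eqToIso.hom, comp_eqToHom_val,
        eqToHom_comp_val]
      obtain ⟨⟨j₂, j₁⟩, rfl⟩ := finProdFinEquiv.surjective j
      have e1 : Fin.cast (one_mul Y.n).symm i = finProdFinEquiv ((0 : Fin 1), i) := by
        apply Fin.ext
        simp [finProdFinEquiv]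
      have e2 := fin_one_mul j₂ j₁
      refine Eq.trans (congrFun (congrArg _ e1) _) ?_
      refine Eq.trans (tensorHom_apply_val f (𝟙 (unit N)) (0 : Fin 1) i j₂ j₁) ?_
      refine Eq.trans ?_ (congrArg (f.1 i) e2.symm)
      change (f.1 * X.hom 1) i j₁ = _
      exact congrFun (congrFun f.2.1 i) j₁)
    (pentagon := fun W X Y Z => by
      simp only [associator_def, eqToIso.hom]
      rw [← eqToHom_refl Z rfl, ← eqToHom_refl W rfl, tensorHom_eqToHom, tensorHom_eqToHom]
      simp)
    (triangle := fun X Y => by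
      simp only [associator_def, leftUnitor_def, rightUnitor_def, eqToIso.hom]
      rw [← eqToHom_refl X rfl, ← eqToHom_refl Y rfl, tensorHom_eqToHom, tensorHom_eqToHom]
      simp)

theorem whiskerLeft_val (X : Obj N) {Y Z : Obj N} (f : Y ⟶ Z) :
    (X ◁ f).1 = X.toBimod.tensorHom X.idArrow f.1 := rfl

theorem tensorHom_entry {X₁ Y₁ X₂ Y₂ : Obj N} (f : X₁ ⟶ Y₁) (g : X₂ ⟶ Y₂) (i₂ i₁ j₂ j₁) :
    (f ⊗ₘ g).1 (finProdFinEquiv (i₂, i₁)) (finProdFinEquiv (j₂, j₁)) =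
      ∑ k, f.1 i₁ k * X₁.hom (g.1 i₂ j₂) k j₁ := by
  rw [tensorHom_apply_val, Matrix.mul_apply]

theorem hom_ext_prod {X₁ Y₁ X₂ Y₂ : Obj N} {f g : X₁ ⊗ X₂ ⟶ Y₁ ⊗ Y₂}
    (h : ∀ i₂ i₁ j₂ j₁, f.1 (finProdFinEquiv (i₂, i₁)) (finProdFinEquiv (j₂, j₁)) =
      g.1 (finProdFinEquiv (i₂, i₁)) (finProdFinEquiv (j₂, j₁))) : f = g :=
  hom_ext (Bimod.ext_fin h)

noncomputable instance : MonoidalPreadditive (Obj N) where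
  whiskerLeft_zero := hom_ext_prod fun i₂ i₁ j₂ j₁ => by
    simp only [← id_tensorHom]
    rw [tensorHom_entry]
    simp
  zero_whiskerRight := hom_ext_prod fun i₂ i₁ j₂ j₁ => by
    simp only [← tensorHom_id]
    rw [tensorHom_entry]
    simp
  whiskerLeft_add f g := hom_ext_prod fun i₂ i₁ j₂ j₁ => by
    simp only [← id_tensorHom]
    rw [add_val, Matrix.add_apply, tensorHom_entry, tensorHom_entry, tensorHom_entry]
    simp [mul_add, Finset.sum_add_distrib]
  add_whiskerRight f g := hom_ext_prod fun i₂ i₁ j₂ j₁ => by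
    simp only [← tensorHom_id]
    rw [add_val, Matrix.add_apply, tensorHom_entry, tensorHom_entry, tensorHom_entry]
    simp [add_mul, Finset.sum_add_distrib]

noncomputable instance : MonoidalLinear ℂ (Obj N) where
  whiskerLeft_smul X _ _ c f := hom_ext_prod fun i₂ i₁ j₂ j₁ => by
    simp only [← id_tensorHom]
    rw [smul_val, Matrix.smul_apply, tensorHom_entry, tensorHom_entry]
    simp [Finset.smul_sum]
  smul_whiskerRight c _ _ f X := hom_ext_prod fun i₂ i₁ j₂ j₁ => by
    simp only [← tensorHom_id]
    rw [smul_val, Matrix.smul_apply, tensorHom_entry, tensorHom_entry]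
    simp [Finset.smul_sum]

end Obj

/-! ## The symmetry -/

namespace Obj

/-- The adjoint of an arrow. -/
noncomputable def adjoint {X Y : Obj N} (f : X ⟶ Y) : Y ⟶ X := ⟨f.1ᴴ, f.2.star⟩

@[simp] theorem adjoint_val {X Y : Obj N} (f : X ⟶ Y) : (adjoint f).1 = f.1ᴴ := rfl

@[simp] theorem adjoint_adjoint {X Y : Obj N} (f : X ⟶ Y) : adjoint (adjoint f) = f :=
  hom_ext (Matrix.conjTranspose_conjTranspose _)

@[simp] theorem adjoint_comp {X Y Z : Obj N} (f : X ⟶ Y) (g : Y ⟶ Z) :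
    adjoint (f ≫ g) = adjoint g ≫ adjoint f := hom_ext (Matrix.conjTranspose_mul _ _)

@[simp] theorem adjoint_id (X : Obj N) : adjoint (𝟙 X) = 𝟙 X := hom_ext X.idArrow_star

theorem adjoint_tensor {X Y X' Y' : Obj N} (f : X ⟶ Y) (g : X' ⟶ Y') :
    adjoint (f ⊗ₘ g) = adjoint f ⊗ₘ adjoint g := hom_ext (Bimod.tensorHom_star f.2 g.1)

theorem adjoint_eqToHom {X Y : Obj N} (h : X = Y) : adjoint (eqToHom h) = eqToHom h.symm := by
  subst h
  exact adjoint_id X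

/-- A unitary arrow. -/
structure Unitary {X Y : Obj N} (U : X ⟶ Y) : Prop where
  left : U ≫ adjoint U = 𝟙 X
  right : adjoint U ≫ U = 𝟙 Y

theorem Unitary.isUnitary {X Y : Obj N} {U : X ⟶ Y} (h : Unitary U) :
    X.IsUnitary Y.toBimod U.1 :=
  ⟨⟨U.2, congrArg Subtype.val h.left⟩, congrArg Subtype.val h.right⟩

theorem _root_.AQFT.Bimod.IsUnitary.unitary {X Y : Obj N} {U : Matrix (Fin Y.n) (Fin X.n) N.alg}
    (h : X.IsUnitary Y.toBimod U) : Unitary (X := X) (Y := Y) ⟨U, h.1.1⟩ :=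
  ⟨hom_ext h.1.2, hom_ext h.2⟩

theorem Unitary.comp {X Y Z : Obj N} {U : X ⟶ Y} {V : Y ⟶ Z} (h : Unitary U) (h' : Unitary V) :
    Unitary (U ≫ V) :=
  ⟨by rw [adjoint_comp, Category.assoc, reassoc_of% h'.left, h.left],
    by rw [adjoint_comp, Category.assoc, reassoc_of% h.right, h'.right]⟩

theorem unitary_id (X : Obj N) : Unitary (𝟙 X) := ⟨by simp, by simp⟩

theorem Unitary.tensor {X Y X' Y' : Obj N} {U : X ⟶ Y} {V : X' ⟶ Y'} (h : Unitary U)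
    (h' : Unitary V) : Unitary (U ⊗ₘ V) :=
  ⟨by rw [adjoint_tensor, tensorHom_comp_tensorHom, h.left, h'.left, tensor_id_id],
    by rw [adjoint_tensor, tensorHom_comp_tensorHom, h.right, h'.right, tensor_id_id]⟩

theorem exists_transport (X : Obj N) (o : DoubleCone) : ∃ (Y : Obj N) (U : X ⟶ Y),
    Y.LocalizedIn o ∧ Unitary U := by
  obtain ⟨Y, hY, U, hU⟩ := X.transport o
  exact ⟨Y, _, hY, hU.unitary⟩

theorem isIntertwiner {X Y : Obj N} (f : X ⟶ Y) :
    X.toMor.IsIntertwiner Y.toMor (coeMat f.1) := by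
  refine ⟨?_, ?_, fun A => ?_⟩
  · exact (coeMat_mul _ _).symm.trans (congrArg coeMat f.2.1)
  · exact (coeMat_mul _ _).symm.trans (congrArg coeMat f.2.2.1)
  · exact (coeMat_mul _ _).symm.trans ((congrArg coeMat (f.2.2.2 A)).trans (coeMat_mul _ _))

theorem entry_mem {X Y : Obj N} {c : DoubleCone} (hX : X.LocalizedIn c) (hY : Y.LocalizedIn c)
    (f : X ⟶ Y) (i j) : (f.1 i j : H →L[ℂ] H) ∈ N.loc c :=
  (isIntertwiner f).entry_mem hX hY i j

theorem _root_.AQFT.Net.commute (N : Net H) {a b : DoubleCone} (h : a.Perp b) {A B : N.alg}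
    (hA : (A : H →L[ℂ] H) ∈ N.loc a) (hB : (B : H →L[ℂ] H) ∈ N.loc b) : A * B = B * A := by
  apply Subtype.ext
  have := N.locality a b h hA
  rw [VonNeumannAlgebra.mem_commutant_iff] at this
  exact (this _ hB).symm

theorem tensor_entry {X X' Y Y' : Obj N} {e f : DoubleCone} (h : e.Perp f) (hX : X.LocalizedIn e)
    (hX' : X'.LocalizedIn e) (hY : Y.LocalizedIn f) (hY' : Y'.LocalizedIn f) (S : X ⟶ X')
    (T : Y ⟶ Y') (i₂ i₁ j₂ j₁) :
    (S ⊗ₘ T).1 (finProdFinEquiv (i₂, i₁)) (finProdFinEquiv (j₂, j₁)) = S.1 i₁ j₁ * T.1 i₂ j₂ := by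
  have hT := entry_mem hY hY' T i₂ j₂
  obtain ⟨B, hB⟩ : ∃ B, B = T.1 i₂ j₂ := ⟨_, rfl⟩
  rw [← hB] at hT
  refine (tensorHom_apply_val S T _ _ _ _).trans ?_
  refine Eq.trans (congrArg (fun B => (S.1 * X.hom B) i₁ j₁) hB.symm) ?_
  refine Eq.trans ?_ (congrArg (S.1 i₁ j₁ * ·) hB)
  have h1 : S.1 * (Matrix.diagonal fun _ => B : Matrix (Fin X.n) (Fin X.n) N.alg) =
      (Matrix.diagonal fun _ => B : Matrix (Fin X'.n) (Fin X'.n) N.alg) * S.1 := by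
    ext1 i j
    refine (Matrix.mul_diagonal _ _ _ _).trans (Eq.trans ?_ (Matrix.diagonal_mul _ _ _ _).symm)
    exact N.commute h (entry_mem hX hX' S i j) hT
  have h2 : S.1 * X.hom B =
      (Matrix.diagonal fun _ => B : Matrix (Fin X'.n) (Fin X'.n) N.alg) * S.1 := by
    rw [Bimod.LocalizedIn.hom_eq hX h.symm hT, ← Matrix.mul_assoc, h1, Matrix.mul_assoc, S.2.1]
  refine (congrFun (congrFun h2 i₁) j₁).trans ?_
  refine (Matrix.diagonal_mul _ _ _ _).trans ?_
  exact (N.commute h (entry_mem hX hX' S i₁ j₁) hT).symm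

theorem flip_mul_apply {n m k : ℕ} (M : Matrix (Fin (m * n)) (Fin k) N.alg) (a : Fin n) (b : Fin m)
    (j) : (flip N n m * M) (finProdFinEquiv (a, b)) j = M (finProdFinEquiv (b, a)) j := by
  rw [Matrix.mul_apply, ← finProdFinEquiv.sum_comp, Fintype.sum_eq_single (b, a)]
  · simp only [flip, Matrix.of_apply, Equiv.symm_apply_apply]
    rw [if_pos (by simp), one_mul]
  · rintro ⟨x, y⟩ hxy
    simp only [flip, Matrix.of_apply, Equiv.symm_apply_apply]
    rw [if_neg, zero_mul]
    rintro ⟨rfl, rfl⟩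
    exact hxy rfl

theorem mul_flip_apply {n m k : ℕ} (M : Matrix (Fin k) (Fin (n * m)) N.alg) (a : Fin n) (b : Fin m)
    (i) : (M * flip N n m) i (finProdFinEquiv (b, a)) = M i (finProdFinEquiv (a, b)) := by
  rw [Matrix.mul_apply, ← finProdFinEquiv.sum_comp, Fintype.sum_eq_single (a, b)]
  · simp only [flip, Matrix.of_apply, Equiv.symm_apply_apply]
    rw [if_pos (by simp), mul_one]
  · rintro ⟨x, y⟩ hxy
    simp only [flip, Matrix.of_apply, Equiv.symm_apply_apply]
    rw [if_neg, mul_zero]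
    rintro ⟨rfl, rfl⟩
    exact hxy rfl

theorem flip_flip (n m : ℕ) : flip N n m * flip N m n = 1 := by
  apply Bimod.ext_fin
  intro i₂ i₁ j₂ j₁
  rw [flip_mul_apply]
  simp only [flip, Matrix.of_apply, Equiv.symm_apply_apply, Matrix.one_apply,
    EmbeddingLike.apply_eq_iff_eq, Prod.mk.injEq]
  congr 1
  exact propext and_comm

theorem flip_tensor {X X' Y Y' : Obj N} {e f : DoubleCone} (h : e.Perp f) (hX : X.LocalizedIn e)
    (hX' : X'.LocalizedIn e) (hY : Y.LocalizedIn f) (hY' : Y'.LocalizedIn f) (S : X ⟶ X')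
    (T : Y ⟶ Y') : flip N X'.n Y'.n * (S ⊗ₘ T).1 = (T ⊗ₘ S).1 * flip N X.n Y.n := by
  apply Bimod.ext_fin
  intro i₂ i₁ j₂ j₁
  rw [flip_mul_apply]
  refine Eq.trans ?_ (mul_flip_apply (T ⊗ₘ S).1 _ _ _).symm
  rw [tensor_entry h hX hX' hY hY', tensor_entry h.symm hY hY' hX hX']
  exact N.commute h (entry_mem hX hX' S _ _) (entry_mem hY hY' T _ _)

/-- The value of the symmetry defined by a pair of unitaries. -/
noncomputable def symVal {X Y X' Y' : Obj N} (U : X ⟶ X') (V : Y ⟶ Y') :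
    Matrix (Fin (X.n * Y.n)) (Fin (Y.n * X.n)) N.alg :=
  (adjoint V ⊗ₘ adjoint U).1 * flip N X'.n Y'.n * (U ⊗ₘ V).1

theorem tensor_mul {X Y Z X' Y' Z' : Obj N} (f : X ⟶ Y) (g : Y ⟶ Z) (f' : X' ⟶ Y') (g' : Y' ⟶ Z') :
    (g ⊗ₘ g').1 * (f ⊗ₘ f').1 = ((f ≫ g) ⊗ₘ (f' ≫ g')).1 :=
  congrArg Subtype.val (tensorHom_comp_tensorHom f f' g g')

theorem symVal_step {X Y X₁ Y₁ X₂ Y₂ : Obj N} {e f : DoubleCone} (h : e.Perp f)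
    (hX₁ : X₁.LocalizedIn e) (hX₂ : X₂.LocalizedIn e) (hY₁ : Y₁.LocalizedIn f)
    (hY₂ : Y₂.LocalizedIn f) {U : X ⟶ X₁} {V : Y ⟶ Y₁} {U' : X ⟶ X₂} {V' : Y ⟶ Y₂}
    (hU : Unitary U) (hV : Unitary V) (hU' : Unitary U') (hV' : Unitary V') :
    symVal U V = symVal U' V' := by
  have h1 : (U' ⊗ₘ V').1 = ((adjoint U ≫ U') ⊗ₘ (adjoint V ≫ V')).1 * (U ⊗ₘ V).1 := by
    rw [tensor_mul, reassoc_of% hU.left, reassoc_of% hV.left]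
  have h2 : (adjoint V' ⊗ₘ adjoint U').1 * ((adjoint V ≫ V') ⊗ₘ (adjoint U ≫ U')).1 =
      (adjoint V ⊗ₘ adjoint U).1 := by
    rw [tensor_mul, Category.assoc, Category.assoc, hU'.left, hV'.left, Category.comp_id,
      Category.comp_id]
  have h3 := flip_tensor h hX₁ hX₂ hY₁ hY₂ (adjoint U ≫ U') (adjoint V ≫ V')
  rw [symVal, symVal, h1, ← h2]
  calc _ = (adjoint V' ⊗ₘ adjoint U').1 * (((adjoint V ≫ V') ⊗ₘ (adjoint U ≫ U')).1 *
        flip N X₁.n Y₁.n) * (U ⊗ₘ V).1 := by rw [Matrix.mul_assoc (adjoint V' ⊗ₘ adjoint U').1]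
    _ = _ := by
      rw [← h3]
      simp only [Matrix.mul_assoc]

theorem symVal_eq {X Y X₁ Y₁ X₂ Y₂ : Obj N} {o a o' a' : DoubleCone} (h : o.Perp a)
    (h' : o'.Perp a') (hX₁ : X₁.LocalizedIn o) (hX₂ : X₂.LocalizedIn o') (hY₁ : Y₁.LocalizedIn a)
    (hY₂ : Y₂.LocalizedIn a') {U : X ⟶ X₁} {V : Y ⟶ Y₁} {U' : X ⟶ X₂} {V' : Y ⟶ Y₂}
    (hU : Unitary U) (hV : Unitary V) (hU' : Unitary U') (hV' : Unitary V') :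
    symVal U V = symVal U' V' := by
  refine perp_connected (P := fun o' a' => ∀ (X₂ Y₂ : Obj N) (U' : X ⟶ X₂) (V' : Y ⟶ Y₂),
    X₂.LocalizedIn o' → Y₂.LocalizedIn a' → Unitary U' → Unitary V' → symVal U V = symVal U' V')
    ?_ h h' ?_ X₂ Y₂ U' V' hX₂ hY₂ hU' hV'
  · intro o a o' a' e f hef h1 h2 h3 h4 hP X₂ Y₂ U' V' hX₂ hY₂ hU' hV'
    obtain ⟨X₃, U₃, hX₃, hU₃⟩ := X.exists_transport o
    obtain ⟨Y₃, V₃, hY₃, hV₃⟩ := Y.exists_transport a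
    rw [hP X₃ Y₃ U₃ V₃ hX₃ hY₃ hU₃ hV₃]
    exact symVal_step hef (Mor.LocalizedIn.mono hX₃ h1) (Mor.LocalizedIn.mono hX₂ h2)
      (Mor.LocalizedIn.mono hY₃ h3) (Mor.LocalizedIn.mono hY₂ h4) hU₃ hV₃ hU' hV'
  · intro X₂ Y₂ U' V' hX₂ hY₂ hU' hV'
    exact symVal_step h hX₁ hX₂ hY₁ hY₂ hU hV hU' hV'

theorem symmetry_eq {X Y X' Y' : Obj N} {o a : DoubleCone} (h : o.Perp a)
    (hX' : X'.LocalizedIn o) (hY' : Y'.LocalizedIn a) {U : X ⟶ X'} {V : Y ⟶ Y'}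
    (hU : Unitary U) (hV : Unitary V) : X.symmetry Y = symVal U V := by
  have hs : X.IsSymmetryValue Y (X.symmetry Y) := (X.exists_isSymmetryValue Y).choose_spec
  obtain ⟨o', a', X₁, Y₁, U₁, V₁, h', hX₁, hY₁, hU₁, hV₁, hE⟩ := hs
  have hE' : X.symmetry Y = symVal (X' := X₁) (Y' := Y₁) ⟨U₁, hU₁.1.1⟩ ⟨V₁, hV₁.1.1⟩ := hE
  rw [hE']
  exact symVal_eq h' h hX₁ hX' hY₁ hY' hU₁.unitary hV₁.unitary hU hV

theorem symmetry_isArrow (X Y : Obj N) :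
    (X ⊗ Y).IsArrow (Y ⊗ X).toBimod (X.symmetry Y) := by
  have hid : ∀ {X' Y' : Obj N} (U : X ⟶ X') (V : Y ⟶ Y'),
      symVal U V * (X ⊗ Y).idArrow = symVal U V ∧ (Y ⊗ X).idArrow * symVal U V = symVal U V := by
    intro X' Y' U V
    refine ⟨?_, ?_⟩
    · rw [symVal, Matrix.mul_assoc, (U ⊗ₘ V).2.1]
    · rw [symVal, Matrix.mul_assoc, ← Matrix.mul_assoc (Y ⊗ X).idArrow,
        (adjoint V ⊗ₘ adjoint U).2.2.1]
  obtain ⟨o₀, a₀, h₀⟩ := DoubleCone.exists_perp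
  refine ⟨?_, ?_, fun A => ?_⟩
  · obtain ⟨X', U, hX', hU⟩ := X.exists_transport o₀
    obtain ⟨Y', V, hY', hV⟩ := Y.exists_transport a₀
    rw [symmetry_eq h₀ hX' hY' hU hV]
    exact (hid U V).1
  · obtain ⟨X', U, hX', hU⟩ := X.exists_transport o₀
    obtain ⟨Y', V, hY', hV⟩ := Y.exists_transport a₀
    rw [symmetry_eq h₀ hX' hY' hU hV]
    exact (hid U V).2
  · have hcont : ∀ (Z : Obj N) (i j), Continuous fun A : N.alg => Z.hom A i j := fun Z i j =>
      continuous_induced_rng.2 (Z.toMor.continuous_entry i j)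
    refine N.alg_induction (P := fun A => X.symmetry Y * (X ⊗ Y).hom A =
      (Y ⊗ X).hom A * X.symmetry Y) ?_ o₀ (fun c _ A hA => ?_) A
    · have : {A : N.alg | X.symmetry Y * (X ⊗ Y).hom A = (Y ⊗ X).hom A * X.symmetry Y} =
          ⋂ (i) (j), {A : N.alg | (X.symmetry Y * (X ⊗ Y).hom A) i j =
            ((Y ⊗ X).hom A * X.symmetry Y) i j} := by
        ext A
        simp only [Set.mem_iInter, Set.mem_ofPred_eq]
        exact ⟨fun h i j => by rw [h], fun h => Matrix.ext h⟩
      rw [this]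
      refine isClosed_iInter fun i => isClosed_iInter fun j => ?_
      simp only [Matrix.mul_apply]
      refine isClosed_eq (continuous_finsetSum _ fun k _ => ?_)
        (continuous_finsetSum _ fun k _ => ?_)
      · exact continuous_const.mul (hcont _ _ _)
      · exact (hcont _ _ _).mul continuous_const
    · obtain ⟨o, ho⟩ := exists_perp c
      obtain ⟨c', hc, ho'⟩ := DoubleCone.directed c o
      obtain ⟨a, ha⟩ := exists_perp c'
      obtain ⟨X', U, hX', hU⟩ := X.exists_transport o
      obtain ⟨Y', V, hY', hV⟩ := Y.exists_transport a
      rw [symmetry_eq (ha.mono ho').symm hX' hY' hU hV]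
      have hXA := Bimod.LocalizedIn.hom_eq hX' ho.symm hA
      have hYA := Bimod.LocalizedIn.hom_eq hY' (ha.mono hc).symm hA
      have key : flip N X'.n Y'.n * (X' ⊗ Y').hom A = (Y' ⊗ X').hom A * flip N X'.n Y'.n := by
        have e1 : ∀ i₂ i₁ j₂ j₁, (X' ⊗ Y').hom A (finProdFinEquiv (i₂, i₁))
            (finProdFinEquiv (j₂, j₁)) = A * ((𝟙 X' ⊗ₘ 𝟙 Y' : X' ⊗ Y' ⟶ X' ⊗ Y').1
              (finProdFinEquiv (i₂, i₁)) (finProdFinEquiv (j₂, j₁))) := by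
          intro i₂ i₁ j₂ j₁
          refine (tensor_hom_apply X'.toBimod Y'.toBimod A _ _ _ _).trans ?_
          rw [tensorHom_apply_val, hYA]
          refine (congrArg (fun B => X'.hom B i₁ j₁) (Matrix.diagonal_mul _ _ _ _)).trans ?_
          rw [map_mul, hXA]
          rw [Matrix.mul_assoc]
          exact Matrix.diagonal_mul _ _ _ _
        have e2 : ∀ i₂ i₁ j₂ j₁, (Y' ⊗ X').hom A (finProdFinEquiv (i₂, i₁))
            (finProdFinEquiv (j₂, j₁)) = A * ((𝟙 Y' ⊗ₘ 𝟙 X' : Y' ⊗ X' ⟶ Y' ⊗ X').1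
              (finProdFinEquiv (i₂, i₁)) (finProdFinEquiv (j₂, j₁))) := by
          intro i₂ i₁ j₂ j₁
          refine (tensor_hom_apply Y'.toBimod X'.toBimod A _ _ _ _).trans ?_
          rw [tensorHom_apply_val, hXA]
          refine (congrArg (fun B => Y'.hom B i₁ j₁) (Matrix.diagonal_mul _ _ _ _)).trans ?_
          rw [map_mul, hYA]
          rw [Matrix.mul_assoc]
          exact Matrix.diagonal_mul _ _ _ _
        apply Bimod.ext_fin
        intro i₂ i₁ j₂ j₁
        rw [flip_mul_apply]
        refine Eq.trans ?_ (mul_flip_apply ((Y' ⊗ X').hom A) _ _ _).symm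
        rw [e1, e2]
        congr 1
        have := congrFun (congrFun (flip_tensor (ha.mono ho').symm hX' hX' hY' hY' (𝟙 X') (𝟙 Y'))
          (finProdFinEquiv (i₂, i₁))) (finProdFinEquiv (j₂, j₁))
        rw [flip_mul_apply] at this
        exact this.trans (mul_flip_apply _ _ _ _)
      rw [symVal]
      rw [Matrix.mul_assoc, (U ⊗ₘ V).2.2.2, ← Matrix.mul_assoc, Matrix.mul_assoc _ (flip N _ _)]
      refine Eq.trans (congrArg (fun M => (adjoint V ⊗ₘ adjoint U).1 * M * (U ⊗ₘ V).1) key) ?_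
      rw [← Matrix.mul_assoc, (adjoint V ⊗ₘ adjoint U).2.2.2]
      simp only [Matrix.mul_assoc]

/-- The symmetry as an arrow. -/
noncomputable def sym (X Y : Obj N) : X ⊗ Y ⟶ Y ⊗ X := ⟨X.symmetry Y, symmetry_isArrow X Y⟩

theorem sym_val (X Y : Obj N) : (sym X Y).1 = X.symmetry Y := rfl

theorem sym_naturality {X X' Y Y' : Obj N} (S : X ⟶ X') (T : Y ⟶ Y') :
    (S ⊗ₘ T) ≫ sym X' Y' = sym X Y ≫ (T ⊗ₘ S) := by
  obtain ⟨o, a, h⟩ := DoubleCone.exists_perp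
  obtain ⟨X₁, U, hX₁, hU⟩ := X.exists_transport o
  obtain ⟨Y₁, V, hY₁, hV⟩ := Y.exists_transport a
  obtain ⟨X₂, U', hX₂, hU'⟩ := X'.exists_transport o
  obtain ⟨Y₂, V', hY₂, hV'⟩ := Y'.exists_transport a
  apply hom_ext
  rw [comp_val, comp_val, sym_val, sym_val, symmetry_eq h hX₁ hY₁ hU hV,
    symmetry_eq h hX₂ hY₂ hU' hV', symVal, symVal]
  have h1 : (U' ⊗ₘ V').1 * (S ⊗ₘ T).1 =
      ((adjoint U ≫ S ≫ U') ⊗ₘ (adjoint V ≫ T ≫ V')).1 * (U ⊗ₘ V).1 := by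
    rw [tensor_mul, tensor_mul, reassoc_of% hU.left, reassoc_of% hV.left]
  have h2 : (T ⊗ₘ S).1 * (adjoint V ⊗ₘ adjoint U).1 =
      (adjoint V' ⊗ₘ adjoint U').1 * ((adjoint V ≫ T ≫ V') ⊗ₘ (adjoint U ≫ S ≫ U')).1 := by
    rw [tensor_mul, tensor_mul]
    simp only [Category.assoc, hU'.left, hV'.left, Category.comp_id]
  rw [Matrix.mul_assoc, h1, ← Matrix.mul_assoc, Matrix.mul_assoc _ (flip N _ _),
    flip_tensor h hX₁ hX₂ hY₁ hY₂]
  simp only [← Matrix.mul_assoc]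
  rw [h2]

theorem sym_sym (X Y : Obj N) : sym X Y ≫ sym Y X = 𝟙 (X ⊗ Y) := by
  obtain ⟨o, a, h⟩ := DoubleCone.exists_perp
  obtain ⟨X₁, U, hX₁, hU⟩ := X.exists_transport o
  obtain ⟨Y₁, V, hY₁, hV⟩ := Y.exists_transport a
  apply hom_ext
  rw [comp_val, sym_val, sym_val, symmetry_eq h hX₁ hY₁ hU hV,
    symmetry_eq h.symm hY₁ hX₁ hV hU, symVal, symVal]
  have h1 : (V ⊗ₘ U).1 * (adjoint V ⊗ₘ adjoint U).1 = (𝟙 Y₁ ⊗ₘ 𝟙 X₁).1 := by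
    rw [tensor_mul, hV.right, hU.right]
  calc _ = (adjoint U ⊗ₘ adjoint V).1 * (flip N Y₁.n X₁.n *
        ((V ⊗ₘ U).1 * (adjoint V ⊗ₘ adjoint U).1)) * flip N X₁.n Y₁.n * (U ⊗ₘ V).1 := by
        simp only [Matrix.mul_assoc]
    _ = (adjoint U ⊗ₘ adjoint V).1 * ((𝟙 X₁ ⊗ₘ 𝟙 Y₁).1 * (flip N Y₁.n X₁.n *
        flip N X₁.n Y₁.n)) * (U ⊗ₘ V).1 := by
        rw [h1, flip_tensor h.symm hY₁ hY₁ hX₁ hX₁]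
        simp only [Matrix.mul_assoc]
    _ = (adjoint U ⊗ₘ adjoint V).1 * (U ⊗ₘ V).1 := by
        rw [flip_flip, Matrix.mul_one, tensor_mul, Category.id_comp, Category.id_comp]
    _ = _ := by
        rw [tensor_mul, hU.left, hV.left, tensor_id_id]

theorem sym_localized {X Y : Obj N} {o a : DoubleCone} (h : o.Perp a)
    (hX : X.LocalizedIn o) (hY : Y.LocalizedIn a) (i₂ i₁ j₂ j₁) :
    (sym X Y).1 (finProdFinEquiv (i₁, i₂)) (finProdFinEquiv (j₂, j₁)) =
      X.idArrow i₁ j₁ * Y.idArrow i₂ j₂ := by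
  rw [sym_val, symmetry_eq h hX hY (unitary_id X) (unitary_id Y), symVal, adjoint_id, adjoint_id,
    ← flip_tensor h hX hX hY hY, Matrix.mul_assoc, tensor_mul, Category.id_comp, Category.id_comp,
    flip_mul_apply, tensor_entry h hX hX hY hY]
  rfl

theorem adjoint_sym (X Y : Obj N) : adjoint (sym X Y) = sym Y X := by
  obtain ⟨o, a, h⟩ := DoubleCone.exists_perp
  obtain ⟨X₁, U, hX₁, hU⟩ := X.exists_transport o
  obtain ⟨Y₁, V, hY₁, hV⟩ := Y.exists_transport a
  have h1 : (flip N X₁.n Y₁.n)ᴴ = flip N Y₁.n X₁.n := by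
    ext1 i j
    simp only [Matrix.conjTranspose_apply, flip, Matrix.of_apply]
    rw [apply_ite star, star_one, star_zero]
    congr 1
    exact propext ⟨fun h => ⟨h.2.symm, h.1.symm⟩, fun h => ⟨h.2.symm, h.1.symm⟩⟩
  apply hom_ext
  rw [adjoint_val, sym_val, sym_val, symmetry_eq h hX₁ hY₁ hU hV,
    symmetry_eq h.symm hY₁ hX₁ hV hU, symVal, symVal, Matrix.conjTranspose_mul,
    Matrix.conjTranspose_mul, h1, ← adjoint_val, ← adjoint_val, adjoint_tensor, adjoint_tensor,
    adjoint_adjoint, adjoint_adjoint, Matrix.mul_assoc]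

theorem sum_mul_of_commute {R : Type*} [Semiring R] {ι κ ι' κ' μ ν : Type*} [Fintype ι] [Fintype κ]
    (A : Matrix ι' ι R) (A' : Matrix ι μ R) (B : Matrix κ' κ R) (B' : Matrix κ ν R)
    (h : ∀ i j k l, Commute (B i j) (A' k l)) (i : ι') (j : μ) (i' : κ') (j' : ν) :
    ∑ k, ∑ l, (A i k * B i' l) * (A' k j * B' l j') = (A * A') i j * (B * B') i' j' := by
  rw [Matrix.mul_apply, Matrix.mul_apply, Finset.sum_mul_sum]
  refine Finset.sum_congr rfl fun k _ => Finset.sum_congr rfl fun l _ => ?_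
  rw [mul_assoc, mul_assoc, ← mul_assoc (B i' l), (h i' l k j).eq, mul_assoc]

theorem sum_fin_prod {M : Type*} [AddCommMonoid M] {m n : ℕ} (f : Fin (m * n) → M) :
    ∑ i, f i = ∑ a, ∑ b, f (finProdFinEquiv (a, b)) := by
  rw [← finProdFinEquiv.sum_comp, Fintype.sum_prod_type]

theorem idArrow_mul_self (X : Obj N) : X.idArrow * X.idArrow = X.idArrow := X.idArrow_isArrow.1

theorem hom_entry_mem {Y : Obj N} {a : DoubleCone} (hY : Y.LocalizedIn a) {A : N.alg}
    (hA : (A : H →L[ℂ] H) ∈ N.loc a) (i j) : (Y.hom A i j : H →L[ℂ] H) ∈ N.loc a :=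
  Mor.LocalizedIn.entry_mem_loc hY A hA i j

theorem idArrow_entry_mem {Y : Obj N} {a : DoubleCone} (hY : Y.LocalizedIn a) (i j) :
    (Y.idArrow i j : H →L[ℂ] H) ∈ N.loc a := hom_entry_mem hY (one_mem (N.loc a)) i j

theorem hom_apply_of_perp {X : Obj N} {o a : DoubleCone} (h : o.Perp a) (hX : X.LocalizedIn o)
    {A : N.alg} (hA : (A : H →L[ℂ] H) ∈ N.loc a) (i j) : X.hom A i j = A * X.idArrow i j := by
  rw [Bimod.LocalizedIn.hom_eq hX h.symm hA]
  exact Matrix.diagonal_mul _ _ _ _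

theorem whiskerLeft_sym_entry {X Y Z : Obj N} {o a : DoubleCone} (h : o.Perp a)
    (hX : X.LocalizedIn o) (hY : Y.LocalizedIn a) (hZ : Z.LocalizedIn a) (iX iY iZ kX kY kZ) :
    (Y ◁ sym X Z).1 (finProdFinEquiv (finProdFinEquiv (iX, iZ), iY))
      (finProdFinEquiv (finProdFinEquiv (kZ, kX), kY)) =
      X.idArrow iX kX * (Y.hom (Z.idArrow iZ kZ)) iY kY := by
  rw [← id_tensorHom]
  refine (tensorHom_apply_val _ _ _ _ _ _).trans ?_
  rw [id_val, Y.idArrow_isArrow.2.2]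
  refine (congrFun (congrFun (congrArg (Y.hom · * Y.idArrow) (sym_localized h hX hZ _ _ _ _)) _)
    _).trans ?_
  rw [map_mul, Matrix.mul_assoc, ← Y.idArrow_isArrow.2.2, ← Matrix.mul_assoc,
    Bimod.LocalizedIn.hom_eq hY h (idArrow_entry_mem hX iX kX), Matrix.mul_assoc,
    Matrix.mul_assoc, ← Matrix.mul_assoc Y.idArrow, idArrow_mul_self]
  refine (Matrix.diagonal_mul _ _ _ _).trans ?_
  refine congrArg (X.idArrow iX kX * ·) (congrFun (congrFun ?_ iY) kY)
  rw [Bimod.idArrow, ← map_mul, one_mul]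

theorem sym_whiskerRight_entry {X Y Z : Obj N} {o a : DoubleCone} (h : o.Perp a)
    (hX : X.LocalizedIn o) (hY : Y.LocalizedIn a) (hZ : Z.LocalizedIn a) (kX kY kZ jX jY jZ) :
    (sym X Y ▷ Z).1 (finProdFinEquiv (kZ, finProdFinEquiv (kX, kY)))
      (finProdFinEquiv (jZ, finProdFinEquiv (jY, jX))) =
      X.idArrow kX jX * (Y.hom (Z.idArrow kZ jZ)) kY jY := by
  rw [← tensorHom_id]
  refine (tensorHom_apply_val _ _ _ _ _ _).trans ?_
  rw [id_val, Matrix.mul_apply]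
  refine (sum_fin_prod _).trans ?_
  have hB := idArrow_entry_mem hZ kZ jZ
  have e1 : ∀ lY lX, (X ⊗ Y).hom (Z.idArrow kZ jZ) (finProdFinEquiv (lY, lX))
      (finProdFinEquiv (jY, jX)) = X.idArrow lX jX * Y.hom (Z.idArrow kZ jZ) lY jY := by
    intro lY lX
    refine (tensor_hom_apply X.toBimod Y.toBimod _ _ _ _ _).trans ?_
    rw [hom_apply_of_perp h hX (hom_entry_mem hY hB _ _)]
    exact N.commute h.symm (hom_entry_mem hY hB _ _) (idArrow_entry_mem hX _ _)
  have e2 : ∀ lY lX, (sym X Y).1 (finProdFinEquiv (kX, kY)) (finProdFinEquiv (lY, lX)) *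
      (X ⊗ Y).hom (Z.idArrow kZ jZ) (finProdFinEquiv (lY, lX)) (finProdFinEquiv (jY, jX)) =
      (X.idArrow kX lX * Y.idArrow kY lY) *
        (X.idArrow lX jX * Y.hom (Z.idArrow kZ jZ) lY jY) := fun lY lX =>
    congrArg₂ (· * ·) (sym_localized h hX hY _ _ _ _) (e1 lY lX)
  refine (Finset.sum_congr rfl fun lY _ => Finset.sum_congr rfl fun lX _ => e2 lY lX).trans ?_
  rw [Finset.sum_comm]
  refine (sum_mul_of_commute X.idArrow X.idArrow Y.idArrow _ (fun _ _ _ _ =>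
    N.commute h.symm (idArrow_entry_mem hY _ _) (idArrow_entry_mem hX _ _)) _ _ _ _).trans ?_
  rw [idArrow_mul_self]
  congr 2
  rw [Bimod.idArrow, ← map_mul, one_mul]

theorem hexagon_localized {X Y Z : Obj N} {o a : DoubleCone} (h : o.Perp a)
    (hX : X.LocalizedIn o) (hY : Y.LocalizedIn a) (hZ : Z.LocalizedIn a) :
    (α_ X Y Z).hom ≫ sym X (Y ⊗ Z) ≫ (α_ Y Z X).hom =
      sym X Y ▷ Z ≫ (α_ Y X Z).hom ≫ Y ◁ sym X Z := by
  apply hom_ext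
  ext1 i j
  obtain ⟨⟨i', iY⟩, rfl⟩ := finProdFinEquiv.surjective i
  obtain ⟨⟨jZ, j'⟩, rfl⟩ := finProdFinEquiv.surjective j
  obtain ⟨⟨iX, iZ⟩, rfl⟩ := finProdFinEquiv.surjective i'
  obtain ⟨⟨jY, jX⟩, rfl⟩ := finProdFinEquiv.surjective j'
  trans X.idArrow iX jX * (Y.hom (Z.idArrow iZ jZ)) iY jY
  · rw [associator_def, associator_def, eqToIso.hom, eqToIso.hom, eqToHom_comp_val,
      comp_eqToHom_val]
    have e2 := fin_assoc jZ jY jX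
    have e1 : Fin.cast (mul_assoc X.n Z.n Y.n) (finProdFinEquiv (finProdFinEquiv (iX, iZ), iY)) =
        finProdFinEquiv (iX, finProdFinEquiv (iZ, iY)) := by rw [← fin_assoc]; rfl
    refine Eq.trans (congrArg₂ (sym X (Y ⊗ Z)).1 e1 e2) ?_
    refine (sym_localized (Y := Y ⊗ Z) h hX (hY.tensor hZ) _ _ _ _).trans ?_
    refine congrArg _ ?_
    refine (tensor_hom_apply Y.toBimod Z.toBimod _ _ _ _ _).trans ?_
    rfl
  · have e1 : ∀ kZ kX kY, ((α_ Y X Z).hom ≫ Y ◁ sym X Z).1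
        (finProdFinEquiv (finProdFinEquiv (iX, iZ), iY))
        (finProdFinEquiv (kZ, finProdFinEquiv (kX, kY))) =
        X.idArrow iX kX * (Y.hom (Z.idArrow iZ kZ)) iY kY := by
      intro kZ kX kY
      rw [associator_def, eqToIso.hom, eqToHom_comp_val]
      refine (congrArg _ (fin_assoc kZ kX kY)).trans ?_
      exact whiskerLeft_sym_entry h hX hY hZ _ _ _ _ _ _
    have e2 : ∀ kZ kX kY, ((α_ Y X Z).hom ≫ Y ◁ sym X Z).1
        (finProdFinEquiv (finProdFinEquiv (iX, iZ), iY))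
        (finProdFinEquiv (kZ, finProdFinEquiv (kX, kY))) *
        (sym X Y ▷ Z).1 (finProdFinEquiv (kZ, finProdFinEquiv (kX, kY)))
          (finProdFinEquiv (jZ, finProdFinEquiv (jY, jX))) =
        (X.idArrow iX kX * (Y.hom (Z.idArrow iZ kZ)) iY kY) *
          (X.idArrow kX jX * (Y.hom (Z.idArrow kZ jZ)) kY jY) := fun kZ kX kY =>
      congrArg₂ (· * ·) (e1 kZ kX kY) (sym_whiskerRight_entry h hX hY hZ _ _ _ _ _ _)
    symm
    refine Eq.trans (Matrix.mul_apply (M := ((α_ Y X Z).hom ≫ Y ◁ sym X Z).1)) ?_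
    trans ∑ kZ, ∑ kX, ∑ kY, (X.idArrow iX kX * (Y.hom (Z.idArrow iZ kZ)) iY kY) *
          (X.idArrow kX jX * (Y.hom (Z.idArrow kZ jZ)) kY jY)
    · refine (sum_fin_prod _).trans (Finset.sum_congr rfl fun kZ _ => ?_)
      refine (sum_fin_prod _).trans ?_
      exact Finset.sum_congr rfl fun kX _ => Finset.sum_congr rfl fun kY _ => e2 kZ kX kY
    · have hc : ∀ kZ i j k l, Commute (Y.hom (Z.idArrow iZ kZ) i j) (X.idArrow k l) :=
        fun kZ i j k l => N.commute h.symm (hom_entry_mem hY (idArrow_entry_mem hZ _ _) _ _)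
          (idArrow_entry_mem hX _ _)
      rw [Finset.sum_congr rfl fun kZ _ => sum_mul_of_commute X.idArrow X.idArrow
        (Y.hom (Z.idArrow iZ kZ)) (Y.hom (Z.idArrow kZ jZ)) (hc kZ) iX jX iY jY,
        ← Finset.mul_sum, idArrow_mul_self, ← Matrix.sum_apply]
      congr 2
      simp only [← map_mul]
      rw [← map_sum, ← Matrix.mul_apply, idArrow_mul_self]

theorem hexagon (X Y Z : Obj N) :
    (α_ X Y Z).hom ≫ sym X (Y ⊗ Z) ≫ (α_ Y Z X).hom =
      sym X Y ▷ Z ≫ (α_ Y X Z).hom ≫ Y ◁ sym X Z := by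
  obtain ⟨o, a, h⟩ := DoubleCone.exists_perp
  obtain ⟨X₁, U, hX₁, hU⟩ := X.exists_transport o
  obtain ⟨Y₁, V, hY₁, hV⟩ := Y.exists_transport a
  obtain ⟨Z₁, W, hZ₁, hW⟩ := Z.exists_transport a
  have hu : Unitary (V ⊗ₘ (W ⊗ₘ U)) := hV.tensor (hW.tensor hU)
  have key : ∀ f g : (X ⊗ Y) ⊗ Z ⟶ Y ⊗ (Z ⊗ X), f ≫ (V ⊗ₘ (W ⊗ₘ U)) = g ≫ (V ⊗ₘ (W ⊗ₘ U)) →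
      f = g := fun f g hfg => by
    have := congrArg (· ≫ adjoint (V ⊗ₘ (W ⊗ₘ U))) hfg
    simpa only [Category.assoc, hu.left, Category.comp_id] using this
  apply key
  have e1 : ((α_ X Y Z).hom ≫ sym X (Y ⊗ Z) ≫ (α_ Y Z X).hom) ≫ (V ⊗ₘ (W ⊗ₘ U)) =
      ((U ⊗ₘ V) ⊗ₘ W) ≫ (α_ X₁ Y₁ Z₁).hom ≫ sym X₁ (Y₁ ⊗ Z₁) ≫ (α_ Y₁ Z₁ X₁).hom := by
    rw [Category.assoc, Category.assoc, ← associator_naturality,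
      ← reassoc_of% sym_naturality U (V ⊗ₘ W), associator_naturality_assoc]
  have e2 : (sym X Y ▷ Z ≫ (α_ Y X Z).hom ≫ Y ◁ sym X Z) ≫ (V ⊗ₘ (W ⊗ₘ U)) =
      ((U ⊗ₘ V) ⊗ₘ W) ≫ sym X₁ Y₁ ▷ Z₁ ≫ (α_ Y₁ X₁ Z₁).hom ≫ Y₁ ◁ sym X₁ Z₁ := by
    simp only [← id_tensorHom, ← tensorHom_id, Category.assoc]
    rw [tensorHom_comp_tensorHom, Category.id_comp, ← sym_naturality U W,
      tensorHom_comp_tensorHom_assoc, Category.comp_id, sym_naturality U V,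
      ← Category.comp_id V, ← tensorHom_comp_tensorHom, Category.comp_id,
      ← associator_naturality_assoc, tensorHom_comp_tensorHom_assoc, Category.id_comp]
  rw [e1, e2, hexagon_localized h hX₁ hY₁ hZ₁]

noncomputable instance : SymmetricCategory (Obj N) where
  braiding X Y := ⟨sym X Y, sym Y X, sym_sym X Y, sym_sym Y X⟩
  braiding_naturality_right X Y Z f := by
    simpa only [id_tensorHom, tensorHom_id] using sym_naturality (𝟙 X) f
  braiding_naturality_left f Z := by
    simpa only [id_tensorHom, tensorHom_id] using sym_naturality f (𝟙 Z)
  hexagon_forward X Y Z := hexagon X Y Z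
  hexagon_reverse X Y Z := by
    have h := hexagon Z X Y
    have h1 : ((α_ X Y Z).inv ≫ sym (X ⊗ Y) Z ≫ (α_ Z X Y).inv) ≫
        ((α_ Z X Y).hom ≫ sym Z (X ⊗ Y) ≫ (α_ X Y Z).hom) = 𝟙 _ := by
      simp only [Category.assoc, Iso.inv_hom_id_assoc]
      rw [reassoc_of% sym_sym, Iso.inv_hom_id]
    have h2 : (sym Z X ▷ Y ≫ (α_ X Z Y).hom ≫ X ◁ sym Z Y) ≫
        (X ◁ sym Y Z ≫ (α_ X Z Y).inv ≫ sym X Z ▷ Y) = 𝟙 _ := by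
      simp only [Category.assoc]
      rw [← MonoidalCategory.whiskerLeft_comp_assoc, sym_sym, MonoidalCategory.whiskerLeft_id,
        Category.id_comp, Iso.hom_inv_id_assoc, ← comp_whiskerRight, sym_sym, id_whiskerRight]
    rw [h] at h1
    have h3 := congrArg (· ≫ (X ◁ sym Y Z ≫ (α_ X Z Y).inv ≫ sym X Z ▷ Y)) h1
    replace h3 : _ ≫ (_ ≫ _ ≫ _) = _ := h3
    rw [Category.assoc, h2, Category.comp_id, Category.id_comp] at h3
    exact h3
  symmetry X Y := sym_sym X Y

end Obj

/-! ## The extension to the presheaf of the commutants -/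

/-- The matrix `A ⊗ 1`. -/
abbrev amp {R : Type*} [Semiring R] (n : ℕ) : R →+* Matrix (Fin n) (Fin n) R :=
  Matrix.scalar (Fin n)

theorem amp_def {R : Type*} [Semiring R] (n : ℕ) (A : R) :
    amp n A = Matrix.diagonal fun _ => A := rfl

theorem amp_mul_apply {R : Type*} [Semiring R] {n m : ℕ} (A : R) (M : Matrix (Fin n) (Fin m) R)
    (i j) : (amp n A * M) i j = A * M i j := Matrix.diagonal_mul _ _ _ _

theorem mul_amp_apply {R : Type*} [Semiring R] {n m : ℕ} (A : R) (M : Matrix (Fin m) (Fin n) R)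
    (i j) : (M * amp n A) i j = M i j * A := Matrix.mul_diagonal _ _ _ _

theorem amp_star {R : Type*} [Semiring R] [StarRing R] (n : ℕ) (A : R) :
    amp n (star A) = (amp n A)ᴴ := by
  rw [amp_def, amp_def, Matrix.diagonal_conjTranspose]
  rfl

theorem amp_comm {R : Type*} [Semiring R] {n m : ℕ} {A : R} {M : Matrix (Fin n) (Fin m) R}
    (h : ∀ i j, A * M i j = M i j * A) : amp n A * M = M * amp m A := by
  ext1 i j
  rw [amp_mul_apply, mul_amp_apply, h]

theorem comm_of_amp {R : Type*} [Semiring R] {n m : ℕ} {A : R} {M : Matrix (Fin n) (Fin m) R}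
    (h : amp n A * M = M * amp m A) (i j) : A * M i j = M i j * A := by
  rw [← amp_mul_apply, h, mul_amp_apply]

theorem commutant_comm {a : DoubleCone} {A B : H →L[ℂ] H} (hA : A ∈ (N.loc a).commutant)
    (hB : B ∈ N.loc a) : A * B = B * A :=
  (VonNeumannAlgebra.mem_commutant_iff.1 hA B hB).symm

theorem mem_commutant_of {a : DoubleCone} {A : H →L[ℂ] H}
    (h : ∀ B ∈ N.loc a, A * B = B * A) : A ∈ (N.loc a).commutant :=
  VonNeumannAlgebra.mem_commutant_iff.2 fun B hB => (h B hB).symm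

theorem loc_le_commutant {a b : DoubleCone} (h : a.Perp b) {A : H →L[ℂ] H} (hA : A ∈ N.loc a) :
    A ∈ (N.loc b).commutant := N.locality a b h hA

namespace Obj

/-- An arrow as a matrix of operators. -/
noncomputable def op {X Y : Obj N} (f : X ⟶ Y) : Matrix (Fin Y.n) (Fin X.n) (H →L[ℂ] H) :=
  coeMat f.1

theorem op_apply {X Y : Obj N} (f : X ⟶ Y) (i j) : op f i j = (f.1 i j : H →L[ℂ] H) := rfl

theorem op_comp {X Y Z : Obj N} (f : X ⟶ Y) (g : Y ⟶ Z) : op (f ≫ g) = op g * op f :=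
  coeMat_mul _ _

theorem op_adjoint {X Y : Obj N} (f : X ⟶ Y) : op (adjoint f) = (op f)ᴴ := rfl

theorem op_injective {X Y : Obj N} {f g : X ⟶ Y} (h : op f = op g) : f = g :=
  hom_ext (coeMat_injective h)

/-- The projection `1_X` as a matrix of operators. -/
noncomputable abbrev unitMat (X : Obj N) : Matrix (Fin X.n) (Fin X.n) (H →L[ℂ] H) := op (𝟙 X)

theorem unitMat_def (X : Obj N) : X.unitMat = coeMat X.idArrow := rfl

theorem op_mul_unitMat {X Y : Obj N} (f : X ⟶ Y) : op f * X.unitMat = op f := by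
  rw [← op_comp, Category.id_comp]

theorem unitMat_mul_op {X Y : Obj N} (f : X ⟶ Y) : Y.unitMat * op f = op f := by
  rw [← op_comp, Category.comp_id]

theorem unitMat_mul_self (X : Obj N) : X.unitMat * X.unitMat = X.unitMat := op_mul_unitMat _

theorem unitMat_star (X : Obj N) : X.unitMatᴴ = X.unitMat := by rw [← op_adjoint, adjoint_id]

/-- The value `X(A)` as a matrix of operators. -/
noncomputable abbrev val (X : Obj N) (A : N.alg) : Matrix (Fin X.n) (Fin X.n) (H →L[ℂ] H) :=
  coeMat (X.hom A)

theorem val_one (X : Obj N) : X.val 1 = X.unitMat := rfl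

theorem val_mul (X : Obj N) (A B : N.alg) : X.val (A * B) = X.val A * X.val B := by
  rw [val, map_mul, coeMat_mul]

theorem val_star (X : Obj N) (A : N.alg) : X.val (star A) = (X.val A)ᴴ := by
  rw [val, map_star]; rfl

theorem op_mul_val {X Y : Obj N} (f : X ⟶ Y) (A : N.alg) : op f * X.val A = Y.val A * op f := by
  rw [op, val, val, ← coeMat_mul, f.2.2.2, coeMat_mul]

theorem val_mul_unitMat (X : Obj N) (A : N.alg) : X.val A * X.unitMat = X.val A := by
  rw [← val_one, ← val_mul, mul_one]

theorem unitMat_mul_val (X : Obj N) (A : N.alg) : X.unitMat * X.val A = X.val A := by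
  rw [← val_one, ← val_mul, one_mul]

theorem val_of_perp {X : Obj N} {o a : DoubleCone} (hX : X.LocalizedIn o) (h : o.Perp a)
    {A : N.alg} (hA : (A : H →L[ℂ] H) ∈ N.loc a) : X.val A = amp _ (A : H →L[ℂ] H) * X.unitMat :=
  hX a h.symm A hA

theorem val_of_perp' {X : Obj N} {o a : DoubleCone} (hX : X.LocalizedIn o) (h : o.Perp a)
    {A : N.alg} (hA : (A : H →L[ℂ] H) ∈ N.loc a) : X.val A = X.unitMat * amp _ (A : H →L[ℂ] H) :=
  Mor.LocalizedIn.hom_eq_right hX h.symm A hA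

theorem Unitary.op_left {X Y : Obj N} {U : X ⟶ Y} (h : Unitary U) :
    (op U)ᴴ * op U = X.unitMat := by rw [← op_adjoint, ← op_comp, h.left]

theorem Unitary.op_right {X Y : Obj N} {U : X ⟶ Y} (h : Unitary U) :
    op U * (op U)ᴴ = Y.unitMat := by rw [← op_adjoint, ← op_comp, h.right]

theorem amp_op {X Y : Obj N} {a : DoubleCone} (hX : X.LocalizedIn a) (hY : Y.LocalizedIn a)
    (f : X ⟶ Y) {A : H →L[ℂ] H} (hA : A ∈ (N.loc a).commutant) :
    amp Y.n A * op f = op f * amp X.n A :=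
  amp_comm fun i j => commutant_comm hA (entry_mem hX hY f i j)

theorem ext_eq {X Y : Obj N} {a : DoubleCone} (hY : Y.LocalizedIn a) {U : X ⟶ Y} (hU : Unitary U)
    {A : H →L[ℂ] H} (hA : A ∈ (N.loc a).commutant) :
    X.ext a A = (op U)ᴴ * amp Y.n A * op U := by
  obtain ⟨Y', hY', V, hV, hE⟩ : ∃ (Y' : Obj N) (_ : Y'.LocalizedIn a) (V : X ⟶ Y')
      (_ : Unitary V), X.ext a A = (op V)ᴴ * amp Y'.n A * op V :=
    ⟨_, (X.transport a).choose_spec.1, _,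
      ((X.transport a).choose_spec.2.choose_spec).unitary, rfl⟩
  have h1 := amp_op hY hY' (adjoint U ≫ V) hA
  rw [op_comp, op_adjoint] at h1
  have h2 : op V = op V * (op U)ᴴ * op U := by
    rw [Matrix.mul_assoc, hU.op_left, op_mul_unitMat]
  have h3 : (op V)ᴴ * op V * (op U)ᴴ = (op U)ᴴ := by
    rw [hV.op_left, ← op_adjoint, unitMat_mul_op]
  calc _ = (op V)ᴴ * (amp Y'.n A * (op V * (op U)ᴴ)) * op U := by
        rw [hE]
        nth_rewrite 2 [h2]
        simp only [Matrix.mul_assoc]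
    _ = (op V)ᴴ * op V * (op U)ᴴ * amp Y.n A * op U := by
        rw [h1]
        simp only [Matrix.mul_assoc]
    _ = _ := by rw [h3]

theorem op_mul_ext {X Y : Obj N} (f : X ⟶ Y) {a : DoubleCone} {A : H →L[ℂ] H}
    (hA : A ∈ (N.loc a).commutant) : op f * X.ext a A = Y.ext a A * op f := by
  obtain ⟨X', U, hX', hU⟩ := X.exists_transport a
  obtain ⟨Y', V, hY', hV⟩ := Y.exists_transport a
  rw [ext_eq hX' hU hA, ext_eq hY' hV hA]
  have h1 := amp_op hX' hY' (adjoint U ≫ f ≫ V) hA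
  rw [op_comp, op_comp, op_adjoint] at h1
  have h2 : op f * (op U)ᴴ = (op V)ᴴ * (op V * op f * (op U)ᴴ) := by
    rw [← Matrix.mul_assoc, ← Matrix.mul_assoc, hV.op_left, unitMat_mul_op]
  have h3 : op V * op f = op V * op f * (op U)ᴴ * op U := by
    rw [Matrix.mul_assoc _ _ (op U), hU.op_left, Matrix.mul_assoc, op_mul_unitMat]
  calc _ = (op f * (op U)ᴴ) * amp X'.n A * op U := by simp only [Matrix.mul_assoc]
    _ = (op V)ᴴ * (op V * op f * (op U)ᴴ * amp X'.n A) * op U := by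
        rw [h2]; simp only [Matrix.mul_assoc]
    _ = (op V)ᴴ * amp Y'.n A * (op V * op f * (op U)ᴴ * op U) := by
        rw [← h1]; simp only [Matrix.mul_assoc]
    _ = _ := by rw [← h3]; simp only [Matrix.mul_assoc]

theorem ext_mul (X : Obj N) {a : DoubleCone} {A B : H →L[ℂ] H} (hA : A ∈ (N.loc a).commutant)
    (hB : B ∈ (N.loc a).commutant) : X.ext a (A * B) = X.ext a A * X.ext a B := by
  obtain ⟨X', U, hX', hU⟩ := X.exists_transport a
  rw [ext_eq hX' hU hA, ext_eq hX' hU hB, ext_eq hX' hU (mul_mem hA hB)]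
  have h1 := amp_op hX' hX' (𝟙 X') hA
  calc _ = (op U)ᴴ * amp X'.n A * (amp X'.n B * (X'.unitMat * op U)) := by
        rw [unitMat_mul_op, map_mul]; simp only [Matrix.mul_assoc]
    _ = (op U)ᴴ * amp X'.n A * (amp X'.n B * X'.unitMat) * op U := by simp only [Matrix.mul_assoc]
    _ = (op U)ᴴ * amp X'.n A * (op U * (op U)ᴴ * amp X'.n B) * op U := by
        rw [amp_op hX' hX' (𝟙 X') hB, hU.op_right]
    _ = _ := by simp only [Matrix.mul_assoc]

theorem ext_star (X : Obj N) {a : DoubleCone} {A : H →L[ℂ] H} (hA : A ∈ (N.loc a).commutant) :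
    X.ext a (star A) = (X.ext a A)ᴴ := by
  obtain ⟨X', U, hX', hU⟩ := X.exists_transport a
  rw [ext_eq hX' hU hA, ext_eq hX' hU (star_mem hA), amp_star]
  simp only [Matrix.conjTranspose_mul, Matrix.conjTranspose_conjTranspose, Matrix.mul_assoc]

theorem ext_one (X : Obj N) (a : DoubleCone) : X.ext a 1 = X.unitMat := by
  obtain ⟨X', U, hX', hU⟩ := X.exists_transport a
  rw [ext_eq hX' hU (one_mem _), map_one, Matrix.mul_one, hU.op_left]

theorem ext_add (X : Obj N) {a : DoubleCone} {A B : H →L[ℂ] H} (hA : A ∈ (N.loc a).commutant)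
    (hB : B ∈ (N.loc a).commutant) : X.ext a (A + B) = X.ext a A + X.ext a B := by
  obtain ⟨X', U, hX', hU⟩ := X.exists_transport a
  rw [ext_eq hX' hU hA, ext_eq hX' hU hB, ext_eq hX' hU (add_mem hA hB), map_add, Matrix.mul_add,
    Matrix.add_mul]

theorem smul_mem_commutant {a : DoubleCone} {A : H →L[ℂ] H} (c : ℂ)
    (hA : A ∈ (N.loc a).commutant) : c • A ∈ (N.loc a).commutant :=
  mem_commutant_of fun B hB => by
    rw [smul_mul_assoc, mul_smul_comm, commutant_comm hA hB]

theorem ext_smul (X : Obj N) {a : DoubleCone} (c : ℂ) {A : H →L[ℂ] H}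
    (hA : A ∈ (N.loc a).commutant) : X.ext a (c • A) = c • X.ext a A := by
  obtain ⟨X', U, hX', hU⟩ := X.exists_transport a
  have : amp X'.n (c • A) = c • amp X'.n A := by
    rw [amp_def, amp_def, ← Matrix.diagonal_smul]; rfl
  rw [ext_eq hX' hU hA, ext_eq hX' hU (smul_mem_commutant c hA), this, Matrix.mul_smul,
    Matrix.smul_mul]

theorem ext_mul_unitMat (X : Obj N) {a : DoubleCone} {A : H →L[ℂ] H}
    (hA : A ∈ (N.loc a).commutant) : X.ext a A * X.unitMat = X.ext a A := by
  rw [← ext_one X a, ← ext_mul X hA (one_mem _), mul_one]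

theorem unitMat_mul_ext (X : Obj N) {a : DoubleCone} {A : H →L[ℂ] H}
    (hA : A ∈ (N.loc a).commutant) : X.unitMat * X.ext a A = X.ext a A := by
  rw [← ext_one X a, ← ext_mul X (one_mem _) hA, one_mul]

theorem ext_mono (X : Obj N) {a b : DoubleCone} (h : a.Sub b) {A : H →L[ℂ] H}
    (hA : A ∈ (N.loc b).commutant) : X.ext b A = X.ext a A := by
  obtain ⟨X', U, hX', hU⟩ := X.exists_transport a
  have hA' : A ∈ (N.loc a).commutant :=
    mem_commutant_of fun B hB => commutant_comm hA (N.isotony _ _ h hB)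
  rw [ext_eq hX' hU hA', ext_eq (Mor.LocalizedIn.mono hX' h) hU hA]

theorem ext_entry_mem {X : Obj N} {o a : DoubleCone} (hX : X.LocalizedIn o) (h : o.Perp a)
    {A : H →L[ℂ] H} (hA : A ∈ (N.loc a).commutant) (i j) :
    X.ext a A i j ∈ (N.loc a).commutant := by
  obtain ⟨Y, U, hY, hU⟩ := X.exists_transport a
  refine mem_commutant_of fun B hB => ?_
  rw [eq_comm]
  revert i j
  refine comm_of_amp ?_
  obtain ⟨B, rfl⟩ : ∃ B' : N.alg, (B' : H →L[ℂ] H) = B := ⟨⟨B, N.loc_le_alg a hB⟩, rfl⟩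
  have h1 : op U * amp X.n (B : H →L[ℂ] H) = Y.val B * op U := by
    rw [← op_mul_val, val_of_perp' hX h hB, ← Matrix.mul_assoc, op_mul_unitMat U]
  have h2 : amp X.n (B : H →L[ℂ] H) * (op U)ᴴ = (op U)ᴴ * Y.val B := by
    rw [← op_adjoint, op_mul_val, val_of_perp hX h hB, Matrix.mul_assoc, unitMat_mul_op (adjoint U)]
  have h3 : amp Y.n A * Y.val B = Y.val B * amp Y.n A :=
    amp_comm fun i j => commutant_comm hA (hom_entry_mem hY hB i j)
  rw [ext_eq hY hU hA]
  calc _ = amp X.n (B : H →L[ℂ] H) * (op U)ᴴ * amp Y.n A * op U := by simp only [Matrix.mul_assoc]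
    _ = (op U)ᴴ * (amp Y.n A * Y.val B) * op U := by rw [h2, h3]; simp only [Matrix.mul_assoc]
    _ = (op U)ᴴ * amp Y.n A * (op U * amp X.n (B : H →L[ℂ] H)) := by
        rw [h1]; simp only [Matrix.mul_assoc]
    _ = _ := by simp only [Matrix.mul_assoc]

theorem ext_of_perp (X : Obj N) {a b : DoubleCone} (h : b.Perp a) {A : N.alg}
    (hA : (A : H →L[ℂ] H) ∈ N.loc b) : X.ext a A = X.val A := by
  obtain ⟨Y, U, hY, hU⟩ := X.exists_transport a
  rw [ext_eq hY hU (loc_le_commutant h hA), ← unitMat_mul_op U, Matrix.mul_assoc,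
    ← Matrix.mul_assoc (amp _ _), ← val_of_perp hY h.symm hA, ← op_mul_val, ← Matrix.mul_assoc,
    unitMat_mul_op, hU.op_left, unitMat_mul_val]

/-- The observables on which the objects localized in `a` act trivially. -/
def outer (N : Net H) (a : DoubleCone) : Set N.alg :=
  {A | ∀ X : Obj N, X.LocalizedIn a → X.val A = amp _ (A : H →L[ℂ] H) * X.unitMat}

theorem mem_outer {a b : DoubleCone} (h : a.Perp b) {A : N.alg} (hA : (A : H →L[ℂ] H) ∈ N.loc b) :
    A ∈ outer N a := fun X hX => val_of_perp hX h hA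

theorem outer_mul {a : DoubleCone} {A B : N.alg} (hA : A ∈ outer N a) (hB : B ∈ outer N a) :
    A * B ∈ outer N a := fun X hX => by
  calc _ = amp X.n (A : H →L[ℂ] H) * X.unitMat * X.val B := by rw [val_mul, hA X hX]
    _ = amp X.n (A : H →L[ℂ] H) * (amp X.n (B : H →L[ℂ] H) * X.unitMat) := by
      rw [Matrix.mul_assoc, unitMat_mul_val, hB X hX]
    _ = _ := by rw [← Matrix.mul_assoc, ← map_mul]; rfl

theorem outer_sum {a : DoubleCone} {ι : Type*} (s : Finset ι) (A : ι → N.alg)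
    (hA : ∀ i ∈ s, A i ∈ outer N a) : ∑ i ∈ s, A i ∈ outer N a := fun X hX => by
  have h1 : X.val (∑ i ∈ s, A i) = ∑ i ∈ s, X.val (A i) := by
    rw [val, map_sum]
    ext1 i j
    simp [coeMat, Matrix.sum_apply]
  have h2 : ((∑ i ∈ s, A i : N.alg) : H →L[ℂ] H) = ∑ i ∈ s, (A i : H →L[ℂ] H) := by simp
  rw [h1, h2, map_sum, Finset.sum_mul]
  exact Finset.sum_congr rfl fun i hi => hA i hi X hX

theorem hom_mem_outer {Y : Obj N} {o a b : DoubleCone} (hY : Y.LocalizedIn o) (h : o.Perp a)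
    (hb : b.Perp a) {B : N.alg} (hB : (B : H →L[ℂ] H) ∈ N.loc b) (i j) :
    Y.hom B i j ∈ outer N a := by
  obtain ⟨p, e, hoe, hpe, hea, hpb⟩ := exists_move h b
  obtain ⟨Y', V, hY', hV⟩ := Y.exists_transport (ball p 1 one_pos)
  have h1 : Y.hom B = V.1ᴴ * (amp Y'.n B * V.1) := by
    apply coeMat_injective
    rw [coeMat_mul, coeMat_mul, coeMat_conjTranspose]
    refine Eq.trans ?_ (congrArg (fun M => (op V)ᴴ * (M * op V)) (coeMat_diagonal _ B).symm)
    rw [← unitMat_mul_op V, ← Matrix.mul_assoc (Matrix.diagonal _)]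
    refine Eq.trans ?_ (congrArg (fun M => (Y'.unitMat * op V)ᴴ * (M * op V))
      (val_of_perp hY' hpb hB))
    rw [unitMat_mul_op, ← op_mul_val, ← Matrix.mul_assoc, hV.op_left, unitMat_mul_val]
  have hVe : ∀ i j, V.1 i j ∈ outer N a := fun i j =>
    mem_outer hea.symm (entry_mem (Mor.LocalizedIn.mono hY hoe) (Mor.LocalizedIn.mono hY' hpe) V i j)
  have hVe' : ∀ i j, star (V.1 i j) ∈ outer N a := fun i j =>
    mem_outer hea.symm (star_mem (S := VonNeumannAlgebra H) (s := N.loc e)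
      (entry_mem (Mor.LocalizedIn.mono hY hoe) (Mor.LocalizedIn.mono hY' hpe) V i j))
  rw [h1, Matrix.mul_apply]
  refine outer_sum _ _ fun k _ => outer_mul ?_ ?_
  · exact hVe' k i
  · refine (congrArg (· ∈ outer N a) (amp_mul_apply B V.1 k j)).mpr ?_
    exact outer_mul (mem_outer hb.symm hB) (hVe k j)

/-- The underlying additive and multiplicative map of an object. -/
noncomputable def valHom (X : Obj N) : N.alg →ₙ+* Matrix (Fin X.n) (Fin X.n) (H →L[ℂ] H) where
  toFun := X.val
  map_mul' := X.val_mul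
  map_zero' := by rw [val, map_zero]; rfl
  map_add' A B := by rw [val, map_add]; rfl

theorem valHom_apply (X : Obj N) (A : N.alg) : X.valHom A = X.val A := rfl

theorem valHom_map_star (X : Obj N) {m n : ℕ} (M : Matrix (Fin m) (Fin n) N.alg) :
    (M.map X.valHom)ᴴ = Mᴴ.map X.valHom := by
  ext1 i j
  exact (X.val_star (M j i)).symm

theorem amp_map_star {m n k : ℕ} (M : Matrix (Fin m) (Fin n) (H →L[ℂ] H)) :
    (M.map (amp k))ᴴ = Mᴴ.map (amp k) := by
  ext1 i j
  exact (amp_star k (M j i)).symm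

theorem outer_right {a : DoubleCone} {A : N.alg} (hA : A ∈ outer N a) (hA' : star A ∈ outer N a)
    {X : Obj N} (hX : X.LocalizedIn a) : X.val A = X.unitMat * amp X.n (A : H →L[ℂ] H) := by
  have h := congrArg Matrix.conjTranspose (hA' X hX)
  rw [val_star, Matrix.conjTranspose_conjTranspose, Matrix.conjTranspose_mul, unitMat_star,
    ← amp_star] at h
  rw [h]
  simp

theorem star_hom_mem_outer {Y : Obj N} {o a b : DoubleCone} (hY : Y.LocalizedIn o) (h : o.Perp a)
    (hb : b.Perp a) {B : N.alg} (hB : (B : H →L[ℂ] H) ∈ N.loc b) (i j) :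
    star (Y.hom B i j) ∈ outer N a := by
  have := hom_mem_outer hY h hb (B := star B)
    (star_mem (S := VonNeumannAlgebra H) (s := N.loc b) hB) j i
  rwa [map_star, Matrix.star_apply] at this

theorem map_amp_amp {m n k : ℕ} (A : H →L[ℂ] H) (M : Matrix (Fin m) (Fin n) (H →L[ℂ] H)) :
    (M * amp n A).map (amp k) = M.map (amp k) * amp n (amp k A) := by
  ext1 i j
  refine (congrArg (amp k) (mul_amp_apply A M i j)).trans ?_
  rw [map_mul]
  exact (mul_amp_apply (amp k A) (M.map (amp k)) i j).symm

section

variable {X Y Y' : Obj N} {o a : DoubleCone} (hX : X.LocalizedIn a) (hY : Y.LocalizedIn o)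
  (hY' : Y'.LocalizedIn a) (h : o.Perp a) {V : Y ⟶ Y'} (hV : Unitary V)

include hX hY hY' h hV

theorem map_hom_eq {b : DoubleCone} (hb : b.Perp a) {B : N.alg} (hB : (B : H →L[ℂ] H) ∈ N.loc b) :
    (Y.hom B).map X.valHom = amp Y.n X.unitMat * (Y.val B).map (amp X.n) := by
  ext1 i j
  refine Eq.trans ?_ (amp_mul_apply X.unitMat ((Y.val B).map (amp X.n)) i j).symm
  exact outer_right (hom_mem_outer hY h hb hB i j) (star_hom_mem_outer hY h hb hB i j) hX

theorem map_idArrow_eq' (hXo : X.LocalizedIn a) :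
    Y.idArrow.map X.valHom = amp Y.n X.unitMat * Y.unitMat.map (amp X.n) := by
  ext1 i j
  refine Eq.trans ?_ (amp_mul_apply X.unitMat (Y.unitMat.map (amp X.n)) i j).symm
  exact val_of_perp' hX h.symm (idArrow_entry_mem hY i j)

theorem valHom_mul_amp (M : Matrix (Fin Y'.n) (Fin Y.n) N.alg) :
    M.map X.valHom * amp Y.n X.unitMat = M.map X.valHom := by
  ext1 i j
  refine (mul_amp_apply X.unitMat (M.map X.valHom) i j).trans ?_
  exact X.val_mul_unitMat _

theorem transfer_mul :
    V.1.map X.valHom * ((op V).map (amp X.n))ᴴ * (op V).map (amp X.n) = V.1.map X.valHom := by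
  rw [Matrix.mul_assoc, amp_map_star, ← Matrix.map_mul, hV.op_left]
  have h1 := valHom_mul_amp hX hY hY' h hV V.1
  nth_rewrite 1 [← h1]
  rw [Matrix.mul_assoc, ← map_idArrow_eq' hX hY hY' h hV hX, ← Matrix.map_mul]
  exact congrArg (Matrix.map · X.valHom) V.2.1

theorem transfer_comm {b : DoubleCone} (hb : b.Perp a) {B : N.alg}
    (hB : (B : H →L[ℂ] H) ∈ N.loc b) :
    amp Y'.n (amp X.n (B : H →L[ℂ] H)) * (V.1.map X.valHom * ((op V).map (amp X.n))ᴴ) =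
      V.1.map X.valHom * ((op V).map (amp X.n))ᴴ * amp Y'.n (amp X.n (B : H →L[ℂ] H)) := by
  have h1 : (op V)ᴴ * amp Y'.n (B : H →L[ℂ] H) = Y.val B * (op V)ᴴ := by
    have := op_mul_val (adjoint V) B
    rw [val_of_perp' hY' hb.symm hB, ← Matrix.mul_assoc, op_mul_unitMat (adjoint V)] at this
    exact this
  have h2 : Y'.hom B * V.1 = amp Y'.n B * V.1 := by
    have := Bimod.LocalizedIn.hom_eq hY' hb hB
    rw [this, Matrix.mul_assoc, V.2.2.1]
    rfl
  have h3 : (V.1 * Y.hom B).map X.valHom =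
      amp Y'.n (amp X.n (B : H →L[ℂ] H)) * V.1.map X.valHom := by
    rw [V.2.2.2, h2]
    ext1 i j
    refine (congrArg X.valHom (amp_mul_apply B V.1 i j)).trans ?_
    refine Eq.trans ?_ (amp_mul_apply (amp X.n (B : H →L[ℂ] H)) (V.1.map X.valHom) i j).symm
    rw [map_mul, valHom_apply, valHom_apply, val_of_perp hX hb.symm hB, Matrix.mul_assoc,
      unitMat_mul_val]
    rfl
  rw [Matrix.mul_assoc, amp_map_star, ← map_amp_amp, h1, Matrix.map_mul, ← Matrix.mul_assoc,
    ← Matrix.mul_assoc, ← h3, Matrix.map_mul, map_hom_eq hX hY hY' h hV hb hB,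
    ← Matrix.mul_assoc, valHom_mul_amp hX hY hY' h hV]

theorem transfer_entry_mem (i j p q) :
    (V.1.map X.valHom * ((op V).map (amp X.n))ᴴ) i j p q ∈ N.loc a := by
  refine N.mem_loc_of_commute a fun b hb B hB => ?_
  have h1 := transfer_comm hX hY hY' h hV hb (B := ⟨B, N.loc_le_alg b hB⟩) hB
  have h2 := comm_of_amp h1 i j
  exact (comm_of_amp h2 p q).symm

theorem conj_map_val {A : H →L[ℂ] H} (hA : A ∈ (N.loc a).commutant) :
    (V.1.map X.valHom)ᴴ * amp Y'.n (amp X.n A) * V.1.map X.valHom =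
      amp Y.n X.unitMat * ((op V)ᴴ * amp Y'.n A * op V).map (amp X.n) := by
  set u := V.1.map X.valHom with hu
  set w := (op V).map (amp X.n) with hw
  have h1 : u * wᴴ * w = u := transfer_mul hX hY hY' h hV
  have h2 : amp Y'.n (amp X.n A) * (u * wᴴ) = u * wᴴ * amp Y'.n (amp X.n A) :=
    amp_comm fun i j => (amp_comm fun p q =>
      commutant_comm hA (transfer_entry_mem hX hY hY' h hV i j p q))
  have h3 : uᴴ * u * wᴴ = amp Y.n X.unitMat * wᴴ := by
    rw [hu, valHom_map_star, ← Matrix.map_mul,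
      show V.1ᴴ * V.1 = Y.idArrow from congrArg Subtype.val hV.left,
      map_idArrow_eq' hX hY hY' h hV hX, Matrix.mul_assoc, hw, amp_map_star, ← Matrix.map_mul,
      ← op_adjoint, unitMat_mul_op]
  calc _ = uᴴ * (amp Y'.n (amp X.n A) * (u * wᴴ)) * w := by
        nth_rewrite 2 [← h1]
        simp only [Matrix.mul_assoc]
    _ = uᴴ * u * wᴴ * amp Y'.n (amp X.n A) * w := by
      rw [h2]
      simp only [Matrix.mul_assoc]
    _ = _ := by
      rw [h3, hw, amp_map_star, Matrix.map_mul, map_amp_amp]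
      simp only [Matrix.mul_assoc]

end

theorem ext_tensor {X Y : Obj N} {o a : DoubleCone} (hX : X.LocalizedIn o) (hY : Y.LocalizedIn o)
    (h : o.Perp a) {A : H →L[ℂ] H} (hA : A ∈ (N.loc a).commutant) (i₂ i₁ j₂ j₁) :
    (X ⊗ Y).ext a A (finProdFinEquiv (i₂, i₁)) (finProdFinEquiv (j₂, j₁)) =
      X.ext a (Y.ext a A i₂ j₂) i₁ j₁ := by
  obtain ⟨X', U, hX', hU⟩ := X.exists_transport a
  obtain ⟨Y', V, hY', hV⟩ := Y.exists_transport a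
  have h1 := congrFun (congrFun (conj_map_val hX' hY hY' h hV hA) i₂) j₂
  rw [← ext_eq hY' hV hA] at h1
  have h2 : (amp Y.n X'.unitMat * (Y.ext a A).map (amp X'.n)) i₂ j₂ =
      X'.unitMat * amp X'.n (Y.ext a A i₂ j₂) := amp_mul_apply _ _ _ _
  rw [h2] at h1
  rw [ext_eq (hX'.tensor hY' : (X' ⊗ Y').LocalizedIn a) (hU.tensor hV) hA,
    ext_eq hX' hU (ext_entry_mem hY h hA i₂ j₂)]
  have h3 : (op U)ᴴ * amp X'.n (Y.ext a A i₂ j₂) * op U =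
      (op U)ᴴ * (X'.unitMat * amp X'.n (Y.ext a A i₂ j₂)) * op U := by
    rw [← Matrix.mul_assoc, ← op_adjoint, op_mul_unitMat]
  rw [h3, ← h1]
  have h4 : ∀ k₂ k₁ j₂ j₁, op (U ⊗ₘ V) (finProdFinEquiv (k₂, k₁)) (finProdFinEquiv (j₂, j₁)) =
      (X'.val (V.1 k₂ j₂) * op U) k₁ j₁ := by
    intro k₂ k₁ j₂ j₁
    rw [op_apply, tensorHom_apply_val, U.2.2.2]
    exact congrFun (congrFun (coeMat_mul _ _) k₁) j₁
  have h5 : ((V.1.map X'.valHom)ᴴ * amp Y'.n (amp X'.n A) * V.1.map X'.valHom) i₂ j₂ =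
      ∑ k₂, (X'.val (V.1 k₂ i₂))ᴴ * (amp X'.n A * X'.val (V.1 k₂ j₂)) := by
    rw [Matrix.mul_assoc, Matrix.mul_apply]
    refine Finset.sum_congr rfl fun k₂ _ => ?_
    refine congrArg _ ?_
    exact amp_mul_apply (amp X'.n A) (V.1.map X'.valHom) k₂ j₂
  rw [h5, Matrix.mul_sum, Matrix.sum_mul, Matrix.mul_assoc, Matrix.mul_apply, Matrix.sum_apply]
  refine (sum_fin_prod _).trans (Finset.sum_congr rfl fun k₂ _ => ?_)
  have h6 : (op U)ᴴ * ((X'.val (V.1 k₂ i₂))ᴴ * (amp X'.n A * X'.val (V.1 k₂ j₂))) * op U =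
      (X'.val (V.1 k₂ i₂) * op U)ᴴ * (amp X'.n A * (X'.val (V.1 k₂ j₂) * op U)) := by
    rw [Matrix.conjTranspose_mul]
    simp only [Matrix.mul_assoc]
  rw [h6, Matrix.mul_apply]
  refine Finset.sum_congr rfl fun k₁ _ => congrArg₂ (· * ·) ?_ ?_
  · exact congrArg star (h4 k₂ k₁ i₂ i₁)
  · refine (amp_mul_apply A (op (U ⊗ₘ V)) _ _).trans (Eq.trans ?_ (amp_mul_apply A _ _ _).symm)
    exact congrArg (A * ·) (h4 k₂ k₁ j₂ j₁)

end Obj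

open scoped ComplexOrder

/-! ## Matrices of operators -/

section Act

variable {ι κ μ : Type} [Fintype ι] [Fintype κ] [Fintype μ]

/-- The action of a matrix of operators. -/
noncomputable def act (M : Matrix κ ι (H →L[ℂ] H)) (x : ι → H) : κ → H :=
  fun i => ∑ j, M i j (x j)

/-- The inner product of `H ⊗ ℂ^ι`. -/
noncomputable def ip (x y : ι → H) : ℂ := ∑ i, inner ℂ (x i) (y i)

theorem act_mul (M : Matrix μ κ (H →L[ℂ] H)) (M' : Matrix κ ι (H →L[ℂ] H)) (x : ι → H) :
    act (M * M') x = act M (act M' x) := by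
  funext i
  simp only [act, Matrix.mul_apply, map_sum, sum_apply,
    mul_apply_eq_comp]
  exact Finset.sum_comm

theorem act_add (M M' : Matrix κ ι (H →L[ℂ] H)) (x : ι → H) :
    act (M + M') x = act M x + act M' x := by
  funext i
  simp [act, Finset.sum_add_distrib]

theorem act_neg (M : Matrix κ ι (H →L[ℂ] H)) (x : ι → H) : act (-M) x = -act M x := by
  funext i
  simp [act]

theorem act_smul (c : ℂ) (M : Matrix κ ι (H →L[ℂ] H)) (x : ι → H) :
    act (c • M) x = c • act M x := by
  funext i
  simp [act, Finset.smul_sum]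

theorem ip_act (M : Matrix κ ι (H →L[ℂ] H)) (x : κ → H) (y : ι → H) :
    ip x (act M y) = ip (act Mᴴ x) y := by
  simp only [ip, act, inner_sum, sum_inner, Matrix.conjTranspose_apply,
    ContinuousLinearMap.star_eq_adjoint, ContinuousLinearMap.adjoint_inner_left]
  exact Finset.sum_comm

theorem ip_add (x y z : ι → H) : ip x (y + z) = ip x y + ip x z := by
  simp [ip, Finset.sum_add_distrib]

theorem ip_neg (x y : ι → H) : ip x (-y) = -ip x y := by simp [ip]

theorem ip_smul (c : ℂ) (x y : ι → H) : ip x (c • y) = c * ip x y := by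
  simp [ip, Finset.mul_sum]

theorem star_ip (x y : ι → H) : star (ip x y) = ip y x := by
  simp [ip]

theorem inner_self_nonneg' {v : H} : 0 ≤ inner ℂ v v := by
  rw [inner_self_eq_norm_sq_to_K]
  have h : (0 : ℂ) ≤ ((‖v‖ ^ 2 : ℝ) : ℂ) := Complex.zero_le_real.2 (sq_nonneg ‖v‖)
  rw [Complex.ofReal_pow] at h
  exact h

theorem ip_self_nonneg (x : ι → H) : 0 ≤ ip x x :=
  Finset.sum_nonneg fun i _ => by
    exact inner_self_nonneg'

theorem ip_self_eq_zero {x : ι → H} (h : ip x x = 0) : x = 0 := by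
  have h1 := (Finset.sum_eq_zero_iff_of_nonneg (fun i _ => by
    exact inner_self_nonneg')).1 h
  funext i
  simpa using h1 i (Finset.mem_univ i)

theorem eq_zero_of_act {M : Matrix κ ι (H →L[ℂ] H)} (h : ∀ x, act M x = 0) : M = 0 := by
  classical
  ext1 i j
  ext v
  have := congrFun (h (Pi.single j v)) i
  rw [act, Finset.sum_eq_single j (fun k _ hk => by simp [hk]) (by simp)] at this
  simpa using this

theorem isPositiveOpMatrix_iff {M : Matrix ι ι (H →L[ℂ] H)} :
    IsPositiveOpMatrix M ↔ ∀ x, 0 ≤ ip x (act M x) := by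
  unfold IsPositiveOpMatrix
  refine forall_congr' fun x => ?_
  have : ip x (act M x) = ∑ i, ∑ j, inner ℂ (x i) (M i j (x j)) := by
    simp [ip, act]
  rw [← this, Complex.nonneg_iff, eq_comm (a := (0 : ℝ)) (b := (ip x (act M x)).im)]

theorem eq_zero_of_ip {M : Matrix ι ι (H →L[ℂ] H)} (h : ∀ x, ip x (act M x) = 0) : M = 0 := by
  let T : PiLp 2 (fun _ : ι => H) →ₗ[ℂ] PiLp 2 (fun _ : ι => H) :=
    { toFun := fun x => WithLp.toLp 2 (act M x)
      map_add' := fun x y => by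
        ext i
        simp [act, Finset.sum_add_distrib]
      map_smul' := fun c x => by
        ext i
        simp [act, Finset.smul_sum] }
  have hT : T = 0 := by
    rw [← inner_map_self_eq_zero]
    intro x
    have := congrArg star (h x)
    rw [star_ip, star_zero] at this
    rw [PiLp.inner_apply]
    exact this
  refine eq_zero_of_act fun x => ?_
  have := congrArg (fun S => WithLp.ofLp (S (WithLp.toLp 2 x))) hT
  exact this

theorem IsPositiveOpMatrix.isHermitian {M : Matrix ι ι (H →L[ℂ] H)} (h : IsPositiveOpMatrix M) :
    Mᴴ = M := by
  have := isPositiveOpMatrix_iff.1 h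
  rw [← sub_eq_zero]
  refine eq_zero_of_ip fun x => ?_
  rw [sub_eq_add_neg, act_add, act_neg, ip_add, ip_neg, ip_act, Matrix.conjTranspose_conjTranspose,
    ← star_ip, (IsSelfAdjoint.of_nonneg (this x)).star_eq, add_neg_cancel]

theorem isPositiveOpMatrix_zero : IsPositiveOpMatrix (0 : Matrix ι ι (H →L[ℂ] H)) := by
  intro x
  simp

theorem IsPositiveOpMatrix.add {M M' : Matrix ι ι (H →L[ℂ] H)} (h : IsPositiveOpMatrix M)
    (h' : IsPositiveOpMatrix M') : IsPositiveOpMatrix (M + M') := by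
  rw [isPositiveOpMatrix_iff] at *
  intro x
  rw [act_add, ip_add]
  exact add_nonneg (h x) (h' x)

theorem IsPositiveOpMatrix.smul {M : Matrix ι ι (H →L[ℂ] H)} (h : IsPositiveOpMatrix M) {r : ℝ}
    (hr : 0 ≤ r) : IsPositiveOpMatrix ((r : ℂ) • M) := by
  rw [isPositiveOpMatrix_iff] at *
  intro x
  rw [act_smul, ip_smul]
  exact mul_nonneg (by exact_mod_cast hr) (h x)

theorem IsPositiveOpMatrix.conj {M : Matrix ι ι (H →L[ℂ] H)} (h : IsPositiveOpMatrix M)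
    (B : Matrix ι κ (H →L[ℂ] H)) : IsPositiveOpMatrix (Bᴴ * M * B) := by
  rw [isPositiveOpMatrix_iff] at *
  intro x
  rw [act_mul, act_mul, ip_act, Matrix.conjTranspose_conjTranspose]
  exact h _

theorem isPositiveOpMatrix_star_mul (B : Matrix κ ι (H →L[ℂ] H)) :
    IsPositiveOpMatrix (Bᴴ * B) := by
  rw [isPositiveOpMatrix_iff]
  intro x
  rw [act_mul, ip_act, Matrix.conjTranspose_conjTranspose]
  exact ip_self_nonneg _

theorem eq_zero_of_star_mul {B : Matrix κ ι (H →L[ℂ] H)} (h : Bᴴ * B = 0) : B = 0 := by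
  refine eq_zero_of_act fun x => ip_self_eq_zero ?_
  have h1 : act (Bᴴ * B) x = 0 := by rw [h]; funext i; simp [act]
  rw [act_mul] at h1
  have h2 := ip_act B (act B x) x
  rw [h2, ← star_ip, h1]
  simp [ip]

theorem IsPositiveOpMatrix.antisymm {M : Matrix ι ι (H →L[ℂ] H)} (h : IsPositiveOpMatrix M)
    (h' : IsPositiveOpMatrix (-M)) : M = 0 := by
  rw [isPositiveOpMatrix_iff] at *
  refine eq_zero_of_ip fun x => le_antisymm ?_ (h x)
  have := h' x
  rw [act_neg, ip_neg] at this
  exact neg_nonneg.1 this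

end Act

/-! ## Functional calculus -/

/-- A continuous functional calculus of an element of a ring with involution. -/
structure Calculus {R : Type*} [Ring R] [StarRing R] [Algebra ℂ R] (a : R) where
  K : Set ℝ
  bdd : ∃ C : ℝ, ∀ t ∈ K, t ≤ C
  F : (ℝ → ℝ) → R
  mul : ∀ f g, ContinuousOn f K → ContinuousOn g K → F (fun t => f t * g t) = F f * F g
  add : ∀ f g, ContinuousOn f K → ContinuousOn g K → F (fun t => f t + g t) = F f + F g
  const : ∀ c : ℝ, F (fun _ => c) = (c : ℂ) • 1
  id : F (fun t => t) = a
  star : ∀ f, star (F f) = F f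
  comm : ∀ f b, Commute a b → Commute (F f) b
  congr : ∀ f g, Set.EqOn f g K → F f = F g
  inj : ∀ f g, ContinuousOn f K → ContinuousOn g K → F f = F g → Set.EqOn f g K

theorem nonempty_calculus {A : Type*} [CStarAlgebra A] {a : A} (ha : IsSelfAdjoint a) :
    Nonempty (Calculus a) :=
  ⟨{ K := spectrum ℝ a
     bdd := (ContinuousFunctionalCalculus.isCompact_spectrum a).bddAbove
     F := fun f => cfc f a
     mul := fun f g hf hg => cfc_mul f g a hf hg
     add := fun f g hf hg => cfc_add a f g hf hg
     const := fun c => by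
       rw [cfc_const c a, Algebra.algebraMap_eq_smul_one]
       rfl
     id := cfc_id' ℝ a
     star := fun f => (cfc_predicate f a : IsSelfAdjoint (cfc f a))
     comm := fun f b hb => hb.cfc_real f
     congr := fun f g h => cfc_congr h
     inj := fun f g hf hg h => eqOn_of_cfc_eq_cfc h hf hg ha }⟩

theorem nonempty_calculus_matrix {n : ℕ} {M : Matrix (Fin n) (Fin n) (H →L[ℂ] H)} (hM : Mᴴ = M) :
    Nonempty (Calculus M) := by
  let e : Matrix (Fin n) (Fin n) (H →L[ℂ] H) ≃⋆ₐ[ℂ] CStarMatrix (Fin n) (Fin n) (H →L[ℂ] H) :=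
    CStarMatrix.ofMatrixStarAlgEquiv
  have ha : IsSelfAdjoint (e M) := by
    rw [isSelfAdjoint_iff, ← map_star]
    exact congrArg e hM
  obtain ⟨c⟩ := nonempty_calculus ha
  exact ⟨{
    K := c.K
    bdd := c.bdd
    F := fun f => e.symm (c.F f)
    mul := fun f g hf hg => by rw [c.mul f g hf hg, map_mul]
    add := fun f g hf hg => by rw [c.add f g hf hg, map_add]
    const := fun r => by rw [c.const, map_smul, map_one]
    id := by rw [c.id]; exact e.symm_apply_apply M
    star := fun f => by rw [← map_star, c.star]
    comm := fun f b hb => by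
      have h1 : Commute (e M) (e b) := by
        rw [commute_iff_eq, ← map_mul, hb.eq, map_mul]
      have h2 := (c.comm f (e b) h1).eq
      have h3 := congrArg e.symm h2
      rw [map_mul, map_mul, StarAlgEquiv.symm_apply_apply] at h3
      exact h3
    congr := fun f g h => by rw [c.congr f g h]
    inj := fun f g hf hg h => c.inj f g hf hg (e.symm.injective h) }⟩

namespace Calculus

variable {n : ℕ} {M : Matrix (Fin n) (Fin n) (H →L[ℂ] H)} (c : Calculus M)

include c in
theorem hermitian (f : ℝ → ℝ) : (c.F f)ᴴ = c.F f := c.star f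

theorem positive {g : ℝ → ℝ} (hg : ContinuousOn g c.K) (h : ∀ t ∈ c.K, 0 ≤ g t) :
    IsPositiveOpMatrix (c.F g) := by
  have h1 : c.F g = (c.F fun t => √(g t))ᴴ * c.F fun t => √(g t) := by
    rw [c.hermitian, ← c.mul _ _ (hg.sqrt) (hg.sqrt)]
    exact c.congr _ _ fun t ht => (Real.mul_self_sqrt (h t ht)).symm
  rw [h1]
  exact isPositiveOpMatrix_star_mul _

theorem zero : c.F (fun _ => 0) = 0 := by
  rw [c.const]
  simp

theorem neg {f : ℝ → ℝ} (hf : ContinuousOn f c.K) : c.F (fun t => -f t) = -c.F f := by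
  rw [eq_neg_iff_add_eq_zero, ← c.add (fun t => -f t) f hf.neg hf, ← c.zero]
  exact c.congr _ _ fun t _ => neg_add_cancel _

theorem nonneg_of_positive {g : ℝ → ℝ} (hg : ContinuousOn g c.K) (h : IsPositiveOpMatrix (c.F g)) :
    ∀ t ∈ c.K, 0 ≤ g t := by
  have hh : ContinuousOn (fun t => max 0 (-g t)) c.K := continuousOn_const.sup hg.neg
  have hk : ContinuousOn (fun t => max 0 (-g t) * √(max 0 (-g t))) c.K := hh.mul hh.sqrt
  have h1 : (c.F fun t => max 0 (-g t))ᴴ * c.F g * (c.F fun t => max 0 (-g t)) =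
      -((c.F fun t => max 0 (-g t) * √(max 0 (-g t)))ᴴ *
        c.F fun t => max 0 (-g t) * √(max 0 (-g t))) := by
    rw [c.hermitian, c.hermitian, ← c.mul _ _ hh hg,
      ← c.mul (fun t => max 0 (-g t) * g t) _ (hh.mul hg) hh,
      ← c.mul _ _ hk hk,
      ← c.neg (f := fun t => max 0 (-g t) * √(max 0 (-g t)) *
        (max 0 (-g t) * √(max 0 (-g t)))) (hk.mul hk)]
    refine c.congr _ _ fun t ht => ?_
    have h2 : √(max 0 (-g t)) * √(max 0 (-g t)) = max 0 (-g t) :=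
      Real.mul_self_sqrt (le_max_left _ _)
    rcases le_total 0 (g t) with h3 | h3
    · rw [max_eq_left (by linarith)]
      simp
    · rw [mul_mul_mul_comm, h2, max_eq_right (by linarith)]
      ring
  have h2 := h.conj (c.F fun t => max 0 (-g t))
  rw [h1] at h2
  have h3 := eq_zero_of_star_mul ((isPositiveOpMatrix_star_mul _).antisymm h2)
  rw [← c.zero] at h3
  intro t ht
  have h4 := c.inj _ _ hk continuousOn_const h3 ht
  dsimp only at h4
  by_contra! h5
  have h6 : max 0 (-g t) = -g t := max_eq_right (by linarith)
  rw [h6] at h4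
  have h7 : 0 < -g t := by linarith
  have h8 : 0 < √(-g t) := Real.sqrt_pos.2 h7
  exact (mul_pos h7 h8).ne' h4

end Calculus

theorem exists_bound {n : ℕ} {M : Matrix (Fin n) (Fin n) (H →L[ℂ] H)} (hM : Mᴴ = M) :
    ∃ C : ℝ, 0 ≤ C ∧ IsPositiveOpMatrix ((C : ℂ) • (1 : Matrix (Fin n) (Fin n) (H →L[ℂ] H)) - M) := by
  obtain ⟨c⟩ := nonempty_calculus_matrix hM
  obtain ⟨C, hC⟩ := c.bdd
  refine ⟨max C 0, le_max_right _ _, ?_⟩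
  have h1 : c.F (fun t => max C 0 + -t) =
      ((max C 0 : ℝ) : ℂ) • (1 : Matrix (Fin n) (Fin n) (H →L[ℂ] H)) - M := by
    rw [c.add (fun _ => max C 0) (fun t => -t) continuousOn_const continuousOn_id.neg, c.const,
      c.neg (f := fun t => t) continuousOn_id, c.id, sub_eq_add_neg]
  rw [← h1]
  exact c.positive (continuousOn_const.add continuousOn_id.neg) fun t ht => by
    have := hC t ht
    have := le_max_left C 0
    linarith

theorem IsPositiveOpMatrix.exists_sqrt {n : ℕ} {M : Matrix (Fin n) (Fin n) (H →L[ℂ] H)}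
    (h : IsPositiveOpMatrix M) : ∃ Q, Qᴴ = Q ∧ Q * Q = M ∧ ∀ B, Commute M B → Commute Q B := by
  obtain ⟨c⟩ := nonempty_calculus_matrix h.isHermitian
  have h1 := c.nonneg_of_positive (g := fun t => t) continuousOn_id (by rw [c.id]; exact h)
  refine ⟨c.F fun t => √t, c.hermitian _, ?_, fun B hB => c.comm _ B hB⟩
  rw [← c.mul (fun t => √t) (fun t => √t) continuousOn_id.sqrt continuousOn_id.sqrt]
  exact (c.congr _ _ fun t ht => Real.mul_self_sqrt (h1 t ht)).trans c.id

namespace Obj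

/-! ## Entrywise extension -/

theorem zero_mem_commutant (a : DoubleCone) : (0 : H →L[ℂ] H) ∈ (N.loc a).commutant := zero_mem _

theorem ext_zero (X : Obj N) (a : DoubleCone) : X.ext a 0 = 0 := by
  have := X.ext_smul (a := a) 0 (zero_mem_commutant a)
  simpa using this

theorem ext_sum (X : Obj N) {a : DoubleCone} {ι : Type*} (s : Finset ι) (A : ι → H →L[ℂ] H)
    (hA : ∀ i ∈ s, A i ∈ (N.loc a).commutant) :
    X.ext a (∑ i ∈ s, A i) = ∑ i ∈ s, X.ext a (A i) := by
  classical
  induction s using Finset.induction_on with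
  | empty => simp [ext_zero]
  | insert i s hi ih =>
    have h1 : ∀ j ∈ s, A j ∈ (N.loc a).commutant := fun j hj => hA j (Finset.mem_insert_of_mem hj)
    rw [Finset.sum_insert hi, Finset.sum_insert hi, ext_add X (hA i (Finset.mem_insert_self i s))
      (sum_mem h1), ih h1]

/-- The extension applied to the entries of a matrix. -/
noncomputable def extMat (X : Obj N) (a : DoubleCone) {m n : ℕ}
    (B : Matrix (Fin m) (Fin n) (H →L[ℂ] H)) :
    Matrix (Fin (m * X.n)) (Fin (n * X.n)) (H →L[ℂ] H) :=
  Matrix.of fun i j => X.ext a (B (finProdFinEquiv.symm i).1 (finProdFinEquiv.symm j).1)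
    (finProdFinEquiv.symm i).2 (finProdFinEquiv.symm j).2

theorem extMat_apply (X : Obj N) (a : DoubleCone) {m n : ℕ}
    (B : Matrix (Fin m) (Fin n) (H →L[ℂ] H)) (i₂ i₁ j₂ j₁) :
    X.extMat a B (finProdFinEquiv (i₂, i₁)) (finProdFinEquiv (j₂, j₁)) =
      X.ext a (B i₂ j₂) i₁ j₁ := by
  simp only [extMat, Matrix.of_apply, Equiv.symm_apply_apply]

theorem ext_fin {m n k l : ℕ} {M M' : Matrix (Fin (m * n)) (Fin (k * l)) (H →L[ℂ] H)}
    (h : ∀ i₂ i₁ j₂ j₁, M (finProdFinEquiv (i₂, i₁)) (finProdFinEquiv (j₂, j₁)) =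
      M' (finProdFinEquiv (i₂, i₁)) (finProdFinEquiv (j₂, j₁))) : M = M' := by
  ext1 i j
  obtain ⟨⟨i₂, i₁⟩, rfl⟩ := finProdFinEquiv.surjective i
  obtain ⟨⟨j₂, j₁⟩, rfl⟩ := finProdFinEquiv.surjective j
  exact h _ _ _ _

theorem extMat_zero (X : Obj N) (a : DoubleCone) (m n : ℕ) :
    X.extMat a (0 : Matrix (Fin m) (Fin n) (H →L[ℂ] H)) = 0 := ext_fin fun i₂ i₁ j₂ j₁ => by
  rw [extMat_apply, Matrix.zero_apply, ext_zero]
  rfl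

theorem extMat_mul (X : Obj N) {a : DoubleCone} {m n k : ℕ}
    {B : Matrix (Fin m) (Fin n) (H →L[ℂ] H)} {C : Matrix (Fin n) (Fin k) (H →L[ℂ] H)}
    (hB : ∀ i j, B i j ∈ (N.loc a).commutant) (hC : ∀ i j, C i j ∈ (N.loc a).commutant) :
    X.extMat a (B * C) = X.extMat a B * X.extMat a C := ext_fin fun i₂ i₁ j₂ j₁ => by
  rw [extMat_apply, Matrix.mul_apply, Matrix.mul_apply, sum_fin_prod,
    ext_sum X _ _ (fun k _ => mul_mem (hB _ _) (hC _ _)), Matrix.sum_apply]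
  refine Finset.sum_congr rfl fun k₂ _ => ?_
  rw [ext_mul X (hB _ _) (hC _ _), Matrix.mul_apply]
  refine Finset.sum_congr rfl fun k₁ _ => ?_
  rw [extMat_apply, extMat_apply]

theorem extMat_star (X : Obj N) {a : DoubleCone} {m n : ℕ}
    {B : Matrix (Fin m) (Fin n) (H →L[ℂ] H)} (hB : ∀ i j, B i j ∈ (N.loc a).commutant) :
    X.extMat a Bᴴ = (X.extMat a B)ᴴ := ext_fin fun i₂ i₁ j₂ j₁ => by
  rw [extMat_apply, Matrix.conjTranspose_apply, Matrix.conjTranspose_apply, extMat_apply,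
    ext_star X (hB _ _), Matrix.conjTranspose_apply]

theorem op_mem_commutant {Y Z : Obj N} {o a : DoubleCone} (h : o.Perp a) (hY : Y.LocalizedIn o)
    (hZ : Z.LocalizedIn o) (f : Y ⟶ Z) (i j) : op f i j ∈ (N.loc a).commutant :=
  loc_le_commutant h (entry_mem hY hZ f i j)

theorem op_whiskerLeft (X : Obj N) {Y Z : Obj N} {o a : DoubleCone} (h : o.Perp a)
    (hY : Y.LocalizedIn o) (hZ : Z.LocalizedIn o) (f : Y ⟶ Z) :
    op (X ◁ f) = X.extMat a (op f) := ext_fin fun i₂ i₁ j₂ j₁ => by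
  rw [extMat_apply, op_apply, op_apply, ext_of_perp X h (entry_mem hY hZ f i₂ j₂)]
  rw [← id_tensorHom]
  refine congrArg Subtype.val (tensorHom_apply_val (𝟙 X) f _ _ _ _) |>.trans ?_
  refine congrArg Subtype.val (congrFun (congrFun ?_ i₁) j₁)
  change X.hom 1 * _ = _
  rw [← map_mul, one_mul]

theorem ext_tensor_eq {X Y : Obj N} {o a : DoubleCone} (hX : X.LocalizedIn o)
    (hY : Y.LocalizedIn o) (h : o.Perp a) {A : H →L[ℂ] H} (hA : A ∈ (N.loc a).commutant) :
    (X ⊗ Y).ext a A = X.extMat a (Y.ext a A) := ext_fin fun i₂ i₁ j₂ j₁ => by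
  rw [extMat_apply]
  exact ext_tensor hX hY h hA _ _ _ _

/-- An arrow `f` annihilates the extension at `A`. -/
def Annihilates (a : DoubleCone) (A : H →L[ℂ] H) {X Y : Obj N} (f : X ⟶ Y) : Prop :=
  op f * X.ext a A = 0

theorem Annihilates.comp_right {a : DoubleCone} {A : H →L[ℂ] H} {X Y Z : Obj N} {f : X ⟶ Y}
    (g : Y ⟶ Z) (h : Annihilates a A f) : Annihilates a A (f ≫ g) := by
  rw [Annihilates, op_comp, Matrix.mul_assoc, h, Matrix.mul_zero]

theorem Annihilates.comp_left {a : DoubleCone} {A : H →L[ℂ] H} (hA : A ∈ (N.loc a).commutant)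
    {X Y Z : Obj N} (f : X ⟶ Y) {g : Y ⟶ Z} (h : Annihilates a A g) : Annihilates a A (f ≫ g) := by
  rw [Annihilates, op_comp, Matrix.mul_assoc, op_mul_ext f hA, ← Matrix.mul_assoc, h,
    Matrix.zero_mul]

theorem Annihilates.whiskerLeft {a : DoubleCone} {A : H →L[ℂ] H} (hA : A ∈ (N.loc a).commutant)
    (X : Obj N) {Y Z : Obj N} {f : Y ⟶ Z} (h : Annihilates a A f) : Annihilates a A (X ◁ f) := by
  obtain ⟨o, ho⟩ := exists_perp a
  obtain ⟨X', U, hX', hU⟩ := X.exists_transport o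
  obtain ⟨Y', V, hY', hV⟩ := Y.exists_transport o
  obtain ⟨Z', W, hZ', hW⟩ := Z.exists_transport o
  have h1 : Annihilates a A (adjoint V ≫ f ≫ W) := (h.comp_right W).comp_left hA (adjoint V)
  have h2 : Annihilates a A (X' ◁ (adjoint V ≫ f ≫ W)) := by
    rw [Annihilates]
    refine Eq.trans (congrArg₂ (· * ·) (op_whiskerLeft X' ho hY' hZ' _)
      (ext_tensor_eq hX' hY' ho hA)) ?_
    refine Eq.trans (extMat_mul X' (op_mem_commutant ho hY' hZ' _)
      (ext_entry_mem hY' ho hA)).symm ?_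
    rw [h1, extMat_zero]
  have h3 : X ◁ f = (U ⊗ₘ V) ≫ (X' ◁ (adjoint V ≫ f ≫ W)) ≫ (adjoint U ⊗ₘ adjoint W) := by
    rw [← id_tensorHom, ← id_tensorHom, tensorHom_comp_tensorHom, tensorHom_comp_tensorHom,
      Category.id_comp, hU.left, Category.assoc, Category.assoc, hW.left, Category.comp_id,
      reassoc_of% hV.left]
  rw [h3]
  exact (h2.comp_right _).comp_left hA _

/-! ## Subobjects -/

end Obj

namespace Bimod

/-- The subobject defined by a projection. -/
noncomputable def sub (X : Bimod N) {E : Matrix (Fin X.n) (Fin X.n) N.alg} (hE : X.IsArrow X E)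
    (h1 : Eᴴ = E) (h2 : E * E = E) : Bimod N where
  n := X.n
  hom :=
    { toFun := fun A => E * X.hom A
      map_smul' := fun c A => by rw [map_smul, Matrix.mul_smul]; rfl
      map_zero' := by rw [map_zero, Matrix.mul_zero]
      map_add' := fun A B => by rw [map_add, Matrix.mul_add]
      map_mul' := fun A B => by
        rw [map_mul, Matrix.mul_assoc E (X.hom A), ← Matrix.mul_assoc (X.hom A), ← hE.2.2 A]
        simp only [← Matrix.mul_assoc, h2]
      map_star' := fun A => by
        rw [map_star, Matrix.star_eq_conjTranspose, Matrix.star_eq_conjTranspose,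
          Matrix.conjTranspose_mul, h1, ← Matrix.star_eq_conjTranspose, ← map_star, hE.2.2] }

variable {X Y : Bimod N} {E : Matrix (Fin X.n) (Fin X.n) N.alg} (hE : X.IsArrow X E)
    (h1 : Eᴴ = E) (h2 : E * E = E)

theorem sub_idArrow : (X.sub hE h1 h2).idArrow = E := hE.1

theorem LocalizedIn.sub {o : DoubleCone} (h : X.LocalizedIn o) :
    (X.sub hE h1 h2).LocalizedIn o := localizedIn_of fun a ha A hA => by
  rw [sub_idArrow]
  change E * X.hom A = _
  rw [hE.2.2, h.hom_eq ha hA, Matrix.mul_assoc, hE.2.1]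
  rfl

theorem IsUnitary.sub {U : Matrix (Fin Y.n) (Fin X.n) N.alg} (hU : X.IsUnitary Y U)
    {F : Matrix (Fin Y.n) (Fin Y.n) N.alg} (hF : Y.IsArrow Y F)
    (h1' : Fᴴ = F) (h2' : F * F = F) (hEF : F = U * E * Uᴴ) :
    (X.sub hE h1 h2).IsUnitary (Y.sub hF h1' h2') (U * E) := by
  have h3 : F * U = U * E := by
    rw [hEF, Matrix.mul_assoc, hU.1.2, Matrix.mul_assoc, hE.1]
  refine ⟨⟨⟨?_, ?_, fun A => ?_⟩, ?_⟩, ?_⟩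
  · rw [sub_idArrow]
    exact (Matrix.mul_assoc _ _ _).trans (congrArg _ h2)
  · rw [sub_idArrow, ← h3]
    exact (Matrix.mul_assoc _ _ _).symm.trans (congrArg (· * U) h2')
  · change U * E * (E * X.hom A) = F * Y.hom A * (U * E)
    have l : U * E * (E * X.hom A) = Y.hom A * (U * E) := by
      rw [Matrix.mul_assoc U, ← Matrix.mul_assoc E, h2, hE.2.2, ← Matrix.mul_assoc, hU.1.1.2.2,
        Matrix.mul_assoc]
    rw [l, hF.2.2, Matrix.mul_assoc (Y.hom A), ← Matrix.mul_assoc F, h3, Matrix.mul_assoc U, h2]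
  · rw [sub_idArrow]
    change (U * E)ᴴ * (U * E) = E
    rw [Matrix.conjTranspose_mul, h1, Matrix.mul_assoc, ← Matrix.mul_assoc Uᴴ, hU.1.2, hE.2.1, h2]
  · rw [sub_idArrow]
    change (U * E) * (U * E)ᴴ = F
    rw [Matrix.conjTranspose_mul, h1, Matrix.mul_assoc, ← Matrix.mul_assoc E, h2,
      ← Matrix.mul_assoc, hEF]

end Bimod

namespace Obj

/-- The subobject defined by a projection. -/
noncomputable def sub (X : Obj N) {E : X ⟶ X} (h1 : adjoint E = E) (h2 : E ≫ E = E) : Obj N where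
  toBimod := X.toBimod.sub E.2 (congrArg Subtype.val h1) (congrArg Subtype.val h2)
  localized := by
    obtain ⟨o, ho⟩ := X.localized
    exact ⟨o, Bimod.LocalizedIn.sub _ _ _ ho⟩
  transportable := fun o => by
    obtain ⟨Y, U, hY, hU⟩ := X.exists_transport o
    have h1' : adjoint (adjoint U ≫ E ≫ U) = adjoint U ≫ E ≫ U := by
      rw [adjoint_comp, adjoint_comp, adjoint_adjoint, h1, Category.assoc]
    have h2' : (adjoint U ≫ E ≫ U) ≫ (adjoint U ≫ E ≫ U) = adjoint U ≫ E ≫ U := by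
      rw [Category.assoc, Category.assoc, reassoc_of% hU.left, reassoc_of% h2]
    exact ⟨_, Bimod.LocalizedIn.sub (adjoint U ≫ E ≫ U).2 (congrArg Subtype.val h1')
      (congrArg Subtype.val h2') hY, _, (hU.isUnitary.sub E.2 (congrArg Subtype.val h1)
        (congrArg Subtype.val h2) _ _ _ rfl).toMor⟩

theorem exists_sub {X : Obj N} {E : X ⟶ X} (h1 : adjoint E = E) (h2 : E ≫ E = E) :
    ∃ (Z : Obj N) (W : Z ⟶ X), W ≫ adjoint W = 𝟙 Z ∧ adjoint W ≫ W = E := by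
  have e1 : E.1ᴴ = E.1 := congrArg Subtype.val h1
  have e2 : E.1 * E.1 = E.1 := congrArg Subtype.val h2
  refine ⟨X.sub h1 h2, ⟨E.1, ?_, ?_, fun A => ?_⟩, hom_ext ?_, hom_ext ?_⟩
  · exact (congrArg (fun M : Matrix (Fin X.n) (Fin X.n) N.alg => E.1 * M)
      (Bimod.sub_idArrow E.2 e1 e2)).trans e2
  · exact E.2.2.1
  · change E.1 * (E.1 * X.hom A) = _
    rw [← Matrix.mul_assoc, e2]
    exact E.2.2.2 A
  · change E.1ᴴ * E.1 = E.1 * X.hom 1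
    rw [e1, e2]
    exact E.2.1.symm
  · change E.1 * E.1ᴴ = E.1
    rw [e1, e2]

/-! ## Functional calculus of endomorphisms -/

theorem exists_hom {X Y : Obj N} {M : Matrix (Fin Y.n) (Fin X.n) (H →L[ℂ] H)}
    (h1 : M * X.unitMat = M) (h2 : Y.unitMat * M = M) (h3 : ∀ A, M * X.val A = Y.val A * M) :
    ∃ f : X ⟶ Y, op f = M := by
  obtain ⟨p, hp⟩ := X.localized
  obtain ⟨q, hq⟩ := Y.localized
  obtain ⟨c, hpc, hqc⟩ := DoubleCone.directed p q
  have hM : X.toMor.IsIntertwiner Y.toMor M := ⟨h1, h2, h3⟩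
  have hmem : ∀ i j, M i j ∈ N.alg := fun i j =>
    N.loc_le_alg c (hM.entry_mem (Mor.LocalizedIn.mono hp hpc) (Mor.LocalizedIn.mono hq hqc) i j)
  obtain ⟨f, hf⟩ : ∃ f : Matrix (Fin Y.n) (Fin X.n) N.alg, coeMat f = M :=
    ⟨Matrix.of fun i j => ⟨M i j, hmem i j⟩, rfl⟩
  subst hf
  refine ⟨⟨f, ?_, ?_, fun A => ?_⟩, rfl⟩ <;> apply coeMat_injective
  · rw [coeMat_mul]; exact h1
  · rw [coeMat_mul]; exact h2
  · rw [coeMat_mul, coeMat_mul]; exact h3 A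

theorem exists_hom_of_commute {X : Obj N} (T : X ⟶ X)
    {M : Matrix (Fin X.n) (Fin X.n) (H →L[ℂ] H)} (h : ∀ B, Commute (op T) B → Commute M B) :
    ∃ f : X ⟶ X, op f = M * X.unitMat := by
  have h1 : ∀ A, M * X.val A = X.val A * M := fun A => (h _ (op_mul_val T A)).eq
  have h2 : M * X.unitMat = X.unitMat * M := h1 1
  refine exists_hom ?_ ?_ fun A => ?_
  · rw [Matrix.mul_assoc, unitMat_mul_self]
  · rw [← Matrix.mul_assoc, ← h2, Matrix.mul_assoc, unitMat_mul_self]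
  · rw [Matrix.mul_assoc, unitMat_mul_val, h1, h2, ← Matrix.mul_assoc, val_mul_unitMat]

/-- Positivity of an endomorphism. -/
def IsPos {X : Obj N} (T : X ⟶ X) : Prop := IsPositiveOpMatrix (op T)

theorem exists_sqrt {X : Obj N} {T : X ⟶ X} (hT : IsPos T) :
    ∃ Q : X ⟶ X, adjoint Q = Q ∧ Q ≫ Q = T := by
  obtain ⟨Q, h1, h2, h3⟩ := IsPositiveOpMatrix.exists_sqrt hT
  obtain ⟨f, hf⟩ := exists_hom_of_commute T h3
  have h4 : Q * X.unitMat = X.unitMat * Q := (h3 _ (op_mul_val T 1)).eq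
  refine ⟨f, op_injective ?_, op_injective ?_⟩
  · rw [op_adjoint, hf, Matrix.conjTranspose_mul, h1, unitMat_star, h4]
  · rw [op_comp, hf, Matrix.mul_assoc, ← Matrix.mul_assoc X.unitMat, ← h4, Matrix.mul_assoc Q,
      unitMat_mul_self, ← Matrix.mul_assoc, h2, op_mul_unitMat]

theorem op_add {X Y : Obj N} (f g : X ⟶ Y) : op (f + g) = op f + op g := rfl
theorem op_sub {X Y : Obj N} (f g : X ⟶ Y) : op (f - g) = op f - op g := rfl
theorem op_zero {X Y : Obj N} : op (0 : X ⟶ Y) = 0 := rfl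
theorem op_smul {X Y : Obj N} (c : ℂ) (f : X ⟶ Y) : op (c • f) = c • op f := rfl

theorem op_sum {X Y : Obj N} {ι : Type*} (s : Finset ι) (f : ι → (X ⟶ Y)) :
    op (∑ i ∈ s, f i) = ∑ i ∈ s, op (f i) :=
  map_sum (⟨⟨op, op_zero⟩, op_add⟩ : (X ⟶ Y) →+ Matrix (Fin Y.n) (Fin X.n) (H →L[ℂ] H)) f s

end Obj

/-- Around the points of a finite set there are bump functions with sum at most one. -/
theorem exists_bumps (s : Finset ℝ) : ∃ f : ℝ → ℝ → ℝ, (∀ x, Continuous (f x)) ∧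
    (∀ x t, 0 ≤ f x t) ∧ (∀ x, f x x = 1) ∧ ∀ t, ∑ x ∈ s, f x t ≤ 1 := by
  obtain ⟨δ, hδ, h⟩ : ∃ δ : ℝ, 0 < δ ∧ ∀ x ∈ s, ∀ y ∈ s, x ≠ y → δ ≤ |x - y| := by
    induction s using Finset.induction_on with
    | empty => exact ⟨1, one_pos, by simp⟩
    | insert a s ha ih =>
      obtain ⟨δ, hδ, h⟩ := ih
      obtain ⟨ε, hε, h'⟩ : ∃ ε : ℝ, 0 < ε ∧ ∀ y ∈ s, ε ≤ |a - y| := by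
        clear h
        induction s using Finset.induction_on with
        | empty => exact ⟨1, one_pos, by simp⟩
        | insert b s hb ih =>
          rw [Finset.mem_insert, not_or] at ha
          obtain ⟨ε, hε, h'⟩ := ih ha.2
          refine ⟨min ε |a - b|, lt_min hε (abs_pos.2 (sub_ne_zero.2 ha.1)), fun y hy => ?_⟩
          rcases Finset.mem_insert.1 hy with rfl | hy
          · exact min_le_right _ _
          · exact (min_le_left _ _).trans (h' y hy)
      refine ⟨min δ ε, lt_min hδ hε, fun x hx y hy hxy => ?_⟩
      rcases Finset.mem_insert.1 hx with rfl | hx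
      · rcases Finset.mem_insert.1 hy with rfl | hy
        · exact absurd rfl hxy
        · exact (min_le_right _ _).trans (h' y hy)
      · rcases Finset.mem_insert.1 hy with hya | hy
        · rw [hya, abs_sub_comm]
          exact (min_le_right _ _).trans (h' x hx)
        · exact (min_le_left _ _).trans (h x hx y hy hxy)
  refine ⟨fun x t => max 0 (1 - 2 * |t - x| / δ), fun x => by fun_prop,
    fun x t => le_max_left _ _, fun x => by simp, fun t => ?_⟩
  have hle : ∀ x, max 0 (1 - 2 * |t - x| / δ) ≤ 1 := fun x =>
    max_le zero_le_one (by have : 0 ≤ 2 * |t - x| / δ := by positivity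
                           linarith)
  by_cases hs : ∃ x ∈ s, 2 * |t - x| < δ
  · obtain ⟨x, hx, hxt⟩ := hs
    rw [Finset.sum_eq_single x]
    · exact hle x
    · intro y hy hyx
      refine max_eq_left ?_
      have h1 := h x hx y hy hyx.symm
      have h2 : |x - y| ≤ |t - x| + |t - y| := by
        rw [abs_sub_comm t x]
        exact abs_sub_le x t y
      rw [sub_nonpos, le_div_iff₀ hδ]
      linarith
    · exact fun h => absurd hx h
  · push Not at hs
    rw [Finset.sum_eq_zero]
    · exact zero_le_one
    · intro x hx
      refine max_eq_left ?_
      rw [sub_nonpos, le_div_iff₀ hδ]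
      linarith [hs x hx]

theorem Calculus.sum {n : ℕ} {M : Matrix (Fin n) (Fin n) (H →L[ℂ] H)} (c : Calculus M)
    {ι : Type*} (s : Finset ι) (f : ι → ℝ → ℝ) (hf : ∀ i, ContinuousOn (f i) c.K) :
    c.F (fun t => ∑ i ∈ s, f i t) = ∑ i ∈ s, c.F (f i) := by
  classical
  induction s using Finset.induction_on with
  | empty => simpa using c.zero
  | insert i s hi ih =>
    simp only [Finset.sum_insert hi]
    rw [c.add _ _ (hf i) (continuousOn_finsetSum s fun i _ => hf i), ih]

namespace Obj

theorem exists_proj {X : Obj N} (τ : (X ⟶ X) →ₗ[ℂ] ℂ) (c : ℝ)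
    (hτ : ∀ T : X ⟶ X, IsPos T → 0 ≤ τ T ∧ IsPos (((c : ℂ) * τ T) • 𝟙 X - T))
    (T : X ⟶ X) (hT : adjoint T = T) (hT' : ∀ a : ℂ, T ≠ a • 𝟙 X) :
    ∃ E : X ⟶ X, adjoint E = E ∧ E ≫ E = E ∧ E ≠ 0 ∧ E ≠ 𝟙 X := by
  obtain ⟨k⟩ := nonempty_calculus_matrix (M := op T) (congrArg op hT)
  have hP : ∀ f, k.F f * X.unitMat = X.unitMat * k.F f := fun f => (k.comm f _ (op_mul_val T 1)).eq
  choose g hg using fun f : ℝ → ℝ => exists_hom_of_commute T (k.comm f)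
  have hg' : ∀ f, op (g f) = (X.unitMat)ᴴ * k.F f * X.unitMat := fun f => by
    rw [hg, unitMat_star, ← hP, Matrix.mul_assoc, unitMat_mul_self]
  have hTg : ∀ f, ContinuousOn f k.K → op T * op (g f) = k.F fun t => t * f t := fun f hf => by
    rw [hg, hP, ← Matrix.mul_assoc, op_mul_unitMat, k.mul (fun t => t) f continuousOn_id hf]
    exact congrArg (· * k.F f) k.id.symm
  have hid : k.F (fun t => t) = op T := k.id
  by_cases hS : (k.K \ {0}).Infinite
  · exfalso
    obtain ⟨m, hm⟩ := exists_nat_gt ((c : ℂ) * τ (𝟙 X)).re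
    obtain ⟨s, hs, hcard⟩ := hS.exists_subset_card_eq (max m 1)
    obtain ⟨f, f1, f2, f3, f4⟩ := exists_bumps s
    have h1 : ∀ x, IsPos (g (f x)) := fun x => by
      rw [IsPos, hg']
      exact (k.positive (f1 x).continuousOn fun t _ => f2 x t).conj _
    have h2 : ∀ x ∈ s, 1 ≤ ((c : ℂ) * τ (g (f x))).re := by
      intro x hx
      obtain ⟨hxK, hx0⟩ := hs hx
      obtain ⟨h3, h4⟩ := hτ _ (h1 x)
      have h5 : (c : ℂ) * τ (g (f x)) = ((((c : ℂ) * τ (g (f x))).re : ℝ) : ℂ) := by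
        have h6 : ((c : ℂ) * τ (g (f x))).im = 0 := by
          rw [Complex.mul_im, (Complex.nonneg_iff.1 h3).2.symm]
          simp
        exact Complex.ext (by simp) (by rw [h6, Complex.ofReal_im])
      set r := ((c : ℂ) * τ (g (f x))).re with hr
      rw [h5] at h4
      have h7 := IsPositiveOpMatrix.conj h4 (op T)
      have h8 : (op T)ᴴ * op ((r : ℂ) • 𝟙 X - g (f x)) * op T =
          k.F fun t => r * (t * t) + -(t * f x t * t) := by
        have e1 : (op T)ᴴ = op T := congrArg op hT
        have cf : ContinuousOn (fun t => t * f x t) k.K := continuousOn_id.mul (f1 x).continuousOn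
        rw [e1, op_sub, op_smul, Matrix.mul_sub, Matrix.sub_mul, hTg _ (f1 x).continuousOn,
          Matrix.mul_smul, Matrix.smul_mul, op_mul_unitMat,
          k.add (fun t => r * (t * t)) (fun t => -(t * f x t * t))
            (continuousOn_const.mul (continuousOn_id.mul continuousOn_id))
            (cf.mul continuousOn_id).neg, k.neg (f := fun t => t * f x t * t) (cf.mul continuousOn_id),
          k.mul (fun t => t * f x t) (fun t => t) cf continuousOn_id,
          k.mul (fun _ => r) (fun t => t * t) continuousOn_const
            (continuousOn_id.mul continuousOn_id), k.const, Matrix.smul_mul, Matrix.one_mul,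
          k.mul (fun t => t) (fun t => t) continuousOn_id continuousOn_id, hid, sub_eq_add_neg]
      rw [h8] at h7
      have h9 := k.nonneg_of_positive (by
        have := (f1 x).continuousOn (s := k.K)
        fun_prop) h7 x hxK
      rw [f3] at h9
      have h10 : 0 < x * x := mul_self_pos.2 hx0
      nlinarith
    have h3 : IsPos (𝟙 X - ∑ x ∈ s, g (f x)) := by
      have : op (𝟙 X - ∑ x ∈ s, g (f x)) =
          (X.unitMat)ᴴ * k.F (fun t => 1 + -∑ x ∈ s, f x t) * X.unitMat := by
        have hc : ContinuousOn (fun t => ∑ x ∈ s, f x t) k.K :=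
          continuousOn_finsetSum s fun x _ => (f1 x).continuousOn
        rw [k.add (fun _ => 1) (fun t => -∑ x ∈ s, f x t) continuousOn_const hc.neg, k.neg hc,
          k.sum s f fun x => (f1 x).continuousOn, k.const, op_sub, op_sum, Matrix.mul_add,
          Matrix.add_mul, Matrix.mul_neg, Matrix.neg_mul, Matrix.mul_sum, Matrix.sum_mul,
          sub_eq_add_neg, Finset.sum_congr rfl fun x _ => hg' (f x)]
        simp [unitMat_star, unitMat_mul_self]
      rw [IsPos, this]
      refine (k.positive ?_ fun t _ => ?_).conj _
      · exact continuousOn_const.add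
          (continuousOn_finsetSum s fun x _ => (f1 x).continuousOn).neg
      · linarith [f4 t]
    have h4 := (hτ _ h3).1
    rw [map_sub, map_sum] at h4
    have h5 : (∑ x ∈ s, τ (g (f x))).re ≤ (τ (𝟙 X)).re := by
      have := (Complex.nonneg_iff.1 h4).1
      rw [Complex.sub_re] at this
      linarith
    have hre : ∀ z : ℂ, ((c : ℂ) * z).re = c * z.re := fun z => by simp
    have h6 : (s.card : ℝ) ≤ c * (∑ x ∈ s, τ (g (f x))).re := by
      rw [Complex.re_sum, Finset.mul_sum]
      calc (s.card : ℝ) = ∑ x ∈ s, (1 : ℝ) := by simp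
        _ ≤ _ := Finset.sum_le_sum fun x hx => by rw [← hre]; exact h2 x hx
    have h7 : (1 : ℝ) ≤ s.card := by
      rw [hcard]; exact_mod_cast le_max_right _ _
    have h8 : (m : ℝ) ≤ s.card := by
      rw [hcard]; exact_mod_cast le_max_left _ _
    have h9 : 0 ≤ (∑ x ∈ s, τ (g (f x))).re := by
      rw [Complex.re_sum]
      exact Finset.sum_nonneg fun x _ => (Complex.nonneg_iff.1 (hτ _ (h1 x)).1).1
    have h10 : 0 ≤ c := by
      by_contra hc
      nlinarith
    rw [hre] at hm
    nlinarith [mul_le_mul_of_nonneg_left h5 h10]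
  · rw [Set.not_infinite] at hS
    have hfin : k.K.Finite := (hS.insert 0).subset fun t ht => by
      by_cases h0 : t = 0
      · exact Or.inl h0
      · exact Or.inr ⟨ht, h0⟩
    have hcont : ∀ f : ℝ → ℝ, ContinuousOn f k.K := fun f => hfin.continuousOn f
    obtain ⟨x, hxK, hx0⟩ : ∃ x ∈ k.K, x ≠ 0 := by
      by_contra! h
      apply hT' 0
      apply op_injective
      rw [zero_smul, op_zero, ← hid, ← k.zero]
      exact k.congr _ _ fun t ht => h t ht
    let f : ℝ → ℝ := fun t => if t = x then 1 else 0
    have hff : k.F f * k.F f = k.F f := by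
      rw [← k.mul _ _ (hcont _) (hcont _)]
      refine k.congr _ _ fun t _ => ?_
      simp only [f]
      split_ifs <;> simp
    have hTf : op T * op (g f) = (x : ℂ) • op (g f) := by
      have e1 : (k.F fun t => t * f t) = (x : ℂ) • k.F f := by
        have e2 : (x : ℂ) • k.F f = k.F fun t => x * f t := by
          rw [k.mul (fun _ => x) f (hcont _) (hcont _), k.const, Matrix.smul_mul, Matrix.one_mul]
        rw [e2]
        refine k.congr _ _ fun t _ => ?_
        simp only [f]
        split_ifs with h <;> simp [h]
      have e2 := hTg f (hcont f)
      have e3 : op T * op (g f) * X.unitMat = op T * op (g f) := by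
        rw [Matrix.mul_assoc, op_mul_unitMat]
      rw [← e3, e2, e1, Matrix.smul_mul, ← hg]
    refine ⟨g f, op_injective ?_, op_injective ?_, fun h => ?_, fun h => ?_⟩
    · rw [op_adjoint, hg, Matrix.conjTranspose_mul, unitMat_star, k.hermitian, hP]
    · rw [op_comp, hg, Matrix.mul_assoc, ← Matrix.mul_assoc X.unitMat, ← hP, Matrix.mul_assoc _ _
        X.unitMat, unitMat_mul_self, ← Matrix.mul_assoc, hff]
    · have h1 := hTg f (hcont f)
      rw [h, op_zero, Matrix.mul_zero, ← k.zero] at h1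
      have h2 := k.inj _ _ (hcont _) (hcont _) h1 hxK
      simp only [f, if_true, mul_one] at h2
      exact hx0 h2.symm
    · apply hT' x
      apply op_injective
      rw [h, op_mul_unitMat] at hTf
      rw [hTf, op_smul]

theorem eq_zero_of_comp_adjoint {X Y : Obj N} (f : X ⟶ Y) (h : f ≫ adjoint f = 0) : f = 0 := by
  apply op_injective
  have := congrArg op h
  rw [op_comp, op_adjoint] at this
  exact eq_zero_of_star_mul this

theorem unit_irreducible (f : 𝟙_ (Obj N) ⟶ 𝟙_ (Obj N)) : ∃ c : ℂ, f = c • 𝟙 _ := by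
  obtain ⟨F, hF⟩ : ∃ F : Matrix (Fin 1) (Fin 1) N.alg, F = f.1 := ⟨f.1, rfl⟩
  have h1 : ∀ A : N.alg, A * F 0 0 = F 0 0 * A := by
    intro A
    have h : F * (Matrix.of fun _ _ => A : Matrix (Fin 1) (Fin 1) N.alg) =
        (Matrix.of fun _ _ => A : Matrix (Fin 1) (Fin 1) N.alg) * F := by
      rw [hF]
      exact f.2.2.2 A
    have h' := congrFun (congrFun h 0) 0
    rw [Matrix.mul_apply, Matrix.mul_apply, Fin.sum_univ_one, Fin.sum_univ_one] at h'
    exact h'.symm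
  obtain ⟨c, hc⟩ := N.irreducible (F 0 0 : H →L[ℂ] H) fun A hA => congrArg Subtype.val (h1 ⟨A, hA⟩)
  refine ⟨c, hom_ext (hF.symm.trans ?_)⟩
  have h2 : F = c • (Matrix.of fun _ _ => 1 : Matrix (Fin 1) (Fin 1) N.alg) := by
    ext1 i j
    rw [Subsingleton.elim i 0, Subsingleton.elim j 0]
    exact Subtype.ext hc
  exact h2

theorem nonneg_of_pos_smul {X : Obj N} {E : X ⟶ X} {c : ℂ} (h : IsPos E) (hE : E ≠ 0)
    (hc : IsPos (c • E)) : 0 ≤ c := by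
  rw [IsPos, isPositiveOpMatrix_iff] at h hc
  obtain ⟨x, hx⟩ : ∃ x, ip x (act (op E) x) ≠ 0 := by
    by_contra! h'
    exact hE (op_injective (eq_zero_of_ip h'))
  have h1 := hc x
  rw [op_smul, act_smul, ip_smul] at h1
  have h2 : 0 < ip x (act (op E) x) := lt_of_le_of_ne (h x) hx.symm
  obtain ⟨r, hr⟩ : ∃ r : ℝ, ip x (act (op E) x) = r :=
    ⟨(ip x (act (op E) x)).re, Complex.ext (by simp) (by simp [(Complex.nonneg_iff.1 h2.le).2.symm])⟩
  rw [hr] at h1 h2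
  have hr0 : 0 < r := by exact_mod_cast h2
  have := mul_nonneg h1 (Complex.zero_le_real.2 (inv_pos.2 hr0).le)
  rw [Complex.ofReal_inv, mul_assoc, mul_inv_cancel₀ (by exact_mod_cast hr0.ne'), mul_one] at this
  exact this

theorem mul_hom_comp {X Y Z : Obj N} {A : N.alg} (f : X ⟶ Y) {g : Y ⟶ Z} (h : g.1 * Y.hom A = 0) :
    (f ≫ g).1 * X.hom A = 0 := by
  rw [comp_val, Matrix.mul_assoc, f.2.2.2, ← Matrix.mul_assoc, h, Matrix.zero_mul]

theorem mul_hom_whiskerLeft (X : Obj N) {Y Z : Obj N} {A : N.alg} {f : Y ⟶ Z}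
    (h : f.1 * Y.hom A = 0) : (X ◁ f).1 * (X ⊗ Y).hom A = 0 := by
  have h1 : (X ⊗ Y).hom A = X.toBimod.tensorHom X.idArrow (Y.hom A) :=
    Bimod.tensor_hom X.toBimod Y.toBimod A
  rw [h1, whiskerLeft_val]
  refine (Bimod.tensorHom_mul _ X.idArrow_isArrow _ _).trans ?_
  rw [h]
  apply Bimod.ext_fin
  intro i₂ i₁ j₂ j₁
  rw [Bimod.tensorHom_apply, Matrix.zero_apply, map_zero, Matrix.mul_zero]
  rfl

noncomputable instance [Nontrivial H] : StarTensor (Obj N) where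
  dag f := adjoint f
  dag_dag f := adjoint_adjoint f
  dag_id X := adjoint_id X
  dag_comp f g := adjoint_comp f g
  dag_add f g := hom_ext (Matrix.conjTranspose_add _ _)
  dag_smul c f := hom_ext (Matrix.conjTranspose_smul _ _)
  dag_whiskerLeft X _ _ f := by
    rw [← id_tensorHom, ← id_tensorHom, adjoint_tensor, adjoint_id]
  dag_whiskerRight f X := by
    rw [← tensorHom_id, ← tensorHom_id, adjoint_tensor, adjoint_id]
  dag_associator X Y Z := adjoint_eqToHom (tensor_assoc X Y Z)
  dag_leftUnitor X := adjoint_eqToHom (unit_tensor X)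
  dag_rightUnitor X := adjoint_eqToHom (tensor_unit X)
  dag_braiding X Y := adjoint_sym X Y
  eq_zero_of_comp_dag f h := eq_zero_of_comp_adjoint f h
  unit_irreducible := unit_irreducible
  unit_ne_zero h := by
    have h1 := congrArg (fun f => ((f.1 (0 : Fin 1) (0 : Fin 1) : N.alg) : H →L[ℂ] H)) h
    exact one_ne_zero (α := H →L[ℂ] H) h1
  Pos T := IsPos T
  pos_id X := by
    have := isPositiveOpMatrix_star_mul X.unitMat
    rwa [unitMat_star, unitMat_mul_self] at this
  pos_add h h' := IsPositiveOpMatrix.add h h'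
  pos_smul hr h := IsPositiveOpMatrix.smul h hr
  pos_conj {X Y T} f h := by
    have := IsPositiveOpMatrix.conj h (op f)
    rw [IsPos, op_comp, op_comp]
    exact this
  pos_whiskerLeft X Y T h := by
    obtain ⟨Q, h1, h2⟩ := exists_sqrt h
    have h3 : X ◁ T = (X ◁ Q) ≫ adjoint (X ◁ Q) := by
      rw [← h2, MonoidalCategory.whiskerLeft_comp, ← id_tensorHom, adjoint_tensor, adjoint_id, h1]
    rw [IsPos, h3, op_comp, op_adjoint]
    exact isPositiveOpMatrix_star_mul _
  pos_antisymm h h' := op_injective (IsPositiveOpMatrix.antisymm h h')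
  nonneg_of_pos_smul := nonneg_of_pos_smul
  exists_sqrt := exists_sqrt
  exists_sub := exists_sub
  exists_proj := exists_proj
  Index := N.alg ⊕ (Σ a : DoubleCone, (N.loc a).commutant)
  kills i {X Y} f := match i with
    | .inl A => f.1 * X.hom A = 0
    | .inr ⟨a, A⟩ => Annihilates a A.1 f
  kills_comp_right {i X Y Z f} g h := match i with
    | .inl A => by
      change (g.1 * f.1) * X.hom A = 0
      rw [Matrix.mul_assoc, show f.1 * X.hom A = 0 from h, Matrix.mul_zero]
    | .inr ⟨a, A⟩ => Annihilates.comp_right g h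
  kills_comp_left {i X Y Z} f {g} h := match i with
    | .inl A => mul_hom_comp f h
    | .inr ⟨a, A⟩ => Annihilates.comp_left A.2 f h
  kills_whiskerLeft {i} X {Y Z f} h := match i with
    | .inl A => mul_hom_whiskerLeft X h
    | .inr ⟨a, A⟩ => Annihilates.whiskerLeft A.2 X h

end Obj

/-- A linear map dominated by another one with values in a Hilbert space factors through it, by an
operator which commutes with the operators that act on both maps. -/
theorem exists_factor {D : Type*} [AddCommGroup D] [Module ℂ D] (f g : D →ₗ[ℂ] H) {C : ℝ}
    (h : ∀ d, ‖g d‖ ≤ C * ‖f d‖) : ∃ y : H →L[ℂ] H, (∀ d, y (f d) = g d) ∧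
      ∀ (s : H →L[ℂ] H), (∃ L : D →ₗ[ℂ] D, ∀ d, f (L d) = s (f d) ∧ g (L d) = s (g d)) →
        (∃ L : D →ₗ[ℂ] D, ∀ d, f (L d) = star s (f d)) → y * s = s * y := by
  let K : Submodule ℂ H := (LinearMap.range f).topologicalClosure
  have : CompleteSpace K := (Submodule.isClosed_topologicalClosure _).completeSpace_coe
  have hK : ∀ d, f d ∈ K := fun d => Submodule.le_topologicalClosure _ ⟨d, rfl⟩
  let e : D →ₗ[ℂ] K := f.codRestrict K hK
  have he : DenseRange e := by
    rw [DenseRange, dense_iff_closure_eq, ← Set.univ_subset_iff]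
    rintro ⟨x, hx⟩ -
    rw [closure_subtype]
    refine closure_mono ?_ hx
    rintro _ ⟨d, rfl⟩
    exact ⟨e d, ⟨d, rfl⟩, rfl⟩
  have hb : ∃ C : ℝ, ∀ d, ‖g d‖ ≤ C * ‖e d‖ := ⟨C, h⟩
  let y : H →L[ℂ] H := (g.extendOfNorm e).comp K.orthogonalProjectionOnto
  have hy : ∀ d, y (f d) = g d := fun d => by
    change g.extendOfNorm e (K.orthogonalProjectionOnto (e d : H)) = g d
    rw [Submodule.orthogonalProjectionOnto_mem_subspace_eq_self, LinearMap.extendOfNorm_eq he hb]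
  have hy0 : ∀ v ∈ Kᗮ, y v = 0 := fun v hv => by
    change g.extendOfNorm e (K.orthogonalProjectionOnto v) = 0
    rw [Submodule.orthogonalProjectionOnto_eq_zero_iff.2 hv, map_zero]
  refine ⟨y, hy, fun s hs hs' => ?_⟩
  obtain ⟨L, hL⟩ := hs
  obtain ⟨L', hL'⟩ := hs'
  have h1 : ∀ v ∈ K, (y * s) v = (s * y) v := by
    intro v hv
    have hcl : IsClosed {v | (y * s) v = (s * y) v} := isClosed_eq (by fun_prop) (by fun_prop)
    refine closure_minimal ?_ hcl hv
    rintro _ ⟨d, rfl⟩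
    change y (s (f d)) = s (y (f d))
    rw [← (hL d).1, hy, hy, (hL d).2]
  have h2 : ∀ v ∈ Kᗮ, (y * s) v = (s * y) v := by
    intro v hv
    change y (s v) = s (y v)
    rw [hy0 v hv, map_zero, hy0]
    rw [Submodule.mem_orthogonal]
    intro k hk
    have hcl : IsClosed {k : H | inner ℂ k (s v) = 0} := isClosed_eq (by fun_prop) (by fun_prop)
    refine closure_minimal ?_ hcl hk
    rintro _ ⟨d, rfl⟩
    change inner ℂ (f d) (s v) = 0
    rw [← ContinuousLinearMap.adjoint_inner_left, ← ContinuousLinearMap.star_eq_adjoint, ← hL' d]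
    exact (Submodule.mem_orthogonal K v).1 hv _ (hK _)
  ext v
  have h3 : v = K.starProjection v + (v - K.starProjection v) := by abel
  rw [h3, map_add, map_add, h1 _ (Submodule.starProjection_apply_mem K v),
    h2 _ (Submodule.sub_starProjection_mem_orthogonal v)]

section Reduced

variable {n : ℕ}

/-- The vector `s (M x) i`. -/
noncomputable def coordMap (M : Matrix (Fin n) (Fin n) (H →L[ℂ] H)) (s : H →L[ℂ] H) (i : Fin n) :
    (Fin n → H) →ₗ[ℂ] H where
  toFun x := s (act M x i)
  map_add' x y := by simp [act, Finset.sum_add_distrib]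
  map_smul' c x := by simp [act, Finset.smul_sum]

theorem coordMap_apply (M : Matrix (Fin n) (Fin n) (H →L[ℂ] H)) (s : H →L[ℂ] H) (i : Fin n) (x) :
    coordMap M s i x = s (act M x i) := rfl

theorem act_single_same (i j : Fin n) (c : H →L[ℂ] H) (w : Fin n → H) :
    act (Matrix.single i j c) w i = c (w j) := by
  rw [act, Finset.sum_eq_single j]
  · rw [Matrix.single_apply_same]
  · intro k _ hk
    exact congrArg (fun z : H →L[ℂ] H => z (w k)) (Matrix.single_apply_of_col_ne i i hk.symm c)
  · simp

theorem act_single_of_ne {i k : Fin n} (hk : k ≠ i) (j : Fin n) (c : H →L[ℂ] H) (w : Fin n → H) :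
    act (Matrix.single i j c) w k = 0 := by
  rw [act, Finset.sum_eq_zero]
  intro l _
  exact congrArg (fun z : H →L[ℂ] H => z (w l)) (Matrix.single_apply_of_row_ne hk.symm j l c)

theorem ip_act_single (i j : Fin n) (c : H →L[ℂ] H) (v w : Fin n → H) :
    ip v (act (Matrix.single i j c) w) = inner ℂ (v i) (c (w j)) := by
  rw [ip, Finset.sum_eq_single i]
  · rw [act_single_same]
  · intro k _ hk
    rw [act_single_of_ne hk, inner_zero_right]
  · simp

theorem inner_coordMap (M : Matrix (Fin n) (Fin n) (H →L[ℂ] H)) (s t : H →L[ℂ] H) (i j : Fin n)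
    (x z) : inner ℂ (coordMap M s i x) (coordMap M t j z) =
      ip x (act (Mᴴ * Matrix.single i j (star s * t) * M) z) := by
  rw [act_mul, act_mul, ip_act Mᴴ, Matrix.conjTranspose_conjTranspose, ip_act_single,
    ContinuousLinearMap.star_eq_adjoint]
  exact (ContinuousLinearMap.adjoint_inner_right _ _ _).symm

/-- The commutant theorem for a reduced algebra. -/
theorem exists_eq_amp_mul {S : Set (H →L[ℂ] H)} (h1 : 1 ∈ S) (hmul : ∀ s ∈ S, ∀ t ∈ S, s * t ∈ S)
    (hstar : ∀ s ∈ S, star s ∈ S) {P T : Matrix (Fin n) (Fin n) (H →L[ℂ] H)} (hP : Pᴴ = P)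
    (hPP : P * P = P) (hTP : T * P = T) (hPT : P * T = T)
    (hT : ∀ s ∈ S, ∀ i j, Commute T (P * Matrix.single i j s * P)) :
    ∃ y : H →L[ℂ] H, (∀ s ∈ S, y * s = s * y) ∧ T = amp n y * P := by
  obtain ⟨C, hC, hpos⟩ := exists_bound (M := Tᴴ * T) (by
    rw [Matrix.conjTranspose_mul, Matrix.conjTranspose_conjTranspose])
  have hTs : P * Tᴴ = Tᴴ := by
    rw [← hP, ← Matrix.conjTranspose_mul, hTP]
  have hpos' := hpos.conj P
  have e1 : Pᴴ * ((C : ℂ) • (1 : Matrix (Fin n) (Fin n) (H →L[ℂ] H)) - Tᴴ * T) * P =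
      (C : ℂ) • P - Tᴴ * T := by
    rw [hP, Matrix.mul_sub, Matrix.sub_mul, Matrix.mul_smul, Matrix.mul_one, Matrix.smul_mul, hPP,
      ← Matrix.mul_assoc P, hTs, Matrix.mul_assoc, hTP]
  rw [e1] at hpos'
  obtain ⟨R, hR1, hR2, hR3⟩ := hpos'.exists_sqrt
  have hTc : ∀ s ∈ S, ∀ i j, Commute (Tᴴ * T) (P * Matrix.single i j s * P) := by
    intro s hs i j
    refine Commute.mul_left ?_ (hT s hs i j)
    have h2 := congrArg Matrix.conjTranspose (hT (star s) (hstar s hs) j i).eq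
    simp only [Matrix.conjTranspose_mul, hP, Matrix.conjTranspose_single, star_star] at h2
    rw [commute_iff_eq, ← Matrix.mul_assoc] at *
    rw [h2]
    simp only [Matrix.mul_assoc]
  have hRc : ∀ s ∈ S, ∀ i j, Commute R (P * Matrix.single i j s * P) := by
    intro s hs i j
    refine hR3 _ (Commute.sub_left (Commute.smul_left ?_ _) (hTc s hs i j))
    rw [commute_iff_eq]
    simp only [← Matrix.mul_assoc, hPP]
    rw [Matrix.mul_assoc _ P P, hPP]
  have hRP : R * P = P * R ∧ True := by
    refine ⟨(hR3 P (Commute.sub_left (Commute.smul_left (Commute.refl P) _) ?_)).eq, trivial⟩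
    rw [commute_iff_eq, Matrix.mul_assoc, hTP, ← Matrix.mul_assoc, hTs]
  have key : ∀ s ∈ S, ∀ i j, Tᴴ * Matrix.single i j s * T + (R * P)ᴴ * Matrix.single i j s * (R * P)
      = (C : ℂ) • (Pᴴ * Matrix.single i j s * P) := by
    intro s hs i j
    set Z := P * Matrix.single i j s * P with hZ
    have hPZ : P * Z = Z := by rw [hZ]; simp only [← Matrix.mul_assoc, hPP]
    have hZP : Z * P = Z := by rw [hZ, Matrix.mul_assoc _ P P, hPP]
    have e2 : Tᴴ * Matrix.single i j s * T = Tᴴ * T * Z := by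
      have : Tᴴ * Matrix.single i j s * T = Tᴴ * (Z * T) := by
        rw [hZ, Matrix.mul_assoc _ P T, hPT, ← Matrix.mul_assoc Tᴴ, ← Matrix.mul_assoc Tᴴ,
          show Tᴴ * P = Tᴴ by rw [← hP, ← Matrix.conjTranspose_mul, hPT]]
      rw [this, ← (hT s hs i j).eq]
      exact (Matrix.mul_assoc _ _ _).symm
    have e3 : (R * P)ᴴ * Matrix.single i j s * (R * P) = R * R * Z := by
      rw [hRP.1, Matrix.conjTranspose_mul, hP, hR1]
      have : R * P * Matrix.single i j s * (P * R) = R * (Z * R) := by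
        rw [hZ]; simp only [Matrix.mul_assoc]
      rw [this, ← (hRc s hs i j).eq]
      exact (Matrix.mul_assoc _ _ _).symm
    rw [e2, e3, hR2, hP, ← hZ, ← Matrix.add_mul, add_sub_cancel, Matrix.smul_mul, hPZ]
  let D := (S × Fin n) →₀ (Fin n → H)
  let F : Matrix (Fin n) (Fin n) (H →L[ℂ] H) → D →ₗ[ℂ] H := fun M =>
    Finsupp.lsum ℂ fun p : S × Fin n => coordMap M p.1 p.2
  have hF : ∀ M (p : S × Fin n) x, F M (Finsupp.single p x) = coordMap M p.1 p.2 x := fun M p x => by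
    exact Finsupp.lsum_single ..
  have hin : ∀ d d' : D, inner ℂ (F T d) (F T d') + inner ℂ (F (R * P) d) (F (R * P) d') =
      (C : ℂ) * inner ℂ (F P d) (F P d') := by
    intro d d'
    induction d using Finsupp.induction_linear with
    | zero => simp
    | add d₁ d₂ h₁ h₂ =>
      simp only [map_add, inner_add_left, mul_add]
      rw [← h₁, ← h₂]
      ring
    | single p x =>
      induction d' using Finsupp.induction_linear with
      | zero => simp
      | add d₁ d₂ h₁ h₂ =>
        simp only [map_add, inner_add_right, mul_add]
        rw [← h₁, ← h₂]
        ring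
      | single q z =>
        rw [hF, hF, hF, hF, hF, hF, inner_coordMap, inner_coordMap, inner_coordMap, ← ip_add,
          ← act_add, key _ (hmul _ (hstar _ p.1.2) _ q.1.2), act_smul, ip_smul]
  have hbound : ∀ d, ‖F T d‖ ≤ √C * ‖F P d‖ := by
    intro d
    have h2 := hin d d
    simp only [inner_self_eq_norm_sq_to_K] at h2
    have h3 : ‖F T d‖ ^ 2 + ‖F (R * P) d‖ ^ 2 = C * ‖F P d‖ ^ 2 := by
      apply Complex.ofReal_injective
      push_cast
      exact h2
    refine le_of_sq_le_sq ?_ (by positivity)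
    rw [mul_pow, Real.sq_sqrt hC]
    nlinarith [sq_nonneg ‖F (R * P) d‖]
  obtain ⟨y, hy1, hy2⟩ := exists_factor (F P) (F T) hbound
  have hL : ∀ s ∈ S, ∃ L : D →ₗ[ℂ] D, ∀ M d, F M (L d) = s (F M d) := by
    intro s hs
    refine ⟨Finsupp.lmapDomain _ ℂ fun p : S × Fin n => (⟨s * p.1, hmul s hs _ p.1.2⟩, p.2),
      fun M d => ?_⟩
    induction d using Finsupp.induction_linear with
    | zero => simp
    | add d₁ d₂ h₁ h₂ => rw [map_add, map_add, map_add, map_add, h₁, h₂]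
    | single p x =>
      rw [Finsupp.lmapDomain_apply, Finsupp.mapDomain_single, hF, hF]
      rfl
  refine ⟨y, fun s hs => ?_, ?_⟩
  · obtain ⟨L, hL1⟩ := hL s hs
    obtain ⟨L', hL2⟩ := hL _ (hstar s hs)
    exact hy2 s ⟨L, fun d => ⟨hL1 P d, hL1 T d⟩⟩ ⟨L', fun d => hL2 P d⟩
  · rw [← sub_eq_zero]
    refine eq_zero_of_act fun x => ?_
    funext i
    have h2 := hy1 (Finsupp.single (⟨1, h1⟩, i) x)
    rw [hF, hF, coordMap_apply, coordMap_apply] at h2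
    rw [sub_eq_add_neg, act_add, act_neg, act_mul, Pi.add_apply, Pi.neg_apply, Pi.zero_apply]
    have h3 : act (amp n y) (act P x) i = y (act P x i) := by
      rw [act, Finset.sum_eq_single i]
      · rw [amp_def, Matrix.diagonal_apply_eq]
      · intro j _ hj
        rw [amp_def, Matrix.diagonal_apply_ne _ hj.symm]
        rfl
      · simp
    rw [h3]
    change (act T x i) + -(y (act P x i)) = 0
    have h4 : y (act P x i) = act T x i := h2
    rw [h4, add_neg_cancel]

end Reduced

namespace Obj

/-! ## Simple objects -/

theorem IsSimple.exists_sign {γ : Obj N} (h : γ.IsSimple) :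
    ∃ s : ℂ, s * s = 1 ∧ star s = s ∧ sym γ γ = s • 𝟙 (γ ⊗ γ) := by
  rcases h with h | h
  · refine ⟨1, by simp, by simp, hom_ext ?_⟩
    rw [one_smul]
    exact h
  · refine ⟨-1, by simp, by simp, hom_ext ?_⟩
    rw [neg_one_smul]
    exact h

section

variable {γ δ : Obj N} {o a : DoubleCone} (hγ : γ.LocalizedIn o) (hδ : δ.LocalizedIn a)
  (h : o.Perp a) {U : γ ⟶ δ}

include hγ hδ h

theorem sign_entry {s : ℂ} (hs : s * s = 1) (hsym : sym γ γ = s • 𝟙 (γ ⊗ γ)) (p k r r') :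
    γ.hom (U.1 p k) r r' = s • (γ.idArrow r k * U.1 p r') := by
  have h1 : (𝟙 γ ⊗ₘ U) = s • ((U ⊗ₘ 𝟙 γ) ≫ sym δ γ) := by
    have h2 := sym_naturality (𝟙 γ) U
    rw [hsym] at h2
    have h3 : s • ((𝟙 γ ⊗ₘ U) ≫ sym γ δ) = U ⊗ₘ 𝟙 γ := by
      rw [h2, Linear.smul_comp, smul_smul, hs, one_smul, Category.id_comp]
    rw [← h3, Linear.smul_comp, smul_smul, hs, one_smul, Category.assoc, sym_sym,
      Category.comp_id]
  have h4 : (𝟙 γ ⊗ₘ U).1 (finProdFinEquiv (p, r)) (finProdFinEquiv (k, r')) =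
      γ.hom (U.1 p k) r r' := by
    rw [tensorHom_apply_val]
    have : γ.idArrow * γ.hom (U.1 p k) = γ.hom (U.1 p k) := by
      change γ.hom 1 * γ.hom (U.1 p k) = γ.hom (U.1 p k)
      rw [← map_mul, one_mul]
    exact congrFun (congrFun this r) r'
  have h5 : ∀ x y, (U ⊗ₘ 𝟙 γ).1 (finProdFinEquiv (x, y)) (finProdFinEquiv (k, r')) =
      γ.idArrow x k * U.1 y r' := by
    intro x y
    rw [tensorHom_apply_val]
    have h6 : U.1 * γ.hom (γ.idArrow x k) = δ.hom (γ.idArrow x k) * U.1 := U.2.2.2 _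
    refine (congrFun (congrFun h6 y) r').trans ?_
    have h7 : δ.hom (γ.idArrow x k) = amp δ.n (γ.idArrow x k) * δ.idArrow := by
      ext1 i j
      rw [amp_mul_apply]
      exact hom_apply_of_perp h.symm hδ (idArrow_entry_mem hγ x k) i j
    rw [h7, Matrix.mul_assoc, amp_mul_apply]
    have h8 : δ.idArrow * U.1 = U.1 := U.2.2.1
    rw [h8]
  rw [← h4, h1]
  change s • (((sym δ γ).1 * (U ⊗ₘ 𝟙 γ).1 : Matrix _ _ N.alg) (finProdFinEquiv (p, r))
    (finProdFinEquiv (k, r'))) = _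
  congr 1
  refine (Matrix.mul_apply (M := (sym δ γ).1)).trans ((sum_fin_prod (m := γ.n) (n := δ.n) _).trans ?_)
  simp only [h5, sym_localized h.symm hδ hγ]
  have h9 : ∀ x y, δ.idArrow p y * γ.idArrow r x * (γ.idArrow x k * U.1 y r') =
      (γ.idArrow r x * γ.idArrow x k) * (δ.idArrow p y * U.1 y r') := by
    intro x y
    have e1 := N.commute h (idArrow_entry_mem hγ r x) (idArrow_entry_mem hδ p y)
    have e2 := N.commute h (idArrow_entry_mem hγ x k) (idArrow_entry_mem hδ p y)
    rw [← e1, mul_assoc, ← mul_assoc (δ.idArrow p y), ← e2]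
    simp only [mul_assoc]
  simp only [h9, ← Finset.mul_sum, ← Finset.sum_mul]
  have h8 : δ.idArrow * U.1 = U.1 := U.2.2.1
  have h10 := γ.idArrow_mul_self
  rw [← Matrix.mul_apply (M := γ.idArrow), ← Matrix.mul_apply (M := δ.idArrow), h10, h8]

theorem sign_val (hU : Unitary U) {s : ℂ} (hs : s * s = 1) (hsym : sym γ γ = s • 𝟙 (γ ⊗ γ))
    (p k r q) : (γ.val (U.1 p k) * (op U)ᴴ) r q = s • (γ.unitMat r k * δ.unitMat p q) := by
  rw [Matrix.mul_apply]
  have h1 : ∀ x, γ.val (U.1 p k) r x = s • (γ.unitMat r k * op U p x) := fun x =>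
    congrArg (fun A : N.alg => (A : H →L[ℂ] H)) (sign_entry hγ hδ h hs hsym p k r x)
  simp only [h1, smul_mul_assoc, mul_assoc, ← Finset.smul_sum, ← Finset.mul_sum]
  rw [← Matrix.mul_apply (M := op U), hU.op_right]

theorem val_conj (hU : Unitary U) {s : ℂ} (hs : s * s = 1) (hs' : star s = s)
    (hsym : sym γ γ = s • 𝟙 (γ ⊗ γ)) {B : Matrix (Fin γ.n) (Fin γ.n) N.alg}
    (hB : ∀ i j, B i j ∈ outer N a) (hB' : ∀ i j, (B i j : H →L[ℂ] H) ∈ (N.loc a).commutant)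
    (hPB : γ.idArrow * B * γ.idArrow = B) (p p' r r') :
    γ.val ((U.1 * B * U.1ᴴ : Matrix _ _ N.alg) p p') r r' =
      (B r r' : H →L[ℂ] H) * δ.unitMat p p' := by
  have h1 : ∀ k l, γ.val (U.1 p k * B k l * (U.1ᴴ) l p') =
      (γ.val (U.1 p k) * (op U)ᴴ) * amp δ.n (B k l : H →L[ℂ] H) *
        (γ.val (U.1 p' l) * (op U)ᴴ)ᴴ := by
    intro k l
    rw [val_mul, val_mul, Matrix.conjTranspose_apply, val_star, Matrix.conjTranspose_mul,
      Matrix.conjTranspose_conjTranspose]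
    have h2 : γ.val (B k l) = (op U)ᴴ * amp δ.n (B k l : H →L[ℂ] H) * op U := by
      have h3 := op_mul_val U (B k l)
      rw [hB k l δ hδ, Matrix.mul_assoc, unitMat_mul_op] at h3
      rw [← unitMat_mul_val, ← hU.op_left, Matrix.mul_assoc, h3, Matrix.mul_assoc]
    rw [h2]
    simp only [Matrix.mul_assoc]
  have h4 : ∀ k l, γ.val (U.1 p k * B k l * (U.1ᴴ) l p') r r' =
      γ.unitMat r k * (B k l : H →L[ℂ] H) * γ.unitMat l r' * δ.unitMat p p' := by
    intro k l
    rw [h1, Matrix.mul_apply]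
    simp only [mul_amp_apply, Matrix.conjTranspose_apply, sign_val hγ hδ h hU hs hsym]
    have e1 : ∀ x, s • (γ.unitMat r k * δ.unitMat p x) * (B k l : H →L[ℂ] H) *
        star (s • (γ.unitMat r' l * δ.unitMat p' x)) =
        γ.unitMat r k * (B k l : H →L[ℂ] H) * γ.unitMat l r' * (δ.unitMat p x * δ.unitMat x p') := by
      intro x
      have e2 : star (γ.unitMat r' l) = γ.unitMat l r' := congrFun (congrFun γ.unitMat_star l) r'
      have e3 : star (δ.unitMat p' x) = δ.unitMat x p' := congrFun (congrFun δ.unitMat_star x) p'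
      have e4 : (B k l : H →L[ℂ] H) * δ.unitMat p x = δ.unitMat p x * B k l :=
        commutant_comm (hB' k l) (idArrow_entry_mem hδ p x)
      have e5 : γ.unitMat l r' * δ.unitMat p x = δ.unitMat p x * γ.unitMat l r' :=
        commutant_comm (loc_le_commutant h (idArrow_entry_mem hγ l r')) (idArrow_entry_mem hδ p x)
      have e6 : γ.unitMat l r' * δ.unitMat x p' = δ.unitMat x p' * γ.unitMat l r' :=
        commutant_comm (loc_le_commutant h (idArrow_entry_mem hγ l r')) (idArrow_entry_mem hδ x p')
      rw [star_smul, star_mul, e2, e3, hs', smul_mul_assoc, smul_mul_smul_comm, hs, one_smul,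
        ← e6, mul_assoc (γ.unitMat r k) _ (B k l : H →L[ℂ] H), ← e4]
      simp only [mul_assoc]
      rw [← mul_assoc (δ.unitMat p x), ← e5]
      simp only [mul_assoc]
    simp only [e1, ← Finset.mul_sum]
    rw [← Matrix.mul_apply (M := δ.unitMat), unitMat_mul_self]
  have h5 : ((U.1 * B * U.1ᴴ : Matrix _ _ N.alg) p p') =
      ∑ l, ∑ k, U.1 p k * B k l * (U.1ᴴ) l p' := by
    rw [Matrix.mul_apply]
    refine Finset.sum_congr rfl fun l _ => ?_
    rw [Matrix.mul_apply, Finset.sum_mul]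
  have h6 : (B r r' : H →L[ℂ] H) = ∑ l, ∑ k, γ.unitMat r k * (B k l : H →L[ℂ] H) * γ.unitMat l r' := by
    have h7 : γ.unitMat * coeMat B * γ.unitMat = coeMat B := by
      rw [unitMat_def, ← coeMat_mul, ← coeMat_mul, hPB]
    have h8 := congrFun (congrFun h7 r) r'
    refine h8.symm.trans ?_
    rw [Matrix.mul_apply]
    refine Finset.sum_congr rfl fun l _ => ?_
    rw [Matrix.mul_apply, Finset.sum_mul]
    rfl
  rw [h5, h6, Finset.sum_mul]
  have h9 : ∀ A : N.alg, γ.val A = γ.valHom A := fun _ => rfl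
  rw [h9, map_sum, Matrix.sum_apply]
  refine Finset.sum_congr rfl fun l _ => ?_
  rw [map_sum, Matrix.sum_apply, Finset.sum_mul]
  exact Finset.sum_congr rfl fun k _ => h4 k l

end

/-- The quasilocal observables on which the objects localized in `a` act trivially and which commute
with the observables of `a`. -/
def exterior (N : Net H) (a : DoubleCone) : Set (H →L[ℂ] H) :=
  {s | ∃ A : N.alg, (A : H →L[ℂ] H) = s ∧ A ∈ outer N a ∧ star A ∈ outer N a ∧
    s ∈ (N.loc a).commutant}

theorem one_mem_exterior (a : DoubleCone) : (1 : H →L[ℂ] H) ∈ exterior N a := by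
  have h : (1 : N.alg) ∈ outer N a := fun X _ => by
    rw [val_one]
    change _ = amp X.n 1 * _
    rw [map_one, Matrix.one_mul]
  exact ⟨1, rfl, h, by rwa [star_one], one_mem _⟩

theorem mul_mem_exterior {a : DoubleCone} {s t : H →L[ℂ] H} (hs : s ∈ exterior N a)
    (ht : t ∈ exterior N a) : s * t ∈ exterior N a := by
  obtain ⟨A, rfl, h1, h2, h3⟩ := hs
  obtain ⟨B, rfl, k1, k2, k3⟩ := ht
  exact ⟨A * B, rfl, outer_mul h1 k1, by rw [star_mul]; exact outer_mul k2 h2, mul_mem h3 k3⟩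

theorem star_mem_exterior {a : DoubleCone} {s : H →L[ℂ] H} (hs : s ∈ exterior N a) :
    star s ∈ exterior N a := by
  obtain ⟨A, rfl, h1, h2, h3⟩ := hs
  exact ⟨star A, rfl, h2, by rwa [star_star], star_mem h3⟩

theorem loc_subset_exterior {a b : DoubleCone} (h : b.Perp a) {s : H →L[ℂ] H} (hs : s ∈ N.loc b) :
    s ∈ exterior N a :=
  ⟨⟨s, N.loc_le_alg b hs⟩, rfl, mem_outer h.symm hs, mem_outer h.symm (star_mem hs),
    loc_le_commutant h hs⟩

theorem unitMat_mem_exterior {X : Obj N} {o a : DoubleCone} (hX : X.LocalizedIn o) (h : o.Perp a)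
    (i j) : X.unitMat i j ∈ exterior N a :=
  loc_subset_exterior h (idArrow_entry_mem hX i j)

theorem mul_single_mul_apply {R : Type*} [Semiring R] {n : ℕ} (P Q : Matrix (Fin n) (Fin n) R)
    (i j : Fin n) (s : R) (k l) : (P * Matrix.single i j s * Q) k l = P k i * s * Q j l := by
  rw [Matrix.mul_assoc, Matrix.mul_apply, Finset.sum_eq_single i]
  · rw [Matrix.single_mul_apply_same, mul_assoc]
  · intro x _ hx
    rw [Matrix.single_mul_apply_of_ne _ _ _ _ _ hx, mul_zero]
  · simp

section

variable {γ δ : Obj N} {o a : DoubleCone} (hγ : γ.LocalizedIn o) (hδ : δ.LocalizedIn a)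
  (h : o.Perp a) {U : γ ⟶ δ} (hf : γ.IsFaithful) (hs : γ.IsSimple) (hU : Unitary U)

include hγ hδ h hf hs hU

omit hγ hδ h hs hU in
theorem IsFaithful.val_injective {A B : N.alg} (hAB : γ.val A = γ.val B) : A = B := by
  rw [← sub_eq_zero]
  refine hf _ ?_
  rw [map_sub, sub_eq_zero]
  exact coeMat_injective hAB

theorem conj_comm {B : Matrix (Fin γ.n) (Fin γ.n) N.alg}
    (hB : ∀ i j, B i j ∈ outer N a) (hB' : ∀ i j, (B i j : H →L[ℂ] H) ∈ (N.loc a).commutant)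
    (hPB : γ.idArrow * B * γ.idArrow = B) {C : Matrix (Fin δ.n) (Fin δ.n) N.alg}
    (hC : ∀ i j, (C i j : H →L[ℂ] H) ∈ N.loc a) (hPC : δ.idArrow * C * δ.idArrow = C) :
    Commute (U.1 * B * U.1ᴴ : Matrix _ _ N.alg) C := by
  obtain ⟨s, hs, hs', hsym⟩ := hs.exists_sign
  set X : Matrix (Fin δ.n) (Fin δ.n) N.alg := U.1 * B * U.1ᴴ with hX
  have hv : ∀ p p', γ.val (X p p') = Matrix.of fun r r' => (B r r' : H →L[ℂ] H) * δ.unitMat p p' :=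
    fun p p' => by
      ext1 r r'
      exact val_conj hγ hδ h hU hs hs' hsym hB hB' hPB p p' r r'
  have hCB : ∀ p q r r', (C p q : H →L[ℂ] H) * B r r' = B r r' * C p q := fun p q r r' =>
    (commutant_comm (hB' r r') (hC p q)).symm
  have hPC1 : δ.unitMat * coeMat C = coeMat C := by
    rw [unitMat_def, ← coeMat_mul, ← hPC]
    simp only [← Matrix.mul_assoc, idArrow_mul_self]
  have hPC2 : coeMat C * δ.unitMat = coeMat C := by
    rw [unitMat_def, ← coeMat_mul, ← hPC]
    simp only [Matrix.mul_assoc, idArrow_mul_self]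
  have hPB1 : γ.unitMat * coeMat B = coeMat B := by
    rw [unitMat_def, ← coeMat_mul, ← hPB]
    simp only [← Matrix.mul_assoc, idArrow_mul_self]
  have hPB2 : coeMat B * γ.unitMat = coeMat B := by
    rw [unitMat_def, ← coeMat_mul, ← hPB]
    simp only [Matrix.mul_assoc, idArrow_mul_self]
  rw [commute_iff_eq]
  ext1 p q
  refine hf.val_injective ?_
  have h9 : ∀ A : N.alg, γ.val A = γ.valHom A := fun _ => rfl
  ext1 r r'
  rw [Matrix.mul_apply, Matrix.mul_apply, h9, h9, map_sum, map_sum, Matrix.sum_apply,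
    Matrix.sum_apply]
  have e1 : ∀ x, γ.valHom (X p x * C x q) r r' =
      δ.unitMat p x * (C x q : H →L[ℂ] H) * B r r' := by
    intro x
    rw [← h9, val_mul, val_of_perp' hγ h (hC x q), ← Matrix.mul_assoc, mul_amp_apply, hv]
    have : ((Matrix.of fun r r' => (B r r' : H →L[ℂ] H) * δ.unitMat p x) * γ.unitMat :
        Matrix (Fin γ.n) (Fin γ.n) (H →L[ℂ] H)) r r' = δ.unitMat p x * B r r' := by
      rw [Matrix.mul_apply]
      have e2 : ∀ y, (B r y : H →L[ℂ] H) * δ.unitMat p x * γ.unitMat y r' =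
          δ.unitMat p x * ((B r y : H →L[ℂ] H) * γ.unitMat y r') := fun y => by
        have e3 : (B r y : H →L[ℂ] H) * δ.unitMat p x = δ.unitMat p x * B r y :=
          commutant_comm (hB' r y) (idArrow_entry_mem hδ p x)
        rw [e3, mul_assoc]
      refine (Finset.sum_congr rfl fun y _ => e2 y).trans ?_
      rw [← Finset.mul_sum]
      exact congrArg (δ.unitMat p x * ·) (congrFun (congrFun hPB2 r) r')
    rw [this, mul_assoc, mul_assoc, hCB]
  have e3 : ∀ x, γ.valHom (C p x * X x q) r r' =
      (C p x : H →L[ℂ] H) * δ.unitMat x q * B r r' := by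
    intro x
    rw [← h9, val_mul, val_of_perp hγ h (hC p x), Matrix.mul_assoc, amp_mul_apply, hv]
    have : (γ.unitMat * (Matrix.of fun r r' => (B r r' : H →L[ℂ] H) * δ.unitMat x q) :
        Matrix (Fin γ.n) (Fin γ.n) (H →L[ℂ] H)) r r' = B r r' * δ.unitMat x q := by
      rw [Matrix.mul_apply]
      refine (Finset.sum_congr rfl fun y _ => (mul_assoc _ _ _).symm).trans ?_
      rw [← Finset.sum_mul]
      exact congrArg (· * δ.unitMat x q) (congrFun (congrFun hPB1 r) r')
    have e4 : (B r r' : H →L[ℂ] H) * δ.unitMat x q = δ.unitMat x q * B r r' :=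
      commutant_comm (hB' r r') (idArrow_entry_mem hδ x q)
    rw [this, e4, mul_assoc]
  simp only [e1, e3, ← Finset.sum_mul]
  congr 1
  exact (congrFun (congrFun hPC1 p) q).trans (congrFun (congrFun hPC2 p) q).symm

theorem conj_comm_of_exterior {B : Matrix (Fin γ.n) (Fin γ.n) (H →L[ℂ] H)}
    (hB : ∀ i j, B i j ∈ exterior N a) (hPB : γ.unitMat * B * γ.unitMat = B)
    {C : Matrix (Fin δ.n) (Fin δ.n) (H →L[ℂ] H)} (hC : ∀ i j, C i j ∈ N.loc a)
    (hPC : δ.unitMat * C * δ.unitMat = C) :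
    Commute (op U * B * (op U)ᴴ : Matrix (Fin δ.n) (Fin δ.n) (H →L[ℂ] H)) C := by
  choose B' hB1 hB2 hB3 hB4 using hB
  have e1 : coeMat (Matrix.of B') = B := by
    ext1 i j
    exact hB1 i j
  let C' : Matrix (Fin δ.n) (Fin δ.n) N.alg := Matrix.of fun i j => ⟨C i j, N.loc_le_alg a (hC i j)⟩
  have e2 : coeMat C' = C := rfl
  have h1 := conj_comm hγ hδ h hf hs hU (B := Matrix.of B') (C := C') hB2
    (fun i j => by
      have := hB4 i j
      rw [← hB1 i j] at this
      exact this)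
    (coeMat_injective (by
      rw [coeMat_mul, coeMat_mul, e1]
      exact hPB)) hC
    (coeMat_injective (by
      rw [coeMat_mul, coeMat_mul, e2]
      exact hPC))
  have h2 := congrArg coeMat h1.eq
  simp only [coeMat_mul, e1, e2, coeMat_conjTranspose] at h2
  exact h2

theorem IsSimple.exists_ext_of_unitary {B : Matrix (Fin γ.n) (Fin γ.n) (H →L[ℂ] H)}
    (hB : B ∈ γ.reduced a) : ∃ y ∈ (N.loc a).commutant, γ.ext a y = B := by
  have hmid : ∀ C : Matrix (Fin δ.n) (Fin δ.n) (H →L[ℂ] H), (∀ i j, C i j ∈ N.loc a) →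
      δ.unitMat * C * δ.unitMat = C →
      ∃ z ∈ N.loc a, (op U)ᴴ * C * op U = amp γ.n z * γ.unitMat := by
    intro C hC hPC
    have hT : ∀ s ∈ exterior N a, ∀ i j,
        Commute ((op U)ᴴ * C * op U) (γ.unitMat * Matrix.single i j s * γ.unitMat) := by
      intro s hs' i j
      have h1 : ∀ k l, (γ.unitMat * Matrix.single i j s * γ.unitMat) k l ∈ exterior N a := by
        intro k l
        rw [mul_single_mul_apply]
        exact mul_mem_exterior (mul_mem_exterior (unitMat_mem_exterior hγ h k i) hs')
          (unitMat_mem_exterior hγ h j l)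
      have h2 : γ.unitMat * (γ.unitMat * Matrix.single i j s * γ.unitMat) * γ.unitMat =
          γ.unitMat * Matrix.single i j s * γ.unitMat := by
        simp only [← Matrix.mul_assoc, unitMat_mul_self]
        rw [Matrix.mul_assoc _ γ.unitMat γ.unitMat, unitMat_mul_self]
      have h3 := conj_comm_of_exterior hγ hδ h hf hs hU h1 h2 hC hPC
      generalize γ.unitMat * Matrix.single i j s * γ.unitMat = B at h2 h3
      have hBP : B * γ.unitMat = B := by
        rw [← h2, Matrix.mul_assoc _ γ.unitMat γ.unitMat, unitMat_mul_self]
      have hPB : γ.unitMat * B = B := by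
        rw [← h2]; simp only [← Matrix.mul_assoc, unitMat_mul_self]
      rw [commute_iff_eq] at h3 ⊢
      have h4 := congrArg (fun M => (op U)ᴴ * M * op U) h3
      simp only [Matrix.mul_assoc, hU.op_left] at h4
      simp only [← Matrix.mul_assoc, hU.op_left] at h4
      rw [hPB] at h4
      simp only [Matrix.mul_assoc, hBP] at h4 ⊢
      exact h4.symm
    obtain ⟨z, hz, hz'⟩ := exists_eq_amp_mul (S := exterior N a) (one_mem_exterior a)
      (fun s hs t ht => mul_mem_exterior hs ht) (fun s hs => star_mem_exterior hs)
      (P := γ.unitMat) (T := (op U)ᴴ * C * op U) γ.unitMat_star γ.unitMat_mul_self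
      (by rw [Matrix.mul_assoc _ (op U), op_mul_unitMat])
      (by
        have : γ.unitMat * (op U)ᴴ = (op U)ᴴ := unitMat_mul_op (adjoint U)
        rw [← Matrix.mul_assoc, ← Matrix.mul_assoc, this])
      hT
    exact ⟨z, N.mem_loc_of_commute a fun b hb A hA => hz A (loc_subset_exterior hb hA), hz'⟩
  have hBP : B * γ.unitMat = B := by
    rw [← hB.2, Matrix.mul_assoc _ (coeMat γ.idArrow) γ.unitMat]
    exact congrArg _ γ.unitMat_mul_self
  have hPB : γ.unitMat * B = B := by
    rw [← hB.2, ← Matrix.mul_assoc, ← Matrix.mul_assoc]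
    exact congrArg (· * B * coeMat γ.idArrow) γ.unitMat_mul_self
  have hT : ∀ s ∈ {s | s ∈ N.loc a}, ∀ i j,
      Commute (op U * B * (op U)ᴴ : Matrix (Fin δ.n) (Fin δ.n) (H →L[ℂ] H))
        (δ.unitMat * Matrix.single i j s * δ.unitMat) := by
    intro s hs' i j
    have h1 : ∀ k l, (δ.unitMat * Matrix.single i j s * δ.unitMat) k l ∈ N.loc a := by
      intro k l
      rw [mul_single_mul_apply]
      exact mul_mem (mul_mem (idArrow_entry_mem hδ k i) hs') (idArrow_entry_mem hδ j l)
    have h2 : δ.unitMat * (δ.unitMat * Matrix.single i j s * δ.unitMat) * δ.unitMat =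
        δ.unitMat * Matrix.single i j s * δ.unitMat := by
      simp only [← Matrix.mul_assoc, unitMat_mul_self]
      rw [Matrix.mul_assoc _ δ.unitMat δ.unitMat, unitMat_mul_self]
    generalize δ.unitMat * Matrix.single i j s * δ.unitMat = C at h1 h2
    obtain ⟨z, hz, hz'⟩ := hmid C h1 h2
    have hCP : C * δ.unitMat = C := by
      rw [← h2, Matrix.mul_assoc _ δ.unitMat δ.unitMat, unitMat_mul_self]
    have hPC : δ.unitMat * C = C := by
      rw [← h2]; simp only [← Matrix.mul_assoc, unitMat_mul_self]
    have h3 : (op U)ᴴ * C * op U * B = B * ((op U)ᴴ * C * op U) := by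
      have e1 : amp γ.n z * γ.unitMat = γ.unitMat * amp γ.n z := amp_comm fun k l =>
        (commutant_comm (loc_le_commutant h (idArrow_entry_mem hγ k l)) hz).symm
      have e2 : amp γ.n z * B = B * amp γ.n z := amp_comm fun k l =>
        (commutant_comm (hB.1 k l) hz).symm
      rw [hz', Matrix.mul_assoc, hPB, e1, ← Matrix.mul_assoc, hBP, e2]
    have h4 := congrArg (fun M => op U * M * (op U)ᴴ) h3
    simp only [Matrix.mul_assoc, hU.op_right] at h4
    simp only [← Matrix.mul_assoc, hU.op_right] at h4
    rw [commute_iff_eq]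
    rw [hPC] at h4
    simp only [Matrix.mul_assoc, hCP] at h4 ⊢
    exact h4.symm
  obtain ⟨y, hy, hy'⟩ := exists_eq_amp_mul (S := {s | s ∈ N.loc a}) (one_mem (N.loc a))
      (fun s hs t ht => mul_mem (S := VonNeumannAlgebra H) hs ht)
      (fun s hs => star_mem (S := VonNeumannAlgebra H) hs)
      (P := δ.unitMat) (T := op U * B * (op U)ᴴ) δ.unitMat_star δ.unitMat_mul_self
      (by
        have : (op U)ᴴ * δ.unitMat = (op U)ᴴ := op_mul_unitMat (adjoint U)
        rw [Matrix.mul_assoc _ (op U)ᴴ, this])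
      (by rw [← Matrix.mul_assoc, ← Matrix.mul_assoc, unitMat_mul_op])
      hT
  have hyc := mem_commutant_of hy
  refine ⟨y, hyc, ?_⟩
  have h5 : (op U)ᴴ * (op U * B * (op U)ᴴ) * op U = B := by
    simp only [Matrix.mul_assoc, hU.op_left]
    simp only [← Matrix.mul_assoc, hU.op_left]
    rw [hPB, hBP]
  rw [hy'] at h5
  rw [ext_eq hδ hU hyc]
  simp only [Matrix.mul_assoc, unitMat_mul_op] at h5 ⊢
  exact h5

end

/-- For a faithful simple object, the component of the extension is onto. -/
theorem IsSimple.exists_ext {γ : Obj N} {o a : DoubleCone} (hγ : γ.LocalizedIn o) (h : o.Perp a)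
    (hf : γ.IsFaithful) (hs : γ.IsSimple) {B : Matrix (Fin γ.n) (Fin γ.n) (H →L[ℂ] H)}
    (hB : B ∈ γ.reduced a) : ∃ y ∈ (N.loc a).commutant, γ.ext a y = B := by
  obtain ⟨δ, U, hδ, hU⟩ := γ.exists_transport a
  exact hs.exists_ext_of_unitary hγ hδ h hf hU hB

/-! ## The reduced algebras -/

theorem unitMat_mul_of_mem_reduced {X : Obj N} {a : DoubleCone}
    {B : Matrix (Fin X.n) (Fin X.n) (H →L[ℂ] H)} (hB : B ∈ X.reduced a) : X.unitMat * B = B := by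
  rw [← hB.2, ← Matrix.mul_assoc, ← Matrix.mul_assoc]
  exact congrArg (· * B * coeMat X.idArrow) X.unitMat_mul_self

theorem mul_unitMat_of_mem_reduced {X : Obj N} {a : DoubleCone}
    {B : Matrix (Fin X.n) (Fin X.n) (H →L[ℂ] H)} (hB : B ∈ X.reduced a) : B * X.unitMat = B := by
  rw [← hB.2, Matrix.mul_assoc _ (coeMat X.idArrow) X.unitMat]
  exact congrArg _ X.unitMat_mul_self

theorem mem_reduced_of {X : Obj N} {a : DoubleCone} {B : Matrix (Fin X.n) (Fin X.n) (H →L[ℂ] H)}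
    (h : ∀ i j, B i j ∈ (N.loc a).commutant) (h1 : X.unitMat * B = B) (h2 : B * X.unitMat = B) :
    B ∈ X.reduced a := by
  refine ⟨h, ?_⟩
  change X.unitMat * B * X.unitMat = B
  rw [h1, h2]

theorem matrix_mul_mem_commutant {a : DoubleCone} {l m n : ℕ}
    {B : Matrix (Fin l) (Fin m) (H →L[ℂ] H)} {C : Matrix (Fin m) (Fin n) (H →L[ℂ] H)}
    (hB : ∀ i j, B i j ∈ (N.loc a).commutant) (hC : ∀ i j, C i j ∈ (N.loc a).commutant) (i j) :
    (B * C) i j ∈ (N.loc a).commutant := by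
  rw [Matrix.mul_apply]
  exact sum_mem fun k _ => mul_mem (hB i k) (hC k j)

theorem matrix_star_mem_commutant {a : DoubleCone} {m n : ℕ}
    {B : Matrix (Fin m) (Fin n) (H →L[ℂ] H)}
    (hB : ∀ i j, B i j ∈ (N.loc a).commutant) (i j) : Bᴴ i j ∈ (N.loc a).commutant :=
  star_mem (S := VonNeumannAlgebra H) (hB j i)

theorem mul_mem_reduced {X : Obj N} {a : DoubleCone} {B C : Matrix (Fin X.n) (Fin X.n) (H →L[ℂ] H)}
    (hB : B ∈ X.reduced a) (hC : C ∈ X.reduced a) : B * C ∈ X.reduced a :=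
  mem_reduced_of (matrix_mul_mem_commutant hB.1 hC.1)
    (by rw [← Matrix.mul_assoc, unitMat_mul_of_mem_reduced hB])
    (by rw [Matrix.mul_assoc, mul_unitMat_of_mem_reduced hC])

theorem star_mem_reduced {X : Obj N} {a : DoubleCone} {B : Matrix (Fin X.n) (Fin X.n) (H →L[ℂ] H)}
    (hB : B ∈ X.reduced a) : Bᴴ ∈ X.reduced a := by
  refine mem_reduced_of (matrix_star_mem_commutant hB.1) ?_ ?_
  · nth_rewrite 1 [← X.unitMat_star]
    rw [← Matrix.conjTranspose_mul, mul_unitMat_of_mem_reduced hB]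
  · nth_rewrite 1 [← X.unitMat_star]
    rw [← Matrix.conjTranspose_mul, unitMat_mul_of_mem_reduced hB]

theorem ext_mem_reduced {X : Obj N} {o a : DoubleCone} (hX : X.LocalizedIn o) (h : o.Perp a)
    {A : H →L[ℂ] H} (hA : A ∈ (N.loc a).commutant) : X.ext a A ∈ X.reduced a :=
  mem_reduced_of (ext_entry_mem hX h hA) (unitMat_mul_ext X hA) (ext_mul_unitMat X hA)

theorem op_mem_reduced {X : Obj N} {o a : DoubleCone} (hX : X.LocalizedIn o) (h : o.Perp a)
    (f : X ⟶ X) : op f ∈ X.reduced a :=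
  mem_reduced_of (op_mem_commutant h hX hX f) (unitMat_mul_op f) (op_mul_unitMat f)

theorem commutant_mono {a b : DoubleCone} (h : a.Sub b) {A : H →L[ℂ] H}
    (hA : A ∈ (N.loc b).commutant) : A ∈ (N.loc a).commutant :=
  mem_commutant_of fun _ hB => commutant_comm hA (N.isotony a b h hB)

theorem reduced_mono {X : Obj N} {a b : DoubleCone} (h : a.Sub b)
    {B : Matrix (Fin X.n) (Fin X.n) (H →L[ℂ] H)} (hB : B ∈ X.reduced b) : B ∈ X.reduced a :=
  ⟨fun i j => commutant_mono h (hB.1 i j), hB.2⟩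

/-! ## Block matrices -/

/-- A block of a block matrix. -/
def block {R : Type*} {m n k l : ℕ} (M : Matrix (Fin (m * n)) (Fin (k * l)) R) (i : Fin m)
    (j : Fin k) : Matrix (Fin n) (Fin l) R :=
  Matrix.of fun p q => M (finProdFinEquiv (i, p)) (finProdFinEquiv (j, q))

theorem block_injective {R : Type*} {m n k l : ℕ} {M M' : Matrix (Fin (m * n)) (Fin (k * l)) R}
    (h : ∀ i j, block M i j = block M' i j) : M = M' := by
  ext1 x y
  obtain ⟨⟨i, p⟩, rfl⟩ := finProdFinEquiv.surjective x
  obtain ⟨⟨j, q⟩, rfl⟩ := finProdFinEquiv.surjective y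
  exact congrFun (congrFun (h i j) p) q

theorem block_mul {R : Type*} [Semiring R] {m n k l p q : ℕ}
    (M : Matrix (Fin (m * n)) (Fin (k * l)) R) (M' : Matrix (Fin (k * l)) (Fin (p * q)) R) (i j) :
    block (M * M') i j = ∑ x, block M i x * block M' x j := by
  ext1 s t
  rw [Matrix.sum_apply]
  refine (Matrix.mul_apply (M := M)).trans ((sum_fin_prod (m := k) (n := l) _).trans ?_)
  refine Finset.sum_congr rfl fun x _ => ?_
  rw [Matrix.mul_apply]
  rfl

theorem block_conjTranspose {R : Type*} [Star R] {m n k l : ℕ}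
    (M : Matrix (Fin (m * n)) (Fin (k * l)) R) (i j) : block Mᴴ i j = (block M j i)ᴴ := rfl

theorem block_extMat (X : Obj N) (a : DoubleCone) {m n : ℕ}
    (B : Matrix (Fin m) (Fin n) (H →L[ℂ] H)) (i j) : block (X.extMat a B) i j = X.ext a (B i j) := by
  ext1 p q
  exact extMat_apply X a B i p j q

/-- The block matrix with given blocks. -/
def ofBlocks {R : Type*} {m n k l : ℕ} (B : Fin m → Fin k → Matrix (Fin n) (Fin l) R) :
    Matrix (Fin (m * n)) (Fin (k * l)) R :=
  Matrix.of fun x y => B (finProdFinEquiv.symm x).1 (finProdFinEquiv.symm y).1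
    (finProdFinEquiv.symm x).2 (finProdFinEquiv.symm y).2

theorem block_ofBlocks {R : Type*} {m n k l : ℕ} (B : Fin m → Fin k → Matrix (Fin n) (Fin l) R)
    (i j) : block (ofBlocks B) i j = B i j := by
  ext1 p q
  change B (finProdFinEquiv.symm (finProdFinEquiv (i, p))).1
    (finProdFinEquiv.symm (finProdFinEquiv (j, q))).1
    (finProdFinEquiv.symm (finProdFinEquiv (i, p))).2
    (finProdFinEquiv.symm (finProdFinEquiv (j, q))).2 = _
  simp only [Equiv.symm_apply_apply]

theorem isPositiveOpMatrix_reindex {ι κ : Type} [Fintype ι] [Fintype κ] (e : ι ≃ κ)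
    {M : Matrix ι ι (H →L[ℂ] H)} (h : IsPositiveOpMatrix M) :
    IsPositiveOpMatrix (M.submatrix e.symm e.symm) := by
  intro x
  have := h (x ∘ e)
  have h1 : ∑ i, ∑ j, inner ℂ (x i) (M.submatrix e.symm e.symm i j (x j)) =
      ∑ i, ∑ j, inner ℂ ((x ∘ e) i) (M i j ((x ∘ e) j)) := by
    rw [← e.sum_comp]
    refine Finset.sum_congr rfl fun i _ => ?_
    rw [← e.sum_comp]
    refine Finset.sum_congr rfl fun j _ => ?_
    simp
  rw [h1]
  exact this

theorem isPositiveOpMatrix_of_blocks {k l m n : ℕ}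
    (G : Fin l → Fin k → Matrix (Fin m) (Fin n) (H →L[ℂ] H)) :
    IsPositiveOpMatrix (Matrix.of fun p q : Fin k × Fin n =>
      (∑ x, (G x p.1)ᴴ * G x q.1 : Matrix (Fin n) (Fin n) (H →L[ℂ] H)) p.2 q.2) := by
  let B : Matrix (Fin l × Fin m) (Fin k × Fin n) (H →L[ℂ] H) :=
    Matrix.of fun x p => G x.1 p.1 x.2 p.2
  have h := isPositiveOpMatrix_star_mul B
  convert h using 1
  ext1 p q
  rw [Matrix.mul_apply, Fintype.sum_prod_type, Matrix.of_apply, Matrix.sum_apply]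
  refine Finset.sum_congr rfl fun x _ => ?_
  rw [Matrix.mul_apply]
  rfl

theorem exists_block_sqrt {X : Obj N} {o a : DoubleCone} (hX : X.LocalizedIn o) (h : o.Perp a)
    {k : ℕ} (M : Matrix (Fin k) (Fin k) (X.reduced a))
    (hM : IsPositiveOpMatrix (Matrix.of fun p q : Fin k × Fin X.n =>
      (M p.1 q.1 : Matrix (Fin X.n) (Fin X.n) (H →L[ℂ] H)) p.2 q.2)) :
    ∃ R : Fin k → Fin k → Matrix (Fin X.n) (Fin X.n) (H →L[ℂ] H), (∀ i j, R i j ∈ X.reduced a) ∧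
      ∀ i j, (M i j : Matrix (Fin X.n) (Fin X.n) (H →L[ℂ] H)) = ∑ x, (R x i)ᴴ * R x j := by
  obtain ⟨Q, hQ1, hQ2, hQ3⟩ := (isPositiveOpMatrix_reindex finProdFinEquiv hM).exists_sqrt
  have hQM : ∀ i j, block (Q * Q) i j = (M i j : Matrix (Fin X.n) (Fin X.n) (H →L[ℂ] H)) := by
    intro i j
    rw [hQ2]
    exact block_ofBlocks (fun i j => (M i j : Matrix (Fin X.n) (Fin X.n) (H →L[ℂ] H))) i j
  rw [← hQ2] at hQ3
  have hQstar : ∀ i j, (block Q i j)ᴴ = block Q j i := fun i j => by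
    rw [← block_conjTranspose, hQ1]
  let D : Matrix (Fin (k * X.n)) (Fin (k * X.n)) (H →L[ℂ] H) :=
    ofBlocks fun i j => if i = j then X.unitMat else 0
  have hD : ∀ (B : Matrix (Fin (k * X.n)) (Fin (k * X.n)) (H →L[ℂ] H)) i j,
      block (B * D) i j = block B i j * X.unitMat := fun B i j => by
    rw [block_mul, Finset.sum_eq_single j]
    · rw [block_ofBlocks, if_pos rfl]
    · intro x _ hx
      rw [block_ofBlocks, if_neg hx, Matrix.mul_zero]
    · simp
  have hD' : ∀ (B : Matrix (Fin (k * X.n)) (Fin (k * X.n)) (H →L[ℂ] H)) i j,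
      block (D * B) i j = X.unitMat * block B i j := fun B i j => by
    rw [block_mul, Finset.sum_eq_single i]
    · rw [block_ofBlocks, if_pos rfl]
    · intro x _ hx
      rw [block_ofBlocks, if_neg hx.symm, Matrix.zero_mul]
    · simp
  have hQD : ∀ i j, X.unitMat * block Q i j = block Q i j * X.unitMat := by
    intro i j
    rw [← hD, ← hD']
    congr 1
    refine (hQ3 D ?_).eq.symm
    rw [commute_iff_eq]
    refine block_injective fun i j => ?_
    rw [hD, hD', hQM, unitMat_mul_of_mem_reduced (M i j).2, mul_unitMat_of_mem_reduced (M i j).2]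
  have hQa : ∀ i j p q, block Q i j p q ∈ (N.loc a).commutant := by
    intro i j p q
    refine mem_commutant_of fun B hB => ?_
    have h1 : amp (k * X.n) B * Q = Q * amp (k * X.n) B := by
      refine (hQ3 (amp (k * X.n) B) ?_).eq.symm
      refine (amp_comm fun x y => ?_).symm
      obtain ⟨⟨i, p⟩, rfl⟩ := finProdFinEquiv.surjective x
      obtain ⟨⟨j, q⟩, rfl⟩ := finProdFinEquiv.surjective y
      have h2 := congrFun (congrFun (hQM i j) p) q
      have h3 := commutant_comm ((M i j).2.1 p q) hB
      rw [← h2] at h3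
      exact h3.symm
    exact (comm_of_amp h1 _ _).symm
  refine ⟨fun i j => block Q i j * X.unitMat, fun i j => mem_reduced_of ?_ ?_ ?_, fun i j => ?_⟩
  · exact matrix_mul_mem_commutant (hQa i j) (op_mem_commutant h hX hX (𝟙 X))
  · rw [← Matrix.mul_assoc, hQD, Matrix.mul_assoc, unitMat_mul_self]
  · rw [Matrix.mul_assoc, unitMat_mul_self]
  · simp only [Matrix.conjTranspose_mul, hQstar, unitMat_star]
    have h1 : ∀ x, X.unitMat * block Q i x * (block Q x j * X.unitMat) =
        X.unitMat * (block Q i x * block Q x j) * X.unitMat := fun x => by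
      simp only [Matrix.mul_assoc]
    simp only [h1, ← Matrix.mul_sum, ← Matrix.sum_mul]
    rw [← block_mul, hQM]
    exact ((M i j).2.2).symm

theorem isCompletelyPositive_of {X : Obj N} {o a : DoubleCone} (hX : X.LocalizedIn o)
    (h : o.Perp a) {φ : X.reduced a →ₗ[ℂ] (H →L[ℂ] H)}
    (hφ : ∀ (k : ℕ) (R : Fin k → Fin k → Matrix (Fin X.n) (Fin X.n) (H →L[ℂ] H))
      (M : Matrix (Fin k) (Fin k) (X.reduced a)), (∀ i j, R i j ∈ X.reduced a) →
      (∀ i j, (M i j : Matrix (Fin X.n) (Fin X.n) (H →L[ℂ] H)) = ∑ x, (R x i)ᴴ * R x j) →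
      IsPositiveOpMatrix (M.map φ)) : IsCompletelyPositive φ := fun k M hM => by
  obtain ⟨R, hR1, hR2⟩ := exists_block_sqrt hX h M hM
  exact hφ k R M hR1 hR2

theorem _root_.AQFT.IsCompletelyPositive.of_blocks {X : Obj N} {a : DoubleCone}
    {φ : X.reduced a →ₗ[ℂ] (H →L[ℂ] H)} (hφ : IsCompletelyPositive φ) {k l m : ℕ}
    (G : Fin l → Fin k → Matrix (Fin m) (Fin X.n) (H →L[ℂ] H))
    (M : Matrix (Fin k) (Fin k) (X.reduced a))
    (hM : ∀ i j, (M i j : Matrix (Fin X.n) (Fin X.n) (H →L[ℂ] H)) = ∑ x, (G x i)ᴴ * G x j) :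
    IsPositiveOpMatrix (M.map φ) := by
  refine hφ k M ?_
  simp only [hM]
  exact isPositiveOpMatrix_of_blocks G

/-! ## Presheaf-left inverses -/

namespace IsPresheafLeftInverse

variable {X : Obj N} {o : DoubleCone} {φ : ∀ a : DoubleCone, X.reduced a →ₗ[ℂ] (H →L[ℂ] H)}
  (hφ : X.IsPresheafLeftInverse o φ)

include hφ

theorem map_star (hX : X.LocalizedIn o) {a : DoubleCone} (h : a.Perp o)
    {B : Matrix (Fin X.n) (Fin X.n) (H →L[ℂ] H)} (hB : B ∈ X.reduced a) :
    φ a ⟨Bᴴ, star_mem_reduced hB⟩ = star (φ a ⟨B, hB⟩) := by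
  have hP : X.unitMat ∈ X.reduced a := op_mem_reduced hX h.symm (𝟙 X)
  let M : Matrix (Fin 2) (Fin 2) (X.reduced a) :=
    !![⟨_, hP⟩, ⟨B, hB⟩; ⟨Bᴴ, star_mem_reduced hB⟩,
      ⟨Bᴴ * B, mul_mem_reduced (star_mem_reduced hB) hB⟩]
  have h1 := (hφ.completelyPositive a h).of_blocks
    (G := fun (_ : Fin 1) (j : Fin 2) => if j = 0 then X.unitMat else B) M (by
      intro i j
      rw [Fin.sum_univ_one]
      fin_cases i <;> fin_cases j
      · exact (by rw [unitMat_star, unitMat_mul_self] : X.unitMat = X.unitMatᴴ * X.unitMat)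
      · exact (by rw [unitMat_star, unitMat_mul_of_mem_reduced hB] : B = X.unitMatᴴ * B)
      · exact (by rw [mul_unitMat_of_mem_reduced (star_mem_reduced hB)] : Bᴴ = Bᴴ * X.unitMat)
      · rfl)
  exact (congrFun (congrFun h1.isHermitian 1) 0).symm

theorem apply_mul_ext (hX : X.LocalizedIn o) {a : DoubleCone} (h : a.Perp o) {A : H →L[ℂ] H}
    (hA : A ∈ (N.loc a).commutant) {B : Matrix (Fin X.n) (Fin X.n) (H →L[ℂ] H)}
    (hB : B ∈ X.reduced a) :
    φ a ⟨B * X.ext a A, mul_mem_reduced hB (ext_mem_reduced hX h.symm hA)⟩ = φ a ⟨B, hB⟩ * A :=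
  (hφ.leftInverse a h A hA ⟨B, hB⟩).2

theorem apply_ext_mul (hX : X.LocalizedIn o) {a : DoubleCone} (h : a.Perp o) {A : H →L[ℂ] H}
    (hA : A ∈ (N.loc a).commutant) {B : Matrix (Fin X.n) (Fin X.n) (H →L[ℂ] H)}
    (hB : B ∈ X.reduced a) :
    φ a ⟨X.ext a A * B, mul_mem_reduced (ext_mem_reduced hX h.symm hA) hB⟩ = A * φ a ⟨B, hB⟩ := by
  have hA' := star_mem (S := VonNeumannAlgebra H) hA
  have h1 := hφ.apply_mul_ext hX h hA' (star_mem_reduced hB)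
  have h2 := hφ.map_star hX h
    (mul_mem_reduced (star_mem_reduced hB) (ext_mem_reduced hX h.symm hA'))
  rw [h1, hφ.map_star hX h hB, star_mul, star_star, star_star] at h2
  rw [← h2]
  congr 1
  apply Subtype.ext
  change X.ext a A * B = (Bᴴ * X.ext a (star A))ᴴ
  rw [Matrix.conjTranspose_mul, Matrix.conjTranspose_conjTranspose, ext_star X hA,
    Matrix.conjTranspose_conjTranspose]

theorem apply_sub {a b : DoubleCone} (ha : a.Perp o) (hb : b.Perp o) (h : a.Sub b)
    {B : Matrix (Fin X.n) (Fin X.n) (H →L[ℂ] H)} (hB : B ∈ X.reduced b) :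
    φ a ⟨B, reduced_mono h hB⟩ = φ b ⟨B, hB⟩ :=
  (hφ.compatible a b ha hb h ⟨B, hB⟩).2

theorem apply_unitMat (hX : X.LocalizedIn o) {a : DoubleCone} (h : a.Perp o) :
    φ a ⟨X.unitMat, op_mem_reduced hX h.symm (𝟙 X)⟩ = 1 :=
  (hφ.normalized a h).2

end IsPresheafLeftInverse

/-- A matrix that intertwines the local observables is an intertwiner. -/
theorem mul_val_of_local {Y Z : Obj N} {S : Matrix (Fin Z.n) (Fin Y.n) (H →L[ℂ] H)}
    (o : DoubleCone) (h : ∀ c : DoubleCone, o.Sub c → ∀ A : N.alg, (A : H →L[ℂ] H) ∈ N.loc c →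
      S * Y.val A = Z.val A * S) (A : N.alg) : S * Y.val A = Z.val A * S := by
  refine N.alg_induction (P := fun A => S * Y.val A = Z.val A * S) ?_ o h A
  have : {A : N.alg | S * Y.val A = Z.val A * S} = ⋂ i, ⋂ j,
      {A : N.alg | ∑ x, S i x * Y.val A x j = ∑ x, Z.val A i x * S x j} := by
    ext A
    simp only [Set.mem_iInter, Set.mem_ofPred_eq, ← Matrix.mul_apply, ← Matrix.ext_iff]
  rw [this]
  refine isClosed_iInter fun i => isClosed_iInter fun j => isClosed_eq ?_ ?_
  · exact continuous_finsetSum _ fun x _ => continuous_const.mul (Y.toMor.continuous_entry x j)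
  · exact continuous_finsetSum _ fun x _ => (Z.toMor.continuous_entry i x).mul continuous_const

theorem block_val (X Y : Obj N) (A : N.alg) (i j) :
    block (m := Y.n) (n := X.n) (k := Y.n) (l := X.n) ((X ⊗ Y).val A) i j =
      X.val (Y.hom A i j) := by
  ext1 p q
  exact congrArg (fun A : N.alg => (A : H →L[ℂ] H)) (tensor_hom_apply X.toBimod Y.toBimod A i j p q)

/-- A block of an arrow. -/
noncomputable def opBlock {X Y Z : Obj N} (T : X ⊗ Y ⟶ X ⊗ Z) (i : Fin Z.n) (j : Fin Y.n) :
    Matrix (Fin X.n) (Fin X.n) (H →L[ℂ] H) :=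
  block (m := Z.n) (n := X.n) (k := Y.n) (l := X.n) (op T) i j

section

variable {X Y Z : Obj N} (T : X ⊗ Y ⟶ X ⊗ Z)

theorem block_op_mul (M : Matrix (Fin (Y.n * X.n)) (Fin (Y.n * X.n)) (H →L[ℂ] H)) (i j) :
    block (m := Z.n) (n := X.n) (k := Y.n) (l := X.n) (op T * M) i j =
      ∑ x, opBlock T i x * block M x j :=
  block_mul (m := Z.n) (n := X.n) (k := Y.n) (l := X.n) (p := Y.n) (q := X.n) (op T) M i j

theorem block_mul_op (M : Matrix (Fin (Z.n * X.n)) (Fin (Z.n * X.n)) (H →L[ℂ] H)) (i j) :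
    block (m := Z.n) (n := X.n) (k := Y.n) (l := X.n) (M * op T) i j =
      ∑ x, block M i x * opBlock T x j :=
  block_mul (m := Z.n) (n := X.n) (k := Z.n) (l := X.n) (p := Y.n) (q := X.n) M (op T) i j

theorem sum_opBlock_mul_val (A : N.alg) (i j) :
    ∑ x, opBlock T i x * X.val (Y.hom A x j) = ∑ x, X.val (Z.hom A i x) * opBlock T x j := by
  have h1 := congrArg (fun M => block (m := Z.n) (n := X.n) (k := Y.n) (l := X.n) M i j)
    (op_mul_val T A)
  refine Eq.trans ?_ (h1.trans ?_)
  · refine Eq.trans ?_ (block_op_mul T ((X ⊗ Y).val A) i j).symm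
    exact Finset.sum_congr rfl fun x _ => congrArg _ (block_val X Y A x j).symm
  · refine (block_mul_op T ((X ⊗ Z).val A) i j).trans ?_
    exact Finset.sum_congr rfl fun x _ => congrArg (· * opBlock T x j) (block_val X Z A i x)

theorem sum_opBlock_mul_val_one (i j) : ∑ x, opBlock T i x * X.val (Y.idArrow x j) =
    opBlock T i j := by
  refine Eq.trans ?_ (congrArg (fun M => block (m := Z.n) (n := X.n) (k := Y.n) (l := X.n) M i j)
    (op_mul_unitMat T))
  refine Eq.trans ?_ (block_op_mul T ((X ⊗ Y).val 1) i j).symm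
  exact Finset.sum_congr rfl fun x _ => congrArg _ (block_val X Y 1 x j).symm

end

section

variable {X Y Z : Obj N} {o a : DoubleCone} (hX : X.LocalizedIn o) (hY : Y.LocalizedIn o)
  (hZ : Z.LocalizedIn o) (h : a.Perp o) (T : X ⊗ Y ⟶ X ⊗ Z)

include hX hY hZ h

theorem opBlock_mem (i j) : opBlock T i j ∈ X.reduced a := by
  refine mem_reduced_of (fun p q => ?_) ?_ ?_
  · exact op_mem_commutant h.symm (hX.tensor hY) (hX.tensor hZ) T _ _
  · have h1 : opBlock T i j = ∑ x, X.val (Z.idArrow i x) * opBlock T x j :=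
      (sum_opBlock_mul_val_one T i j).symm.trans (sum_opBlock_mul_val T 1 i j)
    rw [h1, Matrix.mul_sum]
    simp only [← Matrix.mul_assoc, unitMat_mul_val]
  · rw [← sum_opBlock_mul_val_one, Matrix.sum_mul]
    simp only [Matrix.mul_assoc, val_mul_unitMat]

end

namespace IsPresheafLeftInverse

open scoped Classical in
/-- The value of a linear map, extended by zero. -/
noncomputable def eval {X : Obj N} (φ : ∀ a : DoubleCone, X.reduced a →ₗ[ℂ] (H →L[ℂ] H))
    (a : DoubleCone) (B : Matrix (Fin X.n) (Fin X.n) (H →L[ℂ] H)) : H →L[ℂ] H :=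
  if hB : B ∈ X.reduced a then φ a ⟨B, hB⟩ else 0

theorem eval_of_mem {X : Obj N} (φ : ∀ a : DoubleCone, X.reduced a →ₗ[ℂ] (H →L[ℂ] H))
    {a : DoubleCone} {B : Matrix (Fin X.n) (Fin X.n) (H →L[ℂ] H)} (hB : B ∈ X.reduced a) :
    eval φ a B = φ a ⟨B, hB⟩ := dif_pos hB

theorem eval_sum {X : Obj N} (φ : ∀ a : DoubleCone, X.reduced a →ₗ[ℂ] (H →L[ℂ] H))
    {a : DoubleCone} {ι : Type*} (s : Finset ι)
    {B : ι → Matrix (Fin X.n) (Fin X.n) (H →L[ℂ] H)} (hB : ∀ i, B i ∈ X.reduced a) :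
    eval φ a (∑ i ∈ s, B i) = ∑ i ∈ s, eval φ a (B i) := by
  simp only [fun i => eval_of_mem φ (hB i)]
  rw [eval_of_mem φ (sum_mem fun i _ => hB i), ← map_sum]
  congr 1
  apply Subtype.ext
  rw [AddSubmonoidClass.coe_finsetSum]

theorem eval_add {X : Obj N} (φ : ∀ a : DoubleCone, X.reduced a →ₗ[ℂ] (H →L[ℂ] H))
    {a : DoubleCone} {B C : Matrix (Fin X.n) (Fin X.n) (H →L[ℂ] H)} (hB : B ∈ X.reduced a)
    (hC : C ∈ X.reduced a) : eval φ a (B + C) = eval φ a B + eval φ a C := by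
  rw [eval_of_mem φ hB, eval_of_mem φ hC, eval_of_mem φ (add_mem hB hC), ← map_add]
  rfl

theorem eval_smul {X : Obj N} (φ : ∀ a : DoubleCone, X.reduced a →ₗ[ℂ] (H →L[ℂ] H))
    {a : DoubleCone} (c : ℂ) {B : Matrix (Fin X.n) (Fin X.n) (H →L[ℂ] H)}
    (hB : B ∈ X.reduced a) : eval φ a (c • B) = c • eval φ a B := by
  rw [eval_of_mem φ hB, eval_of_mem φ (Submodule.smul_mem _ c hB), ← map_smul]
  rfl

variable {X : Obj N} {o : DoubleCone} {φ : ∀ a : DoubleCone, X.reduced a →ₗ[ℂ] (H →L[ℂ] H)}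
  (hφ : X.IsPresheafLeftInverse o φ) (hX : X.LocalizedIn o)

include hφ hX

theorem eval_mul_ext {a : DoubleCone} (h : a.Perp o) {A : H →L[ℂ] H}
    (hA : A ∈ (N.loc a).commutant) {B : Matrix (Fin X.n) (Fin X.n) (H →L[ℂ] H)}
    (hB : B ∈ X.reduced a) : eval φ a (B * X.ext a A) = eval φ a B * A := by
  rw [eval_of_mem φ hB, eval_of_mem φ (mul_mem_reduced hB (ext_mem_reduced hX h.symm hA))]
  exact hφ.apply_mul_ext hX h hA hB

theorem eval_ext_mul {a : DoubleCone} (h : a.Perp o) {A : H →L[ℂ] H}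
    (hA : A ∈ (N.loc a).commutant) {B : Matrix (Fin X.n) (Fin X.n) (H →L[ℂ] H)}
    (hB : B ∈ X.reduced a) : eval φ a (X.ext a A * B) = A * eval φ a B := by
  rw [eval_of_mem φ hB, eval_of_mem φ (mul_mem_reduced (ext_mem_reduced hX h.symm hA) hB)]
  exact hφ.apply_ext_mul hX h hA hB

theorem eval_unitMat {a : DoubleCone} (h : a.Perp o) : eval φ a X.unitMat = 1 := by
  rw [eval_of_mem φ (op_mem_reduced hX h.symm (𝟙 X))]
  exact hφ.apply_unitMat hX h

theorem eval_ext {a : DoubleCone} (h : a.Perp o) {A : H →L[ℂ] H}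
    (hA : A ∈ (N.loc a).commutant) : eval φ a (X.ext a A) = A := by
  rw [← unitMat_mul_ext X hA, hφ.eval_mul_ext hX h hA (op_mem_reduced hX h.symm (𝟙 X)),
    hφ.eval_unitMat hX h, one_mul]

theorem eval_eq_of_sub {a b : DoubleCone} (ha : a.Perp o) (hb : b.Perp o) (h : a.Sub b)
    {B : Matrix (Fin X.n) (Fin X.n) (H →L[ℂ] H)} (hB : B ∈ X.reduced b) :
    eval φ a B = eval φ b B := by
  rw [eval_of_mem φ hB, eval_of_mem φ (reduced_mono h hB)]
  exact hφ.apply_sub ha hb h hB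

theorem exists_hom {Y Z : Obj N} (hY : Y.LocalizedIn o) (hZ : Z.LocalizedIn o) {a : DoubleCone}
    (h : a.Perp o) (T : X ⊗ Y ⟶ X ⊗ Z) :
    ∃ S : Y ⟶ Z, op S = Matrix.of fun i j => eval φ a (opBlock T i j) := by
  have hmem : ∀ {b}, b.Perp o → ∀ i j, opBlock T i j ∈ X.reduced b := fun hb i j =>
    opBlock_mem hX hY hZ hb T i j
  set M : Matrix (Fin Z.n) (Fin Y.n) (H →L[ℂ] H) :=
    Matrix.of fun i j => eval φ a (opBlock T i j) with hMdef
  have hM : ∀ A : N.alg, M * Y.val A = Z.val A * M := by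
    refine mul_val_of_local o fun c hc A hA => ?_
    obtain ⟨p, e, h1, h2, h3, h4⟩ := exists_move h c
    have hb := h3.symm.mono h2
    set b := ball p 1 one_pos with hbdef
    have hb := hb.symm
    have hM' : ∀ i j, M i j = eval φ b (opBlock T i j) := by
      intro i j
      exact (hφ.eval_eq_of_sub hX h h3 h1 (hmem h3 i j)).trans
        (hφ.eval_eq_of_sub hX hb h3 h2 (hmem h3 i j)).symm
    have hY' : ∀ i j, (Y.hom A i j : H →L[ℂ] H) ∈ N.loc c :=
      hom_entry_mem (Mor.LocalizedIn.mono hY hc) hA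
    have hZ' : ∀ i j, (Z.hom A i j : H →L[ℂ] H) ∈ N.loc c :=
      hom_entry_mem (Mor.LocalizedIn.mono hZ hc) hA
    have kY : ∀ i j, X.val (Y.hom A i j) ∈ X.reduced b := fun i j => by
      rw [← ext_of_perp X h4.symm (hY' i j)]
      exact ext_mem_reduced hX hb.symm (loc_le_commutant h4.symm (hY' i j))
    have kZ : ∀ i j, X.val (Z.hom A i j) ∈ X.reduced b := fun i j => by
      rw [← ext_of_perp X h4.symm (hZ' i j)]
      exact ext_mem_reduced hX hb.symm (loc_le_commutant h4.symm (hZ' i j))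
    ext1 i j
    have e1 : ∀ x, M i x * Y.val A x j = eval φ b (opBlock T i x * X.val (Y.hom A x j)) := by
      intro x
      rw [← ext_of_perp X h4.symm (hY' x j), hφ.eval_mul_ext hX hb
        (loc_le_commutant h4.symm (hY' x j)) (hmem hb i x), hM']
      rfl
    have e2 : ∀ x, Z.val A i x * M x j = eval φ b (X.val (Z.hom A i x) * opBlock T x j) := by
      intro x
      rw [← ext_of_perp X h4.symm (hZ' i x), hφ.eval_ext_mul hX hb
        (loc_le_commutant h4.symm (hZ' i x)) (hmem hb x j), hM']
      rfl
    rw [Matrix.mul_apply, Matrix.mul_apply]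
    simp only [e1, e2]
    rw [← eval_sum φ _ fun x => mul_mem_reduced (hmem hb i x) (kY x j),
      ← eval_sum φ _ fun x => mul_mem_reduced (kZ i x) (hmem hb x j), sum_opBlock_mul_val T A i j]
  have hM1 : M * Y.unitMat = M := by
    ext1 i j
    have hP : ∀ x j, (Y.idArrow x j : H →L[ℂ] H) ∈ N.loc o := idArrow_entry_mem hY
    have e1 : ∀ x, M i x * Y.unitMat x j = eval φ a (opBlock T i x * X.val (Y.idArrow x j)) := by
      intro x
      rw [← ext_of_perp X h.symm (hP x j), hφ.eval_mul_ext hX h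
        (loc_le_commutant h.symm (hP x j)) (hmem h i x)]
      rfl
    rw [Matrix.mul_apply]
    simp only [e1]
    have k1 : ∀ x, X.val (Y.idArrow x j) ∈ X.reduced a := fun x => by
      rw [← ext_of_perp X h.symm (hP x j)]
      exact ext_mem_reduced hX h.symm (loc_le_commutant h.symm (hP x j))
    rw [← eval_sum φ _ fun x => mul_mem_reduced (hmem h i x) (k1 x), sum_opBlock_mul_val_one]
    rfl
  exact Obj.exists_hom hM1 ((hM 1).symm.trans hM1) hM

end IsPresheafLeftInverse

theorem IsDoublyFaithful.injective {γ : Obj N} (hd : γ.IsDoublyFaithful) {a : DoubleCone}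
    {A B : H →L[ℂ] H} (hA : A ∈ (N.loc a).commutant) (hB : B ∈ (N.loc a).commutant)
    (h : γ.ext a A = γ.ext a B) : A = B := by
  have hB' := smul_mem_commutant (-1) hB
  have h1 : γ.ext a (A + (-1 : ℂ) • B) = 0 := by
    rw [ext_add γ hA hB', ext_smul γ _ hB, h, neg_one_smul, add_neg_cancel]
  have h2 := hd a _ (add_mem hA hB') h1
  rw [neg_one_smul, ← sub_eq_add_neg, sub_eq_zero] at h2
  exact h2

/-! ## Transport of properties along unitary arrows -/

theorem IsFaithful.transport {γ δ : Obj N} (hf : γ.IsFaithful) {U : γ ⟶ δ} (hU : Unitary U) :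
    δ.IsFaithful := fun A hA => by
  refine hf A (coeMat_injective ?_)
  have h1 := op_mul_val U A
  have h2 : δ.val A = 0 := by
    change coeMat (δ.hom A) = 0
    rw [hA]
    rfl
  rw [h2, Matrix.zero_mul] at h1
  have h3 : γ.val A = (op U)ᴴ * (op U * γ.val A) := by
    rw [← Matrix.mul_assoc, hU.op_left, unitMat_mul_val]
  rw [h1, Matrix.mul_zero] at h3
  exact h3

theorem IsDoublyFaithful.transport {γ δ : Obj N} (hf : γ.IsDoublyFaithful) {U : γ ⟶ δ}
    (hU : Unitary U) : δ.IsDoublyFaithful := fun a A hA h => by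
  refine hf a A hA ?_
  have h1 := op_mul_ext U hA
  rw [h, Matrix.zero_mul] at h1
  have h3 : γ.ext a A = (op U)ᴴ * (op U * γ.ext a A) := by
    rw [← Matrix.mul_assoc, hU.op_left, unitMat_mul_ext γ hA]
  rw [h1, Matrix.mul_zero] at h3
  exact h3

theorem IsSimple.transport {γ δ : Obj N} (hs : γ.IsSimple) {U : γ ⟶ δ} (hU : Unitary U) :
    δ.IsSimple := by
  have h1 : sym δ δ = (adjoint U ⊗ₘ adjoint U) ≫ sym γ γ ≫ (U ⊗ₘ U) := by
    rw [← sym_naturality, tensorHom_comp_tensorHom_assoc, hU.right]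
    simp
  have h2 : (adjoint U ⊗ₘ adjoint U) ≫ (U ⊗ₘ U) = 𝟙 (δ ⊗ δ) := by
    rw [tensorHom_comp_tensorHom, hU.right]
    simp
  rcases hs with h | h
  · left
    have h3 : sym γ γ = 𝟙 (γ ⊗ γ) := hom_ext h
    rw [h3, Category.id_comp, h2] at h1
    exact congrArg Subtype.val h1
  · right
    have h3 : sym γ γ = -𝟙 (γ ⊗ γ) := hom_ext h
    rw [h3, Preadditive.neg_comp, Category.id_comp, Preadditive.comp_neg, h2] at h1
    exact congrArg Subtype.val h1

/-! ## The presheaf-left inverse of a simple object -/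

section

variable {γ : Obj N} {o : DoubleCone} (hγ : γ.LocalizedIn o) (hf : γ.IsFaithful)
  (hs : γ.IsSimple) (hd : γ.IsDoublyFaithful)

include hγ hf hs hd

theorem IsSimple.exists_section {a : DoubleCone} (h : a.Perp o) :
    ∃ φ : γ.reduced a →ₗ[ℂ] (H →L[ℂ] H), ∀ B, φ B ∈ (N.loc a).commutant ∧
      γ.ext a (φ B) = B.1 := by
  choose f hf1 hf2 using fun B : γ.reduced a => hs.exists_ext hγ h.symm hf B.2
  refine ⟨{ toFun := f, map_add' := fun B C => ?_, map_smul' := fun c B => ?_ },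
    fun B => ⟨hf1 B, hf2 B⟩⟩
  · refine hd.injective (hf1 _) (add_mem (hf1 B) (hf1 C)) ?_
    rw [ext_add γ (hf1 B) (hf1 C), hf2, hf2, hf2]
    rfl
  · refine hd.injective (hf1 _) (smul_mem_commutant c (hf1 B)) ?_
    rw [RingHom.id_apply, ext_smul γ c (hf1 B), hf2, hf2]
    rfl

/-- A doubly faithful simple object is homogeneous, and its left inverse is an inverse. -/
theorem IsSimple.exists_leftInverse [Nontrivial H] : ∃ φ, γ.IsPresheafLeftInverse o φ ∧
    ∀ a, a.Perp o → ∀ B, φ a B ∈ (N.loc a).commutant ∧ γ.ext a (φ a B) = B.1 := by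
  have hex : ∀ a, ∃ φ : γ.reduced a →ₗ[ℂ] (H →L[ℂ] H), a.Perp o → ∀ B,
      φ B ∈ (N.loc a).commutant ∧ γ.ext a (φ B) = B.1 := fun a => by
    by_cases h : a.Perp o
    · obtain ⟨φ, hφ⟩ := hs.exists_section hγ hf hd h
      exact ⟨φ, fun _ => hφ⟩
    · exact ⟨0, fun h' => absurd h' h⟩
  choose φ hφ using hex
  have hone : ∀ a (ha : a.Perp o), φ a ⟨_, op_mem_reduced hγ ha.symm (𝟙 γ)⟩ = 1 := fun a ha => by
    refine hd.injective (hφ a ha _).1 (one_mem _) ?_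
    rw [(hφ a ha _).2, ext_one]
  refine ⟨φ, ?_, hφ⟩
  refine ⟨fun a ha B => (hφ a ha B).1, fun a ha h0 => ?_, fun a ha => ?_,
    fun a ha => ⟨_, hone a ha⟩, fun a b ha hb hab B => ⟨reduced_mono hab B.2, ?_⟩,
    fun a ha A hA B => ⟨mul_mem_reduced B.2 (ext_mem_reduced hγ ha.symm hA), ?_⟩⟩
  · have := hone a ha
    rw [h0] at this
    exact zero_ne_one this
  · refine isCompletelyPositive_of hγ ha.symm fun k R M hR hM => ?_
    have h1 : M.map (φ a) =
        (Matrix.of fun i j => φ a ⟨R i j, hR i j⟩)ᴴ * (Matrix.of fun i j => φ a ⟨R i j, hR i j⟩) := by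
      ext1 i j
      have hm : ∀ x, star (φ a ⟨R x i, hR x i⟩) * φ a ⟨R x j, hR x j⟩ ∈ (N.loc a).commutant :=
        fun x => mul_mem (star_mem (S := VonNeumannAlgebra H) (hφ a ha _).1) (hφ a ha _).1
      rw [Matrix.mul_apply, Matrix.map_apply]
      refine hd.injective (a := a) (hφ a ha _).1 (sum_mem fun x _ => hm x) ?_
      rw [(hφ a ha _).2, hM]
      refine Eq.trans ?_ (ext_sum γ Finset.univ _ fun x _ => hm x).symm
      refine Finset.sum_congr rfl fun x _ => ?_
      rw [ext_mul γ (star_mem (S := VonNeumannAlgebra H) (hφ a ha _).1) (hφ a ha _).1,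
        ext_star γ (hφ a ha _).1, (hφ a ha _).2, (hφ a ha _).2]
    rw [h1]
    exact isPositiveOpMatrix_star_mul _
  · refine hd.injective (hφ a ha _).1 (commutant_mono hab (hφ b hb B).1) ?_
    rw [(hφ a ha _).2, ← ext_mono γ hab (hφ b hb B).1, (hφ b hb _).2]
  · refine hd.injective (hφ a ha _).1 (mul_mem (hφ a ha _).1 hA) ?_
    rw [(hφ a ha _).2, ext_mul γ (hφ a ha _).1 hA, (hφ a ha _).2]

theorem IsSimple.exists_whiskerLeft [Nontrivial H] {Y Z : Obj N} (hY : Y.LocalizedIn o)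
    (hZ : Z.LocalizedIn o) (T : γ ⊗ Y ⟶ γ ⊗ Z) : ∃ S : Y ⟶ Z, γ ◁ S = T := by
  obtain ⟨φ, hφ, hφ'⟩ := hs.exists_leftInverse hγ hf hd
  obtain ⟨a, h⟩ := exists_perp o
  obtain ⟨S, hS⟩ := hφ.exists_hom hγ hY hZ h T
  refine ⟨S, op_injective ?_⟩
  rw [op_whiskerLeft γ h.symm hY hZ, hS]
  refine block_injective (m := Z.n) (n := γ.n) (k := Y.n) (l := γ.n) fun i j => ?_
  refine (block_extMat γ a _ i j).trans ?_
  rw [Matrix.of_apply, IsPresheafLeftInverse.eval_of_mem φ (opBlock_mem hγ hY hZ h T i j),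
    (hφ' a h _).2]
  rfl

theorem IsSimple.isPos_of_whiskerLeft [Nontrivial H] {Y : Obj N} (hY : Y.LocalizedIn o)
    {S : Y ⟶ Y} (hS : IsPos (γ ◁ S)) : IsPos S := by
  obtain ⟨φ, hφ, hφ'⟩ := hs.exists_leftInverse hγ hf hd
  obtain ⟨a, h⟩ := exists_perp o
  have hSm := op_mem_commutant h.symm hY hY S
  let M : Matrix (Fin Y.n) (Fin Y.n) (γ.reduced a) :=
    Matrix.of fun i j => ⟨γ.ext a (op S i j), ext_mem_reduced hγ h.symm (hSm i j)⟩
  have h1 : M.map (φ a) = op S := by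
    ext1 i j
    refine hd.injective (hφ' a h _).1 (hSm i j) ?_
    exact (hφ' a h _).2
  unfold IsPos at hS ⊢
  rw [op_whiskerLeft γ h.symm hY hY] at hS
  rw [← h1]
  refine hφ.completelyPositive a h _ M ?_
  have h2 := isPositiveOpMatrix_reindex finProdFinEquiv.symm hS
  convert h2 using 1
  ext1 p q
  exact (extMat_apply γ a (op S) p.1 p.2 q.1 q.2).symm

end

theorem whiskerLeft_entry (γ : Obj N) {Y Z : Obj N} (S : Y ⟶ Z) (i p j q) :
    (γ ◁ S).1 (finProdFinEquiv (i, p)) (finProdFinEquiv (j, q)) = γ.hom (S.1 i j) p q := by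
  refine (tensorHom_apply_val (𝟙 γ) S i p j q).trans ?_
  have : γ.idArrow * γ.hom (S.1 i j) = γ.hom (S.1 i j) := by
    change γ.hom 1 * γ.hom (S.1 i j) = γ.hom (S.1 i j)
    rw [← map_mul, one_mul]
  exact congrFun (congrFun this p) q

theorem IsFaithful.whiskerLeft_injective {γ : Obj N} (hf : γ.IsFaithful) {Y Z : Obj N}
    {S S' : Y ⟶ Z} (h : γ ◁ S = γ ◁ S') : S = S' := by
  refine hom_ext ?_
  ext1 i j
  rw [← sub_eq_zero]
  refine hf _ ?_
  rw [map_sub, sub_eq_zero]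
  ext1 p q
  rw [← whiskerLeft_entry, ← whiskerLeft_entry, h]

theorem IsFaithful.mul_hom_of_whiskerLeft {γ : Obj N} (hf : γ.IsFaithful) {Y Z : Obj N} {A : N.alg}
    {S : Y ⟶ Z} (h : (γ ◁ S).1 * (γ ⊗ Y).hom A = 0) : S.1 * Y.hom A = 0 := by
  ext1 i j
  refine hf _ ?_
  ext1 p q
  have h1 := congrFun (congrFun h (finProdFinEquiv (i, p))) (finProdFinEquiv (j, q))
  refine Eq.trans ?_ h1
  have h2 : ((γ ◁ S).1 * (γ ⊗ Y).hom A) (finProdFinEquiv (i, p)) (finProdFinEquiv (j, q)) =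
      ∑ x, ∑ y, γ.hom (S.1 i x) p y * γ.hom (Y.hom A x j) y q := by
    refine (Matrix.mul_apply (M := (γ ◁ S).1)).trans
      ((sum_fin_prod (m := Y.n) (n := γ.n) _).trans ?_)
    refine Finset.sum_congr rfl fun x _ => Finset.sum_congr rfl fun y _ => ?_
    exact congrArg₂ (· * ·) (whiskerLeft_entry γ S i p x y)
      (tensor_hom_apply γ.toBimod Y.toBimod A x j y q)
  refine Eq.trans ?_ h2.symm
  rw [Matrix.mul_apply, map_sum, Matrix.sum_apply]
  refine Finset.sum_congr rfl fun x _ => ?_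
  rw [map_mul, Matrix.mul_apply]

theorem IsDoublyFaithful.annihilates_of_whiskerLeft {γ : Obj N} (hd : γ.IsDoublyFaithful)
    {Y Z : Obj N} {o a : DoubleCone} (h : o.Perp a) (hγ : γ.LocalizedIn o) (hY : Y.LocalizedIn o)
    (hZ : Z.LocalizedIn o) {A : H →L[ℂ] H} (hA : A ∈ (N.loc a).commutant) {S : Y ⟶ Z}
    (hS : Annihilates a A (γ ◁ S)) : Annihilates a A S := by
  have hS' := op_mem_commutant h hY hZ S
  have hA' := ext_entry_mem hY h hA
  have h1 : γ.extMat a (op S * Y.ext a A) = 0 := by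
    rw [extMat_mul γ hS' hA', ← op_whiskerLeft γ h hY hZ, ← ext_tensor_eq hγ hY h hA]
    exact hS
  change op S * Y.ext a A = 0
  ext1 i j
  refine hd a _ (matrix_mul_mem_commutant hS' hA' i j) ?_
  rw [← block_extMat, h1]
  rfl

open StarTensor in
/-- Faithful simple objects which are doubly faithful can be cancelled. -/
theorem IsSimple.cancellable [Nontrivial H] {γ : Obj N} (hs : γ.IsSimple) (hf : γ.IsFaithful)
    (hd : γ.IsDoublyFaithful) : Cancellable γ where
  exists_eq {Y Z} T := by
    obtain ⟨o, -, -⟩ := DoubleCone.exists_perp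
    obtain ⟨δ, W, hδ, hW⟩ := γ.exists_transport o
    obtain ⟨Y', U, hY, hU⟩ := Y.exists_transport o
    obtain ⟨Z', V, hZ, hV⟩ := Z.exists_transport o
    obtain ⟨S, hS⟩ := (hs.transport hW).exists_whiskerLeft hδ (hf.transport hW) (hd.transport hW)
      hY hZ ((adjoint W ⊗ₘ adjoint U) ≫ T ≫ (W ⊗ₘ V))
    refine ⟨U ≫ S ≫ adjoint V, ?_⟩
    have h1 : γ ◁ (U ≫ S ≫ adjoint V) = (W ⊗ₘ U) ≫ δ ◁ S ≫ (adjoint W ⊗ₘ adjoint V) := by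
      rw [← id_tensorHom, ← id_tensorHom, tensorHom_comp_tensorHom, tensorHom_comp_tensorHom,
        Category.id_comp, hW.left]
    rw [h1, hS]
    simp only [Category.assoc, tensorHom_comp_tensorHom, tensorHom_comp_tensorHom_assoc, hW.left,
      hU.left, hV.left, id_tensorHom_id, Category.id_comp, Category.comp_id]
  injective h := hf.whiskerLeft_injective h
  pos {Y S} h := by
    obtain ⟨o, -, -⟩ := DoubleCone.exists_perp
    obtain ⟨δ, W, hδ, hW⟩ := γ.exists_transport o
    obtain ⟨Y', U, hY, hU⟩ := Y.exists_transport o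
    have h1 : δ ◁ (adjoint U ≫ S ≫ U) =
        (adjoint W ⊗ₘ adjoint U) ≫ γ ◁ S ≫ dag (adjoint W ⊗ₘ adjoint U) := by
      change _ = _ ≫ _ ≫ adjoint (adjoint W ⊗ₘ adjoint U)
      rw [adjoint_tensor, adjoint_adjoint, adjoint_adjoint, ← id_tensorHom, ← id_tensorHom,
        tensorHom_comp_tensorHom, tensorHom_comp_tensorHom, Category.id_comp, hW.right]
    have h2 : Pos (δ ◁ (adjoint U ≫ S ≫ U)) := by
      rw [h1]
      exact pos_conj _ h
    have h3 : Pos (adjoint U ≫ S ≫ U) := (hs.transport hW).isPos_of_whiskerLeft hδ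
      (hf.transport hW) (hd.transport hW) hY h2
    have h4 := pos_conj U h3
    change Pos (U ≫ _ ≫ adjoint U) at h4
    simp only [Category.assoc, hU.left, Category.comp_id] at h4
    rwa [← Category.assoc, hU.left, Category.id_comp] at h4
  kills {i Y Z S} h := match i with
    | .inl A => hf.mul_hom_of_whiskerLeft h
    | .inr ⟨a, A⟩ => by
      obtain ⟨o, ho⟩ := exists_perp a
      obtain ⟨δ, W, hδ, hW⟩ := γ.exists_transport o
      obtain ⟨Y', U, hY, hU⟩ := Y.exists_transport o
      obtain ⟨Z', V, hZ, hV⟩ := Z.exists_transport o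
      have h1 : δ ◁ (adjoint U ≫ S ≫ V) =
          (adjoint W ⊗ₘ adjoint U) ≫ γ ◁ S ≫ (W ⊗ₘ V) := by
        rw [← id_tensorHom, ← id_tensorHom, tensorHom_comp_tensorHom, tensorHom_comp_tensorHom,
          Category.id_comp, hW.right]
      have h2 : Annihilates a A.1 (δ ◁ (adjoint U ≫ S ≫ V)) := by
        rw [h1]
        exact Annihilates.comp_left A.2 _ (Annihilates.comp_right _ h)
      have h3 := (hd.transport hW).annihilates_of_whiskerLeft ho hδ hY hZ A.2 h2
      have h4 := Annihilates.comp_left A.2 U (Annihilates.comp_right (adjoint V) h3)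
      have h5 : U ≫ (adjoint U ≫ S ≫ V) ≫ adjoint V = S := by
        simp only [Category.assoc, hV.left, Category.comp_id]
        rw [← Category.assoc, hU.left, Category.id_comp]
      rw [h5] at h4
      exact h4

/-! ## Presheaf-left inverses from conjugates -/

theorem extMat_mem_commutant {X : Obj N} {o a : DoubleCone} (hX : X.LocalizedIn o) (h : o.Perp a)
    {m n : ℕ} {B : Matrix (Fin m) (Fin n) (H →L[ℂ] H)} (hB : ∀ i j, B i j ∈ (N.loc a).commutant)
    (i j) : X.extMat a B i j ∈ (N.loc a).commutant := ext_entry_mem hX h (hB _ _) _ _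

theorem extMat_add (X : Obj N) {a : DoubleCone} {m n : ℕ}
    {B C : Matrix (Fin m) (Fin n) (H →L[ℂ] H)} (hB : ∀ i j, B i j ∈ (N.loc a).commutant)
    (hC : ∀ i j, C i j ∈ (N.loc a).commutant) :
    X.extMat a (B + C) = X.extMat a B + X.extMat a C := ext_fin fun i₂ i₁ j₂ j₁ => by
  rw [Matrix.add_apply, extMat_apply, extMat_apply, extMat_apply, Matrix.add_apply,
    ext_add X (hB _ _) (hC _ _), Matrix.add_apply]

theorem extMat_smul (X : Obj N) {a : DoubleCone} {m n : ℕ} (c : ℂ)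
    {B : Matrix (Fin m) (Fin n) (H →L[ℂ] H)} (hB : ∀ i j, B i j ∈ (N.loc a).commutant) :
    X.extMat a (c • B) = c • X.extMat a B := ext_fin fun i₂ i₁ j₂ j₁ => by
  rw [Matrix.smul_apply, extMat_apply, extMat_apply, Matrix.smul_apply, ext_smul X c (hB _ _),
    Matrix.smul_apply]

theorem extMat_mono (X : Obj N) {a b : DoubleCone} (h : a.Sub b) {m n : ℕ}
    {B : Matrix (Fin m) (Fin n) (H →L[ℂ] H)} (hB : ∀ i j, B i j ∈ (N.loc b).commutant) :
    X.extMat b B = X.extMat a B := ext_fin fun i₂ i₁ j₂ j₁ => by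
  rw [extMat_apply, extMat_apply, ext_mono X h (hB _ _)]

section

variable {X Y γ : Obj N} {o : DoubleCone} (hX : X.LocalizedIn o) (hY : Y.LocalizedIn o)
  (hγ : γ.LocalizedIn o) (R : γ ⟶ X ⊗ Y)

/-- The compression of the entrywise extension with an arrow. -/
noncomputable def compress (a : DoubleCone) (B : Matrix (Fin Y.n) (Fin Y.n) (H →L[ℂ] H)) :
    Matrix (Fin γ.n) (Fin γ.n) (H →L[ℂ] H) :=
  (op R : Matrix (Fin (Y.n * X.n)) (Fin γ.n) (H →L[ℂ] H))ᴴ * X.extMat a B *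
    (op R : Matrix (Fin (Y.n * X.n)) (Fin γ.n) (H →L[ℂ] H))

theorem compress_add {a : DoubleCone} {B C : Matrix (Fin Y.n) (Fin Y.n) (H →L[ℂ] H)}
    (hB : B ∈ Y.reduced a) (hC : C ∈ Y.reduced a) :
    compress R a (B + C) = compress R a B + compress R a C := by
  rw [compress, extMat_add X hB.1 hC.1, Matrix.mul_add, Matrix.add_mul]
  rfl

theorem compress_smul {a : DoubleCone} (c : ℂ) {B : Matrix (Fin Y.n) (Fin Y.n) (H →L[ℂ] H)}
    (hB : B ∈ Y.reduced a) : compress R a (c • B) = c • compress R a B := by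
  rw [compress, extMat_smul X c hB.1, Matrix.mul_smul, Matrix.smul_mul]
  rfl

theorem compress_mono {a b : DoubleCone} (h : a.Sub b)
    {B : Matrix (Fin Y.n) (Fin Y.n) (H →L[ℂ] H)} (hB : B ∈ Y.reduced b) :
    compress R b B = compress R a B := by
  rw [compress, extMat_mono X h hB.1]
  rfl

theorem compress_star_mul {a : DoubleCone} {B C : Matrix (Fin Y.n) (Fin Y.n) (H →L[ℂ] H)}
    (hB : B ∈ Y.reduced a) (hC : C ∈ Y.reduced a) :
    compress R a (Bᴴ * C) =
      (X.extMat a B * (op R : Matrix (Fin (Y.n * X.n)) (Fin γ.n) (H →L[ℂ] H)))ᴴ *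
      (X.extMat a C * (op R : Matrix (Fin (Y.n * X.n)) (Fin γ.n) (H →L[ℂ] H))) := by
  rw [compress, extMat_mul X (star_mem_reduced hB).1 hC.1, extMat_star X hB.1,
    Matrix.conjTranspose_mul]
  simp only [Matrix.mul_assoc]

include hX hY hγ

theorem compress_mem {a : DoubleCone} (h : o.Perp a)
    {B : Matrix (Fin Y.n) (Fin Y.n) (H →L[ℂ] H)} (hB : B ∈ Y.reduced a) :
    compress R a B ∈ γ.reduced a := by
  have hR := op_mem_commutant h hγ (hX.tensor hY) R
  refine mem_reduced_of (matrix_mul_mem_commutant (matrix_mul_mem_commutant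
    (matrix_star_mem_commutant hR) (extMat_mem_commutant hX h hB.1)) hR) ?_ ?_
  · have h1 : γ.unitMat * (op R)ᴴ = (op R)ᴴ := unitMat_mul_op (adjoint R)
    rw [compress, ← Matrix.mul_assoc, ← Matrix.mul_assoc]
    exact congrArg (fun M : Matrix (Fin γ.n) (Fin (Y.n * X.n)) (H →L[ℂ] H) => M * X.extMat a B *
      (op R : Matrix (Fin (Y.n * X.n)) (Fin γ.n) (H →L[ℂ] H))) h1
  · rw [compress, Matrix.mul_assoc]
    exact congrArg (fun M : Matrix (Fin (Y.n * X.n)) (Fin γ.n) (H →L[ℂ] H) =>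
      (op R : Matrix (Fin (Y.n * X.n)) (Fin γ.n) (H →L[ℂ] H))ᴴ * X.extMat a B * M) (op_mul_unitMat R)

theorem compress_mul_ext {a : DoubleCone} (h : o.Perp a) {A : H →L[ℂ] H}
    (hA : A ∈ (N.loc a).commutant) {B : Matrix (Fin Y.n) (Fin Y.n) (H →L[ℂ] H)}
    (hB : B ∈ Y.reduced a) : compress R a (B * Y.ext a A) = compress R a B * γ.ext a A := by
  rw [compress, extMat_mul X hB.1 (ext_entry_mem hY h hA), ← ext_tensor_eq hX hY h hA, compress,
    Matrix.mul_assoc _ _ (γ.ext a A)]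
  refine Eq.trans ?_ (congrArg (fun M : Matrix (Fin (Y.n * X.n)) (Fin γ.n) (H →L[ℂ] H) =>
    (op R : Matrix (Fin (Y.n * X.n)) (Fin γ.n) (H →L[ℂ] H))ᴴ * X.extMat a B * M)
    (op_mul_ext R hA).symm)
  simp only [Matrix.mul_assoc]

theorem compress_unitMat (hR : R ≫ adjoint R = 𝟙 γ) {a : DoubleCone} (h : o.Perp a) :
    compress R a Y.unitMat = γ.unitMat := by
  rw [compress, ← ext_one Y a, ← ext_tensor_eq hX hY h (one_mem _), ext_one, Matrix.mul_assoc]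
  have h1 : (X ⊗ Y).unitMat * op R = op R := unitMat_mul_op R
  have h2 : (op R)ᴴ * op R = γ.unitMat := by
    rw [← op_adjoint, ← op_comp, hR]
  exact (congrArg (fun M : Matrix (Fin (Y.n * X.n)) (Fin γ.n) (H →L[ℂ] H) =>
      (op R : Matrix (Fin (Y.n * X.n)) (Fin γ.n) (H →L[ℂ] H))ᴴ * M) h1).trans h2

/-- A presheaf-left inverse of an object that is contained in `X ⊗ Y` gives one of `Y`. -/
theorem IsPresheafLeftInverse.compress [Nontrivial H] {ψ : ∀ a, γ.reduced a →ₗ[ℂ] (H →L[ℂ] H)}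
    (hψ : γ.IsPresheafLeftInverse o ψ) (hR : R ≫ adjoint R = 𝟙 γ) :
    ∃ φ, Y.IsPresheafLeftInverse o φ := by
  have hex : ∀ a, ∃ L : Y.reduced a →ₗ[ℂ] γ.reduced a, a.Perp o → ∀ B,
      (L B).1 = Obj.compress R a B.1 := fun a => by
    by_cases h : a.Perp o
    · exact ⟨{
        toFun := fun B => ⟨Obj.compress R a B.1, compress_mem hX hY hγ R h.symm B.2⟩
        map_add' := fun B C => Subtype.ext (compress_add R B.2 C.2)
        map_smul' := fun c B => Subtype.ext (compress_smul R c B.2) }, fun _ _ => rfl⟩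
    · exact ⟨0, fun h' => absurd h' h⟩
  choose L hL using hex
  have hone : ∀ a (ha : a.Perp o), (ψ a ∘ₗ L a) ⟨_, op_mem_reduced hY ha.symm (𝟙 Y)⟩ = 1 :=
    fun a ha => by
      rw [← hψ.apply_unitMat hγ ha]
      refine congrArg (ψ a) (Subtype.ext ?_)
      rw [hL a ha]
      exact compress_unitMat hX hY hγ R hR ha.symm
  refine ⟨fun a => ψ a ∘ₗ L a, fun a ha B => hψ.mem a ha _, fun a ha h0 => ?_, fun a ha => ?_,
    fun a ha => ⟨_, hone a ha⟩, fun a b ha hb hab B => ⟨reduced_mono hab B.2, ?_⟩,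
    fun a ha A hA B => ⟨mul_mem_reduced B.2 (ext_mem_reduced hY ha.symm hA), ?_⟩⟩
  · have := hone a ha
    rw [h0] at this
    exact zero_ne_one this
  · refine isCompletelyPositive_of hY ha.symm fun k G M hG hM => ?_
    refine (hψ.completelyPositive a ha).of_blocks
      (fun x i => X.extMat a (G x i) * (op R : Matrix (Fin (Y.n * X.n)) (Fin γ.n) (H →L[ℂ] H)))
      (M.map (L a)) fun i j => ?_
    rw [Matrix.map_apply, hL a ha, hM]
    have h1 : ∀ s : Finset (Fin k), Obj.compress R a (∑ x ∈ s, (G x i)ᴴ * G x j) =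
        ∑ x ∈ s, Obj.compress R a ((G x i)ᴴ * G x j) := fun s => by
      classical
      induction s using Finset.induction_on with
      | empty =>
        rw [Finset.sum_empty, Finset.sum_empty, Obj.compress, extMat_zero, Matrix.mul_zero,
          Matrix.zero_mul]
      | insert x s hx ih =>
        rw [Finset.sum_insert hx, Finset.sum_insert hx, compress_add R
          (mul_mem_reduced (star_mem_reduced (hG x i)) (hG x j))
          (sum_mem fun x _ => mul_mem_reduced (star_mem_reduced (hG x i)) (hG x j)), ih]
    rw [h1]
    exact Finset.sum_congr rfl fun x _ => compress_star_mul R (hG x i) (hG x j)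
  · have h1 : (L b B).1 ∈ γ.reduced a := reduced_mono hab (L b B).2
    have h2 := (hψ.compatible a b ha hb hab (L b B)).2
    change ψ a (L a _) = ψ b (L b B)
    rw [← h2]
    refine congrArg (ψ a) (Subtype.ext ?_)
    rw [hL a ha, hL b hb]
    exact (compress_mono R hab B.2).symm
  · have h2 := (hψ.leftInverse a ha A hA (L a B)).2
    change ψ a (L a _) = ψ a (L a B) * A
    rw [← h2]
    refine congrArg (ψ a) (Subtype.ext ?_)
    change (L a _).1 = (L a B).1 * γ.ext a A
    rw [hL a ha, hL a ha]
    exact compress_mul_ext hX hY hγ R ha.symm hA B.2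

end

theorem isPositiveOpMatrix_sum {κ : Type} [Fintype κ] {ι : Type*} (s : Finset ι)
    {M : ι → Matrix κ κ (H →L[ℂ] H)} (h : ∀ i ∈ s, IsPositiveOpMatrix (M i)) :
    IsPositiveOpMatrix (∑ i ∈ s, M i) := by
  classical
  induction s using Finset.induction_on with
  | empty => exact isPositiveOpMatrix_zero
  | insert x s hx ih =>
    rw [Finset.sum_insert hx]
    exact (h x (Finset.mem_insert_self _ _)).add
      (ih fun i hi => h i (Finset.mem_insert_of_mem hi))

theorem conj_mem_reduced {X Y : Obj N} {o a : DoubleCone} (hX : X.LocalizedIn o)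
    (hY : Y.LocalizedIn o) (h : o.Perp a) (W : Y ⟶ X) {B : Matrix (Fin X.n) (Fin X.n) (H →L[ℂ] H)}
    (hB : B ∈ X.reduced a) : (op W)ᴴ * B * op W ∈ Y.reduced a := by
  have hW := op_mem_commutant h hY hX W
  refine mem_reduced_of (matrix_mul_mem_commutant (matrix_mul_mem_commutant
    (matrix_star_mem_commutant hW) hB.1) hW) ?_ ?_
  · have h1 : Y.unitMat * (op W)ᴴ = (op W)ᴴ := unitMat_mul_op (adjoint W)
    rw [← Matrix.mul_assoc, ← Matrix.mul_assoc, h1]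
  · rw [Matrix.mul_assoc, op_mul_unitMat]

/-- A direct sum of objects with presheaf-left inverses has a presheaf-left inverse. -/
theorem exists_leftInverse_of_sum [Nontrivial H] {X : Obj N} {o : DoubleCone}
    (hX : X.LocalizedIn o) {ι : Type} [Fintype ι] [Nonempty ι] {σ : ι → Obj N}
    (hσ : ∀ i, (σ i).LocalizedIn o) (W : ∀ i, σ i ⟶ X) (hW : ∀ i, W i ≫ adjoint (W i) = 𝟙 _)
    (hφ : ∀ i, ∃ φ, (σ i).IsPresheafLeftInverse o φ) : ∃ φ, X.IsPresheafLeftInverse o φ := by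
  choose ψ hψ using hφ
  have hex : ∀ a, ∃ L : ∀ i, X.reduced a →ₗ[ℂ] (σ i).reduced a, a.Perp o → ∀ i B,
      (L i B).1 = (op (W i))ᴴ * B.1 * op (W i) := fun a => by
    by_cases h : a.Perp o
    · exact ⟨fun i => {
        toFun := fun B => ⟨(op (W i))ᴴ * B.1 * op (W i), conj_mem_reduced hX (hσ i) h.symm _ B.2⟩
        map_add' := fun B C => Subtype.ext (by
          change _ * (B.1 + C.1) * _ = _ * B.1 * _ + _ * C.1 * _
          rw [Matrix.mul_add, Matrix.add_mul])
        map_smul' := fun c B => Subtype.ext (by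
          change _ * (c • B.1) * _ = c • (_ * B.1 * _)
          rw [Matrix.mul_smul, Matrix.smul_mul]) }, fun _ _ _ => rfl⟩
    · exact ⟨0, fun h' => absurd h' h⟩
  choose L hL using hex
  have hc : ((Fintype.card ι : ℝ) : ℂ) ≠ 0 := by
    rw [Complex.ofReal_ne_zero]
    exact_mod_cast Fintype.card_ne_zero
  let φ : ∀ a, X.reduced a →ₗ[ℂ] (H →L[ℂ] H) := fun a =>
    (((Fintype.card ι : ℝ)⁻¹ : ℝ) : ℂ) • ∑ i, ψ i a ∘ₗ L a i
  have hφ : ∀ a B, φ a B = (((Fintype.card ι : ℝ)⁻¹ : ℝ) : ℂ) • ∑ i, ψ i a (L a i B) :=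
    fun a B => by
      change (((Fintype.card ι : ℝ)⁻¹ : ℝ) : ℂ) • (∑ i, ψ i a ∘ₗ L a i) B = _
      rw [LinearMap.sum_apply]
      rfl
  have hone : ∀ a (ha : a.Perp o), φ a ⟨_, op_mem_reduced hX ha.symm (𝟙 X)⟩ = 1 := fun a ha => by
    have h1 : ∀ i, ψ i a (L a i ⟨_, op_mem_reduced hX ha.symm (𝟙 X)⟩) = 1 := fun i => by
      rw [← (hψ i).apply_unitMat (hσ i) ha]
      refine congrArg (ψ i a) (Subtype.ext ?_)
      rw [hL a ha]
      change (op (W i))ᴴ * X.unitMat * op (W i) = _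
      rw [Matrix.mul_assoc, unitMat_mul_op, ← op_adjoint, ← op_comp, hW]
    rw [hφ]
    simp only [h1]
    rw [Finset.sum_const, Finset.card_univ, ← Nat.cast_smul_eq_nsmul ℂ, smul_smul,
      Complex.ofReal_inv, Complex.ofReal_natCast, inv_mul_cancel₀ (by exact_mod_cast hc), one_smul]
  refine ⟨φ, fun a ha B => ?_, fun a ha h0 => ?_, fun a ha => ?_,
    fun a ha => ⟨_, hone a ha⟩, fun a b ha hb hab B => ⟨reduced_mono hab B.2, ?_⟩,
    fun a ha A hA B => ⟨mul_mem_reduced B.2 (ext_mem_reduced hX ha.symm hA), ?_⟩⟩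
  · rw [hφ]
    exact smul_mem_commutant _ (sum_mem fun i _ => (hψ i).mem a ha _)
  · have := hone a ha
    rw [h0] at this
    exact zero_ne_one this
  · refine isCompletelyPositive_of hX ha.symm fun k G M hG hM => ?_
    have h1 : M.map (φ a) =
        (((Fintype.card ι : ℝ)⁻¹ : ℝ) : ℂ) • ∑ i, (M.map (L a i)).map (ψ i a) := by
      ext1 p q
      rw [Matrix.smul_apply, Matrix.sum_apply, Matrix.map_apply, hφ]
      rfl
    rw [h1]
    refine IsPositiveOpMatrix.smul (isPositiveOpMatrix_sum _ fun i _ => ?_) (by positivity)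
    refine ((hψ i).completelyPositive a ha).of_blocks (fun x p => G x p * op (W i)) _
      fun p q => ?_
    rw [Matrix.map_apply, hL a ha, hM, Matrix.mul_sum, Matrix.sum_mul]
    refine Finset.sum_congr rfl fun x _ => ?_
    rw [Matrix.conjTranspose_mul]
    simp only [Matrix.mul_assoc]
  · rw [hφ, hφ]
    congr 1
    refine Finset.sum_congr rfl fun i _ => ?_
    rw [← ((hψ i).compatible a b ha hb hab (L b i B)).2]
    refine congrArg (ψ i a) (Subtype.ext ?_)
    rw [hL a ha, hL b hb]
  · rw [hφ, hφ, smul_mul_assoc, Finset.sum_mul]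
    congr 1
    refine Finset.sum_congr rfl fun i _ => ?_
    rw [← ((hψ i).leftInverse a ha A hA (L a i B)).2]
    refine congrArg (ψ i a) (Subtype.ext ?_)
    change (L a i _).1 = (L a i B).1 * (σ i).ext a A
    rw [hL a ha, hL a ha]
    simp only [Matrix.mul_assoc]
    rw [op_mul_ext (W i) hA]

/-! ## Homogeneous objects -/

theorem equivalent_iff {X Y : Obj N} : X.Equivalent Y ↔ ∃ U : X ⟶ Y, Unitary U :=
  ⟨fun ⟨_, hU⟩ => ⟨_, hU.unitary⟩, fun ⟨_, hU⟩ => ⟨_, hU.isUnitary⟩⟩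

theorem IsHomogeneous.of_unitary {X Y : Obj N} (hX : X.IsHomogeneous) {U : X ⟶ Y}
    (hU : Unitary U) : Y.IsHomogeneous := fun a Z hZ hZa => by
  obtain ⟨V, hV⟩ := equivalent_iff.1 hZ
  exact hX a Z (equivalent_iff.2 ⟨U ≫ V, hU.comp hV⟩) hZa

theorem isHomogeneous_of_sum [Nontrivial H] {X : Obj N} {ι : Type} [Fintype ι] [Nonempty ι]
    {σ : ι → Obj N} (W : ∀ i, σ i ⟶ X) (hW : ∀ i, W i ≫ adjoint (W i) = 𝟙 _)
    (hσ : ∀ i, (σ i).IsHomogeneous) : X.IsHomogeneous := fun a Y hY hYa => by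
  obtain ⟨U, hU⟩ := equivalent_iff.1 hY
  choose τ V hτ hV using fun i => (σ i).exists_transport a
  refine exists_leftInverse_of_sum hYa hτ (fun i => adjoint (V i) ≫ W i ≫ U) (fun i => ?_)
    fun i => hσ i a (τ i) (equivalent_iff.2 ⟨V i, hV i⟩) (hτ i)
  rw [adjoint_comp, adjoint_comp, adjoint_adjoint]
  simp only [Category.assoc]
  rw [← Category.assoc U, hU.left, Category.id_comp, ← Category.assoc (W i), hW, Category.id_comp,
    (hV i).right]

/-- An object with a conjugate in the sense of a doubly faithful simple object contained in `Y ⊗ X`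
is homogeneous. -/
theorem isHomogeneous_of_conjugate [Nontrivial H] {X Y γ : Obj N} (hf : γ.IsFaithful)
    (hs : γ.IsSimple) (hd : γ.IsDoublyFaithful) (R : γ ⟶ Y ⊗ X) (hR : R ≫ adjoint R = 𝟙 γ) :
    X.IsHomogeneous := fun a Z hZ hZa => by
  obtain ⟨U, hU⟩ := equivalent_iff.1 hZ
  obtain ⟨δ, V, hδ, hV⟩ := γ.exists_transport a
  obtain ⟨Y', T, hY', hT⟩ := Y.exists_transport a
  obtain ⟨ψ, hψ, -⟩ := (hs.transport hV).exists_leftInverse hδ (hf.transport hV) (hd.transport hV)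
  refine hψ.compress hY' hZa hδ (adjoint V ≫ R ≫ (T ⊗ₘ U)) ?_
  have h1 := hT.tensor hU
  rw [adjoint_comp, adjoint_comp, adjoint_adjoint]
  simp only [Category.assoc]
  rw [← Category.assoc (T ⊗ₘ U), h1.left, Category.id_comp, ← Category.assoc R, hR,
    Category.id_comp, hV.right]

theorem opBlock_comp {X Y Z W : Obj N} (S : X ⊗ Y ⟶ X ⊗ Z) (T : X ⊗ Z ⟶ X ⊗ W) (i j) :
    opBlock (S ≫ T) i j = ∑ x, opBlock T i x * opBlock S x j :=
  (congrArg (fun M => block (m := W.n) (n := X.n) (k := Y.n) (l := X.n) M i j)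
    (op_comp S T)).trans
    (block_mul (m := W.n) (n := X.n) (k := Z.n) (l := X.n) (p := Y.n) (q := X.n) (op T) (op S) i j)

theorem opBlock_whiskerLeft (X : Obj N) {Y Z : Obj N} {o a : DoubleCone} (h : o.Perp a)
    (hY : Y.LocalizedIn o) (hZ : Z.LocalizedIn o) (f : Y ⟶ Z) (i j) :
    opBlock (X ◁ f) i j = X.ext a (op f i j) :=
  (congrArg (fun M => block (m := Z.n) (n := X.n) (k := Y.n) (l := X.n) M i j)
    (op_whiskerLeft X h hY hZ f)).trans (block_extMat X a (op f) i j)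

theorem opBlock_adjoint {X Y Z : Obj N} (T : X ⊗ Y ⟶ X ⊗ Z) (i j) :
    opBlock (adjoint T) i j = (opBlock T j i)ᴴ := rfl

theorem swap_entry (X Y : Obj N) (iY i₂ i₁ jY j₂ j₁) :
    ((α_ X X Y).inv ≫ sym X X ▷ Y ≫ (α_ X X Y).hom).1
      (finProdFinEquiv (finProdFinEquiv (iY, i₂), i₁))
      (finProdFinEquiv (finProdFinEquiv (jY, j₂), j₁)) =
    ∑ k₂, ∑ k₁, (sym X X).1 (finProdFinEquiv (i₂, i₁)) (finProdFinEquiv (k₂, k₁)) *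
      X.hom (X.hom (Y.idArrow iY jY) k₂ j₂) k₁ j₁ := by
  have h1 : ((α_ X X Y).inv ≫ sym X X ▷ Y ≫ (α_ X X Y).hom).1
      (finProdFinEquiv (finProdFinEquiv (iY, i₂), i₁))
      (finProdFinEquiv (finProdFinEquiv (jY, j₂), j₁)) =
      (sym X X ▷ Y).1 (finProdFinEquiv (iY, finProdFinEquiv (i₂, i₁)))
        (finProdFinEquiv (jY, finProdFinEquiv (j₂, j₁))) := by
    rw [associator_def]
    refine (eqToHom_comp_val (tensor_assoc X X Y).symm _ _ _).trans ?_
    refine (comp_eqToHom_val _ (tensor_assoc X X Y) _ _).trans ?_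
    have e : ∀ (x : Fin Y.n) (y z : Fin X.n), Fin.cast (mul_assoc Y.n X.n X.n)
        (finProdFinEquiv (finProdFinEquiv (x, y), z)) =
        finProdFinEquiv (x, finProdFinEquiv (y, z)) := fun x y z => by
      rw [← fin_assoc]
      rfl
    exact congrArg₂ (fun p q => (sym X X ▷ Y).1 p q) (e iY i₂ i₁) (e jY j₂ j₁)
  rw [h1]
  refine (tensorHom_apply_val (sym X X) (𝟙 Y) iY _ jY _).trans ?_
  refine (Matrix.mul_apply (M := (sym X X).1)).trans
    ((sum_fin_prod (m := X.n) (n := X.n) _).trans ?_)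
  refine Finset.sum_congr rfl fun k₂ _ => Finset.sum_congr rfl fun k₁ _ => ?_
  exact congrArg _ (tensor_hom_apply X.toBimod X.toBimod (Y.idArrow iY jY) k₂ j₂ k₁ j₁)

theorem opBlock_swap (X Y : Obj N) (iY i₂ jY j₂) :
    opBlock (X := X) (Y := X ⊗ Y) (Z := X ⊗ Y)
      ((α_ X X Y).inv ≫ sym X X ▷ Y ≫ (α_ X X Y).hom)
      (finProdFinEquiv (iY, i₂)) (finProdFinEquiv (jY, j₂)) =
    ∑ k₂, opBlock (sym X X) i₂ k₂ * X.val (X.hom (Y.idArrow iY jY) k₂ j₂) := by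
  ext1 i₁ j₁
  refine (congrArg (fun A : N.alg => (A : H →L[ℂ] H)) (swap_entry X Y iY i₂ i₁ jY j₂ j₁)).trans ?_
  rw [Matrix.sum_apply, AddSubmonoidClass.coe_finsetSum]
  refine Finset.sum_congr rfl fun k₂ _ => ?_
  rw [Matrix.mul_apply, AddSubmonoidClass.coe_finsetSum]
  rfl

namespace IsPresheafLeftInverse

variable {X : Obj N} {o : DoubleCone} {φ : ∀ a : DoubleCone, X.reduced a →ₗ[ℂ] (H →L[ℂ] H)}
  (hφ : X.IsPresheafLeftInverse o φ) (hX : X.LocalizedIn o) {a : DoubleCone} (h : a.Perp o)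

/-- The left inverse of the tensor product with `X` on arrows. -/
noncomputable def homMap {Y Z : Obj N} (hY : Y.LocalizedIn o) (hZ : Z.LocalizedIn o) :
    (X ⊗ Y ⟶ X ⊗ Z) →ₗ[ℂ] (Y ⟶ Z) where
  toFun T := (hφ.exists_hom hX hY hZ h T).choose
  map_add' S T := op_injective (by
    rw [op_add, (hφ.exists_hom hX hY hZ h _).choose_spec, (hφ.exists_hom hX hY hZ h S).choose_spec,
      (hφ.exists_hom hX hY hZ h T).choose_spec]
    ext1 i j
    exact eval_add φ (opBlock_mem hX hY hZ h S i j) (opBlock_mem hX hY hZ h T i j))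
  map_smul' c T := op_injective (by
    rw [RingHom.id_apply, op_smul, (hφ.exists_hom hX hY hZ h _).choose_spec,
      (hφ.exists_hom hX hY hZ h T).choose_spec]
    ext1 i j
    exact eval_smul φ c (opBlock_mem hX hY hZ h T i j))

variable {Y Z W : Obj N} (hY : Y.LocalizedIn o) (hZ : Z.LocalizedIn o) (hW : W.LocalizedIn o)

theorem op_homMap (T : X ⊗ Y ⟶ X ⊗ Z) (i j) :
    op (hφ.homMap hX h hY hZ T) i j = eval φ a (opBlock T i j) :=
  congrFun (congrFun (hφ.exists_hom hX hY hZ h T).choose_spec i) j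

theorem homMap_left (f : Y ⟶ Z) (T : X ⊗ Z ⟶ X ⊗ W) :
    hφ.homMap hX h hY hW (X ◁ f ≫ T) = f ≫ hφ.homMap hX h hZ hW T := by
  refine op_injective ?_
  ext1 i j
  have hT := opBlock_mem hX hZ hW h T
  have hf := op_mem_commutant h.symm hY hZ f
  rw [op_homMap, opBlock_comp, op_comp, Matrix.mul_apply]
  simp only [opBlock_whiskerLeft X h.symm hY hZ, op_homMap]
  rw [eval_sum φ _ fun x => mul_mem_reduced (hT i x) (ext_mem_reduced hX h.symm (hf x j))]
  exact Finset.sum_congr rfl fun x _ => hφ.eval_mul_ext hX h (hf x j) (hT i x)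

theorem homMap_right (T : X ⊗ Y ⟶ X ⊗ Z) (f : Z ⟶ W) :
    hφ.homMap hX h hY hW (T ≫ X ◁ f) = hφ.homMap hX h hY hZ T ≫ f := by
  refine op_injective ?_
  ext1 i j
  have hT := opBlock_mem hX hY hZ h T
  have hf := op_mem_commutant h.symm hZ hW f
  rw [op_homMap, opBlock_comp, op_comp, Matrix.mul_apply]
  simp only [opBlock_whiskerLeft X h.symm hZ hW, op_homMap]
  rw [eval_sum φ _ fun x => mul_mem_reduced (ext_mem_reduced hX h.symm (hf i x)) (hT x j)]
  exact Finset.sum_congr rfl fun x _ => hφ.eval_ext_mul hX h (hf i x) (hT x j)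

theorem homMap_id : hφ.homMap hX h hY hY (𝟙 (X ⊗ Y)) = 𝟙 Y := by
  refine op_injective ?_
  ext1 i j
  have hf := op_mem_commutant h.symm hY hY (𝟙 Y)
  rw [op_homMap, ← MonoidalCategory.whiskerLeft_id, opBlock_whiskerLeft X h.symm hY hY,
    hφ.eval_ext hX h (hf i j)]

theorem homMap_pos {T : X ⊗ Y ⟶ X ⊗ Y} (hT : IsPos T) : IsPos (hφ.homMap hX h hY hY T) := by
  obtain ⟨Q, hQ1, rfl⟩ := exists_sqrt hT
  have hm := opBlock_mem hX hY hY h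
  have h1 := (hφ.completelyPositive a h).of_blocks (fun x i => opBlock Q x i)
    (Matrix.of fun i j => ⟨opBlock (Q ≫ Q) i j, hm _ i j⟩) fun i j => by
      refine (opBlock_comp Q Q i j).trans ?_
      refine Finset.sum_congr rfl fun x _ => ?_
      rw [← opBlock_adjoint, hQ1]
  have h2 : op (hφ.homMap hX h hY hY (Q ≫ Q)) =
      (Matrix.of fun i j => (⟨opBlock (Q ≫ Q) i j, hm _ i j⟩ : X.reduced a)).map (φ a) := by
    ext1 i j
    rw [op_homMap, eval_of_mem φ (hm _ i j)]
    rfl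
  rw [IsPos, h2]
  exact h1

theorem homMap_annihilates {A : H →L[ℂ] H} (hA : A ∈ (N.loc a).commutant) {T : X ⊗ Y ⟶ X ⊗ Z}
    (hT : Annihilates a A T) : Annihilates a A (hφ.homMap hX h hY hZ T) := by
  have hm := opBlock_mem hX hY hZ h T
  have hA' := ext_entry_mem hY h.symm hA
  change op _ * Y.ext a A = 0
  ext1 i j
  rw [Matrix.mul_apply]
  simp only [op_homMap]
  have h1 : ∑ x, opBlock T i x * X.ext a (Y.ext a A x j) = 0 := by
    have h2 : op T * X.extMat a (Y.ext a A) = 0 := by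
      rw [← ext_tensor_eq hX hY h.symm hA]
      exact hT
    have h3 := congrArg (fun M => block (m := Z.n) (n := X.n) (k := Y.n) (l := X.n) M i j) h2
    refine Eq.trans ?_ ((block_op_mul T (X.extMat a (Y.ext a A)) i j).symm.trans h3)
    exact Finset.sum_congr rfl fun x _ => congrArg _ (block_extMat X a (Y.ext a A) x j).symm
  have h2 := congrArg (eval φ a) h1
  rw [eval_sum φ _ fun x => mul_mem_reduced (hm i x) (ext_mem_reduced hX h.symm (hA' x j)),
    eval_of_mem φ (zero_mem _)] at h2
  refine Eq.trans ?_ (h2.trans (map_zero (φ a)))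
  exact Finset.sum_congr rfl fun x _ => (hφ.eval_mul_ext hX h (hA' x j) (hm i x)).symm

theorem homMap_swap {c : ℂ} (hc : hφ.homMap hX h hX hX (sym X X) = c • 𝟙 X) :
    hφ.homMap hX h (hX.tensor hY) (hX.tensor hY)
      ((α_ X X Y).inv ≫ sym X X ▷ Y ≫ (α_ X X Y).hom) = c • 𝟙 (X ⊗ Y) := by
  refine op_injective ?_
  refine ext_fin (m := Y.n) (n := X.n) (k := Y.n) (l := X.n) fun i₂ i₁ j₂ j₁ => ?_
  refine (hφ.op_homMap hX h (hX.tensor hY) (hX.tensor hY) _ _ _).trans ?_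
  have hm := opBlock_mem hX hX hX h (sym X X)
  have hP : ∀ x, (X.hom (Y.idArrow i₂ j₂) x j₁ : H →L[ℂ] H) ∈ N.loc o := fun x =>
    hom_entry_mem hX (idArrow_entry_mem hY i₂ j₂) x j₁
  rw [opBlock_swap]
  have h1 : ∀ x, X.val (X.hom (Y.idArrow i₂ j₂) x j₁) =
      X.ext a (X.hom (Y.idArrow i₂ j₂) x j₁ : H →L[ℂ] H) := fun x =>
    (ext_of_perp X h.symm (hP x)).symm
  have hP' : ∀ x, (X.hom (Y.idArrow i₂ j₂) x j₁ : H →L[ℂ] H) ∈ (N.loc a).commutant := fun x =>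
    loc_le_commutant h.symm (hP x)
  simp only [h1]
  rw [eval_sum φ _ fun x => mul_mem_reduced (hm i₁ x) (ext_mem_reduced hX h.symm (hP' x))]
  have h2 : ∀ x, eval φ a (opBlock (sym X X) i₁ x * X.ext a (X.hom (Y.idArrow i₂ j₂) x j₁)) =
      c • (X.unitMat i₁ x * X.val (Y.idArrow i₂ j₂) x j₁) := fun x => by
    rw [hφ.eval_mul_ext hX h (hP' x) (hm i₁ x), ← hφ.op_homMap hX h hX hX, hc, op_smul,
      Matrix.smul_apply, smul_mul_assoc]
    rfl
  simp only [h2]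
  rw [← Finset.smul_sum, ← Matrix.mul_apply (M := X.unitMat), unitMat_mul_val]
  refine congrArg (c • ·) ?_
  exact (congrFun (congrFun (block_val X Y 1 i₂ j₂) i₁) j₁).symm

end IsPresheafLeftInverse

theorem localizedIn_pow {X : Obj N} {o : DoubleCone} (hX : X.LocalizedIn o) (n : ℕ) :
    (StarTensor.pow X n).LocalizedIn o := by
  induction n with
  | zero => exact Bimod.unit_localizedIn o
  | succ n ih => exact hX.tensor ih

theorem unitary_powMap {X Y : Obj N} {U : X ⟶ Y} (hU : Unitary U) [Nontrivial H] (n : ℕ) :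
    Unitary (StarTensor.powMap U n) := by
  induction n with
  | zero => exact unitary_id _
  | succ n ih => exact hU.tensor ih

theorem eq_zero_of_annihilates_unit {a : DoubleCone} {A : H →L[ℂ] H}
    (hA : A ∈ (N.loc a).commutant) (h : Annihilates a A (𝟙 (𝟙_ (Obj N)))) : A = 0 := by
  have h1 : (𝟙_ (Obj N)).ext a A = amp (𝟙_ (Obj N)).n A * (𝟙_ (Obj N)).unitMat := by
    rw [ext_eq (Bimod.unit_localizedIn a) (unitary_id (𝟙_ (Obj N))) hA, Matrix.mul_assoc,
      amp_op (Bimod.unit_localizedIn a) (Bimod.unit_localizedIn a) (𝟙 (𝟙_ (Obj N))) hA,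
      ← Matrix.mul_assoc, unitMat_star, unitMat_mul_self]
  have h2 : (𝟙_ (Obj N)).ext a A = 0 := by
    rw [← unitMat_mul_ext _ hA]
    exact h
  rw [h2] at h1
  have h3 := congrFun (congrFun h1 (0 : Fin 1)) (0 : Fin 1)
  have h4 := amp_mul_apply A (𝟙_ (Obj N)).unitMat (0 : Fin 1) (0 : Fin 1)
  exact (mul_one A).symm.trans (h4.symm.trans h3.symm)

theorem irred_of_unitary [Nontrivial H] {X Y : Obj N} (hX : StarTensor.Irred X) {U : X ⟶ Y}
    (hU : Unitary U) : StarTensor.Irred Y := by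
  refine ⟨fun h => hX.1 ?_, fun f => ?_⟩
  · rw [← hU.left, ← Category.id_comp (adjoint U), h]
    simp
  · obtain ⟨c, hc⟩ := hX.2 (U ≫ f ≫ adjoint U)
    refine ⟨c, ?_⟩
    have h1 : f = adjoint U ≫ (U ≫ f ≫ adjoint U) ≫ U := by
      simp only [Category.assoc, hU.right, Category.comp_id]
      rw [← Category.assoc, hU.right, Category.id_comp]
    rw [h1, hc, Linear.smul_comp, Linear.comp_smul, Category.id_comp, hU.right]

theorem doublyFaithful_of_homogeneous [Nontrivial H] {X γ : Obj N} (hX : StarTensor.Irred X)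
    (hh : X.IsHomogeneous) (hγ : 𝟙 γ ≠ 0) {b : Bool} {d : ℕ} (V : γ ⟶ StarTensor.pow X (d + 1))
    (hV : V ≫ adjoint V = 𝟙 γ) (hV' : adjoint V ≫ V = StarTensor.symm b X (d + 1)) :
    γ.IsDoublyFaithful := by
  intro a A hA hγA
  obtain ⟨o, ho⟩ := exists_perp a
  obtain ⟨Y, U, hY, hU⟩ := X.exists_transport o
  obtain ⟨φ, hφ⟩ := hh o Y (equivalent_iff.2 ⟨U, hU⟩) hY
  have hloc := localizedIn_pow hY
  have hne : ∀ n ≤ d + 1, StarTensor.symm b Y n ≠ 0 := by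
    intro n hn
    have hP := unitary_powMap hU n
    intro h0
    have h1 : StarTensor.symm b X n = 0 := by
      have h2 := StarTensor.powMap_symm U b n
      rw [h0, Limits.comp_zero] at h2
      have h3 := congrArg (· ≫ adjoint (StarTensor.powMap U n)) h2
      simp only [Category.assoc, hP.left, Category.comp_id, Limits.zero_comp] at h3
      exact h3.symm
    revert h1
    refine Nat.decreasingInduction (motive := fun n _ => StarTensor.symm b X n ≠ 0)
      (fun k _ hk => StarTensor.symm_ne_zero_of_succ hk) ?_ hn
    intro h2
    rw [h2] at hV'
    have h3 := StarTensor.eq_zero_of_dag_comp V hV'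
    rw [h3, Limits.zero_comp] at hV
    exact hγ hV.symm
  obtain ⟨c, hc⟩ := (irred_of_unitary hX hU).2 (hφ.homMap hY ho.symm hY hY (sym Y Y))
  have hΦ : ∀ n, hφ.homMap hY ho.symm (hloc n) (hloc n) (StarTensor.symm b Y (n + 1)) =
      ((1 + n * (PermRep.sgn b * c)) / ((n : ℂ) + 1)) • StarTensor.symm b Y n := by
    intro n
    cases n with
    | zero =>
      rw [StarTensor.symm_one]
      refine (hφ.homMap_id hY ho.symm (hloc 0)).trans ?_
      simp [StarTensor.symm]
    | succ n =>
      have h1 := StarTensor.apply_symm b Y n (hφ.homMap hY ho.symm (hloc (n + 1)) (hloc (n + 1)))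
        (fun f T => hφ.homMap_left hY ho.symm _ _ _ f T)
        (fun f T => hφ.homMap_right hY ho.symm _ _ _ T f) (κ := 1) (c := c)
        (by rw [one_smul]; exact hφ.homMap_id hY ho.symm (hloc (n + 1)))
        (hφ.homMap_swap hY ho.symm (hloc n) hc)
      refine h1.trans ?_
      push_cast
      congr 2
      ring
  have hnonneg : ∀ n ≤ d + 1, (0 : ℂ) ≤ 1 + n * (PermRep.sgn b * c) := by
    intro n hn
    have h1 := hφ.homMap_pos hY ho.symm (hloc n) (StarTensor.pos_symm b Y (n + 1))
    have h2 := hΦ n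
    rw [h2] at h1
    exact StarTensor.nonneg_of_div
      (nonneg_of_pos_smul (StarTensor.pos_symm b Y n) (hne n hn) h1)
  have hcoef : ∀ n ≤ d, (1 + n * (PermRep.sgn b * c)) / ((n : ℂ) + 1) ≠ 0 := by
    intro n hn
    refine div_ne_zero (fun h0 => ?_) (Nat.cast_add_one_ne_zero n)
    have h1 := hnonneg (d + 1) le_rfl
    rw [Complex.nonneg_iff] at h1
    have h2 := congrArg Complex.re h0
    have h3 := h1.1
    simp at h2 h3
    have h4 : (n : ℝ) ≤ d := by exact_mod_cast hn
    have h5 : (0 : ℝ) ≤ n := Nat.cast_nonneg n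
    nlinarith
  have hann : ∀ n ≤ d + 1, Annihilates a A (StarTensor.symm b Y n) := by
    intro n hn
    refine Nat.decreasingInduction
      (motive := fun n _ => Annihilates a A (StarTensor.symm b Y n)) (fun k hk h1 => ?_) ?_ hn
    · have h2 := hφ.homMap_annihilates hY ho.symm (hloc k) (hloc k) hA h1
      rw [hΦ k] at h2
      change ((1 + k * (PermRep.sgn b * c)) / ((k : ℂ) + 1)) •
        op (StarTensor.symm b Y k) * _ = 0 at h2
      rw [Matrix.smul_mul] at h2
      exact (smul_eq_zero.1 h2).resolve_left (hcoef k (by omega))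
    · have h1 : Annihilates a A (𝟙 γ) := by
        change γ.unitMat * γ.ext a A = 0
        rw [hγA, Matrix.mul_zero]
      have hP := unitary_powMap hU (d + 1)
      have h2 : StarTensor.symm b Y (d + 1) = adjoint (V ≫ StarTensor.powMap U (d + 1)) ≫ 𝟙 γ ≫
          V ≫ StarTensor.powMap U (d + 1) := by
        rw [Category.id_comp, adjoint_comp, Category.assoc, ← Category.assoc (adjoint V), hV',
          ← StarTensor.powMap_symm, ← Category.assoc, hP.right, Category.id_comp]
      rw [h2]
      exact Annihilates.comp_left hA _ (Annihilates.comp_right _ h1)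
  exact eq_zero_of_annihilates_unit hA (hann 0 (by omega))

/-! ## Triples -/

theorem swapLeft_val [Nontrivial H] (X M : Obj N) : (StarTensor.swapLeft X M).1 =
    Matrix.reindex (finCongr (mul_assoc M.n X.n X.n).symm)
      (finCongr (mul_assoc M.n X.n X.n).symm)
      ((X.tensor X).tensorHom (X.symmetry X) M.idArrow) := by
  ext1 i j
  have h1 : StarTensor.swapLeft X M = eqToHom (tensor_assoc X X M).symm ≫ (sym X X) ▷ M ≫
      eqToHom (tensor_assoc X X M) := rfl
  rw [h1, eqToHom_comp_val, comp_eqToHom_val]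
  rfl

/-- The two versions of the powers of an object are unitarily equivalent. -/
noncomputable def powIso (X : Obj N) : (n : ℕ) → (X.pow n ⟶ StarTensor.pow X n)
  | 0 => 𝟙 (unit N)
  | n + 1 => (X ◁ powIso X n : X ⊗ X.pow n ⟶ X ⊗ StarTensor.pow X n)

theorem unitary_powIso (X : Obj N) (n : ℕ) : Unitary (X.powIso n) := by
  induction n with
  | zero => exact unitary_id _
  | succ n ih =>
    have h := (unitary_id X).tensor ih
    rw [id_tensorHom] at h
    exact h

/-- The adjacent flips as arrows. -/
noncomputable def flipHom [Nontrivial H] (X : Obj N) : (d : ℕ) → ℕ → (X.pow (d + 1) ⟶ X.pow (d + 1))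
  | 0, _ => 𝟙 _
  | d + 1, 0 => StarTensor.swapLeft X (X.pow d)
  | d + 1, i + 1 => (X ◁ flipHom X d i : X ⊗ X.pow (d + 1) ⟶ X ⊗ X.pow (d + 1))

theorem flipHom_val [Nontrivial H] (X : Obj N) (d : ℕ) (i : Fin d) :
    (X.flipHom d i).1 = X.adjacentFlip d i := by
  induction d with
  | zero => exact i.elim0
  | succ d ih =>
    obtain ⟨i, hi⟩ := i
    cases i with
    | zero => exact swapLeft_val X (X.pow d)
    | succ i =>
      exact congrArg (X.toBimod.tensorHom X.idArrow) (ih ⟨i, Nat.lt_of_succ_lt_succ hi⟩)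

theorem flipHom_powIso [Nontrivial H] (X : Obj N) (d i : ℕ) :
    X.flipHom d i ≫ X.powIso (d + 1) = X.powIso (d + 1) ≫ StarTensor.adjE X d i := by
  induction d generalizing i with
  | zero => exact (Category.id_comp _).trans (Category.comp_id _).symm
  | succ d ih =>
    cases i with
    | zero => exact (StarTensor.swapLeft_naturality X (X.powIso d)).symm
    | succ i =>
      refine (MonoidalCategory.whiskerLeft_comp X (X.flipHom d i) (X.powIso (d + 1))).symm.trans ?_
      exact (congrArg (X ◁ ·) (ih i)).trans
        (MonoidalCategory.whiskerLeft_comp X (X.powIso (d + 1)) (StarTensor.adjE X d i))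

/-- The representation of the permutation group on a power. -/
noncomputable def permHom [Nontrivial H] (X : Obj N) (d : ℕ) (p : Equiv.Perm (Fin (d + 1))) :
    X.pow (d + 1) ⟶ X.pow (d + 1) :=
  X.powIso (d + 1) ≫ StarTensor.permE X d p ≫ adjoint (X.powIso (d + 1))

theorem permHom_one [Nontrivial H] (X : Obj N) (d : ℕ) : X.permHom d 1 = 𝟙 _ := by
  rw [permHom, map_one]
  exact (congrArg _ (Category.id_comp _)).trans (X.unitary_powIso (d + 1)).left

theorem permHom_mul [Nontrivial H] (X : Obj N) (d : ℕ) (p q : Equiv.Perm (Fin (d + 1))) :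
    X.permHom d (p * q) = X.permHom d q ≫ X.permHom d p := by
  simp only [permHom, map_mul, End.mul_def, Category.assoc]
  rw [← Category.assoc (adjoint _), (X.unitary_powIso (d + 1)).right, Category.id_comp]

theorem permHom_adj [Nontrivial H] (X : Obj N) (d i : ℕ) (hi : i < d) :
    X.permHom d (PermRep.adj d i) = X.flipHom d i := by
  rw [permHom, StarTensor.permE_adj X d i hi, ← Category.assoc, ← flipHom_powIso, Category.assoc,
    (X.unitary_powIso (d + 1)).left, Category.comp_id]

theorem isPermRep_permHom [Nontrivial H] (X : Obj N) (d : ℕ) :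
    X.IsPermRep d fun p => (X.permHom d p).1 where
  map_one := congrArg Subtype.val (X.permHom_one d)
  map_mul p q := congrArg Subtype.val (X.permHom_mul d p q)
  map_adjacent i := by
    rw [← flipHom_val, ← permHom_adj X d i i.2, PermRep.adj, dif_pos i.2]

theorem IsPermRep.eq [Nontrivial H] {X : Obj N} {d : ℕ} {π : Equiv.Perm (Fin (d + 1)) →
    Matrix (Fin (X.pow (d + 1)).n) (Fin (X.pow (d + 1)).n) N.alg} (h : X.IsPermRep d π)
    (p : Equiv.Perm (Fin (d + 1))) : π p = (X.permHom d p).1 := by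
  induction p using PermRep.adj_induction with
  | h1 => exact h.map_one.trans (X.isPermRep_permHom d).map_one.symm
  | h2 i hi p ih =>
    rw [h.map_mul, (X.isPermRep_permHom d).map_mul, ih]
    congr 1
    have h1 := h.map_adjacent ⟨i, hi⟩
    rw [PermRep.adj, dif_pos hi, h1]
    exact ((X.isPermRep_permHom d).map_adjacent ⟨i, hi⟩).symm

theorem sum_val {X Y : Obj N} {ι : Type*} (s : Finset ι) (f : ι → (X ⟶ Y)) :
    (∑ i ∈ s, f i).1 = ∑ i ∈ s, (f i).1 :=
  map_sum ((Bimod.arrows X.toBimod Y.toBimod).subtype) f s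

theorem symm_conj_val [Nontrivial H] (X : Obj N) (d : ℕ) (b : Bool) :
    (X.powIso (d + 1) ≫ StarTensor.symm b X (d + 1) ≫ adjoint (X.powIso (d + 1))).1 =
      ((d + 1).factorial : ℂ)⁻¹ • ∑ p, PermRep.chi b p • (X.permHom d p).1 := by
  have h1 : X.powIso (d + 1) ≫ StarTensor.symm b X (d + 1) ≫ adjoint (X.powIso (d + 1)) =
      ((d + 1).factorial : ℂ)⁻¹ • ∑ p, PermRep.chi b p • X.permHom d p := by
    have h2 : StarTensor.symm b X (d + 1) = ((d + 1).factorial : ℂ)⁻¹ •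
      ∑ p, PermRep.chi b p • StarTensor.permE X d p := rfl
    rw [h2, Linear.smul_comp, Linear.comp_smul, Preadditive.sum_comp, Preadditive.comp_sum]
    refine congrArg _ (Finset.sum_congr rfl fun p _ => ?_)
    exact (congrArg (X.powIso (d + 1) ≫ ·) (Linear.smul_comp _ _ _ (PermRep.chi b p)
      (StarTensor.permE X d p) (adjoint (X.powIso (d + 1))))).trans (Linear.comp_smul _ _ _ _ _ _)
  rw [h1, smul_val, sum_val]
  rfl

/-- A triple in the language of the symmetric tensor category. -/
theorem isStatTriple_iff [Nontrivial H] {X γ : Obj N} {d : ℕ} :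
    (∃ V, X.IsStatTriple d γ V) ↔ γ.IsFaithful ∧ γ.IsSimple ∧
      ∃ (b : Bool) (W : γ ⟶ StarTensor.pow X (d + 1)), W ≫ adjoint W = 𝟙 γ ∧
        adjoint W ≫ W = StarTensor.symm b X (d + 1) := by
  have hU := X.unitary_powIso (d + 1)
  constructor
  · rintro ⟨V, hf, hs, ⟨hV, hV'⟩, π, hπ, h⟩
    refine ⟨hf, hs, ?_⟩
    let W : γ ⟶ X.pow (d + 1) := ⟨V, hV⟩
    have hW : W ≫ adjoint W = 𝟙 γ := hom_ext hV'
    obtain ⟨b, hb⟩ : ∃ b : Bool, adjoint W ≫ W =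
        X.powIso (d + 1) ≫ StarTensor.symm b X (d + 1) ≫ adjoint (X.powIso (d + 1)) := by
      rcases h with h | h
      · refine ⟨true, hom_ext ?_⟩
        rw [symm_conj_val]
        simp only [hπ.eq] at h
        exact h
      · refine ⟨false, hom_ext ?_⟩
        rw [symm_conj_val]
        simp only [hπ.eq] at h
        simp only [PermRep.chi, Bool.false_eq_true, if_false, one_smul]
        exact h
    refine ⟨b, W ≫ X.powIso (d + 1), ?_, ?_⟩
    · rw [adjoint_comp, Category.assoc, ← Category.assoc (X.powIso (d + 1)), hU.left,
        Category.id_comp, hW]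
    · rw [adjoint_comp, Category.assoc, ← Category.assoc (adjoint W), hb]
      simp only [Category.assoc]
      rw [hU.right, Category.comp_id, ← Category.assoc, hU.right, Category.id_comp]
  · rintro ⟨hf, hs, b, W, hW, hW'⟩
    have h1 : (W ≫ adjoint (X.powIso (d + 1))) ≫ adjoint (W ≫ adjoint (X.powIso (d + 1))) =
        𝟙 γ := by
      rw [adjoint_comp, adjoint_adjoint, Category.assoc, ← Category.assoc (adjoint (X.powIso _)),
        hU.right, Category.id_comp, hW]
    have h2 : adjoint (W ≫ adjoint (X.powIso (d + 1))) ≫ (W ≫ adjoint (X.powIso (d + 1))) =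
        X.powIso (d + 1) ≫ StarTensor.symm b X (d + 1) ≫ adjoint (X.powIso (d + 1)) := by
      rw [adjoint_comp, adjoint_adjoint, Category.assoc, ← Category.assoc (adjoint W), hW']
    refine ⟨(W ≫ adjoint (X.powIso (d + 1))).1, hf, hs, ⟨(W ≫ adjoint (X.powIso (d + 1))).2,
      congrArg Subtype.val h1⟩, _, X.isPermRep_permHom d, ?_⟩
    have h3 := congrArg Subtype.val h2
    rw [symm_conj_val] at h3
    cases b
    · right
      simp only [PermRep.chi, Bool.false_eq_true, if_false, one_smul] at h3
      exact h3
    · left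
      exact h3

theorem isSimple_iff [Nontrivial H] {γ : Obj N} :
    γ.IsSimple ↔ (β_ γ γ).hom = 𝟙 _ ∨ (β_ γ γ).hom = -𝟙 _ :=
  or_congr ⟨fun h => hom_ext h, fun h => congrArg Subtype.val h⟩
    ⟨fun h => hom_ext h, fun h => congrArg Subtype.val h⟩

theorem isIrreducible_iff [Nontrivial H] {X : Obj N} : X.IsIrreducible ↔ StarTensor.Irred X :=
  and_congr (not_congr ⟨fun h => hom_ext h, fun h => congrArg Subtype.val h⟩)
    ⟨fun h f => (h f.1 f.2).imp fun _ hc => hom_ext hc,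
      fun h T hT => (h ⟨T, hT⟩).imp fun _ hc => congrArg Subtype.val hc⟩

theorem isDirectSum_iff [Nontrivial H] {X : Obj N} {k : ℕ} {σ : Fin k → Obj N} :
    X.IsDirectSum σ ↔ StarTensor.IsSum X σ := by
  constructor
  · rintro ⟨W, hW, hsum⟩
    refine ⟨fun i => ⟨W i, (hW i).1⟩, fun i => hom_ext (hW i).2, hom_ext ?_⟩
    rw [sum_val]
    exact hsum
  · rintro ⟨W, hW, hsum⟩
    refine ⟨fun i => (W i).1, fun i => ⟨(W i).2, congrArg Subtype.val (hW i)⟩, ?_⟩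
    have := congrArg Subtype.val hsum
    rw [sum_val] at this
    exact this

theorem sums_iff [Nontrivial H] {P : Obj N → Prop} {X : Obj N} :
    (∃ (k : ℕ) (σ : Fin k → Obj N), 0 < k ∧ X.IsDirectSum σ ∧
      ∀ i, (σ i).IsIrreducible ∧ P (σ i)) ↔ StarTensor.Sums P X := by
  constructor
  · rintro ⟨k, σ, hk, hs, h⟩
    exact ⟨Fin k, inferInstance, ⟨⟨0, hk⟩⟩, σ, isDirectSum_iff.1 hs,
      fun i => ⟨isIrreducible_iff.1 (h i).1, (h i).2⟩⟩
  · rintro ⟨ι, _, _, σ, ⟨W, hW, hsum⟩, h⟩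
    let e := (Fintype.equivFin ι).symm
    refine ⟨Fintype.card ι, fun i => σ (e i), Fintype.card_pos,
      isDirectSum_iff.2 ⟨fun i => W (e i), fun i => hW (e i), ?_⟩,
      fun i => ⟨isIrreducible_iff.2 (h (e i)).1, (h (e i)).2⟩⟩
    rw [← hsum]
    exact e.sum_comp fun i => StarTensor.dag (W i) ≫ W i

/-- An object has a triple. -/
def HasTriple [Nontrivial H] (X : Obj N) : Prop :=
  ∃ (d : ℕ) (γ : Obj N), γ.IsFaithful ∧ γ.IsSimple ∧
    ∃ (b : Bool) (W : γ ⟶ StarTensor.pow X (d + 1)), W ≫ adjoint W = 𝟙 γ ∧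
      adjoint W ≫ W = StarTensor.symm b X (d + 1)

/-- An object has a triple with a doubly faithful simple object. -/
def HasDoublyFaithfulTriple [Nontrivial H] (X : Obj N) : Prop :=
  ∃ (d : ℕ) (γ : Obj N), (γ.IsFaithful ∧ γ.IsSimple ∧
    ∃ (b : Bool) (W : γ ⟶ StarTensor.pow X (d + 1)), W ≫ adjoint W = 𝟙 γ ∧
      adjoint W ≫ W = StarTensor.symm b X (d + 1)) ∧ γ.IsDoublyFaithful

theorem mem_finiteStatistics [Nontrivial H] {X : Obj N} :
    X ∈ finiteStatistics N ↔ StarTensor.Sums HasTriple X := by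
  rw [← sums_iff]
  simp only [finiteStatistics, Set.mem_ofPred_eq, isStatTriple_iff]
  rfl

theorem isSum_self [Nontrivial H] (X : Obj N) : StarTensor.IsSum X fun _ : Unit => X :=
  ⟨fun _ => 𝟙 X, fun _ => (congrArg _ (StarTensor.dag_id X)).trans (Category.comp_id _), by
    rw [Fintype.sum_unique]
    exact (Category.comp_id _).trans (StarTensor.dag_id X)⟩

theorem mem_finiteHomogeneous [Nontrivial H] {X : Obj N} :
    X ∈ finiteHomogeneous N ↔ StarTensor.Sums HasDoublyFaithfulTriple X := by
  rw [← sums_iff]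
  simp only [finiteHomogeneous, Set.mem_ofPred_eq]
  refine exists_congr fun k => exists_congr fun σ => and_congr_right fun _ =>
    and_congr_right fun _ => forall_congr' fun i => and_congr_right fun hi => ?_
  constructor
  · rintro ⟨-, d, γ, V, hV, hd⟩
    exact ⟨d, γ, isStatTriple_iff.1 ⟨V, hV⟩, hd⟩
  · rintro ⟨d, γ, h, hd⟩
    obtain ⟨V, hV⟩ := isStatTriple_iff.2 h
    exact ⟨mem_finiteStatistics.2 ⟨Unit, inferInstance, inferInstance, _, isSum_self _,
      fun _ => ⟨isIrreducible_iff.1 hi, d, γ, h⟩⟩, d, γ, V, hV, hd⟩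

theorem finiteHomogeneous_subset [Nontrivial H] : finiteHomogeneous N ⊆ finiteStatistics N := by
  intro X hX
  rw [mem_finiteHomogeneous] at hX
  rw [mem_finiteStatistics]
  obtain ⟨ι, h1, h2, σ, h3, h4⟩ := hX
  exact ⟨ι, h1, h2, σ, h3, fun i => ⟨(h4 i).1, by
    obtain ⟨d, γ, h, -⟩ := (h4 i).2
    exact ⟨d, γ, h⟩⟩⟩

/-! ## Markov objects -/

theorem HasDoublyFaithfulTriple.markov [Nontrivial H] {X : Obj N} (hX : StarTensor.Irred X)
    (h : X.HasDoublyFaithfulTriple) : Nonempty (StarTensor.Markov X) := by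
  obtain ⟨d, γ, ⟨hf, hs, b, W, hW, hW'⟩, hd⟩ := h
  exact StarTensor.exists_markov hX (hs.cancellable hf hd) hW hW'

theorem hasDoublyFaithfulTriple_of_markov [Nontrivial H] {X : Obj N} (hX : StarTensor.Irred X)
    (M : StarTensor.Markov X) : X.HasDoublyFaithfulTriple := by
  obtain ⟨b, d, γ, W, hW, hW', hs, hk⟩ := M.exists_triple hX.1
  refine ⟨d, γ, ⟨fun A hA => ?_, isSimple_iff.2 hs, b, W, hW, hW'⟩, fun a A hA h => ?_⟩
  · have h1 := hk (.inl A) (show (𝟙 γ : γ ⟶ γ).1 * γ.hom A = 0 by rw [hA, Matrix.mul_zero])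
    have h2 : (unit N).hom 1 * (unit N).hom A = 0 := h1
    rw [← map_mul, one_mul] at h2
    exact congrFun (congrFun h2 (0 : Fin 1)) (0 : Fin 1)
  · refine eq_zero_of_annihilates_unit hA (hk (.inr ⟨a, ⟨A, hA⟩⟩) ?_)
    change op (𝟙 γ) * γ.ext a A = 0
    rw [h, Matrix.mul_zero]

theorem HasDoublyFaithfulTriple.isHomogeneous [Nontrivial H] {X : Obj N}
    (h : X.HasDoublyFaithfulTriple) : X.IsHomogeneous := by
  obtain ⟨d, γ, ⟨hf, hs, b, W, hW, hW'⟩, hd⟩ := h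
  refine isHomogeneous_of_conjugate (Y := StarTensor.pow X d) hf hs hd
    (W ≫ (sym X (StarTensor.pow X d))) ?_
  rw [adjoint_comp, adjoint_sym, Category.assoc, ← Category.assoc (sym _ _), sym_sym,
    Category.id_comp, hW]

theorem isHomogeneous_of_mem [Nontrivial H] {X : Obj N} (h : X ∈ finiteHomogeneous N) :
    X.IsHomogeneous := by
  rw [mem_finiteHomogeneous] at h
  obtain ⟨ι, _, _, σ, ⟨W, hW, hsum⟩, hσ⟩ := h
  exact isHomogeneous_of_sum W hW fun i => (hσ i).2.isHomogeneous

theorem closedUnderTensor_finiteHomogeneous [Nontrivial H] :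
    ClosedUnderTensor (finiteHomogeneous N) := by
  intro X hX Y hY
  rw [mem_finiteHomogeneous] at *
  exact StarTensor.Sums.tensor hX hY (fun Z hZ h => h.markov hZ)
    fun Z hZ ⟨M⟩ => hasDoublyFaithfulTriple_of_markov hZ M

theorem closedUnderSubobjects_finiteHomogeneous [Nontrivial H] :
    ClosedUnderSubobjects (finiteHomogeneous N) := by
  intro X hX E hE hE1 hE2 hE3
  rw [mem_finiteHomogeneous] at hX
  let T : X ⟶ X := ⟨E, hE⟩
  obtain ⟨Z, W, hW, hW'⟩ := StarTensor.exists_sub (E := T) (hom_ext hE1) (hom_ext hE2)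
  have hZ : 𝟙 Z ≠ 0 := fun h => hE3 (by
    have h1 : T = 0 := by
      rw [← hW', ← Category.id_comp W, h, Limits.zero_comp, Limits.comp_zero]
    exact congrArg Subtype.val h1)
  exact ⟨Z, mem_finiteHomogeneous.2 (hX.sub hW hZ), W.1, ⟨W.2, congrArg Subtype.val hW⟩,
    congrArg Subtype.val hW'⟩

theorem subset_finiteHomogeneous [Nontrivial H] {C : Set (Obj N)} (hC : C ⊆ finiteStatistics N)
    (hsub : ClosedUnderSubobjects C) (hh : ∀ X ∈ C, X.IsHomogeneous) :
    C ⊆ finiteHomogeneous N := by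
  intro X hX
  have hX' := hC hX
  rw [mem_finiteStatistics] at hX'
  rw [mem_finiteHomogeneous]
  obtain ⟨ι, h1, h2, σ, ⟨W, hW, hsum⟩, h4⟩ := hX'
  refine ⟨ι, h1, h2, σ, ⟨W, hW, hsum⟩, fun i => ⟨(h4 i).1, ?_⟩⟩
  replace hW : ∀ i, W i ≫ adjoint (W i) = 𝟙 _ := hW
  have hE : (adjoint (W i) ≫ W i) ≫ adjoint (W i) ≫ W i = adjoint (W i) ≫ W i := by
    rw [Category.assoc, ← Category.assoc (W i), hW, Category.id_comp]
  have hE' : adjoint (adjoint (W i) ≫ W i) = adjoint (W i) ≫ W i := by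
    rw [adjoint_comp, adjoint_adjoint]
  obtain ⟨Z, hZ, V, hV, hV'⟩ := hsub X hX _ (adjoint (W i) ≫ W i).2 (congrArg Subtype.val hE')
    (congrArg Subtype.val hE) fun h0 => (h4 i).1.1 (by
      have h5 : adjoint (W i) ≫ W i = 0 := hom_ext h0
      have h6 : 𝟙 (σ i) = W i ≫ (adjoint (W i) ≫ W i) ≫ adjoint (W i) := by
        rw [Category.assoc, hW, Category.comp_id, hW]
      rw [h6, h5, Limits.zero_comp, Limits.comp_zero])
  let T : Z ⟶ X := ⟨V, hV.1⟩
  have hT : T ≫ adjoint T = 𝟙 Z := hom_ext hV.2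
  have hT' : adjoint T ≫ T = adjoint (W i) ≫ W i := hom_ext hV'
  have hU : Unitary (T ≫ adjoint (W i)) := by
    constructor
    · rw [adjoint_comp, adjoint_adjoint, Category.assoc, ← Category.assoc (adjoint (W i)), ← hT',
        Category.assoc, hT, Category.comp_id, hT]
    · rw [adjoint_comp, adjoint_adjoint, Category.assoc, ← Category.assoc (adjoint T), hT',
        Category.assoc, hW, Category.comp_id, hW]
  obtain ⟨d, γ, hf, hs, b, V', hV1, hV2⟩ := (h4 i).2
  refine ⟨d, γ, ⟨hf, hs, b, V', hV1, hV2⟩, doublyFaithful_of_homogeneous (h4 i).1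
    ((hh Z hZ).of_unitary hU) (fun h0 => ?_) V' hV1 hV2⟩
  exact one_ne_zero (hf 1 (congrArg Subtype.val h0))

end Obj

/-! ## Direct sums -/

section
variable (R : Type*) [Ring R] [StarRing R] (n m : ℕ)

/-- The first inclusion. -/
def inclL : Matrix (Fin (n + m)) (Fin n) R :=
  (1 : Matrix (Fin (n + m)) (Fin (n + m)) R).submatrix id (Fin.castAdd m)

/-- The second inclusion. -/
def inclR : Matrix (Fin (n + m)) (Fin m) R :=
  (1 : Matrix (Fin (n + m)) (Fin (n + m)) R).submatrix id (Fin.natAdd n)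

theorem inclL_star_mul : (inclL R n m)ᴴ * inclL R n m = 1 := by
  rw [inclL, Matrix.conjTranspose_submatrix, Matrix.conjTranspose_one,
    ← Matrix.submatrix_mul _ _ _ _ _ Function.bijective_id, Matrix.one_mul,
    Matrix.submatrix_one _ (Fin.castAdd_injective n m)]

theorem inclR_star_mul : (inclR R n m)ᴴ * inclR R n m = 1 := by
  rw [inclR, Matrix.conjTranspose_submatrix, Matrix.conjTranspose_one,
    ← Matrix.submatrix_mul _ _ _ _ _ Function.bijective_id, Matrix.one_mul,
    Matrix.submatrix_one _ (Fin.natAdd_injective m n)]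

theorem inclL_star_mul_inclR : (inclL R n m)ᴴ * inclR R n m = 0 := by
  rw [inclL, inclR, Matrix.conjTranspose_submatrix, Matrix.conjTranspose_one,
    ← Matrix.submatrix_mul _ _ _ _ _ Function.bijective_id, Matrix.one_mul]
  ext1 i j
  refine Matrix.one_apply_ne fun h => ?_
  have h1 := congrArg Fin.val h
  simp at h1
  omega

theorem inclR_star_mul_inclL : (inclR R n m)ᴴ * inclL R n m = 0 := by
  have := congrArg Matrix.conjTranspose (inclL_star_mul_inclR R n m)
  rwa [Matrix.conjTranspose_mul, Matrix.conjTranspose_conjTranspose,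
    Matrix.conjTranspose_zero] at this

variable {R n m}

theorem amp_mul_inclL (A : R) : amp (n + m) A * inclL R n m =
    inclL R n m * amp n A := by
  ext1 i j
  rw [amp_mul_apply, mul_amp_apply, inclL, Matrix.submatrix_apply, Matrix.one_apply]
  split_ifs <;> simp

theorem amp_mul_inclR (A : R) : amp (n + m) A * inclR R n m =
    inclR R n m * amp m A := by
  ext1 i j
  rw [amp_mul_apply, mul_amp_apply, inclR, Matrix.submatrix_apply, Matrix.one_apply]
  split_ifs <;> simp

/-- The block diagonal matrix. -/
def blockDiag {n' m' : ℕ} (a : Matrix (Fin n') (Fin n) R) (b : Matrix (Fin m') (Fin m) R) :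
    Matrix (Fin (n' + m')) (Fin (n + m)) R :=
  inclL R n' m' * a * (inclL R n m)ᴴ + inclR R n' m' * b * (inclR R n m)ᴴ

theorem blockDiag_mul_inclL {n' m' : ℕ} (a : Matrix (Fin n') (Fin n) R)
    (b : Matrix (Fin m') (Fin m) R) : blockDiag a b * inclL R n m = inclL R n' m' * a := by
  rw [blockDiag, Matrix.add_mul, Matrix.mul_assoc, Matrix.mul_assoc (inclR R n' m' * b),
    inclL_star_mul, inclR_star_mul_inclL, Matrix.mul_one, Matrix.mul_zero, add_zero]

theorem blockDiag_mul_inclR {n' m' : ℕ} (a : Matrix (Fin n') (Fin n) R)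
    (b : Matrix (Fin m') (Fin m) R) : blockDiag a b * inclR R n m = inclR R n' m' * b := by
  rw [blockDiag, Matrix.add_mul, Matrix.mul_assoc, Matrix.mul_assoc (inclR R n' m' * b),
    inclR_star_mul, inclL_star_mul_inclR, Matrix.mul_one, Matrix.mul_zero, zero_add]

theorem blockDiag_mul {n' m' n'' m'' : ℕ} (a : Matrix (Fin n'') (Fin n') R)
    (b : Matrix (Fin m'') (Fin m') R) (c : Matrix (Fin n') (Fin n) R)
    (d : Matrix (Fin m') (Fin m) R) :
      blockDiag a b * blockDiag c d = blockDiag (a * c) (b * d) := by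
  rw [blockDiag.eq_1 c d, Matrix.mul_add, ← Matrix.mul_assoc, ← Matrix.mul_assoc,
    ← Matrix.mul_assoc, ← Matrix.mul_assoc, blockDiag_mul_inclL, blockDiag_mul_inclR,
    Matrix.mul_assoc (inclL R n'' m''), Matrix.mul_assoc (inclR R n'' m'')]
  rfl

theorem blockDiag_star {n' m' : ℕ} (a : Matrix (Fin n') (Fin n) R)
    (b : Matrix (Fin m') (Fin m) R) : (blockDiag a b)ᴴ = blockDiag aᴴ bᴴ := by
  simp only [blockDiag, Matrix.conjTranspose_add, Matrix.conjTranspose_mul,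
    Matrix.conjTranspose_conjTranspose, Matrix.mul_assoc]

theorem amp_mul_blockDiag {n' m' : ℕ} (A : R) (a : Matrix (Fin n') (Fin n) R)
    (b : Matrix (Fin m') (Fin m) R) : amp (n' + m') A * blockDiag a b =
      blockDiag (amp n' A * a) (amp m' A * b) := by
  rw [blockDiag, Matrix.mul_add, ← Matrix.mul_assoc, ← Matrix.mul_assoc, ← Matrix.mul_assoc,
    ← Matrix.mul_assoc, amp_mul_inclL, amp_mul_inclR, Matrix.mul_assoc (inclL R n' m'),
    Matrix.mul_assoc (inclR R n' m')]
  rfl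

end

namespace Bimod

/-- The direct sum of two bimodules. -/
noncomputable abbrev dsum (X Y : Bimod N) : Bimod N where
  n := X.n + Y.n
  hom :=
    { toFun := fun A => blockDiag (X.hom A) (Y.hom A)
      map_smul' := fun c A => by
        simp only [blockDiag, map_smul, Matrix.mul_smul, Matrix.smul_mul, smul_add]
        rfl
      map_zero' := by simp [blockDiag]
      map_add' := fun A B => by
        simp only [blockDiag, map_add, Matrix.mul_add, Matrix.add_mul]
        abel
      map_mul' := fun A B => by rw [map_mul, map_mul, ← blockDiag_mul]
      map_star' := fun A => by
        rw [map_star, map_star, Matrix.star_eq_conjTranspose, Matrix.star_eq_conjTranspose,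
          Matrix.star_eq_conjTranspose, blockDiag_star] }

theorem dsum_hom (X Y : Bimod N) (A : N.alg) : (X.dsum Y).hom A = blockDiag (X.hom A) (Y.hom A) :=
  rfl

theorem dsum_idArrow (X Y : Bimod N) : (X.dsum Y).idArrow = blockDiag X.idArrow Y.idArrow := rfl

theorem LocalizedIn.dsum {X Y : Bimod N} {o : DoubleCone} (hX : X.LocalizedIn o)
    (hY : Y.LocalizedIn o) : (X.dsum Y).LocalizedIn o := by
  refine localizedIn_of fun a ha A hA => ?_
  rw [dsum_hom, dsum_idArrow]
  refine Eq.trans ?_ (amp_mul_blockDiag A X.idArrow Y.idArrow).symm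
  rw [hX.hom_eq ha hA, hY.hom_eq ha hA]
  rfl

theorem IsUnitary.dsum {X Y X' Y' : Bimod N} {U : Matrix (Fin X'.n) (Fin X.n) N.alg}
    {V : Matrix (Fin Y'.n) (Fin Y.n) N.alg} (hU : X.IsUnitary X' U) (hV : Y.IsUnitary Y' V) :
    (X.dsum Y).IsUnitary (X'.dsum Y') (blockDiag U V) := by
  refine ⟨⟨⟨?_, ?_, fun A => ?_⟩, ?_⟩, ?_⟩
  · rw [dsum_idArrow, blockDiag_mul, hU.1.1.1, hV.1.1.1]
  · rw [dsum_idArrow, blockDiag_mul, hU.1.1.2.1, hV.1.1.2.1]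
  · rw [dsum_hom, dsum_hom, blockDiag_mul, blockDiag_mul, hU.1.1.2.2, hV.1.1.2.2]
  · rw [dsum_idArrow, blockDiag_star, blockDiag_mul, hU.1.2, hV.1.2]
  · rw [dsum_idArrow, blockDiag_star, blockDiag_mul, hU.2, hV.2]

end Bimod

namespace Obj

/-- The direct sum of two objects. -/
noncomputable abbrev dsum (X Y : Obj N) : Obj N where
  toBimod := X.toBimod.dsum Y.toBimod
  localized := by
    obtain ⟨p, hp⟩ := X.localized
    obtain ⟨q, hq⟩ := Y.localized
    obtain ⟨c, hpc, hqc⟩ := DoubleCone.directed p q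
    exact ⟨c, Bimod.LocalizedIn.dsum (Mor.LocalizedIn.mono hp hpc) (Mor.LocalizedIn.mono hq hqc)⟩
  transportable := fun o => by
    obtain ⟨X', hX', U, hU⟩ := X.transport o
    obtain ⟨Y', hY', V, hV⟩ := Y.transport o
    exact ⟨_, Bimod.LocalizedIn.dsum hX' hY', _, (hU.dsum hV).toMor⟩

theorem exists_dsum (X Y : Obj N) : ∃ (Z : Obj N) (W : X ⟶ Z) (W' : Y ⟶ Z),
    W ≫ adjoint W = 𝟙 X ∧ W' ≫ adjoint W' = 𝟙 Y ∧ adjoint W ≫ W + adjoint W' ≫ W' = 𝟙 Z := by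
  have hX := idArrow_mul_self X
  have hY := idArrow_mul_self Y
  refine ⟨X.dsum Y, ⟨inclL N.alg X.n Y.n * X.idArrow, ?_, ?_, fun A => ?_⟩,
    ⟨inclR N.alg X.n Y.n * Y.idArrow, ?_, ?_, fun A => ?_⟩, hom_ext ?_, hom_ext ?_, hom_ext ?_⟩
  · rw [Matrix.mul_assoc, hX]
  · rw [Bimod.dsum_idArrow, ← Matrix.mul_assoc, blockDiag_mul_inclL, Matrix.mul_assoc, hX]
  · rw [Bimod.dsum_hom, ← Matrix.mul_assoc, blockDiag_mul_inclL, Matrix.mul_assoc,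
      Matrix.mul_assoc, (Bimod.idArrow_isArrow X.toBimod).2.2]
  · rw [Matrix.mul_assoc, hY]
  · rw [Bimod.dsum_idArrow, ← Matrix.mul_assoc, blockDiag_mul_inclR, Matrix.mul_assoc, hY]
  · rw [Bimod.dsum_hom, ← Matrix.mul_assoc, blockDiag_mul_inclR, Matrix.mul_assoc,
      Matrix.mul_assoc, (Bimod.idArrow_isArrow Y.toBimod).2.2]
  · change (inclL N.alg X.n Y.n * X.idArrow)ᴴ * (inclL N.alg X.n Y.n * X.idArrow) = X.idArrow
    rw [Matrix.conjTranspose_mul, X.idArrow_star, Matrix.mul_assoc,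
      ← Matrix.mul_assoc (inclL N.alg X.n Y.n)ᴴ, inclL_star_mul, Matrix.one_mul, hX]
  · change (inclR N.alg X.n Y.n * Y.idArrow)ᴴ * (inclR N.alg X.n Y.n * Y.idArrow) = Y.idArrow
    rw [Matrix.conjTranspose_mul, Y.idArrow_star, Matrix.mul_assoc,
      ← Matrix.mul_assoc (inclR N.alg X.n Y.n)ᴴ, inclR_star_mul, Matrix.one_mul, hY]
  · change inclL N.alg X.n Y.n * X.idArrow * (inclL N.alg X.n Y.n * X.idArrow)ᴴ +
      inclR N.alg X.n Y.n * Y.idArrow * (inclR N.alg X.n Y.n * Y.idArrow)ᴴ =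
      blockDiag X.idArrow Y.idArrow
    rw [Matrix.conjTranspose_mul, X.idArrow_star, Matrix.conjTranspose_mul, Y.idArrow_star,
      Matrix.mul_assoc, ← Matrix.mul_assoc X.idArrow, hX, Matrix.mul_assoc (inclR N.alg X.n Y.n),
      ← Matrix.mul_assoc Y.idArrow, hY, ← Matrix.mul_assoc, ← Matrix.mul_assoc]
    rfl

theorem closedUnderDirectSums_finiteHomogeneous [Nontrivial H] :
    ClosedUnderDirectSums (finiteHomogeneous N) := by
  intro X hX Y hY
  rw [mem_finiteHomogeneous] at hX hY
  obtain ⟨Z, W, W', hW, hW', h⟩ := X.exists_dsum Y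
  exact ⟨Z, mem_finiteHomogeneous.2 (hX.add hY hW hW' h), W.1, W'.1,
    ⟨W.2, congrArg Subtype.val hW⟩, ⟨W'.2, congrArg Subtype.val hW'⟩, congrArg Subtype.val h⟩

end Obj

end AQFT

theorem proposition3p20 {H : Type*} [NormedAddCommGroup H] [InnerProductSpace ℂ H]
    [CompleteSpace H] [TopologicalSpace.SeparableSpace H] (hH : ¬ FiniteDimensional ℂ H)
    (N : AQFT.Net H) :
    (AQFT.ClosedUnderTensor (AQFT.finiteHomogeneous N) ∧
      AQFT.ClosedUnderDirectSums (AQFT.finiteHomogeneous N) ∧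
      AQFT.ClosedUnderSubobjects (AQFT.finiteHomogeneous N) ∧
      ∀ ρ ∈ AQFT.finiteHomogeneous N, ρ.IsHomogeneous) ∧
    IsGreatest {C : Set (AQFT.Obj N) | C ⊆ AQFT.finiteStatistics N ∧
      AQFT.ClosedUnderSubobjects C ∧ ∀ ρ ∈ C, ρ.IsHomogeneous}
      (AQFT.finiteHomogeneous N) := by
  have : Nontrivial H := by
    by_contra h
    rw [not_nontrivial_iff_subsingleton] at h
    exact hH inferInstance
  exact ⟨⟨AQFT.Obj.closedUnderTensor_finiteHomogeneous,
    AQFT.Obj.closedUnderDirectSums_finiteHomogeneous,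
    AQFT.Obj.closedUnderSubobjects_finiteHomogeneous, fun _ => AQFT.Obj.isHomogeneous_of_mem⟩,
    ⟨AQFT.Obj.finiteHomogeneous_subset, AQFT.Obj.closedUnderSubobjects_finiteHomogeneous,
      fun _ => AQFT.Obj.isHomogeneous_of_mem⟩,
    fun _ hC => AQFT.Obj.subset_finiteHomogeneous hC.1 hC.2.1 hC.2.2⟩
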